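/- Let $N\ge 3$, $\alpha\in\mathbb R$, and let $\theta:(0,\infty)\to\mathbb R$ be essentially bounded with $1-\frac rb\le\theta(r)\le 1+\frac rb$ for almost every $r>0$ and some $b>0$. Let $$\gamma>\gamma_c:=2-\frac{8\sqrt3}{\pi(N-2)\,[\,8+\sqrt3\,(N-3)\,]} .$$ **Notation.** Let $\mathscr H_N=L^2_{\rm sym}(\mathbb R^{3N})$ be the space of $L^2$ functions symmetric under permutations of $x_1,\dots,x_N\in\mathbb R^3$, and let $\mathcal H_0=-\Delta$ with domain $H^2(\mathbb R^{3N})\cap\mathscr H_N$. For $i<j$ let $\pi_{ij}=\{x_i=x_j\}$, with coordinates $(z,Y)$, where $z=x_i=x_j$ and $Y=(y_1,\dots,y_{N-2})$ lists the remaining $x_m$ in increasing order of $m$. By the bosonic symmetry the charges on all the $\pi_{ij}$ are given by one function of $(z,Y)$: let $L^2(\pi)$ be the space of $\xi(z,Y)\in L^2(\mathbb R^{3(N-1)})$ that are symmetric in $y_1,\dots,y_{N-2}$. It is identified with the charge space $L^2(\pi_{ij})$ for every $i<j$. Let $H^1(\pi)=L^2(\pi)\cap H^1(\mathbb R^{3(N-1)})$.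 Let $A$ be multiplication by $$A(z,y_1,\dots,y_{N-2})=\alpha+\gamma\sum_{k=1}^{N-2}\frac{\theta(|y_k-z|)}{|y_k-z|}+\frac\gamma2\sum_{1\le k<\ell\le N-2}\frac{\theta(|y_k-y_\ell|)}{|y_k-y_\ell|}.$$ With $\hat f(p)=(2\pi)^{-d/2}\int_{\mathbb R^d} e^{-ip\cdot x}f(x)\,dx$, and with $P_{lm}$ denoting $(p_1,\dots,p_N)$ with $p_l,p_m$ left out, let $\Gamma^\lambda_{ij}$, for $\lambda>0$, be given by $$\begin{aligned}\widehat{\Gamma^\lambda_{ij}\xi}(k,P_{ij})={}&\tfrac1{\sqrt2}\sqrt{\tfrac12k^2+P_{ij}^2+\lambda}\;\hat\xi(k,P_{ij})-\frac2{\pi^2}\sum_{\ell\notin\{i,j\}}\int_{\mathbb R^6}\delta(p_i+p_j-k)\,\frac{\hat\xi(p_i+p_\ell,P_{i\ell})}{p_1^2+\dots+p_N^2+\lambda}\,dp_i\,dp_j\\&-\frac1{\pi^2}\sum_{\substack{\ell<m\\ \{\ell,m\}\cap\{i,j\}=\emptyset}}\int_{\mathbb R^6}\delta(p_i+p_j-k)\,\frac{\hat\xi(p_\ell+p_m,P_{\ell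 m})}{p_1^2+\dots+p_N^2+\lambda}\,dp_i\,dp_j .\end{aligned}$$ Let $\mathscr G^\lambda\xi\in\mathscr H_N$ be the distributional solution $u$ of $(-\Delta+\lambda)u=8\pi\,\delta_\pi\xi$, where $\langle\delta_\pi\xi,\varphi\rangle=\sum_{i<j}\int\xi(z,Y)\,\varphi|_{\pi_{ij}}(z,Y)\,dz\,dY$ for Schwartz functions $\varphi$. **Statement.** 1. For all $\lambda>0$ and $i<j$, $A+\Gamma^\lambda_{ij}$ with domain $H^1(\pi)$ is a well-defined operator from $L^2(\pi)$ to $L^2(\pi_{ij})$ (the integrals above converge absolutely for almost every $(k,P_{ij})$, and $A\xi$ and $\Gamma^\lambda_{ij}\xi$ are in $L^2$ for $\xi\in H^1(\pi)$), and it is self-adjoint. 2. There is $\lambda_0>0$ such that for every $\lambda>\lambda_0$ and all $i<j$ the operator $A+\Gamma_{ij}^\lambda$ is positive; more precisely, there is $c>0$ with $\langle\xi,(A+\Gamma^\lambda_{ij})\xi\rangle\ge c\,\|\xi\|^2$ for all $\xi\in H^1(\pi)$. 3. The Hamiltonian $\mathcal H_A$ of $N$ bosons with the modified boundary condition at the hyperplanes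 $\pi_{ij}$, that is, $$D(\mathcal H_A)=\big\{\psi\in\mathscr H_N:\ \psi=w+\mathscr G^\lambda\xi,\ w\in H^2(\mathbb R^{3N}),\ \xi\in H^1(\pi),\ (A+\Gamma^\lambda_{ij})\xi=w|_{\pi_{ij}}\ \text{for all } i<j\big\},$$ $$\mathcal H_A\psi=\mathcal H_0w-\lambda\,\mathscr G^\lambda\xi ,$$ is a well-defined operator that does not depend on the choice of $\lambda>0$. It is self-adjoint in $\mathscr H_N$, and with the same $\lambda_0$ as in part 2, $\langle\psi,\mathcal H_A\psi\rangle\ge-\lambda_0\|\psi\|^2$ for all $\psi\in D(\mathcal H_A)$. -/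

import Mathlib

open MeasureTheory Filter Set
open scoped Topology ENNReal SchwartzMap FourierTransform Laplacian

noncomputable section

/-- The one-particle space `ℝ³`. -/
abbrev R3 : Type := EuclideanSpace ℝ (Fin 3)

/-- Configurations `(x_m)_{m ∈ ι}` of points of `ℝ³`, with the Euclidean norm
`(∑ |x_m|²)^{1/2}` and Lebesgue measure. -/
abbrev Config (ι : Type) [Fintype ι] : Type := PiLp 2 (fun _ : ι => R3)

/-- Complex `L²` over the configurations indexed by `ι`. -/
abbrev L2 (ι : Type) [Fintype ι] : Type := Lp ℂ 2 (volume : Measure (Config ι))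

/-- Relabelling of the particles by `e`, as an isometry of `L²`: `ψ ↦ ψ(x_{e⁻¹(·)})`. -/
def permL2 {ι : Type} [Fintype ι] (e : Equiv.Perm ι) : L2 ι →ₗᵢ[ℂ] L2 ι :=
  Lp.compMeasurePreservingₗᵢ ℂ (LinearIsometryEquiv.piLpCongrLeft 2 ℝ R3 e)
    (LinearIsometryEquiv.measurePreserving _)

/-- The `L²` functions that are invariant under all the relabellings `e s`. -/
def invariantL2 {ι S : Type} [Fintype ι] (e : S → Equiv.Perm ι) : Submodule ℂ (L2 ι) :=
  ⨅ s : S, LinearMap.eqLocus (permL2 (e s)).toLinearMap LinearMap.id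

theorem isClosed_invariantL2 {ι S : Type} [Fintype ι] (e : S → Equiv.Perm ι) :
    IsClosed (invariantL2 e : Set (L2 ι)) := by
  rw [invariantL2, Submodule.coe_iInf]
  exact isClosed_iInter fun s => isClosed_eq (permL2 (e s)).continuous continuous_id

instance {ι S : Type} [Fintype ι] (e : S → Equiv.Perm ι) : CompleteSpace (invariantL2 e) :=
  (isClosed_invariantL2 e).completeSpace_coe

/-- The `N`-boson Hilbert space: the functions in `L²(ℝ^{3N})` that are symmetric under all
permutations of the particles. -/
abbrev BosonSpace (N : ℕ) : Type :=
  invariantL2 (fun σ : Equiv.Perm (Fin N) => σ)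

/-- The index set of the coordinates `(z, y_1, …, y_{N-2})` on a coincidence hyperplane: `none`
stands for the common position `z` of the coinciding pair, `some k` for the `k`-th of the
remaining particles (in increasing order of their labels). -/
abbrev ChargeIdx (N : ℕ) : Type := Option (Fin (N - 2))

/-- The charge space `L²(π)` of a system of bosons. By the bosonic symmetry the charges on all the
hyperplanes `π_{ij}` are one and the same function `ξ(z, y_1, …, y_{N-2})` in `L²(ℝ^{3(N-1)})`,
which is symmetric under the permutations of `y_1, …, y_{N-2}`. -/
abbrev ChargeSpace (N : ℕ) : Type :=
  invariantL2 (fun σ : Equiv.Perm (Fin (N - 2)) => (Equiv.optionCongr σ : Equiv.Perm (ChargeIdx N)))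

/-- The increasing enumeration of the labels different from `i` and `j` (for `i ≠ j`). -/
def others {N : ℕ} (i j : Fin N) (k : Fin (N - 2)) : Fin N :=
  ⟨if (k : ℕ) < min (i : ℕ) j then k else if (k : ℕ) + 1 < max (i : ℕ) j then k + 1 else k + 2, by
    have := k.isLt
    split_ifs <;> omega⟩

/-- The configuration of `N` points with `a` in place `i`, `b` in place `j`, and `Y` in the
remaining places, in increasing order. -/
def merge {N : ℕ} (i j : Fin N) (a b : R3) (Y : Fin (N - 2) → R3) : Config (Fin N) :=
  WithLp.toLp 2 fun m =>
    if m = i then a else if m = j then b else ∑ k, if others i j k = m then Y k else 0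

/-- The point of `π_{ij}` with coordinates `X = (z, Y)`, so that `x_i = x_j = z`. -/
def onPlane {N : ℕ} (i j : Fin N) (X : Config (ChargeIdx N)) : Config (Fin N) :=
  merge i j (X none) (X none) fun k => X (some k)

/-- For momenta `p = (p_1, …, p_N)`, the momenta `(p_i + p_j, P_{ij})`, where `P_{ij}` is `p` with
`p_i` and `p_j` left out. -/
def contract {N : ℕ} (i j : Fin N) (p : Config (Fin N)) : Config (ChargeIdx N) :=
  WithLp.toLp 2 fun m => m.elim (p i + p j) fun k => p (others i j k)

/-- For `κ = (k, P)` and `q ∈ ℝ³`, the momenta `p` with `p_i = q`, `p_j = k - q` and `P_{ij} = P`: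
these parametrize `{p : p_i + p_j = k, P_{ij} = P}`, the support of `δ(p_i + p_j - k)`. -/
def split {N : ℕ} (i j : Fin N) (κ : Config (ChargeIdx N)) (q : R3) : Config (Fin N) :=
  merge i j q (κ none - q) fun k => κ (some k)

/-- The unitary Fourier transform `f̂(p) = (2π)^{-d/2} ∫ e^{-ip·x} f(x) dx`, where `d = 3 |ι|`,
of an `L²` function, in terms of Mathlib's `𝓕 f (p) = ∫ e^{-2πip·x} f(x) dx`. -/
def hat {ι : Type} [Fintype ι] (f : L2 ι) (p : Config ι) : ℂ :=
  (((2 * Real.pi) ^ (-(3 * (Fintype.card ι : ℝ)) / 2) : ℝ) : ℂ) *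
    (𝓕 f : L2 ι) ((2 * Real.pi)⁻¹ • p)

/-- The function `A(z, y_1, …, y_{N-2})` of the modified boundary condition. -/
def coefA {N : ℕ} (α γ : ℝ) (θ : ℝ → ℝ) (X : Config (ChargeIdx N)) : ℝ :=
  α + γ * ∑ k, θ ‖X (some k) - X none‖ / ‖X (some k) - X none‖
    + γ / 2 * ∑ k, ∑ l, if k < l then θ ‖X (some k) - X (some l)‖ / ‖X (some k) - X (some l)‖ else 0

/-- `η = A ξ` (multiplication operator). -/
def IsMulA {N : ℕ} (α γ : ℝ) (θ : ℝ → ℝ) (ξ η : ChargeSpace N) : Prop :=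
  ∀ᵐ X, (η : L2 (ChargeIdx N)) X = (coefA α γ θ X : ℂ) * (ξ : L2 (ChargeIdx N)) X

/-- The integrand, as a function of `q = p_i`, of the non-local terms of `Γ_{ij}^lam` at
`κ = (k, P_{ij})`:  `ξ̂(p_l + p_m, P_{lm}) / (p_1² + … + p_N² + lam)` on `p_i + p_j = k`. -/
def gammaIntegrand {N : ℕ} (lam : ℝ) (i j l m : Fin N) (ξ : ChargeSpace N)
    (κ : Config (ChargeIdx N)) (q : R3) : ℂ :=
  hat (ξ : L2 (ChargeIdx N)) (contract l m (split i j κ q)) /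
    ((‖split i j κ q‖ ^ 2 + lam : ℝ) : ℂ)

/-- `η = Γ_{ij}^lam ξ`: the integrals in the Fourier representation of `Γ_{ij}^lam` converge
absolutely almost everywhere, and `η̂` is given by that representation. -/
def IsGamma {N : ℕ} (lam : ℝ) (i j : Fin N) (ξ η : ChargeSpace N) : Prop :=
  ∀ᵐ κ : Config (ChargeIdx N),
    (∀ l m : Fin N, l ≠ m → ({l, m} : Finset (Fin N)) ≠ {i, j} →
      Integrable (gammaIntegrand lam i j l m ξ κ)) ∧
    hat (η : L2 (ChargeIdx N)) κ =
      ((1 / √2 * √(1 / 2 * ‖κ none‖ ^ 2 + ∑ k, ‖κ (some k)‖ ^ 2 + lam) : ℝ) : ℂ) *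
          hat (ξ : L2 (ChargeIdx N)) κ
        - 2 / (Real.pi : ℂ) ^ 2 *
          ∑ l : Fin N, (if l ≠ i ∧ l ≠ j then ∫ q, gammaIntegrand lam i j i l ξ κ q else 0)
        - 1 / (Real.pi : ℂ) ^ 2 *
          ∑ l : Fin N, ∑ m : Fin N,
            (if l < m ∧ l ≠ i ∧ l ≠ j ∧ m ≠ i ∧ m ≠ j
              then ∫ q, gammaIntegrand lam i j m l ξ κ q else 0)

/-- `ξ ∈ H¹(π)`. -/
def MemH1 {N : ℕ} (ξ : ChargeSpace N) : Prop :=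
  TemperedDistribution.MemSobolev 1 2
    ((ξ : L2 (ChargeIdx N)) : 𝓢'(Config (ChargeIdx N), ℂ))

/-- `η = (A + Γ_{ij}^lam) ξ`. -/
def IsAddGamma {N : ℕ} (α γ : ℝ) (θ : ℝ → ℝ) (lam : ℝ) (i j : Fin N)
    (ξ η : ChargeSpace N) : Prop :=
  ∃ η₁ η₂ : ChargeSpace N, IsMulA α γ θ ξ η₁ ∧ IsGamma lam i j ξ η₂ ∧ η = η₁ + η₂

/-- `T` is the operator `A + Γ_{ij}^lam` with domain `H¹(π)`. -/
structure IsChargeOperator {N : ℕ} (α γ : ℝ) (θ : ℝ → ℝ) (lam : ℝ) (i j : Fin N)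
    (T : ChargeSpace N →ₗ.[ℂ] ChargeSpace N) : Prop where
  mem_domain_iff : ∀ ξ : ChargeSpace N, ξ ∈ T.domain ↔ MemH1 ξ
  apply : ∀ ξ : T.domain, IsAddGamma α γ θ lam i j ξ (T ξ)

/-- `u = 𝒢^lam ξ`: the function `u` solves `(-Δ + lam) u = 8π δ_π ξ` in the sense of distributions,
where `δ_π ξ` is the distribution `φ ↦ ∑_{i<j} ∫ ξ(z, Y) φ|_{π_{ij}}(z, Y) dz dY`. -/
def IsPotential {N : ℕ} (lam : ℝ) (ξ : ChargeSpace N) (u : BosonSpace N) : Prop :=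
  ∀ φ : 𝓢(Config (Fin N), ℂ),
    (-Δ ((u : L2 (Fin N)) : 𝓢'(Config (Fin N), ℂ))
        + (lam : ℂ) • ((u : L2 (Fin N)) : 𝓢'(Config (Fin N), ℂ))) φ =
      8 * (Real.pi : ℂ) * ∑ i : Fin N, ∑ j : Fin N,
        if i < j then ∫ X, (ξ : L2 (ChargeIdx N)) X * φ (onPlane i j X) else 0

/-- `w ∈ H²(ℝ^{3N})`. -/
def MemH2 {N : ℕ} (w : BosonSpace N) : Prop :=
  TemperedDistribution.MemSobolev 2 2 ((w : L2 (Fin N)) : 𝓢'(Config (Fin N), ℂ))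

/-- `h = 𝓗₀ w = -Δ w`. -/
def IsFree {N : ℕ} (w h : BosonSpace N) : Prop :=
  ((h : L2 (Fin N)) : 𝓢'(Config (Fin N), ℂ)) = -Δ ((w : L2 (Fin N)) : 𝓢'(Config (Fin N), ℂ))

/-- `η = w|_{π_{ij}}`, the trace of `w ∈ H²(ℝ^{3N})` on `π_{ij}`: the `L²` limit of the
restrictions to `π_{ij}` of Schwartz functions that converge to `w` in `H²` (that is, in `L²`
together with their Laplacians). -/
def IsTrace {N : ℕ} (i j : Fin N) (w : BosonSpace N) (η : ChargeSpace N) : Prop :=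
  ∃ (φ : ℕ → 𝓢(Config (Fin N), ℂ)) (g : L2 (Fin N)),
    Tendsto (fun n => (φ n).toLp 2) atTop (𝓝 (w : L2 (Fin N))) ∧
    Tendsto (fun n => (Δ (φ n)).toLp 2) atTop (𝓝 g) ∧
    Tendsto (fun n => eLpNorm (fun X => φ n (onPlane i j X) - (η : L2 (ChargeIdx N)) X) 2 volume)
      atTop (𝓝 0)

/-- `H` is the Hamiltonian `𝓗_A`, written with the parameter `lam > 0`: its domain consists of the
`ψ = w + 𝒢^lam ξ` with `w ∈ H²`, `ξ ∈ H¹(π)` and `(A + Γ_{ij}^lam) ξ = w|_{π_{ij}}` for all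
`i < j`, and there `H ψ = 𝓗₀ w - lam 𝒢^lam ξ`. -/
def IsHamiltonian {N : ℕ} (α γ : ℝ) (θ : ℝ → ℝ) (lam : ℝ)
    (H : BosonSpace N →ₗ.[ℂ] BosonSpace N) : Prop :=
  ∀ ψ φ : BosonSpace N, (ψ, φ) ∈ H.graph ↔
    ∃ (ξ : ChargeSpace N) (w h u : BosonSpace N),
      MemH1 ξ ∧ MemH2 w ∧ IsFree w h ∧ IsPotential lam ξ u ∧
      (∀ i j : Fin N, i < j → ∃ η, IsAddGamma α γ θ lam i j ξ η ∧ IsTrace i j w η) ∧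
      ψ = w + u ∧ φ = h - (lam : ℂ) • u

/-- The critical value `γ_c`. -/
def gammaCrit (N : ℕ) : ℝ :=
  2 - 8 * √3 / (Real.pi * ((N : ℝ) - 2) * (8 + √3 * ((N : ℝ) - 3)))

end

/-!
The Hamiltonian is constructed from its resolvent, by Krein's formula
`W = (-Δ + lam)⁻¹ + c 𝒢 (A + Γ)⁻¹ 𝒢*`, so that all the analysis concerns the operator `A + Γ` on
charges.

*The charge operator.* In momentum space, `Γ` is the multiplication by a multiple of `√E`, where
`E = chargeEnergy` is the kinetic energy of a charge, minus one integral operator for each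
pair of particles other than the one that carries the charge. Up to a bounded function, `A` is a sum
of Coulomb potentials, one for each of the same interactions, the two partners in the charge being
at one point. For every such interaction (`Link`) there are coordinates
(`PairFrame`) in which the Coulomb potential has the kernel `1 / |v|²` along a fibre `ℝ³`
(`exists_coulomb`), and the non-local term has the kernel `1 / den`. By Schur's test both become
bounded after multiplication by `J = E^{-1/2}` from the right. Hence `L = (A + Γ) J` is bounded
(`exists_boundary_ops`, `IsBoundaryPair`), and `A + Γ = L J⁻¹` with domain `ran J = H¹`.

*Coercivity.* The estimate is made for the real part of `⟨ζ, L ζ⟩ = ⟨√E ξ, (A + Γ) ξ⟩`, `ζ = √E ξ`,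
and not for the form of `A + Γ`. Taking the real part replaces a kernel `k` between `ξ` and `√E ξ`
by `k` times the sum `symSum` of the values of `√E` at the two ends. Now
`symSum / |v|²` and `symSum / den` are geometric series in `1 - |v|² / symSum²` and
`1 - den / symSum²`, whose numerators are sums of rank-one kernels built from the same functions,
with coefficients for the non-local term that are at most as large. Hence the Coulomb term
dominates `±` the non-local term (`dominates_coulKer_denKer`). On the other hand, the non-local term
is bounded by `symConst < π³` by a sharp version of Schur's test (`re_inner_denKer_le`). A convex
combination of the two bounds (`re_inner_pair_ge`), summed over the links, shows that
`⟨ζ, L ζ⟩` is bounded below by a multiple of `gap · ‖ζ‖²`, up to an error `C ‖ζ‖ ‖J ζ‖`; and `gap` is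
positive precisely because `γ > γ_c` (`gap_pos`). So `L + s J` is invertible for some `s`, which makes `L J⁻¹`
self-adjoint (`isSelfAdjoint_pmapOfFactor`). For large `lam` the norm of `J` is small, `L + s J` is
coercive for all `s ≥ -1`, and therefore `A + Γ ≥ 1` (`norm_sq_le_form`).

*The Hamiltonian.* The adjoint of the potential of a hyperplane is the trace of `(-Δ + lam)⁻¹`
(`isTrace_iff_adjoint`). The resolvent identity gives the difference of the operators `Γ` for two
values of `lam` as the trace of the difference of the potentials (`IsGamma.sub_eq`), so that the graph
of the Hamiltonian does not depend on `lam` (`InHamiltonianGraph.change`). For large `lam` the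
functions `ψ = w + 𝒢 ξ` in the domain are those of the form `W f`, where `W ≥ 0` is the bounded
self-adjoint injective operator above (`exists_krein_resolvent`), and `H ψ = f - lam ψ`. This makes
`H` self-adjoint and bounded below by `-lam` for every `lam > lam₀`, hence by `-lam₀`.
-/

set_option linter.unusedSectionVars false

open scoped Real

/-- The complex `L²` space of a Euclidean space with its Lebesgue measure. -/
local notation:max "L²(" E ")" => Lp ℂ 2 (volume : Measure E)

section

/-! ### Unbounded self-adjoint operators from bounded ones -/

section Abstract

variable {K : Type*} [NormedAddCommGroup K] [InnerProductSpace ℂ K] [CompleteSpace K]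

/-- An operator `T` for which `T + s` is the inverse of a bounded self-adjoint injective operator
`R` is self-adjoint. -/
theorem isSelfAdjoint_of_graph_resolvent (R : K →L[ℂ] K) (hR : IsSelfAdjoint R)
    (hinj : ∀ f, R f = 0 → f = 0) (s : ℝ) (T : K →ₗ.[ℂ] K)
    (hT : ∀ x y, (x, y) ∈ T.graph ↔ ∃ f, x = R f ∧ y = f - (s : ℂ) • R f) :
    IsSelfAdjoint T := by
  have hsym : ∀ x y, inner ℂ (R x) y = inner ℂ x (R y) := fun x y =>
    (ContinuousLinearMap.isSelfAdjoint_iff_isSymmetric.1 hR) x y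
  have hdom : ∀ x, x ∈ T.domain ↔ ∃ f, x = R f := by
    intro x
    rw [LinearPMap.mem_domain_iff]
    constructor
    · rintro ⟨y, hy⟩
      obtain ⟨f, hf, -⟩ := (hT x y).1 hy
      exact ⟨f, hf⟩
    · rintro ⟨f, hf⟩
      exact ⟨_, (hT _ _).2 ⟨f, hf, rfl⟩⟩
  have hval : ∀ x : T.domain, ∃ f, (x : K) = R f ∧ T x = f - (s : ℂ) • R f := fun x =>
    (hT x (T x)).1 (T.mem_graph x)
  have hdense : Dense (T.domain : Set K) := by
    rw [Submodule.dense_iff_topologicalClosure_eq_top, Submodule.topologicalClosure_eq_top_iff,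
      Submodule.eq_bot_iff]
    intro y hy
    apply hinj
    rw [← inner_self_eq_zero (𝕜 := ℂ), ← hsym]
    exact (Submodule.mem_orthogonal _ _).1 hy (R (R y)) ((hdom _).2 ⟨_, rfl⟩)
  have hformal : T.IsFormalAdjoint T := by
    intro x y
    obtain ⟨f, hf, hTf⟩ := hval x
    obtain ⟨g, hg, hTg⟩ := hval y
    rw [hTf, hTg, hf, hg]
    rw [inner_sub_left, inner_sub_right, inner_smul_left, inner_smul_right, hsym, ← hsym f g,
      Complex.conj_ofReal]
  rw [LinearPMap.isSelfAdjoint_def]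
  refine le_antisymm ?_ (hformal.le_adjoint hdense)
  have hmem : ∀ y : T.adjoint.domain, ((y : K), T.adjoint y) ∈ T.graph := by
    intro y
    have hadj := T.adjoint_isFormalAdjoint hdense
    rw [hT]
    have key : (y : K) = R (T.adjoint y + (s : ℂ) • (y : K)) := by
      rw [← sub_eq_zero]
      refine ext_inner_right ℂ fun f => ?_
      obtain ⟨g, hg, hTg⟩ := hval ⟨R f, (hdom _).2 ⟨f, rfl⟩⟩
      have hgf : f = g := by
        have : R (f - g) = 0 := by rw [map_sub, sub_eq_zero]; exact hg
        exact sub_eq_zero.1 (hinj _ this)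
      have h := hadj y ⟨R f, (hdom _).2 ⟨f, rfl⟩⟩
      rw [hTg, ← hgf] at h
      simp only [inner_sub_right, inner_smul_right] at h
      rw [inner_sub_left, hsym, inner_add_left, inner_smul_left, inner_zero_left, Complex.conj_ofReal]
      rw [h]
      ring
    refine ⟨T.adjoint y + (s : ℂ) • (y : K), key, ?_⟩
    rw [← key]
    abel
  refine LinearPMap.le_of_le_graph ?_
  intro p hp
  obtain ⟨x, hx⟩ := (LinearPMap.mem_graph_iff _).1 hp
  have := hmem x
  rw [hx.1, hx.2] at this
  exact this

/-- A bounded operator with coercive real part is invertible. -/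
theorem exists_inverse_of_coercive (M : K →L[ℂ] K) {c : ℝ} (hc : 0 < c)
    (hM : ∀ x, c * ‖x‖ ^ 2 ≤ (inner ℂ x (M x)).re) :
    ∃ e : K ≃L[ℂ] K, (e : K →L[ℂ] K) = M := by
  have hbd : ∀ x, c * ‖x‖ ≤ ‖M x‖ := by
    intro x
    rcases eq_or_ne x 0 with rfl | hx
    · simp
    have h1 := (hM x).trans ((Complex.re_le_norm _).trans (norm_inner_le_norm x (M x)))
    have h2 : 0 < ‖x‖ := norm_pos_iff.2 hx
    nlinarith
  have hanti : AntilipschitzWith (Real.toNNReal c⁻¹) M := by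
    refine ContinuousLinearMap.antilipschitz_of_bound M fun x => ?_
    rw [Real.coe_toNNReal _ (inv_nonneg.2 hc.le), ← div_eq_inv_mul, le_div_iff₀ hc, mul_comm]
    exact hbd x
  have hker : M.ker = ⊥ := LinearMap.ker_eq_bot.2 hanti.injective
  have hclosed : IsClosed (M.range : Set K) :=
    (hanti.isClosed_range M.uniformContinuous)
  have hrange : M.range = ⊤ := by
    have : CompleteSpace M.range := hclosed.completeSpace_coe
    rw [← Submodule.orthogonal_eq_bot_iff, Submodule.eq_bot_iff]
    intro y hy
    have h := (Submodule.mem_orthogonal' _ _).1 hy (M y) ⟨y, rfl⟩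
    have h2 := hM y
    rw [h] at h2
    simp only [Complex.zero_re] at h2
    have : ‖y‖ ^ 2 ≤ 0 := by
      by_contra hcon
      push Not at hcon
      nlinarith
    exact norm_eq_zero.1 (pow_eq_zero_iff (two_ne_zero) |>.1 (le_antisymm this (by positivity)))
  exact ⟨ContinuousLinearEquiv.ofBijective M hker hrange, by ext; simp⟩

/-- The (unbounded) operator `L J⁻¹` with domain `ran J`, for an injective `J`. -/
noncomputable def pmapOfFactor (J L : K →L[ℂ] K) : K →ₗ.[ℂ] K :=
  Submodule.toLinearPMap (LinearMap.range ((J : K →ₗ[ℂ] K).prod (L : K →ₗ[ℂ] K)))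

theorem mem_graph_pmapOfFactor {J L : K →L[ℂ] K} (hJ : ∀ x, J x = 0 → x = 0) (x y : K) :
    (x, y) ∈ (pmapOfFactor J L).graph ↔ ∃ z, x = J z ∧ y = L z := by
  rw [pmapOfFactor, Submodule.toLinearPMap_graph_eq]
  · exact ⟨fun ⟨z, h⟩ => ⟨z, (Prod.ext_iff.1 h).1.symm, (Prod.ext_iff.1 h).2.symm⟩,
      fun ⟨z, h⟩ => ⟨z, Prod.ext h.1.symm h.2.symm⟩⟩
  · rintro ⟨x, y⟩ ⟨z, hz⟩ hx
    have h1 : J z = x := (Prod.ext_iff.1 hz).1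
    have h2 : L z = y := (Prod.ext_iff.1 hz).2
    have hx : x = 0 := hx
    change y = 0
    rw [← h2, hJ z (h1.trans hx), map_zero]

variable {J L : K →L[ℂ] K}

/-- If `L J⁻¹` is symmetric and `L + s J` is coercive, then `J (L + s J)⁻¹`, the resolvent of
`L J⁻¹`, is a bounded self-adjoint injective operator. -/
theorem exists_resolvent_of_coercive (hJ : ∀ x, J x = 0 → x = 0)
    (hsym : ∀ x y, inner ℂ (L x) (J y) = inner ℂ (J x) (L y))
    {c s : ℝ} (hc : 0 < c) (hco : ∀ x, c * ‖x‖ ^ 2 ≤ (inner ℂ x (L x + (s : ℂ) • J x)).re) :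
    ∃ R : K →L[ℂ] K, IsSelfAdjoint R ∧ (∀ f, R f = 0 → f = 0) ∧
      (∀ z, R (L z + (s : ℂ) • J z) = J z) ∧
      (∀ f, ∃ z, f = L z + (s : ℂ) • J z) := by
  obtain ⟨e, he⟩ := exists_inverse_of_coercive (L + (s : ℂ) • J) hc (by simpa using hco)
  have he' : ∀ z, e z = L z + (s : ℂ) • J z := fun z => by
    have := congrArg (fun M : K →L[ℂ] K => M z) he
    simpa using this
  refine ⟨J ∘L (e.symm : K →L[ℂ] K), ?_, ?_, ?_, ?_⟩
  · rw [ContinuousLinearMap.isSelfAdjoint_iff_isSymmetric]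
    intro f g
    obtain ⟨x, rfl⟩ := e.surjective f
    obtain ⟨y, rfl⟩ := e.surjective g
    simp only [ContinuousLinearMap.coe_coe, ContinuousLinearMap.comp_apply,
      ContinuousLinearEquiv.coe_coe, ContinuousLinearEquiv.symm_apply_apply]
    rw [he', he', inner_add_left, inner_add_right, inner_smul_left, inner_smul_right,
      Complex.conj_ofReal, hsym]
  · intro f hf
    have := hJ _ hf
    simpa using this
  · intro z
    rw [← he']
    simp
  · intro f
    exact ⟨e.symm f, by rw [← he']; simp⟩

/-- A symmetric operator `L J⁻¹` is self-adjoint if `L + s J` is coercive for some real `s`: then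
`L J⁻¹ + s` is a bijection from `ran J` onto the whole space. -/
theorem isSelfAdjoint_pmapOfFactor (hJ : ∀ x, J x = 0 → x = 0)
    (hsym : ∀ x y, inner ℂ (L x) (J y) = inner ℂ (J x) (L y))
    {c s : ℝ} (hc : 0 < c) (hco : ∀ x, c * ‖x‖ ^ 2 ≤ (inner ℂ x (L x + (s : ℂ) • J x)).re) :
    IsSelfAdjoint (pmapOfFactor J L) := by
  obtain ⟨R, hR, hinj, h1, h2⟩ := exists_resolvent_of_coercive hJ hsym hc hco
  refine isSelfAdjoint_of_graph_resolvent R hR hinj s _ fun x y => ?_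
  rw [mem_graph_pmapOfFactor hJ]
  constructor
  · rintro ⟨z, rfl, rfl⟩
    exact ⟨L z + (s : ℂ) • J z, (h1 z).symm, by rw [h1]; abel⟩
  · rintro ⟨f, rfl, rfl⟩
    obtain ⟨z, rfl⟩ := h2 f
    exact ⟨z, h1 z, by rw [h1]; abel⟩

/-- If `L + s J` is coercive for all `s ≥ 0`, uniformly, then the symmetric operator `L J⁻¹` is
nonnegative. Indeed, its bounded inverse `R` has no negative spectrum, as `1 + s R` is
invertible for all `s > 0`. -/
theorem re_inner_nonneg_of_coercive (hJ : ∀ x, J x = 0 → x = 0)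
    (hsym : ∀ x y, inner ℂ (L x) (J y) = inner ℂ (J x) (L y))
    {c : ℝ} (hc : 0 < c)
    (hco : ∀ s : ℝ, 0 ≤ s → ∀ x, c * ‖x‖ ^ 2 ≤ (inner ℂ x (L x + (s : ℂ) • J x)).re) (x : K) :
    0 ≤ (inner ℂ (J x) (L x)).re := by
  obtain ⟨R, hR, -, h1, h2⟩ := exists_resolvent_of_coercive hJ hsym hc (hco 0 le_rfl)
  have hpos : 0 ≤ R := by
    rw [StarOrderedRing.nonneg_iff_spectrum_nonneg (R := ℝ) R hR]
    intro r hr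
    by_contra hneg
    push Not at hneg
    apply hr
    set s : ℝ := -r⁻¹
    have hs : 0 ≤ s := by
      simp only [s]; exact neg_nonneg.2 (inv_nonpos.2 hneg.le)
    obtain ⟨e0, he0⟩ := exists_inverse_of_coercive (L + ((0 : ℝ) : ℂ) • J) hc
      (by simpa using hco 0 le_rfl)
    obtain ⟨e, he⟩ := exists_inverse_of_coercive (L + (s : ℂ) • J) hc (by simpa using hco s hs)
    -- `r - R = r (L + s J) L⁻¹`
    have hfac : algebraMap ℝ (K →L[ℂ] K) r - R =
        (r : ℂ) • ((e : K →L[ℂ] K) ∘L (e0.symm : K →L[ℂ] K)) := by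
      ext f
      obtain ⟨z, rfl⟩ := e0.surjective f
      have hz0 : e0 z = L z := by
        have := congrArg (fun M : K →L[ℂ] K => M z) he0
        simpa using this
      have hz : e z = L z + (s : ℂ) • J z := by
        have := congrArg (fun M : K →L[ℂ] K => M z) he
        simpa using this
      have hRz : R (e0 z) = J z := by
        rw [hz0]; simpa using h1 z
      have hrs : (r : ℂ) * (s : ℂ) = -1 := by
        rw [← Complex.ofReal_mul]
        simp [s, hneg.ne]
      simp only [sub_apply, smul_apply,
        ContinuousLinearMap.comp_apply, ContinuousLinearEquiv.coe_coe,
        ContinuousLinearEquiv.symm_apply_apply, hRz, hz, smul_add, smul_smul, hrs]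
      rw [Algebra.algebraMap_eq_smul_one, hz0]
      simp [sub_eq_add_neg]
    rw [spectrum.mem_resolventSet_iff, hfac]
    have hu1 : IsUnit ((e : K →L[ℂ] K) ∘L (e0.symm : K →L[ℂ] K)) :=
      ⟨ContinuousLinearEquiv.toUnit (e0.symm.trans e), rfl⟩
    have hr0 : (r : ℂ) ≠ 0 := by exact_mod_cast hneg.ne
    exact hu1.smul (Units.mk0 (r : ℂ) hr0)
  have := ((ContinuousLinearMap.nonneg_iff_isPositive R).1 hpos).2 (L x)
  rw [ContinuousLinearMap.reApplyInnerSelf] at this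
  have h3 : R (L x) = J x := by simpa using h1 x
  rw [h3] at this
  exact this

end Abstract

end

section

/-! ### Radial integrals in `ℝ³` -/

/-- Integration of a nonnegative radial function, by means of a primitive `G` of `r² g(r)`. -/
theorem lintegral_radial_eq {g G : ℝ → ℝ} {l : ℝ} (hG : ContinuousWithinAt G (Ici 0) 0)
    (hd : ∀ r, 0 < r → HasDerivAt G (r ^ 2 * g r) r) (hg : ∀ r, 0 < r → 0 ≤ g r)
    (hl : Tendsto G atTop (𝓝 l)) :
    ∫⁻ x : R3, ENNReal.ofReal (g ‖x‖) = ENNReal.ofReal (4 * π * (l - G 0)) := by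
  have hd' : ∀ r ∈ Ioi (0 : ℝ), HasDerivAt G (r ^ 2 * g r) r := fun r hr => hd r hr
  have hpos : ∀ r ∈ Ioi (0 : ℝ), 0 ≤ r ^ 2 * g r := fun r hr => mul_nonneg (sq_nonneg r) (hg r hr)
  have hint := integrableOn_Ioi_deriv_of_nonneg hG hd' hpos hl
  have hval := integral_Ioi_of_hasDerivAt_of_nonneg hG hd' hpos hl
  have hdim : Module.finrank ℝ R3 = 3 := by simp
  have hint3 : Integrable (fun x : R3 => g ‖x‖) volume := by
    rw [integrable_fun_norm_addHaar, hdim]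
    simpa using hint
  have hae : 0 ≤ᵐ[volume] fun x : R3 => g ‖x‖ := by
    have : ∀ᵐ x : R3, x ≠ 0 := by
      simp [ae_iff, measure_singleton]
    filter_upwards [this] with x hx
    exact hg _ (norm_pos_iff.2 hx)
  rw [← ofReal_integral_eq_lintegral_ofReal hint3 hae, integral_fun_norm_addHaar, hdim]
  have hball : (volume : Measure R3).real (Metric.ball 0 1) = 4 / 3 * π := by
    rw [Measure.real, EuclideanSpace.volume_ball_fin_three]
    simp only [ENNReal.ofReal_one, one_pow, one_mul]
    rw [ENNReal.toReal_ofReal (by positivity)]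
    ring
  rw [hball]
  simp only [Nat.add_one_sub_one, smul_eq_mul, nsmul_eq_mul, Nat.cast_ofNat]
  rw [hval]
  congr 1
  ring

/-- A primitive of `(1 + t) / (√t (1 + t²))`. -/
noncomputable def arctanPrimitive (t : ℝ) : ℝ :=
  √2 * (Real.arctan (√(2 * t) + 1) + Real.arctan (√(2 * t) - 1))

theorem hasDerivAt_arctanPrimitive {t : ℝ} (ht : 0 < t) :
    HasDerivAt arctanPrimitive ((1 + t) / (√t * (1 + t ^ 2))) t := by
  have h2t : 0 < 2 * t := by positivity
  have hu : HasDerivAt (fun t => √(2 * t)) (1 / √(2 * t)) t := by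
    have := ((hasDerivAt_id t).const_mul 2).sqrt (by simpa using h2t.ne')
    refine this.congr_deriv ?_
    simp only [id]
    field_simp
  have h : HasDerivAt arctanPrimitive _ t :=
    ((hu.add_const 1).arctan.add (hu.sub_const 1).arctan).const_mul √2
  refine h.congr_deriv ?_
  have e1 : √(2 * t) = √2 * √t := Real.sqrt_mul (by norm_num) t
  have e2 : √2 ^ 2 = 2 := Real.sq_sqrt (by norm_num)
  have e3 : √t ^ 2 = t := Real.sq_sqrt ht.le
  have hv : 0 < √t := Real.sqrt_pos.2 ht
  rw [e1]
  set v := √t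
  set c := √2
  have hc : 0 < c := Real.sqrt_pos.2 (by norm_num)
  have hp : 1 + (c * v + 1) ^ 2 = 2 * (1 + c * v + v ^ 2) := by
    have : (c * v) ^ 2 = 2 * v ^ 2 := by rw [mul_pow, e2]
    linear_combination this
  have hm : 1 + (c * v - 1) ^ 2 = 2 * (1 - c * v + v ^ 2) := by
    have : (c * v) ^ 2 = 2 * v ^ 2 := by rw [mul_pow, e2]
    linear_combination this
  have hpp : 0 < 1 + c * v + v ^ 2 := by positivity
  have hmp : 0 < 1 - c * v + v ^ 2 := by nlinarith [sq_nonneg (c * v - 1)]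
  rw [hp, hm, ← e3]
  have h4 : (1 + c * v + v ^ 2) * (1 - c * v + v ^ 2) = 1 + (v ^ 2) ^ 2 := by
    linear_combination (-v ^ 2) * e2
  have : 1 / (2 * (1 + c * v + v ^ 2)) * (1 / (c * v)) + 1 / (2 * (1 - c * v + v ^ 2)) * (1 / (c * v))
      = (1 + v ^ 2) / (c * v * (1 + (v ^ 2) ^ 2)) := by
    rw [← h4]
    field_simp
    ring
  rw [this]
  field_simp

theorem continuous_arctanPrimitive : Continuous arctanPrimitive := by
  unfold arctanPrimitive
  fun_prop

theorem arctanPrimitive_zero : arctanPrimitive 0 = 0 := by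
  simp [arctanPrimitive, Real.arctan_neg]

theorem tendsto_arctanPrimitive : Tendsto arctanPrimitive atTop (𝓝 (√2 * π)) := by
  have h : Tendsto (fun t : ℝ => √(2 * t)) atTop atTop :=
    Real.tendsto_sqrt_atTop.comp (tendsto_id.const_mul_atTop (by norm_num))
  have ha := Real.tendsto_arctan_atTop.mono_right nhdsWithin_le_nhds
  have := ((ha.comp (tendsto_atTop_add_const_right _ 1 h)).add
    (ha.comp (tendsto_atTop_add_const_right _ (-1) h))).const_mul √2
  rw [add_halves] at this
  exact this

/-- A primitive of `√t (1 + t) / (1 + t²)²`. -/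
noncomputable def arctanPrimitive₂ (t : ℝ) : ℝ :=
  √t * (t - 1) / (2 * (1 + t ^ 2)) + arctanPrimitive t / 4

theorem hasDerivAt_arctanPrimitive₂ {t : ℝ} (ht : 0 < t) :
    HasDerivAt arctanPrimitive₂ (√t * (1 + t) / (1 + t ^ 2) ^ 2) t := by
  have hv : 0 < √t := Real.sqrt_pos.2 ht
  have h1 : HasDerivAt (fun t => √t * (t - 1)) (1 / (2 * √t) * (t - 1) + √t * 1) t :=
    (Real.hasDerivAt_sqrt ht.ne').mul ((hasDerivAt_id t).sub_const 1)
  have h2 : HasDerivAt (fun t : ℝ => 2 * (1 + t ^ 2)) (2 * (2 * t)) t := by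
    have := ((hasDerivAt_pow 2 t).const_add 1).const_mul 2
    simpa using this
  have h : HasDerivAt arctanPrimitive₂ _ t :=
    (h1.div h2 (by positivity)).add ((hasDerivAt_arctanPrimitive ht).div_const 4)
  refine h.congr_deriv ?_
  have e3 : √t ^ 2 = t := Real.sq_sqrt ht.le
  set v := √t
  rw [← e3]
  field_simp
  ring

theorem continuous_arctanPrimitive₂ : Continuous arctanPrimitive₂ := by
  unfold arctanPrimitive₂
  have := continuous_arctanPrimitive
  refine Continuous.add (Continuous.div (by fun_prop) (by fun_prop) fun t => by positivity)
    (by fun_prop)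

theorem arctanPrimitive₂_zero : arctanPrimitive₂ 0 = 0 := by
  simp [arctanPrimitive₂, arctanPrimitive_zero]

theorem tendsto_arctanPrimitive₂ : Tendsto arctanPrimitive₂ atTop (𝓝 (√2 * π / 4)) := by
  have h : Tendsto (fun t : ℝ => √t * (t - 1) / (2 * (1 + t ^ 2))) atTop (𝓝 0) := by
    have h0 : Tendsto (fun t : ℝ => (√t)⁻¹) atTop (𝓝 0) :=
      tendsto_inv_atTop_zero.comp Real.tendsto_sqrt_atTop
    refine squeeze_zero_norm' ?_ h0
    filter_upwards [eventually_gt_atTop 1] with t ht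
    have hv : 0 < √t := Real.sqrt_pos.2 (by linarith)
    have e3 : √t ^ 2 = t := Real.sq_sqrt (by linarith)
    rw [Real.norm_of_nonneg (div_nonneg (mul_nonneg hv.le (by linarith)) (by positivity)),
      div_le_iff₀ (by positivity), inv_mul_eq_div, le_div_iff₀ hv]
    nlinarith
  have := h.add (tendsto_arctanPrimitive.div_const 4)
  rwa [zero_add] at this

/-- The weight `(1 + t) / (s r² √t (1 + t²))`, where `t = r / s`. -/
noncomputable def radialWeight (s r : ℝ) : ℝ :=
  (1 + r / s) / (√(r / s) * (1 + (r / s) ^ 2)) / (s * r ^ 2)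

/-- The weight `√t (1 + t) / (s r² (1 + t²)²)`, where `t = r / s`. -/
noncomputable def radialWeight₂ (s r : ℝ) : ℝ :=
  √(r / s) * (1 + r / s) / (1 + (r / s) ^ 2) ^ 2 / (s * r ^ 2)

theorem lintegral_radialWeight {s : ℝ} (hs : 0 < s) :
    ∫⁻ x : R3, ENNReal.ofReal (radialWeight s ‖x‖) = ENNReal.ofReal (4 * π * (√2 * π)) := by
  rw [lintegral_radial_eq (G := fun r => arctanPrimitive (r / s)) (l := √2 * π)]
  · simp [arctanPrimitive_zero]
  · exact (continuous_arctanPrimitive.comp (continuous_id.div_const s)).continuousWithinAt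
  · intro r hr
    have h := (hasDerivAt_arctanPrimitive (div_pos hr hs)).comp r ((hasDerivAt_id r).div_const s)
    refine h.congr_deriv ?_
    rw [radialWeight]
    field_simp
  · intro r hr
    rw [radialWeight]
    positivity
  · exact tendsto_arctanPrimitive.comp (tendsto_id.atTop_div_const hs)

theorem lintegral_radialWeight₂ {s : ℝ} (hs : 0 < s) :
    ∫⁻ x : R3, ENNReal.ofReal (radialWeight₂ s ‖x‖) =
      ENNReal.ofReal (4 * π * (√2 * π / 4)) := by
  rw [lintegral_radial_eq (G := fun r => arctanPrimitive₂ (r / s)) (l := √2 * π / 4)]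
  · simp [arctanPrimitive₂_zero]
  · exact (continuous_arctanPrimitive₂.comp (continuous_id.div_const s)).continuousWithinAt
  · intro r hr
    have h := (hasDerivAt_arctanPrimitive₂ (div_pos hr hs)).comp r ((hasDerivAt_id r).div_const s)
    refine h.congr_deriv ?_
    rw [radialWeight₂]
    field_simp
  · intro r hr
    rw [radialWeight₂]
    positivity
  · exact tendsto_arctanPrimitive₂.comp (tendsto_id.atTop_div_const hs)

theorem lintegral_inv_sq_mul_inv_sq_add {s : ℝ} (hs : 0 < s) :
    ∫⁻ x : R3, ENNReal.ofReal (1 / (‖x‖ ^ 2 * (s ^ 2 + ‖x‖ ^ 2))) =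
      ENNReal.ofReal (2 * π ^ 2 / s) := by
  rw [lintegral_radial_eq (g := fun r => 1 / (r ^ 2 * (s ^ 2 + r ^ 2)))
    (G := fun r => Real.arctan (r / s) / s) (l := π / 2 / s)]
  · simp only [zero_div, Real.arctan_zero]
    congr 1
    ring
  · fun_prop
  · intro r hr
    have h := ((hasDerivAt_id r).div_const s).arctan.div_const s
    refine h.congr_deriv ?_
    simp only [id]
    field_simp
  · intro r hr
    positivity
  · exact ((Real.tendsto_arctan_atTop.mono_right nhdsWithin_le_nhds).comp
      (tendsto_id.atTop_div_const hs)).div_const s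

/-- Averaging `⟪p, x⟫²` over the sphere. -/
theorem lintegral_inner_sq_mul_radial (p : R3) (g : ℝ → ℝ≥0∞) (hg : Measurable g) :
    ∫⁻ x : R3, ENNReal.ofReal (inner ℝ p x ^ 2) * g ‖x‖ =
      ENNReal.ofReal (‖p‖ ^ 2 / 3) * ∫⁻ x : R3, ENNReal.ofReal (‖x‖ ^ 2) * g ‖x‖ := by
  -- `⟪p, x⟫²` and `⟪q, x⟫²` have the same average if `‖p‖ = ‖q‖`, as a reflection swaps `p`, `q`
  have hrot : ∀ p q : R3, ‖p‖ = ‖q‖ →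
      ∫⁻ x : R3, ENNReal.ofReal (inner ℝ p x ^ 2) * g ‖x‖ =
        ∫⁻ x : R3, ENNReal.ofReal (inner ℝ q x ^ 2) * g ‖x‖ := by
    intro p q hpq
    set e := (ℝ ∙ (p - q))ᗮ.reflection
    have he : e p = q := Submodule.reflection_sub hpq
    rw [← (LinearIsometryEquiv.measurePreserving e).lintegral_comp
      (f := fun x => ENNReal.ofReal (inner ℝ q x ^ 2) * g ‖x‖) (by fun_prop)]
    refine lintegral_congr fun x => ?_
    rw [← he, e.inner_map_map, e.norm_map]
  let b := EuclideanSpace.basisFun (Fin 3) ℝ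
  have hb : ∀ i, ∫⁻ x : R3, ENNReal.ofReal (inner ℝ p x ^ 2) * g ‖x‖ =
      ENNReal.ofReal (‖p‖ ^ 2) * ∫⁻ x : R3, ENNReal.ofReal (inner ℝ (b i) x ^ 2) * g ‖x‖ := by
    intro i
    rw [hrot p (‖p‖ • b i) (by simp [norm_smul]), ← lintegral_const_mul _ (by fun_prop)]
    refine lintegral_congr fun x => ?_
    rw [inner_smul_left, ← mul_assoc, ← ENNReal.ofReal_mul (by positivity)]
    simp [mul_pow]
  have hsum : ∫⁻ x : R3, ENNReal.ofReal (‖x‖ ^ 2) * g ‖x‖ =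
      ∑ i, ∫⁻ x : R3, ENNReal.ofReal (inner ℝ (b i) x ^ 2) * g ‖x‖ := by
    rw [← lintegral_finsetSum _ (fun i _ => by fun_prop)]
    refine lintegral_congr fun x => ?_
    rw [← Finset.sum_mul, ← ENNReal.ofReal_sum_of_nonneg (fun i _ => sq_nonneg _)]
    congr 2
    have := b.sum_sq_norm_inner_right x
    simpa using this.symm
  have h3 : (3 : ℝ≥0∞) * ∫⁻ x : R3, ENNReal.ofReal (inner ℝ p x ^ 2) * g ‖x‖ =
      ENNReal.ofReal (‖p‖ ^ 2) * ∫⁻ x : R3, ENNReal.ofReal (‖x‖ ^ 2) * g ‖x‖ := by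
    rw [hsum, Finset.mul_sum, ← Finset.sum_congr rfl (fun i _ => hb i)]
    simp
  rw [ENNReal.ofReal_div_of_pos (by norm_num), ENNReal.div_eq_inv_mul, mul_assoc, ← h3, ← mul_assoc]
  rw [ENNReal.ofReal_ofNat, ENNReal.inv_mul_cancel (by norm_num) (by norm_num), one_mul]

end

section

/-! ### Schur tests for the kernels `|p - q|⁻²` and `(p² + q² - 2c p·q)⁻¹` -/

theorem measurable_radialWeight (s : ℝ) : Measurable (radialWeight s) := by
  unfold radialWeight; fun_prop

theorem measurable_radialWeight₂ (s : ℝ) : Measurable (radialWeight₂ s) := by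
  unfold radialWeight₂; fun_prop

theorem radialWeight_eq {s r : ℝ} (hs : 0 < s) (hr : 0 < r) :
    radialWeight s r = (s + r) * √s / (r ^ 2 * √r * (s ^ 2 + r ^ 2)) := by
  rw [radialWeight, Real.sqrt_div hr.le]
  have h1 : 0 < √s := Real.sqrt_pos.2 hs
  have h2 : 0 < √r := Real.sqrt_pos.2 hr
  field_simp

/-- `|v|²` is bounded below by `s² + r²` unless `|v|` is small. -/
theorem one_div_sq_mul_le {s r v X Y : ℝ} (hs : 0 < s) (hv : 0 < v) (hr : 0 ≤ r)
    (h1 : r ≤ s + v) (hX : 0 ≤ X) (hY : 0 ≤ Y)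
    (hXY : v < s / 2 → X ≤ 8 * Y / s ^ 2) :
    X / v ^ 2 ≤ 13 * (X / (s ^ 2 + r ^ 2) + Y / (v ^ 2 * (s ^ 2 + v ^ 2))) := by
  have hA : 0 ≤ X / (s ^ 2 + r ^ 2) := by positivity
  have hB : 0 ≤ Y / (v ^ 2 * (s ^ 2 + v ^ 2)) := by positivity
  rcases lt_or_ge v (s / 2) with h | h
  · have h2 : X / v ^ 2 ≤ 8 * Y / s ^ 2 / v ^ 2 := by gcongr; exact hXY h
    have h3 : 8 * Y / s ^ 2 / v ^ 2 ≤ 13 * (Y / (v ^ 2 * (s ^ 2 + v ^ 2))) := by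
      rw [div_div, ← mul_div_assoc, div_le_div_iff₀ (by positivity) (by positivity)]
      have : v ^ 2 ≤ s ^ 2 / 4 := by nlinarith
      have hYv : 0 ≤ Y * v ^ 2 := by positivity
      nlinarith [mul_nonneg hYv (sub_nonneg.2 this), mul_nonneg hYv (sq_nonneg s)]
    linarith
  · have h2 : s ^ 2 + r ^ 2 ≤ 13 * v ^ 2 := by nlinarith
    have h3 : X / v ^ 2 ≤ 13 * (X / (s ^ 2 + r ^ 2)) := by
      rw [← mul_div_assoc, div_le_div_iff₀ (by positivity) (by positivity)]
      nlinarith [mul_nonneg hX (sub_nonneg.2 h2)]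
    linarith

/-- The Schur constant for the kernel `|p - q|⁻²`. The factor `13` is that of `one_div_sq_mul_le`,
the two summands are the integrals of the two terms there. -/
noncomputable def schurConst : ℝ := 13 * (4 * π * (√2 * π) + 2 * π ^ 2)

theorem schurConst_pos : 0 < schurConst := by
  unfold schurConst; positivity

/-- Integration of a radial function against `|q - p|⁻²`. Near `p` the function is bounded by a
multiple of `b / |p|²`, and away from `p` the weight is bounded by a multiple of
`1 / (|p|² + |q|²)`. -/
theorem lintegral_hardy_kernel_le {p : R3} (hp : p ≠ 0) {f : ℝ → ℝ} {a b : ℝ} (ha : 0 ≤ a)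
    (hb : 0 ≤ b) (h0 : f 0 = 0) (hf : ∀ r, 0 < r → 0 ≤ f r)
    (hnear : ∀ r, ‖p‖ / 2 ≤ r → f r ≤ 8 * b / ‖p‖ ^ 2)
    (hfar : ∀ r, 0 < r → f r / (‖p‖ ^ 2 + r ^ 2) ≤ a * radialWeight ‖p‖ r) :
    ∫⁻ v : R3, ENNReal.ofReal (f ‖p + v‖ / ‖v‖ ^ 2) ≤
      ENNReal.ofReal (13 * (a * (4 * π * (√2 * π)) + b * (2 * π ^ 2 / ‖p‖))) := by
  have hs : 0 < ‖p‖ := norm_pos_iff.2 hp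
  set s := ‖p‖
  calc ∫⁻ v : R3, ENNReal.ofReal (f ‖p + v‖ / ‖v‖ ^ 2)
      ≤ ∫⁻ v : R3, (ENNReal.ofReal (13 * a) * ENNReal.ofReal (radialWeight s ‖p + v‖) +
          ENNReal.ofReal (13 * b) * ENNReal.ofReal (1 / (‖v‖ ^ 2 * (s ^ 2 + ‖v‖ ^ 2)))) := by
        refine lintegral_mono fun v => ?_
        rcases eq_or_ne v 0 with rfl | hv0
        · simp
        rcases eq_or_ne (p + v) 0 with hq0 | hq0
        · simp [hq0, h0]
        have hv : 0 < ‖v‖ := norm_pos_iff.2 hv0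
        have hr : 0 < ‖p + v‖ := norm_pos_iff.2 hq0
        have htri : s ≤ ‖p + v‖ + ‖v‖ := by simpa using norm_sub_le (p + v) v
        have hw : 0 ≤ radialWeight s ‖p + v‖ := by rw [radialWeight_eq hs hr]; positivity
        rw [← ENNReal.ofReal_mul (by positivity), ← ENNReal.ofReal_mul (by positivity),
          ← ENNReal.ofReal_add (by positivity) (by positivity)]
        refine ENNReal.ofReal_le_ofReal ((one_div_sq_mul_le hs hv hr.le (norm_add_le p v)
          (hf _ hr) hb fun hlt => hnear _ (by linarith)).trans ?_)
        have := hfar _ hr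
        calc _ ≤ 13 * (a * radialWeight s ‖p + v‖ + b / (‖v‖ ^ 2 * (s ^ 2 + ‖v‖ ^ 2))) := by gcongr
          _ = _ := by ring
    _ = _ := by
        rw [lintegral_add_left (by have := measurable_radialWeight s; fun_prop),
          lintegral_const_mul _ (by have := measurable_radialWeight s; fun_prop),
          lintegral_const_mul _ (by fun_prop),
          lintegral_add_left_eq_self (fun q => ENNReal.ofReal (radialWeight s ‖q‖)) p,
          lintegral_radialWeight hs, lintegral_inv_sq_mul_inv_sq_add hs,
          ← ENNReal.ofReal_mul (by positivity), ← ENNReal.ofReal_mul (by positivity),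
          ← ENNReal.ofReal_add (by positivity) (by positivity)]
        congr 1
        ring

theorem sqrt_le_two_mul_sqrt {s r : ℝ} (hs : 0 < s) (h : s / 2 ≤ r) : √s / 2 ≤ √r := by
  rw [div_le_iff₀ two_pos, Real.sqrt_le_iff, mul_pow, Real.sq_sqrt (by linarith)]
  exact ⟨by positivity, by linarith⟩

theorem lintegral_hardy_kernel_high {p : R3} (hp : p ≠ 0) :
    ∫⁻ v : R3, ENNReal.ofReal (1 / (‖v‖ ^ 2 * (‖p + v‖ ^ 2 * √‖p + v‖))) ≤
      ENNReal.ofReal (schurConst / (‖p‖ * √‖p‖)) := by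
  have hs : 0 < ‖p‖ := norm_pos_iff.2 hp
  have h := lintegral_hardy_kernel_le hp (f := fun r => 1 / (r ^ 2 * √r))
    (a := 1 / (‖p‖ * √‖p‖)) (b := 1 / √‖p‖) (by positivity) (by positivity) (by simp)
    (fun r hr => by positivity)
  set s := ‖p‖
  have h1 : 0 < √s := Real.sqrt_pos.2 hs
  convert h (fun r hr => ?_) (fun r hr => ?_) using 4
  · rw [div_div, mul_comm]
  · rw [schurConst]
    field_simp
  · have := sqrt_le_two_mul_sqrt hs hr
    calc 1 / (r ^ 2 * √r) ≤ 1 / ((s / 2) ^ 2 * (√s / 2)) := by gcongr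
      _ = 8 * (1 / √s) / s ^ 2 := by field_simp; norm_num
  · have h2 : 0 < √r := Real.sqrt_pos.2 hr
    rw [radialWeight_eq hs hr, div_div, div_mul_div_comm, one_mul,
      div_le_div_iff₀ (by positivity) (by positivity)]
    have : 0 ≤ √s * (r ^ 2 * √r * (s ^ 2 + r ^ 2)) * r := by positivity
    nlinarith

theorem lintegral_hardy_kernel_low {p : R3} (hp : p ≠ 0) :
    ∫⁻ v : R3, ENNReal.ofReal (1 / (‖v‖ ^ 2 * (‖p + v‖ * √‖p + v‖))) ≤
      ENNReal.ofReal (schurConst / √‖p‖) := by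
  have hs : 0 < ‖p‖ := norm_pos_iff.2 hp
  have h := lintegral_hardy_kernel_le hp (f := fun r => 1 / (r * √r))
    (a := 1 / √‖p‖) (b := √‖p‖) (by positivity) (by positivity) (by simp)
    (fun r hr => by positivity)
  set s := ‖p‖
  have h1 : 0 < √s := Real.sqrt_pos.2 hs
  have hss : √s ^ 2 = s := Real.sq_sqrt hs.le
  convert h (fun r hr => ?_) (fun r hr => ?_) using 4
  · rw [div_div, mul_comm]
  · rw [schurConst]
    field_simp
    rw [hss]
    ring
  · have := sqrt_le_two_mul_sqrt hs hr
    have hr0 : 0 ≤ r := by linarith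
    calc 1 / (r * √r) ≤ 1 / ((s / 2) * (√s / 2)) := by gcongr
      _ = 4 / (s * √s) := by field_simp; norm_num
      _ ≤ 8 * √s / s ^ 2 := by
          rw [div_le_div_iff₀ (by positivity) (by positivity)]
          nlinarith [mul_pos hs hs]
  · have h2 : 0 < √r := Real.sqrt_pos.2 hr
    rw [radialWeight_eq hs hr, div_div, div_mul_div_comm, one_mul,
      div_le_div_iff₀ (by positivity) (by positivity)]
    have : 0 ≤ √s * (r * √r * (s ^ 2 + r ^ 2)) * s := by positivity
    nlinarith

/-- The kernel of the symmetrized Schur test for `(p² + q² - 2c p·q)⁻¹` between `q` and `p`. -/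
noncomputable def symKernel (c : ℝ) (p q : R3) : ℝ :=
  (1 / ‖p‖ + 1 / ‖q‖) / 2 * (‖p‖ / ‖q‖ * √(‖p‖ / ‖q‖)) /
    (‖p‖ ^ 2 + ‖q‖ ^ 2 - 2 * c * inner ℝ p q)

/-- The constant of the symmetrized Schur test. -/
noncomputable def symConst : ℝ := 19 / 9 * √2 * π ^ 2

theorem symConst_lt : symConst < π ^ 3 := by
  have h2 : √2 < 1.4143 := by
    rw [Real.sqrt_lt' (by norm_num)]; norm_num
  have hpi := Real.pi_gt_d4
  have : symConst < 3 * π ^ 2 := by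
    unfold symConst
    have : 19 / 9 * √2 < 3 := by linarith
    have := Real.pi_pos
    gcongr
  nlinarith [Real.pi_pos, sq_nonneg π]

/-- In the average over `±q` the direction of `q` enters only through `⟪p, q⟫²`, which can be
integrated explicitly over spheres. -/
theorem symKernel_add_symKernel_neg_le {c : ℝ} (hc : |c| ≤ 1 / 2) {p q : R3} (hp : p ≠ 0) (hq : q ≠ 0) :
    0 ≤ symKernel c p q ∧ symKernel c p q + symKernel c p (-q) ≤
      radialWeight ‖p‖ ‖q‖ + 4 / 3 * inner ℝ p q ^ 2 *
        (radialWeight ‖p‖ ‖q‖ / (‖p‖ ^ 2 + ‖q‖ ^ 2) ^ 2) := by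
  have hs : 0 < ‖p‖ := norm_pos_iff.2 hp
  have hr : 0 < ‖q‖ := norm_pos_iff.2 hq
  have hi : |inner ℝ p q| ≤ ‖p‖ * ‖q‖ := abs_real_inner_le_norm p q
  rw [symKernel, symKernel, inner_neg_right, norm_neg, radialWeight]
  set s := ‖p‖
  set r := ‖q‖
  set x : ℝ := inner ℝ p q
  have hA : 2 * (s * r) ≤ s ^ 2 + r ^ 2 := by nlinarith [sq_nonneg (s - r)]
  have hB : |2 * c * x| ≤ |x| := by
    rw [abs_mul, abs_mul, abs_two]
    nlinarith [abs_nonneg x]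
  have hBA : 2 * |2 * c * x| ≤ s ^ 2 + r ^ 2 := by linarith
  set A := s ^ 2 + r ^ 2
  set B := 2 * c * x
  have hA0 : 0 < A := by positivity
  have hm : 0 < A - B := by have := le_abs_self B; linarith
  have hpl : 0 < A + B := by have := neg_abs_le B; linarith
  have hB2 : B ^ 2 ≤ x ^ 2 := sq_le_sq.2 hB
  have hBA2 : 4 * B ^ 2 ≤ A ^ 2 := by
    have : (2 * |B|) ^ 2 ≤ A ^ 2 := by gcongr
    rw [mul_pow, sq_abs] at this
    linarith
  have h1 : 0 < √s := Real.sqrt_pos.2 hs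
  have h2 : 0 < √r := Real.sqrt_pos.2 hr
  have hss : √s ^ 2 = s := Real.sq_sqrt hs.le
  have hrr : √r ^ 2 = r := Real.sq_sqrt hr.le
  refine ⟨by positivity, ?_⟩
  set w := (1 / s + 1 / r) / 2 * (s / r * √(s / r)) with hw
  have hw0 : 0 < w := by positivity
  have e1 : (1 + r / s) / (√(r / s) * (1 + (r / s) ^ 2)) / (s * r ^ 2) = 2 * w / A := by
    rw [hw, Real.sqrt_div hr.le, Real.sqrt_div hs.le]
    have : A = s ^ 2 + r ^ 2 := rfl
    rw [this]
    field_simp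
    ring
  rw [e1, show 2 * c * -x = -B by ring, sub_neg_eq_add]
  have e2 : w / (A - B) + w / (A + B) = 2 * w * (A / (A ^ 2 - B ^ 2)) := by
    rw [show A ^ 2 - B ^ 2 = (A - B) * (A + B) by ring]
    field_simp
    ring
  have hAB : 0 < A ^ 2 - B ^ 2 := by nlinarith
  -- This is `1 / (1 - y) ≤ 1 + 4 y / 3` for `y = (B / A)² ≤ 1 / 4`.
  have e3 : A / (A ^ 2 - B ^ 2) ≤ 1 / A + 4 / 3 * B ^ 2 / A ^ 3 := by
    have : 1 / A + 4 / 3 * B ^ 2 / A ^ 3 = (A ^ 2 + 4 / 3 * B ^ 2) / A ^ 3 := by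
      field_simp
    rw [this, div_le_div_iff₀ hAB (by positivity)]
    nlinarith [mul_nonneg (sq_nonneg B) (sub_nonneg.2 hBA2)]
  calc _ = 2 * w * (A / (A ^ 2 - B ^ 2)) := e2
    _ ≤ 2 * w * (1 / A + 4 / 3 * x ^ 2 / A ^ 3) := by
        refine mul_le_mul_of_nonneg_left (e3.trans ?_) (by positivity)
        gcongr
    _ = _ := by
        field_simp

/-- The symmetrized Schur test. The dependence of the kernel on the direction of `q` is removed by
averaging over `±q` and by `1 / (1 - x²) ≤ 1 + 4 x² / 3` for `x² ≤ 1 / 4`. -/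
theorem lintegral_symKernel_le {c : ℝ} (hc : |c| ≤ 1 / 2) {p : R3} (hp : p ≠ 0) :
    ∫⁻ q : R3, ENNReal.ofReal (symKernel c p q) ≤ ENNReal.ofReal symConst := by
  have hs : 0 < ‖p‖ := norm_pos_iff.2 hp
  have hmeas : Measurable fun q : R3 => ENNReal.ofReal (symKernel c p q) := by
    unfold symKernel; fun_prop
  have mw := measurable_radialWeight ‖p‖
  have mw2 := measurable_radialWeight₂ ‖p‖
  have hneg : ∫⁻ q : R3, ENNReal.ofReal (symKernel c p (-q)) =
      ∫⁻ q : R3, ENNReal.ofReal (symKernel c p q) :=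
    (Measure.measurePreserving_neg (volume : Measure R3)).lintegral_comp hmeas
  have hae : ∀ᵐ q : R3, q ≠ 0 := by simp [ae_iff, measure_singleton]
  have hg : Measurable fun r : ℝ =>
      ENNReal.ofReal (radialWeight ‖p‖ r / (‖p‖ ^ 2 + r ^ 2) ^ 2) := by fun_prop
  have h2 : 2 * ∫⁻ q : R3, ENNReal.ofReal (symKernel c p q) ≤ 2 * ENNReal.ofReal symConst := by
    calc 2 * ∫⁻ q : R3, ENNReal.ofReal (symKernel c p q)
        = ∫⁻ q : R3, (ENNReal.ofReal (symKernel c p q) + ENNReal.ofReal (symKernel c p (-q))) := by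
          rw [lintegral_add_left hmeas, hneg, two_mul]
      _ ≤ ∫⁻ q : R3, (ENNReal.ofReal (radialWeight ‖p‖ ‖q‖) + ENNReal.ofReal (4 / 3) *
            (ENNReal.ofReal (inner ℝ p q ^ 2) *
              ENNReal.ofReal (radialWeight ‖p‖ ‖q‖ / (‖p‖ ^ 2 + ‖q‖ ^ 2) ^ 2))) := by
          refine lintegral_mono_ae ?_
          filter_upwards [hae] with q hq
          have hr : 0 < ‖q‖ := norm_pos_iff.2 hq
          have h0 : 0 ≤ radialWeight ‖p‖ ‖q‖ := by rw [radialWeight_eq hs hr]; positivity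
          rw [← ENNReal.ofReal_add (symKernel_add_symKernel_neg_le hc hp hq).1
            (symKernel_add_symKernel_neg_le hc hp (neg_ne_zero.2 hq)).1,
            ← ENNReal.ofReal_mul (by positivity), ← ENNReal.ofReal_mul (by positivity),
            ← ENNReal.ofReal_add h0 (by positivity)]
          refine ENNReal.ofReal_le_ofReal ?_
          rw [← mul_assoc]
          exact (symKernel_add_symKernel_neg_le hc hp hq).2
      _ = ∫⁻ q : R3, (ENNReal.ofReal (radialWeight ‖p‖ ‖q‖) + ENNReal.ofReal (4 / 3) *
            (ENNReal.ofReal (‖p‖ ^ 2 / 3) * (ENNReal.ofReal (‖q‖ ^ 2) *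
              ENNReal.ofReal (radialWeight ‖p‖ ‖q‖ / (‖p‖ ^ 2 + ‖q‖ ^ 2) ^ 2)))) := by
          rw [lintegral_add_left (by fun_prop), lintegral_add_left (by fun_prop),
            lintegral_const_mul _ (by fun_prop), lintegral_const_mul _ (by fun_prop),
            lintegral_const_mul _ (by fun_prop), lintegral_inner_sq_mul_radial p _ hg]
      _ ≤ ∫⁻ q : R3, (ENNReal.ofReal (radialWeight ‖p‖ ‖q‖) + ENNReal.ofReal (2 / 9) *
            ENNReal.ofReal (radialWeight₂ ‖p‖ ‖q‖)) := by
          refine lintegral_mono_ae ?_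
          filter_upwards [hae] with q hq
          have hr : 0 < ‖q‖ := norm_pos_iff.2 hq
          have h0 : 0 ≤ radialWeight ‖p‖ ‖q‖ := by rw [radialWeight_eq hs hr]; positivity
          refine add_le_add_right ?_ _
          rw [← ENNReal.ofReal_mul (by positivity), ← ENNReal.ofReal_mul (by positivity),
            ← ENNReal.ofReal_mul (by positivity), ← ENNReal.ofReal_mul (by positivity)]
          refine ENNReal.ofReal_le_ofReal ?_
          set s := ‖p‖
          set r := ‖q‖
          have e : radialWeight₂ s r = radialWeight s r * (s * r / (s ^ 2 + r ^ 2)) := by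
            have h1 : 0 < √s := Real.sqrt_pos.2 hs
            have h2 : 0 < √r := Real.sqrt_pos.2 hr
            have hss : √s ^ 2 = s := Real.sq_sqrt hs.le
            have hrr : √r ^ 2 = r := Real.sq_sqrt hr.le
            rw [radialWeight, radialWeight₂, Real.sqrt_div hr.le]
            field_simp
            rw [hss, hrr]
            ring
          have hz : s * r / (s ^ 2 + r ^ 2) ≤ 1 / 2 := by
            rw [div_le_div_iff₀ (by positivity) (by norm_num)]
            nlinarith [sq_nonneg (s - r)]
          have hz0 : 0 ≤ s * r / (s ^ 2 + r ^ 2) := by positivity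
          rw [e]
          calc 4 / 3 * (s ^ 2 / 3 * (r ^ 2 * (radialWeight s r / (s ^ 2 + r ^ 2) ^ 2)))
              = 4 / 9 * radialWeight s r * (s * r / (s ^ 2 + r ^ 2)) * (s * r / (s ^ 2 + r ^ 2)) := by
                field_simp; ring
            _ ≤ 4 / 9 * radialWeight s r * (s * r / (s ^ 2 + r ^ 2)) * (1 / 2) := by
                gcongr
            _ = _ := by ring
      _ = 2 * ENNReal.ofReal symConst := by
          rw [lintegral_add_left (by fun_prop), lintegral_const_mul _ (by fun_prop),
            lintegral_radialWeight hs, lintegral_radialWeight₂ hs,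
            ← ENNReal.ofReal_mul (by positivity), ← ENNReal.ofReal_add (by positivity) (by positivity),
            ← ENNReal.ofReal_ofNat 2, ← ENNReal.ofReal_mul (by positivity)]
          congr 1
          rw [symConst]
          ring
  exact (ENNReal.mul_le_mul_iff_right (by norm_num) (by norm_num)).1 h2

end

section

/-! ### Pair frames and the integral operators attached to them -/

theorem measurePreserving_of_involutive {F : Type*} [NormedAddCommGroup F] [NormedSpace ℝ F]
    [FiniteDimensional ℝ F] [MeasurableSpace F] [BorelSpace F] (μ : Measure F) [μ.IsAddHaarMeasure]
    (T : F →L[ℝ] F) (hT : ∀ x, T (T x) = x) : MeasurePreserving T μ μ := by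
  refine ⟨T.measurable, ?_⟩
  have h1 : T.toLinearMap.comp T.toLinearMap = LinearMap.id := by
    ext x; exact hT x
  have h2 : LinearMap.det T.toLinearMap * LinearMap.det T.toLinearMap = 1 := by
    rw [← LinearMap.det_comp, h1, LinearMap.det_id]
  have h3 : LinearMap.det T.toLinearMap ≠ 0 := by
    intro h; simp [h] at h2
  have h4 : |(LinearMap.det T.toLinearMap)⁻¹| = 1 := by
    rw [abs_inv, inv_eq_one]
    rcases mul_self_eq_one_iff.1 h2 with h | h <;> simp [h]
  have := Measure.map_linearMap_addHaar_eq_smul_addHaar μ h3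
  rw [h4] at this
  simpa using this

/-- The Cauchy-Schwarz inequality with a weight `w`, for a kernel `k` of which no square root has
to be integrable. -/
theorem lintegral_mul_sq_le {α : Type*} [MeasurableSpace α] {μ : Measure α} {k F w : α → ℝ≥0∞}
    (hk : AEMeasurable k μ) (hF : AEMeasurable F μ) (hw : AEMeasurable w μ)
    (hw0 : ∀ᵐ x ∂μ, w x ≠ 0) (hw1 : ∀ᵐ x ∂μ, w x ≠ ∞) :
    (∫⁻ x, k x * F x ∂μ) ^ 2 ≤ (∫⁻ x, k x * w x ∂μ) * ∫⁻ x, k x * (F x ^ 2 / w x) ∂μ := by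
  have hs : ∀ x : ℝ≥0∞, (x ^ (1 / 2 : ℝ)) ^ (2 : ℝ) = x := fun x => by
    rw [← ENNReal.rpow_mul]; norm_num
  have h := ENNReal.lintegral_mul_le_Lp_mul_Lq μ Real.HolderConjugate.two_two
    (f := fun x => (k x * w x) ^ (1 / 2 : ℝ)) (g := fun x => (k x * (F x ^ 2 / w x)) ^ (1 / 2 : ℝ))
    (by fun_prop) (by fun_prop)
  have e : ∫⁻ x, ((fun x => (k x * w x) ^ (1 / 2 : ℝ)) *
      fun x => (k x * (F x ^ 2 / w x)) ^ (1 / 2 : ℝ)) x ∂μ = ∫⁻ x, k x * F x ∂μ := by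
    refine lintegral_congr_ae ?_
    filter_upwards [hw0, hw1] with x h0 h1
    simp only [Pi.mul_apply]
    rw [← ENNReal.mul_rpow_of_nonneg _ _ (by norm_num)]
    have : k x * w x * (k x * (F x ^ 2 / w x)) = (k x * F x) ^ (2 : ℝ) := by
      have h2 : w x * (F x ^ 2 / w x) = F x ^ 2 := ENNReal.mul_div_cancel h0 h1
      calc _ = k x * k x * (w x * (F x ^ 2 / w x)) := by ring
        _ = (k x * F x) ^ 2 := by rw [h2]; ring
        _ = _ := by rw [← ENNReal.rpow_natCast]; norm_num
    rw [this, ← ENNReal.rpow_mul]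
    norm_num
  rw [e] at h
  simp only [hs] at h
  calc _ ≤ ((∫⁻ x, k x * w x ∂μ) ^ (1 / 2 : ℝ) *
        (∫⁻ x, k x * (F x ^ 2 / w x) ∂μ) ^ (1 / 2 : ℝ)) ^ 2 := by gcongr
    _ = _ := by
      rw [mul_pow, ← ENNReal.rpow_natCast, ← ENNReal.rpow_natCast]
      push_cast
      rw [hs, hs]

/-- Relative coordinates for two of the particles in momentum space `E`: `a` is a relative
momentum, `ι` shifts it, `U` exchanges the two pairs of particles that a non-local term couples,
and `√(|a|² + m2)` is the kinetic symbol. The number `m0` is a positive lower bound of `m2`, and `c`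
is the coefficient in the mixed term `-2 c ⟪p, q⟫` of the energy denominator `den`. -/
structure PairFrame (E : Type) [NormedAddCommGroup E] [InnerProductSpace ℝ E] where
  ι : R3 →L[ℝ] E
  U : E →L[ℝ] E
  a : E →L[ℝ] R3
  m2 : E → ℝ
  m0 : ℝ
  c : ℝ
  U_U : ∀ x, U (U x) = x
  U_ι : ∀ v, U (ι v) = ι v
  a_ι : ∀ v, a (ι v) = v
  a_U : ∀ x, a (U x) = a x
  m2_add : ∀ x v, m2 (x + ι v) = m2 x
  m2_U : ∀ x, m2 (U x) = m2 x
  m2_cont : Continuous m2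
  m0_pos : 0 < m0
  m0_le : ∀ x, m0 ≤ m2 x
  abs_c_le : |c| ≤ 1 / 2

namespace PairFrame

variable {E : Type} [NormedAddCommGroup E] [InnerProductSpace ℝ E] (P : PairFrame E)

/-- The point to which the integral operators of the frame transport `x`. -/
noncomputable def mv (x : E) (v : R3) : E := P.U x + P.ι v

/-- The kinetic symbol. -/
noncomputable def sym (x : E) : ℝ := √(‖P.a x‖ ^ 2 + P.m2 x)

/-- The energy denominator of the non-local term. -/
noncomputable def den (x : E) (v : R3) : ℝ :=
  ‖P.a x‖ ^ 2 + ‖P.a x + v‖ ^ 2 - 2 * P.c * inner ℝ (P.a x) (P.a x + v) + (1 - P.c ^ 2) * P.m2 x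

/-- The same frame without exchange of pairs. -/
noncomputable def base : PairFrame E :=
  { P with
    U := ContinuousLinearMap.id ℝ E
    U_U := fun _ => rfl
    U_ι := fun _ => rfl
    a_U := fun _ => rfl
    m2_U := fun _ => rfl }

@[simp] theorem base_mv (x : E) (v : R3) : P.base.mv x v = x + P.ι v := rfl
@[simp] theorem base_sym (x : E) : P.base.sym x = P.sym x := rfl
@[simp] theorem base_a : P.base.a = P.a := rfl

@[simp] theorem a_mv (x : E) (v : R3) : P.a (P.mv x v) = P.a x + v := by
  simp [mv, P.a_U, P.a_ι]

@[simp] theorem m2_mv (x : E) (v : R3) : P.m2 (P.mv x v) = P.m2 x := by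
  simp [mv, P.m2_U, P.m2_add]

@[simp] theorem mv_mv (x : E) (v : R3) : P.mv (P.mv x v) (-v) = x := by
  simp [mv, P.U_U, P.U_ι]

theorem sym_mv (x : E) (v : R3) : P.sym (P.mv x v) = √(‖P.a x + v‖ ^ 2 + P.m2 x) := by
  simp [sym]

theorem den_mv (x : E) (v : R3) : P.den (P.mv x v) (-v) = P.den x v := by
  simp only [den, a_mv, m2_mv, add_neg_cancel_right]
  rw [real_inner_comm]
  ring

theorem m2_pos (x : E) : 0 < P.m2 x := P.m0_pos.trans_le (P.m0_le x)

theorem sym_pos (x : E) : 0 < P.sym x :=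
  Real.sqrt_pos.2 (by have := P.m2_pos x; positivity)

theorem sq_sym (x : E) : P.sym x ^ 2 = ‖P.a x‖ ^ 2 + P.m2 x :=
  Real.sq_sqrt (by have := P.m2_pos x; positivity)

theorem sqrt_m0_le_sym (x : E) : √P.m0 ≤ P.sym x :=
  Real.sqrt_le_sqrt (by have := P.m0_le x; nlinarith [sq_nonneg ‖P.a x‖])

theorem norm_a_le_sym (x : E) : ‖P.a x‖ ≤ P.sym x :=
  Real.le_sqrt_of_sq_le (by have := P.m2_pos x; linarith)

theorem continuous_sym : Continuous P.sym := by
  have := P.m2_cont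
  unfold sym; fun_prop

theorem continuous_mv : Continuous fun z : E × R3 => P.mv z.1 z.2 := by
  unfold mv; fun_prop

theorem continuous_den : Continuous fun z : E × R3 => P.den z.1 z.2 := by
  have := P.m2_cont
  unfold den; fun_prop

theorem c_bounds : -(1 / 2) ≤ P.c ∧ P.c ≤ 1 / 2 := abs_le.1 P.abs_c_le

theorem c_sq_le : P.c ^ 2 ≤ 1 / 4 := by
  have := P.c_bounds; nlinarith

theorem abs_mul_inner_le (p q : R3) : |2 * P.c * inner ℝ p q| ≤ ‖p‖ * ‖q‖ := by
  rw [abs_mul, abs_mul, abs_two]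
  have := abs_real_inner_le_norm p q
  have h2 := P.abs_c_le
  nlinarith [abs_nonneg (inner ℝ p q : ℝ), abs_nonneg P.c]

theorem half_le_den (x : E) (v : R3) :
    (‖P.a x‖ ^ 2 + ‖P.a x + v‖ ^ 2) / 2 ≤ P.den x v := by
  have h1 := (abs_le.1 (P.abs_mul_inner_le (P.a x) (P.a x + v))).2
  have h2 : 0 ≤ (1 - P.c ^ 2) * P.m2 x :=
    mul_nonneg (by have := P.c_sq_le; linarith) (P.m2_pos x).le
  rw [den]
  nlinarith [sq_nonneg (‖P.a x‖ - ‖P.a x + v‖)]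

theorem den_pos (x : E) (v : R3) : 0 < P.den x v := by
  have h1 := (abs_le.1 (P.abs_mul_inner_le (P.a x) (P.a x + v))).2
  have h2 : 0 < (1 - P.c ^ 2) * P.m2 x :=
    mul_pos (by have := P.c_sq_le; linarith) (P.m2_pos x)
  rw [den]
  nlinarith [sq_nonneg (‖P.a x‖ - ‖P.a x + v‖), sq_nonneg ‖P.a x‖, sq_nonneg ‖P.a x + v‖]

theorem sq_norm_le_den (x : E) (v : R3) : ‖v‖ ^ 2 ≤ 4 * P.den x v := by
  have h : ‖v‖ ≤ ‖P.a x + v‖ + ‖P.a x‖ := by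
    have := norm_sub_le (P.a x + v) (P.a x); simpa using this
  have := P.half_le_den x v
  nlinarith [sq_nonneg (‖P.a x‖ - ‖P.a x + v‖), norm_nonneg v]

variable [FiniteDimensional ℝ E] [MeasurableSpace E] [BorelSpace E]

/-- The involution `(x, v) ↦ (mv x v, -v)`. -/
noncomputable def flip : (E × R3) →L[ℝ] (E × R3) :=
  ((P.U.comp (ContinuousLinearMap.fst ℝ E R3)) + P.ι.comp (ContinuousLinearMap.snd ℝ E R3)).prod
    (-(ContinuousLinearMap.snd ℝ E R3))

omit [FiniteDimensional ℝ E] [MeasurableSpace E] [BorelSpace E] in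
@[simp] theorem flip_apply (z : E × R3) : P.flip z = (P.mv z.1 z.2, -z.2) := rfl

theorem measurePreserving_flip :
    MeasurePreserving P.flip ((volume : Measure E).prod (volume : Measure R3))
      ((volume : Measure E).prod (volume : Measure R3)) :=
  measurePreserving_of_involutive _ _ fun z => by simp

theorem measurableEmbedding_flip : MeasurableEmbedding P.flip :=
  (Homeomorph.measurableEmbedding
    { toFun := P.flip
      invFun := P.flip
      left_inv := fun z => by simp
      right_inv := fun z => by simp
      continuous_toFun := P.flip.continuous
      continuous_invFun := P.flip.continuous })

theorem measurePreserving_U : MeasurePreserving P.U (volume : Measure E) volume :=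
  measurePreserving_of_involutive _ _ P.U_U

theorem measurable_mv : Measurable fun z : E × R3 => P.mv z.1 z.2 := P.continuous_mv.measurable

theorem lintegral_lintegral_flip {F : E → R3 → ℝ≥0∞} (hF : Measurable (Function.uncurry F)) :
    ∫⁻ x, ∫⁻ v, F x v = ∫⁻ x, ∫⁻ v, F (P.mv x v) (-v) := by
  rw [lintegral_lintegral hF.aemeasurable,
    lintegral_lintegral (f := fun x v => F (P.mv x v) (-v))
      ((hF.comp P.flip.measurable).aemeasurable)]
  exact (P.measurePreserving_flip.lintegral_comp hF).symm

theorem ae_ae_mv {p : E → Prop} (hp : ∀ᵐ x, p x) : ∀ᵐ x : E, ∀ᵐ v : R3, p (P.mv x v) := by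
  have h1 : ∀ᵐ z ∂((volume : Measure E).prod (volume : Measure R3)), p z.1 :=
    Measure.quasiMeasurePreserving_fst.ae hp
  exact Measure.ae_ae_of_ae_prod (P.measurePreserving_flip.quasiMeasurePreserving.ae h1)

/-- Schur's test with the weight `w`, for a kernel that transports `x` to `mv x v`. Since `flip`
exchanges `(x, v)` with `(mv x v, -v)`, the second hypothesis concerns the transposed kernel. -/
theorem lintegral_sq_lintegral_le {k : E → R3 → ℝ≥0∞} (hk : Measurable (Function.uncurry k))
    {w F : E → ℝ≥0∞} (hw : Measurable w) (hF : Measurable F)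
    (hw0 : ∀ᵐ x, w x ≠ 0) (hw1 : ∀ᵐ x, w x ≠ ∞) {A B : ℝ≥0∞}
    (hA : ∀ᵐ x, ∫⁻ v, k x v * w (P.mv x v) ≤ A * w x)
    (hB : ∀ᵐ x, ∫⁻ v, k (P.mv x v) (-v) * w (P.mv x v) ≤ B * w x) :
    ∫⁻ x, (∫⁻ v, k x v * F (P.mv x v)) ^ 2 ≤ A * B * ∫⁻ x, F x ^ 2 := by
  have hmv := P.measurable_mv
  have hm1 : Measurable fun z : E × R3 => F (P.mv z.1 z.2) := hF.comp hmv
  have hm2 : Measurable fun z : E × R3 => w (P.mv z.1 z.2) := hw.comp hmv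
  have hk1 : Measurable fun z : E × R3 => k z.1 z.2 := hk
  calc ∫⁻ x, (∫⁻ v, k x v * F (P.mv x v)) ^ 2
      ≤ ∫⁻ x, A * (∫⁻ v, w x * (k x v * (F (P.mv x v) ^ 2 / w (P.mv x v)))) := by
        refine lintegral_mono_ae ?_
        filter_upwards [P.ae_ae_mv hw0, P.ae_ae_mv hw1, hA] with x h0 h1 hAx
        have e : Measurable fun v : R3 => (x, v) := measurable_prodMk_left
        have := lintegral_mul_sq_le (hk1.comp e).aemeasurable (hm1.comp e).aemeasurable
          (hm2.comp e).aemeasurable h0 h1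
        refine this.trans ?_
        have e2 : Measurable fun v : R3 => k x v * (F (P.mv x v) ^ 2 / w (P.mv x v)) := by
          have h1 := hk1.comp e
          have h2 := hm1.comp e
          have h3 := hm2.comp e
          exact h1.mul ((h2.pow_const 2).div h3)
        rw [lintegral_const_mul _ e2, ← mul_assoc]
        exact mul_le_mul_left hAx _
    _ = A * ∫⁻ x, ∫⁻ v, w x * (k x v * (F (P.mv x v) ^ 2 / w (P.mv x v))) := by
        rw [lintegral_const_mul]
        refine Measurable.lintegral_prod_right' (f := fun z : E × R3 =>
          w z.1 * (k z.1 z.2 * (F (P.mv z.1 z.2) ^ 2 / w (P.mv z.1 z.2)))) ?_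
        fun_prop
    _ = A * ∫⁻ x, ∫⁻ v, w (P.mv x v) * (k (P.mv x v) (-v) * (F x ^ 2 / w x)) := by
        rw [P.lintegral_lintegral_flip
          (F := fun x v => w x * (k x v * (F (P.mv x v) ^ 2 / w (P.mv x v))))]
        · simp only [mv_mv]
        · simp only [Function.uncurry_def]; fun_prop
    _ ≤ A * ∫⁻ x, B * F x ^ 2 := by
        refine mul_le_mul_right ?_ _
        refine lintegral_mono_ae ?_
        filter_upwards [hw0, hw1, hB] with x h0 h1 hBx
        have e : Measurable fun v : R3 => k (P.mv x v) (-v) * w (P.mv x v) := by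
          have h1 : Measurable fun z : E × R3 => k (P.mv z.1 z.2) (-z.2) :=
            hk.comp P.flip.measurable
          exact (h1.comp measurable_prodMk_left).mul (hm2.comp measurable_prodMk_left)
        calc ∫⁻ v, w (P.mv x v) * (k (P.mv x v) (-v) * (F x ^ 2 / w x))
            = ∫⁻ v, (k (P.mv x v) (-v) * w (P.mv x v)) * (F x ^ 2 / w x) := by
              refine lintegral_congr fun v => by ring
          _ = (∫⁻ v, k (P.mv x v) (-v) * w (P.mv x v)) * (F x ^ 2 / w x) :=
              lintegral_mul_const _ e
          _ ≤ B * w x * (F x ^ 2 / w x) := by gcongr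
          _ = B * F x ^ 2 := by rw [mul_assoc, ENNReal.mul_div_cancel h0 h1]
    _ = A * B * ∫⁻ x, F x ^ 2 := by
        rw [lintegral_const_mul _ (by fun_prop), mul_assoc]

theorem ae_a_ne_zero : ∀ᵐ x : E, P.a x ≠ 0 := by
  have h : (volume : Measure E) (P.a.toLinearMap.ker : Set E) = 0 := by
    refine Measure.addHaar_submodule _ _ ?_
    intro h
    rw [LinearMap.ker_eq_top] at h
    obtain ⟨v, hv⟩ := exists_ne (0 : R3)
    have : P.a (P.ι v) = 0 := by
      have := LinearMap.congr_fun h (P.ι v); simpa using this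
    rw [P.a_ι] at this
    exact hv this
  rw [ae_iff]
  convert h using 2
  ext x; simp

/-- The kernels of the frame define bounded operators: Schur's test with the weight `|a|^{-3/2}`. The
bound of the kernel contains the factor `1 / |a + v|` at one end only, so the integrals for the
kernel and for its transpose differ; they are the two Hardy integrals. -/
theorem lintegral_sq_kernel_le {k : E → R3 → ℝ≥0∞} (hk : Measurable (Function.uncurry k)) {C : ℝ}
    (hC : 0 ≤ C)
    (hkC : ∀ x v, v ≠ 0 → P.a x + v ≠ 0 → k x v ≤ ENNReal.ofReal (C / (‖v‖ ^ 2 * ‖P.a x + v‖)))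
    {F : E → ℝ≥0∞} (hF : Measurable F) :
    ∫⁻ x, (∫⁻ v, k x v * F (P.mv x v)) ^ 2 ≤
      ENNReal.ofReal (C * schurConst) * ENNReal.ofReal (C * schurConst) * ∫⁻ x, F x ^ 2 := by
  have hsc := schurConst_pos
  refine P.lintegral_sq_lintegral_le hk
    (w := fun x => ENNReal.ofReal (1 / (‖P.a x‖ * √‖P.a x‖))) (by fun_prop) hF ?_ ?_ ?_ ?_
  · filter_upwards [P.ae_a_ne_zero] with x hx
    have h1 : 0 < ‖P.a x‖ := norm_pos_iff.2 hx
    have h2 : 0 < √‖P.a x‖ := Real.sqrt_pos.2 h1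
    have : 0 < 1 / (‖P.a x‖ * √‖P.a x‖) := by positivity
    exact (ENNReal.ofReal_pos.2 this).ne'
  · exact Eventually.of_forall fun x => ENNReal.ofReal_ne_top
  · filter_upwards [P.ae_a_ne_zero] with x hx
    have h1 : 0 < ‖P.a x‖ := norm_pos_iff.2 hx
    calc ∫⁻ v, k x v * ENNReal.ofReal (1 / (‖P.a (P.mv x v)‖ * √‖P.a (P.mv x v)‖))
        ≤ ∫⁻ v, ENNReal.ofReal C *
            ENNReal.ofReal (1 / (‖v‖ ^ 2 * (‖P.a x + v‖ ^ 2 * √‖P.a x + v‖))) := by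
          refine lintegral_mono_ae ?_
          filter_upwards [Measure.ae_ne volume 0, Measure.ae_ne volume (-P.a x)] with v hv hv'
          rw [a_mv]
          refine (mul_le_mul_left (hkC x v hv fun h => hv' (eq_neg_of_add_eq_zero_right h)) _).trans ?_
          rw [← ENNReal.ofReal_mul (by positivity), ← ENNReal.ofReal_mul (by positivity)]
          refine ENNReal.ofReal_le_ofReal (le_of_eq ?_)
          rw [div_mul_div_comm, mul_one, mul_one_div]
          ring
      _ ≤ ENNReal.ofReal C * ENNReal.ofReal (schurConst / (‖P.a x‖ * √‖P.a x‖)) := by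
          rw [lintegral_const_mul _ (by fun_prop)]
          gcongr
          exact lintegral_hardy_kernel_high hx
      _ = _ := by
          rw [← ENNReal.ofReal_mul hC, ← ENNReal.ofReal_mul (by positivity)]
          congr 1; ring
  · filter_upwards [P.ae_a_ne_zero] with x hx
    have h1 : 0 < ‖P.a x‖ := norm_pos_iff.2 hx
    calc ∫⁻ v, k (P.mv x v) (-v) * ENNReal.ofReal (1 / (‖P.a (P.mv x v)‖ * √‖P.a (P.mv x v)‖))
        ≤ ∫⁻ v, ENNReal.ofReal (C / ‖P.a x‖) *
            ENNReal.ofReal (1 / (‖v‖ ^ 2 * (‖P.a x + v‖ * √‖P.a x + v‖))) := by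
          refine lintegral_mono_ae ?_
          filter_upwards [Measure.ae_ne volume 0] with v hv
          refine (mul_le_mul_left (hkC (P.mv x v) (-v) (neg_ne_zero.2 hv) (by simpa using hx)) _).trans ?_
          rw [a_mv, add_neg_cancel_right, norm_neg]
          rw [← ENNReal.ofReal_mul (by positivity), ← ENNReal.ofReal_mul (by positivity)]
          refine ENNReal.ofReal_le_ofReal (le_of_eq ?_)
          rw [div_mul_div_comm, mul_one, div_mul_div_comm, mul_one]
          ring
      _ ≤ ENNReal.ofReal (C / ‖P.a x‖) * ENNReal.ofReal (schurConst / √‖P.a x‖) := by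
          rw [lintegral_const_mul _ (by fun_prop)]
          gcongr
          exact lintegral_hardy_kernel_low hx
      _ = _ := by
          rw [← ENNReal.ofReal_mul (by positivity), ← ENNReal.ofReal_mul (by positivity)]
          congr 1
          rw [div_mul_div_comm, mul_one_div]

end PairFrame

end

section

theorem eLpNorm_two_sq {α : Type*} [MeasurableSpace α] {μ : Measure α} (f : α → ℂ) :
    eLpNorm f 2 μ ^ 2 = ∫⁻ x, ‖f x‖ₑ ^ 2 ∂μ := by
  have := eLpNorm_nnreal_pow_eq_lintegral (μ := μ) (f := f) (p := 2) (by norm_num)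
  simpa using this

theorem lintegral_enorm_sq_Lp {α : Type*} [MeasurableSpace α] {μ : Measure α} (f : Lp ℂ 2 μ) :
    ∫⁻ x, ‖f x‖ₑ ^ 2 ∂μ = ENNReal.ofReal (‖f‖ ^ 2) := by
  rw [← eLpNorm_two_sq, Lp.norm_def, ← ENNReal.toReal_pow,
    ENNReal.ofReal_toReal (ENNReal.pow_ne_top (Lp.eLpNorm_ne_top f))]

theorem _root_.ENNReal.mul_le_sq_add_sq (a b : ℝ≥0∞) : a * b ≤ a ^ 2 + b ^ 2 := by
  rcases le_total a b with h | h
  · calc a * b ≤ b * b := by gcongr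
      _ = b ^ 2 := (sq b).symm
      _ ≤ _ := le_add_self
  · calc a * b ≤ a * a := by gcongr
      _ = a ^ 2 := (sq a).symm
      _ ≤ _ := le_self_add

namespace PairFrame

variable {E : Type} [NormedAddCommGroup E] [InnerProductSpace ℝ E] (P : PairFrame E)
  [FiniteDimensional ℝ E] [MeasurableSpace E] [BorelSpace E]

/-- `L` is the integral operator `ζ ↦ ∫ k(x, v) ζ(mv x v) dv`. -/
def IsKernelOp (k : E → R3 → ℝ) (L : L²(E) →L[ℂ] L²(E)) :
    Prop :=
  ∀ ζ : L²(E), ∀ᵐ x, Integrable (fun v => (k x v : ℂ) * ζ (P.mv x v)) ∧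
    L ζ x = ∫ v, (k x v : ℂ) * ζ (P.mv x v)

theorem stronglyMeasurable_kernel {k : E → R3 → ℝ} (hk : Measurable (Function.uncurry k))
    (ζ : L²(E)) :
    StronglyMeasurable fun z : E × R3 => (k z.1 z.2 : ℂ) * ζ (P.mv z.1 z.2) := by
  have h1 : Measurable fun z : E × R3 => (k z.1 z.2 : ℂ) := Complex.measurable_ofReal.comp hk
  exact (h1.mul ((Lp.stronglyMeasurable ζ).measurable.comp P.measurable_mv)).stronglyMeasurable

theorem lintegral_sq_kernel_Lp_le {k : E → R3 → ℝ} (hk : Measurable (Function.uncurry k)) {C : ℝ}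
    (hC : 0 ≤ C) (hkC : ∀ x v, v ≠ 0 → P.a x + v ≠ 0 → |k x v| ≤ C / (‖v‖ ^ 2 * ‖P.a x + v‖))
    (ζ : L²(E)) :
    ∫⁻ x, (∫⁻ v, ‖(k x v : ℂ) * ζ (P.mv x v)‖ₑ) ^ 2 ≤
      ENNReal.ofReal ((C * schurConst * ‖ζ‖) ^ 2) := by
  have hsc := schurConst_pos
  have := P.lintegral_sq_kernel_le (k := fun x v => ‖k x v‖ₑ) (F := fun x => ‖ζ x‖ₑ)
    (measurable_enorm.comp hk) hC ?_ (Lp.stronglyMeasurable ζ).enorm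
  · rw [lintegral_enorm_sq_Lp, ← ENNReal.ofReal_mul (by positivity),
      ← ENNReal.ofReal_mul (by positivity)] at this
    convert this using 2
    · simp only [enorm_mul]
      have : ∀ r : ℝ, ‖(r : ℂ)‖ₑ = ‖r‖ₑ := fun r => by
        rw [← ofReal_norm, ← ofReal_norm, Complex.norm_real]
      simp only [this]
    · ring
  · intro x v h h'
    rw [Real.enorm_eq_ofReal_abs]
    exact ENNReal.ofReal_le_ofReal (hkC x v h h')

/-- A kernel with the singularities `|v|⁻²` and `|a + v|⁻¹` defines a bounded operator on `L²`. -/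
theorem exists_isKernelOp {k : E → R3 → ℝ} (hk : Measurable (Function.uncurry k)) {C : ℝ}
    (hC : 0 ≤ C) (hkC : ∀ x v, v ≠ 0 → P.a x + v ≠ 0 → |k x v| ≤ C / (‖v‖ ^ 2 * ‖P.a x + v‖)) :
    ∃ L, P.IsKernelOp k L := by
  have hsc := schurConst_pos
  have hint : ∀ ζ : L²(E), ∀ᵐ x,
      Integrable (fun v => (k x v : ℂ) * ζ (P.mv x v)) := by
    intro ζ
    have hsm := P.stronglyMeasurable_kernel hk ζ
    have hfin := (P.lintegral_sq_kernel_Lp_le hk hC hkC ζ).trans_lt ENNReal.ofReal_lt_top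
    have hm : Measurable fun x => (∫⁻ v, ‖(k x v : ℂ) * ζ (P.mv x v)‖ₑ) ^ 2 :=
      (hsm.measurable.enorm.lintegral_prod_right').pow_const 2
    filter_upwards [ae_lt_top hm hfin.ne] with x hx
    refine ⟨(hsm.comp_measurable measurable_prodMk_left).aestronglyMeasurable, ?_⟩
    by_contra h
    rw [HasFiniteIntegral, not_lt, top_le_iff] at h
    rw [h] at hx
    simp at hx
  have hbd : ∀ ζ : L²(E),
      eLpNorm (fun x => ∫ v, (k x v : ℂ) * ζ (P.mv x v)) 2 volume ≤
        ENNReal.ofReal (C * schurConst * ‖ζ‖) := by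
    intro ζ
    rw [← ENNReal.pow_le_pow_left_iff (n := 2) (by norm_num), eLpNorm_two_sq,
      ← ENNReal.ofReal_pow (by positivity)]
    refine le_trans (lintegral_mono fun x => ?_) (P.lintegral_sq_kernel_Lp_le hk hC hkC ζ)
    gcongr
    exact enorm_integral_le_lintegral_enorm _
  have hmem : ∀ ζ : L²(E),
      MemLp (fun x => ∫ v, (k x v : ℂ) * ζ (P.mv x v)) 2 volume := fun ζ =>
    ⟨(P.stronglyMeasurable_kernel hk ζ).integral_prod_right'.aestronglyMeasurable,
      (hbd ζ).trans_lt ENNReal.ofReal_lt_top⟩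
  let L₀ : L²(E) →ₗ[ℂ] L²(E) :=
    { toFun := fun ζ => (hmem ζ).toLp _
      map_add' := fun ζ ζ' => by
        ext1
        filter_upwards [(hmem (ζ + ζ')).coeFn_toLp, Lp.coeFn_add ((hmem ζ).toLp _) ((hmem ζ').toLp _),
          (hmem ζ).coeFn_toLp, (hmem ζ').coeFn_toLp, hint ζ, hint ζ',
          P.ae_ae_mv (Lp.coeFn_add ζ ζ')] with x h1 h2 h3 h4 h5 h6 h7
        rw [h1, h2, Pi.add_apply, h3, h4, ← integral_add h5 h6]
        refine integral_congr_ae ?_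
        filter_upwards [h7] with v hv
        rw [hv, Pi.add_apply, mul_add]
      map_smul' := fun c ζ => by
        ext1
        filter_upwards [(hmem (c • ζ)).coeFn_toLp, Lp.coeFn_smul c ((hmem ζ).toLp _),
          (hmem ζ).coeFn_toLp, P.ae_ae_mv (Lp.coeFn_smul c ζ)] with x h1 h2 h3 h7
        rw [h1, RingHom.id_apply, h2, Pi.smul_apply, h3, smul_eq_mul, ← integral_const_mul]
        refine integral_congr_ae ?_
        filter_upwards [h7] with v hv
        rw [hv, Pi.smul_apply, smul_eq_mul]
        ring }
  refine ⟨L₀.mkContinuous (C * schurConst) fun ζ => ?_, fun ζ => ?_⟩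
  · change ‖(hmem ζ).toLp _‖ ≤ _
    rw [Lp.norm_toLp]
    exact ENNReal.toReal_le_of_le_ofReal (by positivity) (hbd ζ)
  · filter_upwards [hint ζ, (hmem ζ).coeFn_toLp] with x h1 h2
    exact ⟨h1, h2⟩

theorem integrable_form {k : E → R3 → ℝ} (hk : Measurable (Function.uncurry k)) {C : ℝ}
    (hC : 0 ≤ C) (hkC : ∀ x v, v ≠ 0 → P.a x + v ≠ 0 → |k x v| ≤ C / (‖v‖ ^ 2 * ‖P.a x + v‖))
    (g ζ : L²(E)) :
    Integrable (fun z : E × R3 => starRingEnd ℂ (g z.1) * ((k z.1 z.2 : ℂ) * ζ (P.mv z.1 z.2)))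
      ((volume : Measure E).prod volume) := by
  have hsm := P.stronglyMeasurable_kernel hk ζ
  have hg : StronglyMeasurable fun z : E × R3 => starRingEnd ℂ (g z.1) :=
    (RCLike.continuous_conj (K := ℂ)).comp_stronglyMeasurable
      ((Lp.stronglyMeasurable g).comp_measurable measurable_fst)
  refine ⟨(hg.mul hsm).aestronglyMeasurable, ?_⟩
  rw [HasFiniteIntegral, lintegral_prod _ (by exact (hg.mul hsm).measurable.enorm.aemeasurable)]
  calc ∫⁻ x, ∫⁻ v, ‖starRingEnd ℂ (g x) * ((k x v : ℂ) * ζ (P.mv x v))‖ₑ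
      = ∫⁻ x, ‖g x‖ₑ * ∫⁻ v, ‖(k x v : ℂ) * ζ (P.mv x v)‖ₑ := by
        refine lintegral_congr fun x => ?_
        have e : Measurable fun v => ‖(k x v : ℂ) * ζ (P.mv x v)‖ₑ :=
          hsm.measurable.enorm.comp measurable_prodMk_left
        rw [← lintegral_const_mul _ e]
        refine lintegral_congr fun v => ?_
        rw [enorm_mul, RCLike.enorm_conj]
    _ ≤ ∫⁻ x, (‖g x‖ₑ ^ 2 + (∫⁻ v, ‖(k x v : ℂ) * ζ (P.mv x v)‖ₑ) ^ 2) :=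
        lintegral_mono fun x => ENNReal.mul_le_sq_add_sq _ _
    _ < ∞ := by
        rw [lintegral_add_left ((Lp.stronglyMeasurable g).enorm.pow_const 2),
          lintegral_enorm_sq_Lp]
        exact ENNReal.add_lt_top.2 ⟨ENNReal.ofReal_lt_top,
          (P.lintegral_sq_kernel_Lp_le hk hC hkC ζ).trans_lt ENNReal.ofReal_lt_top⟩

variable {P}

theorem IsKernelOp.inner_eq {k : E → R3 → ℝ} (hk : Measurable (Function.uncurry k)) {C : ℝ}
    (hC : 0 ≤ C) (hkC : ∀ x v, v ≠ 0 → P.a x + v ≠ 0 → |k x v| ≤ C / (‖v‖ ^ 2 * ‖P.a x + v‖))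
    {L : L²(E) →L[ℂ] L²(E)} (hL : P.IsKernelOp k L)
    (g ζ : L²(E)) :
    inner ℂ g (L ζ) = ∫ z : E × R3, starRingEnd ℂ (g z.1) * ((k z.1 z.2 : ℂ) * ζ (P.mv z.1 z.2))
      ∂((volume : Measure E).prod volume) := by
  rw [integral_prod _ (P.integrable_form hk hC hkC g ζ), L2.inner_def]
  refine integral_congr_ae ?_
  filter_upwards [hL ζ] with x hx
  rw [hx.2, integral_const_mul, RCLike.inner_apply, mul_comm]

variable (P)

theorem integral_flip (F : E × R3 → ℂ) :
    ∫ z, F (P.mv z.1 z.2, -z.2) ∂((volume : Measure E).prod (volume : Measure R3)) =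
      ∫ z, F z ∂((volume : Measure E).prod (volume : Measure R3)) :=
  P.measurePreserving_flip.integral_comp P.measurableEmbedding_flip F

theorem integrable_flip {F : E × R3 → ℂ}
    (hF : Integrable F ((volume : Measure E).prod (volume : Measure R3))) :
    Integrable (fun z : E × R3 => F (P.mv z.1 z.2, -z.2)) ((volume : Measure E).prod volume) :=
  P.measurePreserving_flip.integrable_comp_of_integrable hF

/-- The kernel of `n` composed with multiplication by the inverse of the symbol. -/
noncomputable def relKer (n : E → R3 → ℝ) (x : E) (v : R3) : ℝ := n x v / P.sym (P.mv x v)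

/-- The kernels of the two interaction terms are symmetric and of the order of `|v|⁻²`. -/
structure IsPairKernel (n : E → R3 → ℝ) : Prop where
  meas : Measurable (Function.uncurry n)
  nonneg : ∀ x v, 0 ≤ n x v
  le : ∀ x v, v ≠ 0 → n x v ≤ 4 / ‖v‖ ^ 2
  flip : ∀ x v, n (P.mv x v) (-v) = n x v

variable {P}

theorem IsPairKernel.meas_relKer {n : E → R3 → ℝ} (h : P.IsPairKernel n) :
    Measurable (Function.uncurry (P.relKer n)) :=
  h.meas.div (P.continuous_sym.measurable.comp P.measurable_mv)

theorem IsPairKernel.relKer_le {n : E → R3 → ℝ} (h : P.IsPairKernel n) (x : E) (v : R3)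
    (hv : v ≠ 0) (hv' : P.a x + v ≠ 0) : |P.relKer n x v| ≤ 4 / (‖v‖ ^ 2 * ‖P.a x + v‖) := by
  have hs := P.sym_pos (P.mv x v)
  have h1 : 0 < ‖v‖ := norm_pos_iff.2 hv
  have h2 : 0 < ‖P.a x + v‖ := norm_pos_iff.2 hv'
  have h3 : ‖P.a x + v‖ ≤ P.sym (P.mv x v) := by
    have := P.norm_a_le_sym (P.mv x v)
    rwa [a_mv] at this
  rw [relKer, abs_of_nonneg (div_nonneg (h.nonneg x v) hs.le), ← div_div]
  exact div_le_div₀ (by positivity) (h.le x v hv) h2 h3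

theorem IsPairKernel.exists_op {n : E → R3 → ℝ} (h : P.IsPairKernel n) :
    ∃ L, P.IsKernelOp (P.relKer n) L :=
  P.exists_isKernelOp h.meas_relKer (by norm_num) h.relKer_le

/-- The sesquilinear form of a pair kernel. -/
theorem IsKernelOp.inner_eq_of_isPairKernel {n : E → R3 → ℝ} (h : P.IsPairKernel n)
    {L : L²(E) →L[ℂ] L²(E)}
    (hL : P.IsKernelOp (P.relKer n) L) (g ζ : L²(E)) :
    inner ℂ g (L ζ) = ∫ z : E × R3, starRingEnd ℂ (g z.1) *
      ((P.relKer n z.1 z.2 : ℂ) * ζ (P.mv z.1 z.2)) ∂((volume : Measure E).prod volume) :=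
  hL.inner_eq h.meas_relKer (by norm_num) h.relKer_le g ζ

theorem IsPairKernel.integrable {n : E → R3 → ℝ} (h : P.IsPairKernel n)
    (g ζ : L²(E)) :
    Integrable (fun z : E × R3 => starRingEnd ℂ (g z.1) *
      ((P.relKer n z.1 z.2 : ℂ) * ζ (P.mv z.1 z.2))) ((volume : Measure E).prod volume) :=
  P.integrable_form h.meas_relKer (by norm_num) h.relKer_le g ζ

variable (P) in
theorem ae_prod_mv {p : E → Prop} (hp : ∀ᵐ x, p x) :
    ∀ᵐ z ∂((volume : Measure E).prod (volume : Measure R3)), p z.1 ∧ p (P.mv z.1 z.2) := by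
  have h1 : ∀ᵐ z ∂((volume : Measure E).prod (volume : Measure R3)), p z.1 :=
    Measure.quasiMeasurePreserving_fst.ae hp
  exact h1.and (P.measurePreserving_flip.quasiMeasurePreserving.ae h1)

/-- The operators of the pair kernels are symmetric with respect to the form of `1 / sym`. -/
theorem IsKernelOp.inner_symm {n : E → R3 → ℝ} (h : P.IsPairKernel n)
    {L : L²(E) →L[ℂ] L²(E)}
    (hL : P.IsKernelOp (P.relKer n) L) {s : ℝ}
    {ζ ζ' jζ jζ' : L²(E)}
    (h1 : ∀ᵐ x, jζ x = (s / P.sym x : ℝ) * ζ x) (h2 : ∀ᵐ x, jζ' x = (s / P.sym x : ℝ) * ζ' x) :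
    inner ℂ (L ζ) jζ' = inner ℂ jζ (L ζ') := by
  rw [← inner_conj_symm, hL.inner_eq_of_isPairKernel h, hL.inner_eq_of_isPairKernel h,
    ← integral_conj, ← P.integral_flip]
  refine integral_congr_ae ?_
  filter_upwards [P.ae_prod_mv h1, P.ae_prod_mv h2] with z hz1 hz2
  simp only [mv_mv, relKer, h.flip]
  rw [hz1.1, hz2.2]
  simp only [map_mul, Complex.conj_conj, Complex.conj_ofReal]
  push_cast
  ring

end PairFrame

end

section

/-! ### Positivity of the difference of the interaction forms -/

theorem abs_geom_sum_le {y : ℝ} (h1 : -1 < y) (h2 : y < 1) (n : ℕ) :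
    |∑ i ∈ Finset.range n, y ^ i| ≤ 2 / (1 - y) := by
  have h3 : 0 < 1 - y := by linarith
  have h4 : |y ^ n| ≤ 1 := by
    rw [abs_pow]; exact pow_le_one₀ (abs_nonneg _) (abs_le.2 ⟨h1.le, h2.le⟩)
  rw [geom_sum_eq h2.ne, ← neg_div_neg_eq, abs_div, neg_sub, neg_sub, abs_of_pos h3]
  gcongr
  have := abs_le.1 h4
  rw [abs_le]; constructor <;> linarith

namespace PairFrame

variable {E : Type} [NormedAddCommGroup E] [InnerProductSpace ℝ E] (P : PairFrame E)
  [FiniteDimensional ℝ E] [MeasurableSpace E] [BorelSpace E]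

/-- The integrand of the form of a kernel `k` at the test function `f`. -/
noncomputable def formFun (k : E → R3 → ℝ) (f : E → ℂ) (z : E × R3) : ℝ :=
  (starRingEnd ℂ (f z.1) * f (P.mv z.1 z.2)).re * k z.1 z.2

/-- The pairs of kernels for which the form of the first one, without exchange, dominates the form
of the second one, with exchange. -/
structure Dominates (k₁ k₂ : E → R3 → ℝ) : Prop where
  meas₁ : Measurable (Function.uncurry k₁)
  meas₂ : Measurable (Function.uncurry k₂)
  int₁ : ∀ f : E → ℂ, Continuous f → HasCompactSupport f →
    Integrable (P.base.formFun k₁ f) ((volume : Measure E).prod volume)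
  int₂ : ∀ f : E → ℂ, Continuous f → HasCompactSupport f →
    Integrable (P.formFun k₂ f) ((volume : Measure E).prod volume)
  nonneg : ∀ f : E → ℂ, Continuous f → HasCompactSupport f → ∀ s : ℝ, |s| ≤ 1 →
    0 ≤ (∫ z, P.base.formFun k₁ f z ∂((volume : Measure E).prod volume)) -
      s * ∫ z, P.formFun k₂ f z ∂((volume : Measure E).prod volume)

theorem hasCompactSupport_mv {f g : E → ℂ} (hf : HasCompactSupport f) (hg : HasCompactSupport g) :
    HasCompactSupport fun z : E × R3 => starRingEnd ℂ (f z.1) * g (P.mv z.1 z.2) := by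
  have hc : IsCompact ((fun z : E × E => (z.1, P.a z.2 - P.a z.1)) '' (tsupport f ×ˢ tsupport g)) :=
    (IsCompact.prod hf hg).image (by fun_prop)
  refine HasCompactSupport.intro hc fun z hz => ?_
  by_contra h
  rw [mul_eq_zero, not_or] at h
  refine hz ⟨(z.1, P.mv z.1 z.2), ⟨subset_tsupport _ ?_, subset_tsupport _ h.2⟩, ?_⟩
  · intro h0; exact h.1 (by simpa using h0)
  · ext1 <;> simp

theorem integrable_mv {f g : E → ℂ} (hfc : Continuous f) (hf : HasCompactSupport f)
    (hgc : Continuous g) (hg : HasCompactSupport g) :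
    Integrable (fun z : E × R3 => starRingEnd ℂ (f z.1) * g (P.mv z.1 z.2))
      ((volume : Measure E).prod volume) := by
  refine Continuous.integrable_of_hasCompactSupport ?_ (P.hasCompactSupport_mv hf hg)
  have := P.continuous_mv
  have h2 := RCLike.continuous_conj (K := ℂ)
  fun_prop

/-- Integration over the fibres of the relative coordinate. -/
noncomputable def fib (f : E → ℂ) (x : E) : ℂ := ∫ v, f (x + P.ι v)

theorem fib_add (f : E → ℂ) (x : E) (v : R3) : P.fib f (x + P.ι v) = P.fib f x := by
  unfold fib
  rw [← integral_add_left_eq_self (fun w => f (x + P.ι w)) v]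
  simp [add_assoc]

theorem measurable_fib {f : E → ℂ} (hf : Continuous f) : StronglyMeasurable (P.fib f) := by
  have : Continuous fun z : E × R3 => f (z.1 + P.ι z.2) := by fun_prop
  exact this.stronglyMeasurable.integral_prod_right'

theorem exists_norm_fib_le {f : E → ℂ} (hf : Continuous f) (hs : HasCompactSupport f) :
    ∃ M, ∀ x, ‖P.fib f x‖ ≤ M := by
  obtain ⟨C, hC⟩ := hs.exists_bound_of_continuous hf
  have hK : IsCompact (P.a '' tsupport f) := IsCompact.image hs P.a.continuous
  let g : R3 → ℝ := (P.a '' tsupport f).indicator fun _ => C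
  have hg : Integrable g := by
    rw [integrable_indicator_iff hK.measurableSet]
    exact integrableOn_const hK.measure_lt_top.ne
  refine ⟨∫ w, g w, fun x => ?_⟩
  rw [← integral_add_left_eq_self g (P.a x)]
  refine norm_integral_le_of_norm_le (hg.comp_add_left (P.a x)) (Eventually.of_forall fun v => ?_)
  by_cases h : f (x + P.ι v) = 0
  · rw [h, norm_zero]
    exact indicator_nonneg (fun _ _ => (norm_nonneg _).trans (hC 0)) _
  · have : P.a x + v ∈ P.a '' tsupport f := ⟨x + P.ι v, subset_tsupport _ h, by simp [P.a_ι]⟩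
    change _ ≤ (P.a '' tsupport f).indicator (fun _ => C) _
    rw [indicator_of_mem this]
    exact hC _

/-- A normalized cutoff in the relative coordinate turns integrals over `E` of functions that
are constant along the fibres into integrals of fibre averages. -/
theorem integral_mul_fiberwise {χ : R3 → ℝ} (hχ : Continuous χ) (hχs : HasCompactSupport χ)
    (hχ1 : ∫ w, χ w = 1) {f : E → ℂ} (hf : Continuous f) (hs : HasCompactSupport f) {G : E → ℂ}
    (hG : StronglyMeasurable G) {M : ℝ} (hM : ∀ x, ‖G x‖ ≤ M) (hGι : ∀ x v, G (x + P.ι v) = G x) :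
    Integrable (fun x => (χ (P.a x) : ℂ) * (starRingEnd ℂ (P.fib f x) * G x)) ∧
    ∫ x, starRingEnd ℂ (f x) * G x = ∫ x, (χ (P.a x) : ℂ) * (starRingEnd ℂ (P.fib f x) * G x) := by
  have h2 := RCLike.continuous_conj (K := ℂ)
  have hχc : Continuous fun w => (χ w : ℂ) := Complex.continuous_ofReal.comp hχ
  let F : E × R3 → ℂ := fun z => (χ (P.a z.1 + z.2) : ℂ) * starRingEnd ℂ (f z.1) * G z.1
  have hF : Integrable F ((volume : Measure E).prod volume) := by
    refine Integrable.mul_bdd (c := M) ?_ ?_ (Eventually.of_forall fun z => hM z.1)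
    · refine Continuous.integrable_of_hasCompactSupport (by fun_prop) ?_
      have hc : IsCompact ((fun z : E × R3 => (z.1, z.2 - P.a z.1)) '' (tsupport f ×ˢ tsupport χ)) :=
        (IsCompact.prod hs hχs).image (by fun_prop)
      refine HasCompactSupport.intro hc fun z hz => ?_
      by_contra h
      rw [mul_eq_zero, not_or] at h
      refine hz ⟨(z.1, P.a z.1 + z.2), ⟨subset_tsupport _ ?_, subset_tsupport _ ?_⟩, ?_⟩
      · intro h0; exact h.2 (by simpa using h0)
      · intro h0; exact h.1 (by simpa using h0)
      · ext1 <;> simp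
    · exact (hG.comp_measurable measurable_fst).aestronglyMeasurable
  have hF' := P.base.integrable_flip hF
  have e : ∀ x, ∫ v, F (P.base.mv x v, -v) = (χ (P.a x) : ℂ) * (starRingEnd ℂ (P.fib f x) * G x) := by
    intro x
    simp only [F, base_mv, map_add, P.a_ι, add_neg_cancel_right, hGι]
    rw [fib, ← integral_conj, ← integral_mul_const, ← integral_const_mul]
    congr 1; ext v; ring
  constructor
  · exact hF'.integral_prod_left.congr (Eventually.of_forall e)
  · have h3 := P.base.integral_flip F
    rw [integral_prod _ hF', integral_prod _ hF] at h3
    simp only [e] at h3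
    rw [h3]
    congr 1; ext x
    simp only [F]
    simp only [mul_assoc]
    rw [integral_mul_const, integral_complex_ofReal, integral_add_left_eq_self, hχ1]
    simp

theorem integral_form_one {f : E → ℂ} (hf : Continuous f) (hs : HasCompactSupport f) :
    ∫ z : E × R3, starRingEnd ℂ (f z.1) * f (P.mv z.1 z.2) ∂((volume : Measure E).prod volume) =
      ∫ x, starRingEnd ℂ (f x) * P.fib f (P.U x) := by
  rw [integral_prod _ (P.integrable_mv hf hs hf hs)]
  simp only [integral_const_mul]
  rfl

/-- The case of constant kernels. With `F = fib f`, the forms are the integrals of `|F|²` and of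
`F̄ · F ∘ U` over the quotient of `E` by the range of `ι`, and the Cauchy-Schwarz inequality applies,
since `U` preserves the measure. -/
theorem dominates_one : P.Dominates (fun _ _ => 1) (fun _ _ => 1) := by
  have hint : ∀ (Q : PairFrame E) (f : E → ℂ), Continuous f → HasCompactSupport f →
      Integrable (Q.formFun (fun _ _ => 1) f) ((volume : Measure E).prod volume) := by
    intro Q f hf hs
    refine (Q.integrable_mv hf hs hf hs).re.congr (Eventually.of_forall fun z => ?_)
    simp [formFun]
  refine ⟨by fun_prop, by fun_prop, hint P.base, hint P, fun f hf hs s hs1 => ?_⟩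
  -- The cutoff `χ (P.a x)` realizes the integration over the quotient by the range of `ι`.
  let b : ContDiffBump (0 : R3) := ⟨1, 2, by norm_num, by norm_num⟩
  let χ : R3 → ℝ := b.normed volume
  have hχ : Continuous χ := b.continuous_normed
  have hχs : HasCompactSupport χ := b.hasCompactSupport_normed
  have hχ1 : ∫ w, χ w = 1 := b.integral_normed
  have hχ0 : ∀ w, 0 ≤ χ w := b.nonneg_normed
  obtain ⟨M, hM⟩ := P.exists_norm_fib_le hf hs
  have hm := P.measurable_fib hf
  have h1 := P.integral_mul_fiberwise hχ hχs hχ1 hf hs hm hM (P.fib_add f)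
  have h2 := P.integral_mul_fiberwise hχ hχs hχ1 hf hs (G := fun x => P.fib f (P.U x))
    (hm.comp_measurable P.U.measurable) (fun x => hM _)
    (fun x v => by rw [map_add, P.U_ι, P.fib_add])
  have e1 : ∫ z, P.base.formFun (fun _ _ => 1) f z ∂((volume : Measure E).prod volume) =
      ∫ x, χ (P.a x) * ‖P.fib f x‖ ^ 2 := by
    have : ∀ z, P.base.formFun (fun _ _ => 1) f z =
        RCLike.re (starRingEnd ℂ (f z.1) * f (P.base.mv z.1 z.2)) := by intro z; simp [formFun]
    simp only [this]
    rw [integral_re (P.base.integrable_mv hf hs hf hs), P.base.integral_form_one hf hs]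
    change RCLike.re (∫ x, starRingEnd ℂ (f x) * P.fib f x) = _
    rw [h1.2, ← integral_re h1.1]
    congr 1; ext x
    rw [Complex.conj_mul']
    rw [RCLike.re_eq_complex_re, ← Complex.ofReal_pow, ← Complex.ofReal_mul, Complex.ofReal_re]
  have e2 : ∫ z, P.formFun (fun _ _ => 1) f z ∂((volume : Measure E).prod volume) =
      ∫ x, RCLike.re ((χ (P.a x) : ℂ) * (starRingEnd ℂ (P.fib f x) * P.fib f (P.U x))) := by
    have : ∀ z, P.formFun (fun _ _ => 1) f z =
        RCLike.re (starRingEnd ℂ (f z.1) * f (P.mv z.1 z.2)) := by intro z; simp [formFun]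
    simp only [this]
    rw [integral_re (P.integrable_mv hf hs hf hs), P.integral_form_one hf hs, h2.2,
      ← integral_re h2.1]
  have i1 : Integrable fun x => χ (P.a x) * ‖P.fib f x‖ ^ 2 := by
    refine h1.1.re.congr (Eventually.of_forall fun x => ?_)
    simp only
    rw [Complex.conj_mul', RCLike.re_eq_complex_re, ← Complex.ofReal_pow, ← Complex.ofReal_mul,
      Complex.ofReal_re]
  have i2 : Integrable fun x => χ (P.a x) * ‖P.fib f (P.U x)‖ ^ 2 := by
    have := P.measurePreserving_U.integrable_comp_of_integrable i1
    refine this.congr (Eventually.of_forall fun x => ?_)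
    simp [P.a_U]
  have e3 : ∫ x, χ (P.a x) * ‖P.fib f (P.U x)‖ ^ 2 = ∫ x, χ (P.a x) * ‖P.fib f x‖ ^ 2 := by
    have hU : MeasurableEmbedding P.U := Homeomorph.measurableEmbedding
      { toFun := P.U, invFun := P.U, left_inv := P.U_U, right_inv := P.U_U,
        continuous_toFun := P.U.continuous, continuous_invFun := P.U.continuous }
    rw [← P.measurePreserving_U.integral_comp hU]
    simp only [P.a_U, P.U_U]
  have key : |∫ x, RCLike.re ((χ (P.a x) : ℂ) * (starRingEnd ℂ (P.fib f x) * P.fib f (P.U x)))| ≤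
      ∫ x, χ (P.a x) * ‖P.fib f x‖ ^ 2 := by
    calc _ ≤ ∫ x, (χ (P.a x) * ‖P.fib f x‖ ^ 2 + χ (P.a x) * ‖P.fib f (P.U x)‖ ^ 2) / 2 := by
          rw [← Real.norm_eq_abs]
          refine norm_integral_le_of_norm_le ((i1.add i2).div_const 2)
            (Eventually.of_forall fun x => ?_)
          refine (RCLike.norm_re_le_norm _).trans ?_
          rw [norm_mul, norm_mul, RCLike.norm_conj, Complex.norm_real, Real.norm_eq_abs,
            abs_of_nonneg (hχ0 _)]
          nlinarith [mul_nonneg (hχ0 (P.a x)) (sq_nonneg (‖P.fib f x‖ - ‖P.fib f (P.U x)‖))]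
      _ = _ := by
          rw [integral_div, integral_add i1 i2, e3]; ring
  rw [e1, e2]
  set A := ∫ x, χ (P.a x) * ‖P.fib f x‖ ^ 2
  set B := ∫ x, RCLike.re ((χ (P.a x) : ℂ) * (starRingEnd ℂ (P.fib f x) * P.fib f (P.U x)))
  have : |s * B| ≤ A := by
    rw [abs_mul]
    calc |s| * |B| ≤ 1 * A := mul_le_mul hs1 key (abs_nonneg _) zero_le_one
      _ = A := one_mul A
  linarith [(abs_le.1 this).2]

variable {P}

/-- Multiplication by rank-one kernels `φ(x) φ(mv x v)`, with a coefficient `|s| ≤ 1` for the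
dominated kernel: the function `φ` is absorbed into the test function. -/
theorem Dominates.mul {k₁ k₂ : E → R3 → ℝ} (h : P.Dominates k₁ k₂) {φ : E → ℝ} (hφ : Continuous φ)
    {s : ℝ} (hs : |s| ≤ 1) :
    P.Dominates (fun x v => k₁ x v * (φ x * φ (P.base.mv x v)))
      (fun x v => k₂ x v * (s * (φ x * φ (P.mv x v)))) := by
  have hφm := hφ.measurable
  have e : ∀ (Q : PairFrame E) (f : E → ℂ) (s : ℝ) (k : E → R3 → ℝ),
      Q.formFun (fun x v => k x v * (s * (φ x * φ (Q.mv x v)))) f =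
        fun z => s * Q.formFun k (fun x => f x * φ x) z := by
    intro Q f s k
    ext z
    simp only [formFun, map_mul, Complex.conj_ofReal]
    rw [show starRingEnd ℂ (f z.1) * (φ z.1 : ℂ) * (f (Q.mv z.1 z.2) * (φ (Q.mv z.1 z.2) : ℂ)) =
      ((φ z.1 * φ (Q.mv z.1 z.2) : ℝ) : ℂ) * (starRingEnd ℂ (f z.1) * f (Q.mv z.1 z.2)) by
        push_cast; ring, Complex.re_ofReal_mul]
    ring
  have e1 : ∀ f, P.base.formFun (fun x v => k₁ x v * (φ x * φ (P.base.mv x v))) f =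
      P.base.formFun k₁ (fun x => f x * φ x) := by
    intro f
    have := e P.base f 1 k₁
    simpa using this
  have hf' : ∀ f : E → ℂ, Continuous f → Continuous fun x => f x * (φ x : ℂ) := fun f hf =>
    hf.mul (Complex.continuous_ofReal.comp hφ)
  have hs' : ∀ f : E → ℂ, HasCompactSupport f → HasCompactSupport fun x => f x * (φ x : ℂ) :=
    fun f hf => hf.mul_right
  refine ⟨h.meas₁.mul ((hφm.comp measurable_fst).mul (hφm.comp P.base.measurable_mv)),
    h.meas₂.mul (((hφm.comp measurable_fst).mul (hφm.comp P.measurable_mv)).const_mul s),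
    fun f hf hsf => ?_, fun f hf hsf => ?_, fun f hf hsf t ht => ?_⟩
  · rw [e1]; exact h.int₁ _ (hf' f hf) (hs' f hsf)
  · rw [e]; exact (h.int₂ _ (hf' f hf) (hs' f hsf)).const_mul s
  · rw [e1, e, integral_const_mul, ← mul_assoc]
    refine h.nonneg _ (hf' f hf) (hs' f hsf) _ ?_
    rw [abs_mul]
    exact mul_le_one₀ ht (abs_nonneg _) hs

theorem Dominates.add {k₁ k₂ l₁ l₂ : E → R3 → ℝ} (h : P.Dominates k₁ k₂) (h' : P.Dominates l₁ l₂) :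
    P.Dominates (fun x v => k₁ x v + l₁ x v) (fun x v => k₂ x v + l₂ x v) := by
  have e : ∀ (Q : PairFrame E) (f : E → ℂ) (k l : E → R3 → ℝ),
      Q.formFun (fun x v => k x v + l x v) f = Q.formFun k f + Q.formFun l f := by
    intro Q f k l; ext z; simp [formFun, mul_add]
  refine ⟨h.meas₁.add h'.meas₁, h.meas₂.add h'.meas₂, fun f hf hs => ?_, fun f hf hs => ?_,
    fun f hf hs s hs1 => ?_⟩
  · rw [e]; exact (h.int₁ f hf hs).add (h'.int₁ f hf hs)
  · rw [e]; exact (h.int₂ f hf hs).add (h'.int₂ f hf hs)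
  · rw [e, e, integral_add' (h.int₁ f hf hs) (h'.int₁ f hf hs),
      integral_add' (h.int₂ f hf hs) (h'.int₂ f hf hs)]
    have h1 := h.nonneg f hf hs s hs1
    have h2 := h'.nonneg f hf hs s hs1
    linarith

variable (P) in
theorem dominates_zero : P.Dominates (fun _ _ => 0) (fun _ _ => 0) := by
  have := P.dominates_one.mul (φ := fun _ => 0) continuous_const (s := 0) (by simp)
  simpa using this

theorem Dominates.sum {k₁ k₂ : ℕ → E → R3 → ℝ} (h : ∀ i, P.Dominates (k₁ i) (k₂ i)) (n : ℕ) :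
    P.Dominates (fun x v => ∑ i ∈ Finset.range n, k₁ i x v)
      (fun x v => ∑ i ∈ Finset.range n, k₂ i x v) := by
  induction n with
  | zero => simpa using P.dominates_zero
  | succ n ih => simpa only [Finset.sum_range_succ] using ih.add (h n)

theorem integrable_formFun_of_le {Q : PairFrame E} {k l : E → R3 → ℝ}
    (hk : Measurable (Function.uncurry k)) {C : ℝ}
    (hle : ∀ x v, v ≠ 0 → |k x v| ≤ C * |l x v|) {f : E → ℂ} (hf : Continuous f)
    (hl : Integrable (Q.formFun l f) ((volume : Measure E).prod volume)) :
    (∀ᵐ z ∂((volume : Measure E).prod (volume : Measure R3)),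
      ‖Q.formFun k f z‖ ≤ C * ‖Q.formFun l f z‖) ∧
    Integrable (Q.formFun k f) ((volume : Measure E).prod volume) := by
  have hv : ∀ᵐ z ∂((volume : Measure E).prod (volume : Measure R3)), z.2 ≠ 0 :=
    Measure.quasiMeasurePreserving_snd.ae (Measure.ae_ne volume 0)
  have h1 : ∀ᵐ z ∂((volume : Measure E).prod (volume : Measure R3)),
      ‖Q.formFun k f z‖ ≤ C * ‖Q.formFun l f z‖ := by
    filter_upwards [hv] with z hz
    rw [formFun, formFun, norm_mul, norm_mul]
    have := hle z.1 z.2 hz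
    calc _ ≤ ‖(starRingEnd ℂ (f z.1) * f (Q.mv z.1 z.2)).re‖ * (C * |l z.1 z.2|) := by
          gcongr; exact this
      _ = _ := by rw [Real.norm_eq_abs (l z.1 z.2)]; ring
  refine ⟨h1, Integrable.mono' (hl.norm.const_mul C) ?_ h1⟩
  refine Measurable.aestronglyMeasurable (Measurable.mul ?_ hk)
  have h3 := Q.continuous_mv
  have h2 := RCLike.continuous_conj (K := ℂ)
  exact (Complex.continuous_re.comp (by fun_prop)).measurable

/-- Dominated limits. -/
theorem Dominates.lim {k₁ k₂ : ℕ → E → R3 → ℝ} (h : ∀ n, P.Dominates (k₁ n) (k₂ n))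
    {κ₁ κ₂ l₁ l₂ : E → R3 → ℝ} {C : ℝ}
    (hm₁ : Measurable (Function.uncurry κ₁)) (hm₂ : Measurable (Function.uncurry κ₂))
    (hb₁ : ∀ n x v, v ≠ 0 → |k₁ n x v| ≤ C * |l₁ x v|)
    (hb₂ : ∀ n x v, v ≠ 0 → |k₂ n x v| ≤ C * |l₂ x v|)
    (hl₁ : ∀ f : E → ℂ, Continuous f → HasCompactSupport f →
      Integrable (P.base.formFun l₁ f) ((volume : Measure E).prod volume))
    (hl₂ : ∀ f : E → ℂ, Continuous f → HasCompactSupport f →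
      Integrable (P.formFun l₂ f) ((volume : Measure E).prod volume))
    (ht₁ : ∀ x v, v ≠ 0 → Tendsto (fun n => k₁ n x v) atTop (𝓝 (κ₁ x v)))
    (ht₂ : ∀ x v, v ≠ 0 → Tendsto (fun n => k₂ n x v) atTop (𝓝 (κ₂ x v))) :
    P.Dominates κ₁ κ₂ := by
  have hv : ∀ᵐ z ∂((volume : Measure E).prod (volume : Measure R3)), z.2 ≠ 0 :=
    Measure.quasiMeasurePreserving_snd.ae (Measure.ae_ne volume 0)
  have hκ₁ : ∀ x v, v ≠ 0 → |κ₁ x v| ≤ C * |l₁ x v| := fun x v hv =>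
    le_of_tendsto (ht₁ x v hv).abs (Eventually.of_forall fun n => hb₁ n x v hv)
  have hκ₂ : ∀ x v, v ≠ 0 → |κ₂ x v| ≤ C * |l₂ x v| := fun x v hv =>
    le_of_tendsto (ht₂ x v hv).abs (Eventually.of_forall fun n => hb₂ n x v hv)
  refine ⟨hm₁, hm₂, fun f hf hs => (integrable_formFun_of_le hm₁ hκ₁ hf (hl₁ f hf hs)).2,
    fun f hf hs => (integrable_formFun_of_le hm₂ hκ₂ hf (hl₂ f hf hs)).2, fun f hf hs s hs1 => ?_⟩
  have t₁ := tendsto_integral_of_dominated_convergence (fun z => C * ‖P.base.formFun l₁ f z‖)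
    (fun n => ((h n).int₁ f hf hs).aestronglyMeasurable) ((hl₁ f hf hs).norm.const_mul C)
    (fun n => (integrable_formFun_of_le (h n).meas₁ (hb₁ n) hf (hl₁ f hf hs)).1)
    (f := P.base.formFun κ₁ f) (by
      filter_upwards [hv] with z hz
      exact (ht₁ z.1 z.2 hz).const_mul _)
  have t₂ := tendsto_integral_of_dominated_convergence (fun z => C * ‖P.formFun l₂ f z‖)
    (fun n => ((h n).int₂ f hf hs).aestronglyMeasurable) ((hl₂ f hf hs).norm.const_mul C)
    (fun n => (integrable_formFun_of_le (h n).meas₂ (hb₂ n) hf (hl₂ f hf hs)).1)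
    (f := P.formFun κ₂ f) (by
      filter_upwards [hv] with z hz
      exact (ht₂ z.1 z.2 hz).const_mul _)
  exact ge_of_tendsto' (t₁.sub (t₂.const_mul s)) fun n => (h n).nonneg f hf hs s hs1

end PairFrame

end

section

namespace PairFrame

variable {E : Type} [NormedAddCommGroup E] [InnerProductSpace ℝ E] (P : PairFrame E)
  [FiniteDimensional ℝ E] [MeasurableSpace E] [BorelSpace E]

/-- The sum of the symbols at `x` and at `mv x v`. -/
noncomputable def symSum (x : E) (v : R3) : ℝ := P.sym x + √(‖P.a x + v‖ ^ 2 + P.m2 x)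

/-- `symSum² - |v|²`. -/
noncomputable def gram₁ (x : E) (v : R3) : ℝ :=
  2 * (P.sym x * √(‖P.a x + v‖ ^ 2 + P.m2 x)) + 2 * inner ℝ (P.a x) (P.a x + v) + 2 * P.m2 x

/-- `symSum² - den`. -/
noncomputable def gram₂ (x : E) (v : R3) : ℝ :=
  2 * (P.sym x * √(‖P.a x + v‖ ^ 2 + P.m2 x)) + 2 * P.c * inner ℝ (P.a x) (P.a x + v)
    + (1 + P.c ^ 2) * P.m2 x

theorem base_sym_mv (x : E) (v : R3) : P.sym (P.base.mv x v) = √(‖P.a x + v‖ ^ 2 + P.m2 x) := by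
  simp [sym, P.a_ι, P.m2_add]

theorem measurable_sym' : Measurable fun z : E × R3 => √(‖P.a z.1 + z.2‖ ^ 2 + P.m2 z.1) := by
  have := P.m2_cont.measurable
  fun_prop

theorem measurable_symSum : Measurable (Function.uncurry P.symSum) :=
  (P.continuous_sym.measurable.comp measurable_fst).add P.measurable_sym'

theorem symSum_pos (x : E) (v : R3) : 0 < P.symSum x v :=
  add_pos_of_pos_of_nonneg (P.sym_pos x) (Real.sqrt_nonneg _)

theorem sq_symSum (x : E) (v : R3) : P.symSum x v ^ 2 = ‖v‖ ^ 2 + P.gram₁ x v := by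
  have h1 := P.sq_sym x
  have h2 : √(‖P.a x + v‖ ^ 2 + P.m2 x) ^ 2 = ‖P.a x + v‖ ^ 2 + P.m2 x :=
    Real.sq_sqrt (by have := P.m2_pos x; positivity)
  have h3 : ‖v‖ ^ 2 = ‖P.a x + v‖ ^ 2 - 2 * inner ℝ (P.a x) (P.a x + v) + ‖P.a x‖ ^ 2 := by
    have := norm_sub_sq_real (P.a x + v) (P.a x)
    rw [add_sub_cancel_left, real_inner_comm] at this
    exact this
  rw [symSum, gram₁, h3, add_sq, h1, h2]
  ring

theorem sq_symSum' (x : E) (v : R3) : P.symSum x v ^ 2 = P.den x v + P.gram₂ x v := by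
  have h1 := P.sq_sym x
  have h2 : √(‖P.a x + v‖ ^ 2 + P.m2 x) ^ 2 = ‖P.a x + v‖ ^ 2 + P.m2 x :=
    Real.sq_sqrt (by have := P.m2_pos x; positivity)
  rw [symSum, gram₂, den, add_sq, h1, h2]
  ring

theorem norm_mul_norm_le (x : E) (v : R3) :
    ‖P.a x‖ * ‖P.a x + v‖ ≤ P.sym x * √(‖P.a x + v‖ ^ 2 + P.m2 x) := by
  have h1 := P.norm_a_le_sym x
  have h2 := P.norm_a_le_sym (P.mv x v)
  rw [P.sym_mv, a_mv] at h2
  exact mul_le_mul h1 h2 (norm_nonneg _) (P.sym_pos x).le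

theorem gram₁_nonneg (x : E) (v : R3) : 0 ≤ P.gram₁ x v := by
  have h1 := P.norm_mul_norm_le x v
  have h2 := (abs_le.1 (abs_real_inner_le_norm (P.a x) (P.a x + v))).1
  have h3 := P.m2_pos x
  rw [gram₁]; linarith

theorem gram₂_nonneg (x : E) (v : R3) : 0 ≤ P.gram₂ x v := by
  have h1 := P.norm_mul_norm_le x v
  have h2 := (abs_le.1 (P.abs_mul_inner_le (P.a x) (P.a x + v))).1
  have h3 : 0 ≤ (1 + P.c ^ 2) * P.m2 x := mul_nonneg (by positivity) (P.m2_pos x).le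
  have h4 : 0 ≤ ‖P.a x‖ * ‖P.a x + v‖ := by positivity
  rw [gram₂]; linarith

variable {P}

/-- The Cauchy kernel `1 / (s + t)` is positive semidefinite: with `X = (s - 1) / (s + 1)` and
`Y = (t - 1) / (t + 1)` it is a geometric series in `X Y`. -/
theorem one_div_add_eq {s t : ℝ} (hs : 0 < s) (ht : 0 < t) :
    -1 < (s - 1) / (s + 1) * ((t - 1) / (t + 1)) ∧ (s - 1) / (s + 1) * ((t - 1) / (t + 1)) < 1 ∧
    √2 / (s + 1) * (√2 / (t + 1)) * (1 - (s - 1) / (s + 1) * ((t - 1) / (t + 1)))⁻¹ =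
      1 / (s + t) := by
  have h2 : √2 * √2 = 2 := Real.mul_self_sqrt (by norm_num)
  have e : 1 - (s - 1) / (s + 1) * ((t - 1) / (t + 1)) = 2 * (s + t) / ((s + 1) * (t + 1)) := by
    field_simp; ring
  have e2 : 1 + (s - 1) / (s + 1) * ((t - 1) / (t + 1)) = 2 * (1 + s * t) / ((s + 1) * (t + 1)) := by
    field_simp; ring
  have p1 : 0 < 2 * (s + t) / ((s + 1) * (t + 1)) := by positivity
  have p2 : 0 < 2 * (1 + s * t) / ((s + 1) * (t + 1)) := by positivity
  refine ⟨by linarith, by linarith, ?_⟩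
  rw [e, div_mul_div_comm, h2]
  field_simp

/-- Division by `symSum`, since the kernel `1 / symSum` is a limit of sums of rank-one kernels by
`one_div_add_eq`. -/
theorem Dominates.div_symSum {k₁ k₂ : E → R3 → ℝ} (h : P.Dominates k₁ k₂) :
    P.Dominates (fun x v => k₁ x v / P.symSum x v) (fun x v => k₂ x v / P.symSum x v) := by
  -- The Cayley transform of the symbol, the variable of the geometric series.
  let X : E → ℝ := fun x => (P.sym x - 1) / (P.sym x + 1)
  let W : E → ℝ := fun x => √2 / (P.sym x + 1)
  have hpos : ∀ x, P.sym x + 1 ≠ 0 := fun x => by have := P.sym_pos x; positivity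
  have hsc := P.continuous_sym
  have hX : Continuous X := (by fun_prop : Continuous fun x => P.sym x - 1).div (by fun_prop) hpos
  have hW : Continuous W := continuous_const.div (by fun_prop) hpos
  have hn := Dominates.sum (fun n => h.mul (φ := fun x => W x * X x ^ n)
    (hW.mul (hX.pow n)) (s := 1) (by simp))
  have main : ∀ (k : E → R3 → ℝ) (Q : PairFrame E), (∀ x v, P.sym (Q.mv x v) = √(‖P.a x + v‖ ^ 2 + P.m2 x)) →
      ∀ x v, (∀ n, |∑ i ∈ Finset.range n, k x v * (1 * (W x * X x ^ i * (W (Q.mv x v) * X (Q.mv x v) ^ i)))| ≤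
        2 / √P.m0 * |k x v|) ∧
        Tendsto (fun n => ∑ i ∈ Finset.range n, k x v * (1 * (W x * X x ^ i * (W (Q.mv x v) * X (Q.mv x v) ^ i))))
          atTop (𝓝 (k x v / P.symSum x v)) := by
    intro k Q hQ x v
    have hm0 : 0 < √P.m0 := Real.sqrt_pos.2 P.m0_pos
    have hs1 := P.sym_pos x
    have hs2 := P.sym_pos (Q.mv x v)
    obtain ⟨h1, h2, h3⟩ := one_div_add_eq hs1 hs2
    have hS : P.symSum x v = P.sym x + P.sym (Q.mv x v) := by rw [symSum, hQ]
    have e : ∀ n, ∑ i ∈ Finset.range n, k x v * (1 * (W x * X x ^ i * (W (Q.mv x v) * X (Q.mv x v) ^ i))) =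
        k x v * (W x * W (Q.mv x v)) * ∑ i ∈ Finset.range n, (X x * X (Q.mv x v)) ^ i := by
      intro n
      rw [Finset.mul_sum]
      refine Finset.sum_congr rfl fun i _ => ?_
      rw [mul_pow]; ring
    simp only [e]
    constructor
    · intro n
      -- The partial sums of the series for `1 / symSum` are at most `2 / symSum`.
      have hW0 : 0 < W x * W (Q.mv x v) := by
        simp only [W]; positivity
      rw [abs_mul, abs_mul, abs_of_pos hW0]
      have h4 : X x * X (Q.mv x v) < 1 := h2
      have h5 : 0 < 1 - X x * X (Q.mv x v) := by linarith
      calc |k x v| * (W x * W (Q.mv x v)) * |∑ i ∈ Finset.range n, (X x * X (Q.mv x v)) ^ i|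
          ≤ |k x v| * (W x * W (Q.mv x v)) * (2 / (1 - X x * X (Q.mv x v))) := by
            gcongr
            exact abs_geom_sum_le h1 h2 n
        _ = 2 * (1 / (P.sym x + P.sym (Q.mv x v))) * |k x v| := by
            rw [← h3]
            simp only [W, X]
            rw [div_eq_mul_inv 2 (1 - _)]; ring
        _ ≤ 2 * (1 / √P.m0) * |k x v| := by
            gcongr
            have := P.sqrt_m0_le_sym x
            linarith
        _ = _ := by ring
    · have h4 := (hasSum_geometric_of_abs_lt_one (abs_lt.2 ⟨h1, h2⟩)).tendsto_sum_nat.const_mul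
        (k x v * (W x * W (Q.mv x v)))
      have h5 : k x v * (W x * W (Q.mv x v)) *
          (1 - (P.sym x - 1) / (P.sym x + 1) * ((P.sym (Q.mv x v) - 1) / (P.sym (Q.mv x v) + 1)))⁻¹ =
          k x v / P.symSum x v := by
        rw [mul_assoc, h3, hS]; ring
      rw [h5] at h4
      exact h4
  have m1 := main k₁ P.base P.base_sym_mv
  have m2 := main k₂ P P.sym_mv
  simp only [one_mul] at m1
  refine Dominates.lim hn (l₁ := k₁) (l₂ := k₂) (C := 2 / √P.m0) (h.meas₁.div P.measurable_symSum)
    (h.meas₂.div P.measurable_symSum) (fun n x v _ => (m1 x v).1 n) (fun n x v _ => (m2 x v).1 n)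
    h.int₁ h.int₂ (fun x v _ => (m1 x v).2) (fun x v _ => (m2 x v).2)

/-- `gram₁` is the Gram kernel of the functions `√2 sym`, `√2 aᵢ` and `√2 √m2`, and `gram₂` has the
same rank-one terms with the coefficients `1`, `c` and `(1 + c²) / 2`, which are at most `1` in
absolute value. -/
theorem Dominates.mul_gram {k₁ k₂ : E → R3 → ℝ} (h : P.Dominates k₁ k₂) :
    P.Dominates (fun x v => k₁ x v * P.gram₁ x v) (fun x v => k₂ x v * P.gram₂ x v) := by
  have hc := P.abs_c_le
  have hc2 := P.c_sq_le
  have h2 : √2 * √2 = 2 := Real.mul_self_sqrt (by norm_num)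
  have hsc := P.continuous_sym
  have hm := P.m2_cont
  -- The rank-one terms: the symbol, the three components of `a`, and `√m2`.
  have a0 := h.mul (φ := fun x => √2 * P.sym x) (by fun_prop) (s := 1) (by simp)
  have ai : ∀ i : Fin 3, _ := fun i => h.mul (φ := fun x => √2 * P.a x i) (by fun_prop) (s := P.c) (by linarith)
  have am := h.mul (φ := fun x => √2 * √(P.m2 x)) (by fun_prop) (s := (1 + P.c ^ 2) / 2)
    (by rw [abs_of_pos (by positivity)]; linarith)
  have := a0.add ((ai 0).add ((ai 1).add ((ai 2).add am)))
  have hi : ∀ p q : R3, inner ℝ p q = p 0 * q 0 + p 1 * q 1 + p 2 * q 2 := by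
    intro p q
    simp [PiLp.inner_apply, Fin.sum_univ_three, mul_comm]
  convert this using 3 with x v x v
  · have hms : √(P.m2 x) * √(P.m2 x) = P.m2 x := Real.mul_self_sqrt (P.m2_pos x).le
    have e1 : P.a (P.base.mv x v) = P.a x + v := P.base.a_mv x v
    have e2 : P.m2 (P.base.mv x v) = P.m2 x := P.base.m2_mv x v
    rw [P.base_sym_mv, e1, e2, gram₁, hi]
    linear_combination (-k₁ x v * (P.sym x * √(‖P.a x + v‖ ^ 2 + P.m2 x) + P.a x 0 * (P.a x + v) 0 +
      P.a x 1 * (P.a x + v) 1 + P.a x 2 * (P.a x + v) 2 + P.m2 x)) * h2 - k₁ x v * √2 * √2 * hms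
  · have hms : √(P.m2 x) * √(P.m2 x) = P.m2 x := Real.mul_self_sqrt (P.m2_pos x).le
    rw [P.sym_mv, P.a_mv, P.m2_mv, gram₂, hi]
    linear_combination (-k₂ x v * (P.sym x * √(‖P.a x + v‖ ^ 2 + P.m2 x) + P.c * (P.a x 0 * (P.a x + v) 0 +
      P.a x 1 * (P.a x + v) 1 + P.a x 2 * (P.a x + v) 2) + (1 + P.c ^ 2) / 2 * P.m2 x)) * h2
      - k₂ x v * (1 + P.c ^ 2) / 2 * √2 * √2 * hms

variable (P)

/-- The terms of the geometric series for `symSum / |v|²` and `symSum / den`. -/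
theorem dominates_pow (j : ℕ) : P.Dominates
    (fun x v => 1 / P.symSum x v * (P.gram₁ x v / P.symSum x v ^ 2) ^ j)
    (fun x v => 1 / P.symSum x v * (P.gram₂ x v / P.symSum x v ^ 2) ^ j) := by
  induction j with
  | zero => simpa using P.dominates_one.div_symSum
  | succ j ih =>
    convert ih.mul_gram.div_symSum.div_symSum using 3 with x v x v
    all_goals
      have := P.symSum_pos x v
      rw [pow_succ]
      field_simp

/-- The kernel of the local interaction term. -/
noncomputable def coulKer (_ : E) (v : R3) : ℝ := 1 / ‖v‖ ^ 2

/-- The kernel of the non-local interaction term. -/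
noncomputable def denKer (x : E) (v : R3) : ℝ := 1 / P.den x v

theorem isPairKernel_coulKer : P.IsPairKernel (coulKer (E := E)) where
  meas := by unfold coulKer; fun_prop
  nonneg x v := by unfold coulKer; positivity
  le x v _ := by unfold coulKer; gcongr; norm_num
  flip x v := by simp [coulKer]

theorem isPairKernel_denKer : P.IsPairKernel P.denKer where
  meas := P.continuous_den.measurable.const_div 1
  nonneg x v := by have := P.den_pos x v; unfold denKer; positivity
  le x v hv := by
    have h1 := P.den_pos x v
    have h2 : 0 < ‖v‖ := norm_pos_iff.2 hv
    have h3 := P.sq_norm_le_den x v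
    rw [denKer, div_le_div_iff₀ h1 (by positivity)]
    linarith
  flip x v := by simp [denKer, den_mv]

variable {P}

theorem IsPairKernel.integrable_symSum {n : E → R3 → ℝ} (h : P.IsPairKernel n) {f : E → ℂ}
    (hf : Continuous f) (hs : HasCompactSupport f) :
    Integrable (P.formFun (fun x v => P.symSum x v * n x v) f) ((volume : Measure E).prod volume) := by
  have hsc := P.continuous_sym
  have hscc : Continuous fun x => (P.sym x : ℂ) := Complex.continuous_ofReal.comp hsc
  have hmem : ∀ g : E → ℂ, Continuous g → HasCompactSupport g → MemLp g 2 volume := fun g hg hgs =>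
    hg.memLp_of_hasCompactSupport hgs
  have key : ∀ g g' : E → ℂ, Continuous g → HasCompactSupport g → Continuous g' →
      HasCompactSupport g' → Integrable (fun z : E × R3 => starRingEnd ℂ (g z.1) *
        ((P.relKer n z.1 z.2 : ℂ) * g' (P.mv z.1 z.2))) ((volume : Measure E).prod volume) := by
    intro g g' hg hgs hg' hgs'
    refine (h.integrable ((hmem g hg hgs).toLp g) ((hmem g' hg' hgs').toLp g')).congr ?_
    filter_upwards [P.ae_prod_mv (hmem g hg hgs).coeFn_toLp,
      P.ae_prod_mv (hmem g' hg' hgs').coeFn_toLp] with z h1 h2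
    rw [h1.1, h2.2]
  have i1 := key (fun x => f x * P.sym x) (fun x => f x * P.sym x) (hf.mul hscc) hs.mul_right
    (hf.mul hscc) hs.mul_right
  have i2 := key f (fun x => f x * P.sym x * P.sym x) hf hs ((hf.mul hscc).mul hscc)
    hs.mul_right.mul_right
  refine (i1.add i2).re.congr (Eventually.of_forall fun z => ?_)
  simp only [Pi.add_apply, formFun, relKer, map_mul, Complex.conj_ofReal, symSum]
  rw [← P.sym_mv]
  have h0 : (P.sym (P.mv z.1 z.2) : ℂ) ≠ 0 := by exact_mod_cast (P.sym_pos _).ne'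
  have : starRingEnd ℂ (f z.1) * (P.sym z.1 : ℂ) * (((n z.1 z.2 / P.sym (P.mv z.1 z.2) : ℝ) : ℂ) *
      (f (P.mv z.1 z.2) * (P.sym (P.mv z.1 z.2) : ℂ))) + starRingEnd ℂ (f z.1) *
      (((n z.1 z.2 / P.sym (P.mv z.1 z.2) : ℝ) : ℂ) *
      (f (P.mv z.1 z.2) * (P.sym (P.mv z.1 z.2) : ℂ) * (P.sym (P.mv z.1 z.2) : ℂ))) =
      (((P.sym z.1 + P.sym (P.mv z.1 z.2)) * n z.1 z.2 : ℝ) : ℂ) *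
        (starRingEnd ℂ (f z.1) * f (P.mv z.1 z.2)) := by
    push_cast
    field_simp
  rw [this, RCLike.re_eq_complex_re, Complex.re_ofReal_mul]
  ring

variable (P)

/-- The form of the non-local term is dominated by the form of the local term: their kernels are
the sums of geometric series in `gram₂ / symSum²` and `gram₁ / symSum²`. -/
theorem dominates_coulKer_denKer :
    P.Dominates (fun x v => P.symSum x v * coulKer x v) (fun x v => P.symSum x v * P.denKer x v) := by
  have hn := Dominates.sum P.dominates_pow
  have main : ∀ x v (g d : ℝ), 0 ≤ g → 0 < d → P.symSum x v ^ 2 = d + g →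
      (∀ n, |∑ i ∈ Finset.range n, 1 / P.symSum x v * (g / P.symSum x v ^ 2) ^ i| ≤
        2 * (P.symSum x v * (1 / d))) ∧
      Tendsto (fun n => ∑ i ∈ Finset.range n, 1 / P.symSum x v * (g / P.symSum x v ^ 2) ^ i) atTop
        (𝓝 (P.symSum x v * (1 / d))) := by
    intro x v g d hg hd hS
    have hs := P.symSum_pos x v
    have h0 : 0 ≤ g / P.symSum x v ^ 2 := by positivity
    have h1 : g / P.symSum x v ^ 2 < 1 := by
      rw [div_lt_one (by positivity), hS]; linarith
    have e : 1 - g / P.symSum x v ^ 2 = d / P.symSum x v ^ 2 := by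
      rw [eq_div_iff (by positivity), sub_mul, div_mul_cancel₀ _ (by positivity), one_mul, hS]; ring
    simp only [← Finset.mul_sum]
    constructor
    · intro n
      rw [abs_mul, abs_of_pos (by positivity)]
      calc _ ≤ 1 / P.symSum x v * (2 / (1 - g / P.symSum x v ^ 2)) := by
            gcongr; exact abs_geom_sum_le (by linarith) h1 n
        _ = _ := by rw [e]; field_simp
    · have := (hasSum_geometric_of_lt_one h0 h1).tendsto_sum_nat.const_mul (1 / P.symSum x v)
      rw [e] at this
      convert this using 2
      field_simp
  have m1 := fun (x : E) (v : R3) (hv : v ≠ 0) => main x v (P.gram₁ x v) (‖v‖ ^ 2) (P.gram₁_nonneg x v)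
    (by have : 0 < ‖v‖ := norm_pos_iff.2 hv
        positivity) (P.sq_symSum x v)
  have m2 := fun (x : E) (v : R3) => main x v (P.gram₂ x v) (P.den x v) (P.gram₂_nonneg x v) (P.den_pos x v)
    (P.sq_symSum' x v)
  have hd1 : Measurable (Function.uncurry fun x v => P.symSum x v * coulKer x v) :=
    P.measurable_symSum.mul P.isPairKernel_coulKer.meas
  have hd2 : Measurable (Function.uncurry fun x v => P.symSum x v * P.denKer x v) :=
    P.measurable_symSum.mul P.isPairKernel_denKer.meas
  refine Dominates.lim hn (C := 2) (l₁ := fun x v => P.symSum x v * coulKer x v)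
    (l₂ := fun x v => P.symSum x v * P.denKer x v) hd1 hd2
    (fun n x v hv => ((m1 x v hv).1 n).trans ?_) (fun n x v hv => ((m2 x v).1 n).trans ?_)
    (fun f hf hs => ?_) (fun f hf hs => P.isPairKernel_denKer.integrable_symSum hf hs)
    (fun x v hv => (m1 x v hv).2) (fun x v hv => (m2 x v).2)
  · gcongr; exact le_abs_self _
  · gcongr; exact le_abs_self _
  · exact P.base.isPairKernel_coulKer.integrable_symSum hf hs

end PairFrame

end

section

namespace PairFrame

variable {E : Type} [NormedAddCommGroup E] [InnerProductSpace ℝ E] {P : PairFrame E}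
  [FiniteDimensional ℝ E] [MeasurableSpace E] [BorelSpace E]

theorem dense_continuous_compactSupport :
    Dense {ζ : L²(E) | ∃ g : E → ℂ, Continuous g ∧ HasCompactSupport g ∧
      ζ =ᵐ[volume] g} := by
  intro ζ
  rw [EMetric.mem_closure_iff]
  intro ε hε
  obtain ⟨g, hgs, hg1, hgc, hgm⟩ := (Lp.memLp ζ).exists_hasCompactSupport_eLpNorm_sub_le
    (by norm_num) (ε := ε / 2) (by simpa using hε.ne')
  by_cases htop : ε = ∞
  · refine ⟨hgm.toLp g, ⟨g, hgc, hgs, hgm.coeFn_toLp⟩, ?_⟩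
    rw [htop]; exact edist_lt_top _ _
  refine ⟨hgm.toLp g, ⟨g, hgc, hgs, hgm.coeFn_toLp⟩, ?_⟩
  rw [Lp.edist_def]
  refine lt_of_le_of_lt ?_ (ENNReal.half_lt_self hε.ne' htop)
  refine le_trans (le_of_eq (eLpNorm_congr_ae ?_)) hg1
  filter_upwards [hgm.coeFn_toLp] with x hx
  simp [hx]

/-- The form of the operator of a pair kernel, in terms of the symmetrized kernel. -/
theorem IsKernelOp.re_inner_eq_formFun {n : E → R3 → ℝ} (h : P.IsPairKernel n)
    {L : L²(E) →L[ℂ] L²(E)}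
    (hL : P.IsKernelOp (P.relKer n) L) {ζ : L²(E)} {f : E → ℂ}
    (hζ : ∀ᵐ x, ζ x = P.sym x * f x) :
    2 * (inner ℂ ζ (L ζ)).re =
      ∫ z, P.formFun (fun x v => P.symSum x v * n x v) f z ∂((volume : Measure E).prod volume) := by
  have i1 := h.integrable ζ ζ
  have i2 := P.integrable_flip i1
  rw [hL.inner_eq_of_isPairKernel h, two_mul, ← Complex.add_re]
  nth_rw 2 [← P.integral_flip]
  rw [← integral_add i1 i2, ← RCLike.re_eq_complex_re]
  refine (integral_re (i1.add i2)).symm.trans ?_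
  refine integral_congr_ae ?_
  filter_upwards [P.ae_prod_mv hζ] with z hz
  simp only [Pi.add_apply, mv_mv, relKer, h.flip, formFun, symSum]
  rw [hz.1, hz.2, ← P.sym_mv]
  have h0 : (P.sym (P.mv z.1 z.2) : ℂ) ≠ 0 := by exact_mod_cast (P.sym_pos _).ne'
  have h1 : (P.sym z.1 : ℂ) ≠ 0 := by exact_mod_cast (P.sym_pos _).ne'
  have e1 : starRingEnd ℂ ((P.sym z.1 : ℂ) * f z.1) * (((n z.1 z.2 / P.sym (P.mv z.1 z.2) : ℝ) : ℂ) *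
      ((P.sym (P.mv z.1 z.2) : ℂ) * f (P.mv z.1 z.2))) =
      ((P.sym z.1 * n z.1 z.2 : ℝ) : ℂ) * (starRingEnd ℂ (f z.1) * f (P.mv z.1 z.2)) := by
    simp only [map_mul, Complex.conj_ofReal]
    push_cast
    field_simp
  have e2 : starRingEnd ℂ ((P.sym (P.mv z.1 z.2) : ℂ) * f (P.mv z.1 z.2)) * (((n z.1 z.2 / P.sym z.1 : ℝ) : ℂ) *
      ((P.sym z.1 : ℂ) * f z.1)) =
      ((P.sym (P.mv z.1 z.2) * n z.1 z.2 : ℝ) : ℂ) * starRingEnd ℂ (starRingEnd ℂ (f z.1) * f (P.mv z.1 z.2)) := by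
    simp only [map_mul, Complex.conj_ofReal, Complex.conj_conj]
    push_cast
    field_simp
  rw [e1, e2, RCLike.re_eq_complex_re, Complex.add_re, Complex.re_ofReal_mul,
    Complex.re_ofReal_mul, Complex.conj_re]
  ring

/-- The local term, without exchange, dominates any multiple in `[-1, 1]` of the non-local term. On the
dense set of functions `sym · f` with a test function `f`, this is `dominates_coulKer_denKer`. -/
theorem re_inner_sub_nonneg {L₁ L₂ : L²(E) →L[ℂ] L²(E)}
    (h₁ : P.base.IsKernelOp (P.base.relKer coulKer) L₁) (h₂ : P.IsKernelOp (P.relKer P.denKer) L₂)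
    {s : ℝ} (hs : |s| ≤ 1) (ζ : L²(E)) :
    0 ≤ (inner ℂ ζ (L₁ ζ)).re - s * (inner ℂ ζ (L₂ ζ)).re := by
  have hcl : IsClosed {ζ : L²(E) |
      0 ≤ (inner ℂ ζ (L₁ ζ)).re - s * (inner ℂ ζ (L₂ ζ)).re} :=
    isClosed_le continuous_const (by fun_prop)
  refine hcl.closure_subset_iff.2 ?_ (dense_continuous_compactSupport ζ)
  rintro ζ ⟨g, hg, hgs, hζ⟩
  let f : E → ℂ := fun x => g x * ((P.sym x)⁻¹ : ℝ)
  have hf : Continuous f := hg.mul (Complex.continuous_ofReal.comp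
    (P.continuous_sym.inv₀ fun x => (P.sym_pos x).ne'))
  have hfs : HasCompactSupport f := hgs.mul_right
  have hζf : ∀ᵐ x, ζ x = P.sym x * f x := by
    filter_upwards [hζ] with x hx
    have h0 : (P.sym x : ℂ) ≠ 0 := by exact_mod_cast (P.sym_pos _).ne'
    rw [hx]
    simp only [f]
    push_cast
    field_simp
  have e1 := h₁.re_inner_eq_formFun P.base.isPairKernel_coulKer hζf
  have e2 := h₂.re_inner_eq_formFun P.isPairKernel_denKer hζf
  have := P.dominates_coulKer_denKer.nonneg f hf hfs s hs
  change 0 ≤ (∫ z, P.base.formFun (fun x v => P.base.symSum x v * coulKer x v) f z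
    ∂((volume : Measure E).prod volume)) - _ at this
  rw [← e1, ← e2] at this
  rw [mem_ofPred_eq]
  linarith

/-- The pointwise estimate in the symmetrized Schur test: `2 s t ≤ s² r + t² / r` with
`r = (|p| / |q|)^{3/2}`, where `p = a x` and `q = a x + v`. -/
theorem relKer_add_flip_le {x : E} {v : R3} (hp : P.a x ≠ 0) (hq : P.a x + v ≠ 0) (s t : ℝ)
    (hs : 0 ≤ s) (ht : 0 ≤ t) :
    s * t * (P.relKer P.denKer x v + P.relKer P.denKer (P.mv x v) (-v)) ≤
      s ^ 2 * symKernel P.c (P.a x) (P.a x + v) + t ^ 2 * symKernel P.c (P.a x + v) (P.a x) := by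
  have h1 := P.norm_a_le_sym x
  have h2 := P.norm_a_le_sym (P.mv x v)
  rw [a_mv] at h2
  have hp' : 0 < ‖P.a x‖ := norm_pos_iff.2 hp
  have hq' : 0 < ‖P.a x + v‖ := norm_pos_iff.2 hq
  simp only [relKer, denKer, den_mv, mv_mv, symKernel]
  rw [real_inner_comm (P.a x) (P.a x + v), add_comm (‖P.a x + v‖ ^ 2)]
  set N := ‖P.a x‖ ^ 2 + ‖P.a x + v‖ ^ 2 - 2 * P.c * inner ℝ (P.a x) (P.a x + v) with hN
  have hN0 : 0 < N := by
    have := (abs_le.1 (P.abs_mul_inner_le (P.a x) (P.a x + v))).2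
    nlinarith [sq_nonneg (‖P.a x‖ - ‖P.a x + v‖)]
  have hNd : N ≤ P.den x v := by
    have : 0 ≤ (1 - P.c ^ 2) * P.m2 x :=
      mul_nonneg (by have := P.c_sq_le; linarith) (P.m2_pos x).le
    rw [den]; linarith
  set p := ‖P.a x‖
  set q := ‖P.a x + v‖
  set r := p / q * √(p / q) with hr
  have hr0 : 0 < r := by positivity
  have hr1 : q / p * √(q / p) = 1 / r := by
    rw [hr, Real.sqrt_div hp'.le, Real.sqrt_div hq'.le]
    have : 0 < √p := Real.sqrt_pos.2 hp'
    have : 0 < √q := Real.sqrt_pos.2 hq'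
    field_simp
  rw [hr1]
  have hd := P.den_pos x v
  have hs1 := P.sym_pos x
  have hs2 := P.sym_pos (P.mv x v)
  have hb : 1 / P.den x v / P.sym (P.mv x v) + 1 / P.den x v / P.sym x ≤ (1 / p + 1 / q) / N := by
    have b1 : 1 / P.den x v / P.sym (P.mv x v) ≤ 1 / N / q := by gcongr
    have b2 : 1 / P.den x v / P.sym x ≤ 1 / N / p := by gcongr
    calc _ ≤ 1 / N / q + 1 / N / p := add_le_add b1 b2
      _ = _ := by field_simp; ring
  calc _ ≤ s * t * ((1 / p + 1 / q) / N) := by gcongr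
    _ ≤ (1 / p + 1 / q) / 2 / N * (s ^ 2 * r + t ^ 2 * (1 / r)) := by
        have h3 : 2 * (s * t) ≤ s ^ 2 * r + t ^ 2 * (1 / r) := by
          have : s ^ 2 * r + t ^ 2 * (1 / r) - 2 * (s * t) = (s * r - t) ^ 2 / r := by
            field_simp; ring
          have h4 : 0 ≤ (s * r - t) ^ 2 / r := by positivity
          linarith
        calc _ = (1 / p + 1 / q) / 2 / N * (2 * (s * t)) := by ring
          _ ≤ _ := by gcongr
    _ = _ := by ring

/-- The upper bound for the non-local term. Both the form and its bound are averaged over `flip`;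
only the symmetrized kernel, with `1 / sym` replaced by the mean of its values at both ends, has a
Schur constant below `π³`. -/
theorem re_inner_denKer_le {L : L²(E) →L[ℂ] L²(E)}
    (hL : P.IsKernelOp (P.relKer P.denKer) L) (ζ : L²(E)) :
    (inner ℂ ζ (L ζ)).re ≤ symConst * ‖ζ‖ ^ 2 := by
  have hsc : 0 ≤ symConst := by unfold symConst; positivity
  have hk := P.isPairKernel_denKer
  have hz : Measurable fun x => ‖ζ x‖ := (Lp.stronglyMeasurable ζ).norm.measurable
  have hrel0 : ∀ x v, 0 ≤ P.relKer P.denKer x v := fun x v =>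
    div_nonneg (hk.nonneg x v) (P.sym_pos _).le
  have hrm : Measurable fun z : E × R3 => P.relKer P.denKer z.1 z.2 := hk.meas_relKer
  have hmv := P.measurable_mv
  let F : E × R3 → ℝ := fun z => ‖ζ z.1‖ * (P.relKer P.denKer z.1 z.2 * ‖ζ (P.mv z.1 z.2)‖)
  let A : E × R3 → ℝ := fun z => ‖ζ z.1‖ ^ 2 * symKernel P.c (P.a z.1) (P.a z.1 + z.2)
  have hF : Measurable F := by
    have := hz.comp hmv
    exact (hz.comp measurable_fst).mul (hrm.mul this)
  have hsk : Measurable fun z : E × R3 => symKernel P.c (P.a z.1) (P.a z.1 + z.2) := by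
    unfold symKernel; fun_prop
  have hA : Measurable A := ((hz.comp measurable_fst).pow_const 2).mul hsk
  have hflip : ∀ G : E × R3 → ℝ, Measurable G →
      ∫⁻ z, ENNReal.ofReal (G (P.flip z)) ∂((volume : Measure E).prod volume) =
      ∫⁻ z, ENNReal.ofReal (G z) ∂((volume : Measure E).prod volume) := fun G hG =>
    P.measurePreserving_flip.lintegral_comp hG.ennreal_ofReal
  have hF0 : ∀ z, 0 ≤ F z := fun z => by have := hrel0 z.1 z.2; positivity
  have hae : ∀ᵐ z ∂((volume : Measure E).prod (volume : Measure R3)),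
      P.a z.1 ≠ 0 ∧ P.a (P.mv z.1 z.2) ≠ 0 := P.ae_prod_mv P.ae_a_ne_zero
  have hsk0 : ∀ p q : R3, p ≠ 0 → q ≠ 0 → 0 ≤ symKernel P.c p q := fun p q hp hq =>
    (symKernel_add_symKernel_neg_le P.abs_c_le hp hq).1
  have h1 : 2 * ∫⁻ z, ENNReal.ofReal (F z) ∂((volume : Measure E).prod volume) ≤
      2 * ∫⁻ z, ENNReal.ofReal (A z) ∂((volume : Measure E).prod volume) := by
    rw [two_mul, two_mul]
    nth_rw 2 [← hflip F hF]
    nth_rw 2 [← hflip A hA]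
    rw [← lintegral_add_left hF.ennreal_ofReal, ← lintegral_add_left hA.ennreal_ofReal]
    refine lintegral_mono_ae ?_
    filter_upwards [hae] with z hz
    rw [a_mv] at hz
    have hA1 : 0 ≤ A z := mul_nonneg (sq_nonneg _) (hsk0 _ _ hz.1 hz.2)
    have hA2 : A (P.flip z) = ‖ζ (P.mv z.1 z.2)‖ ^ 2 * symKernel P.c (P.a z.1 + z.2) (P.a z.1) := by
      simp [A]
    have hA3 : 0 ≤ A (P.flip z) := by
      rw [hA2]; exact mul_nonneg (sq_nonneg _) (hsk0 _ _ hz.2 hz.1)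
    rw [← ENNReal.ofReal_add (hF0 _) (hF0 _), ← ENNReal.ofReal_add hA1 hA3]
    refine ENNReal.ofReal_le_ofReal ?_
    rw [hA2]
    have := P.relKer_add_flip_le hz.1 hz.2 ‖ζ z.1‖ ‖ζ (P.mv z.1 z.2)‖ (norm_nonneg _) (norm_nonneg _)
    refine le_trans (le_of_eq ?_) this
    simp only [F, flip_apply, mv_mv]
    ring
  have h2 : ∫⁻ z, ENNReal.ofReal (F z) ∂((volume : Measure E).prod volume) ≤
      ENNReal.ofReal (symConst * ‖ζ‖ ^ 2) := by
    refine ((ENNReal.mul_le_mul_iff_right (by norm_num) (by norm_num)).1 h1).trans ?_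
    rw [lintegral_prod _ hA.ennreal_ofReal.aemeasurable]
    calc ∫⁻ x, ∫⁻ v, ENNReal.ofReal (A (x, v)) ≤ ∫⁻ x, ‖ζ x‖ₑ ^ 2 * ENNReal.ofReal symConst := by
          refine lintegral_mono_ae ?_
          filter_upwards [P.ae_a_ne_zero] with x hx
          simp only [A]
          have : ∀ v, ENNReal.ofReal (‖ζ x‖ ^ 2 * symKernel P.c (P.a x) (P.a x + v)) =
              ‖ζ x‖ₑ ^ 2 * ENNReal.ofReal (symKernel P.c (P.a x) (P.a x + v)) := fun v => by
            rw [ENNReal.ofReal_mul (by positivity), ENNReal.ofReal_pow (norm_nonneg _), ofReal_norm]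
          simp only [this]
          rw [lintegral_const_mul _ (by unfold symKernel; fun_prop)]
          gcongr
          rw [lintegral_add_left_eq_self (fun q => ENNReal.ofReal (symKernel P.c (P.a x) q))]
          exact lintegral_symKernel_le P.abs_c_le hx
      _ = _ := by
          rw [lintegral_mul_const _ ((Lp.stronglyMeasurable ζ).enorm.pow_const 2),
            lintegral_enorm_sq_Lp, ← ENNReal.ofReal_mul (by positivity), mul_comm]
  have h3 : ‖inner ℂ ζ (L ζ)‖ₑ ≤ ENNReal.ofReal (symConst * ‖ζ‖ ^ 2) := by
    rw [hL.inner_eq_of_isPairKernel hk]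
    refine (enorm_integral_le_lintegral_enorm _).trans (le_trans (le_of_eq ?_) h2)
    refine lintegral_congr fun z => ?_
    rw [← ofReal_norm, norm_mul, norm_mul, RCLike.norm_conj, Complex.norm_real,
      Real.norm_of_nonneg (hrel0 _ _)]
  rw [← ofReal_norm, ENNReal.ofReal_le_ofReal_iff (by positivity)] at h3
  exact (Complex.re_le_norm _).trans h3

/-- The lower bound for a pair, with a weight `g` of the local term. For `g ≤ 1`, write
`g V - K = g (V - K) - (1 - g) K` with the local term `V` and the non-local term `K`. -/
theorem re_inner_pair_ge {L₁ L₂ : L²(E) →L[ℂ] L²(E)}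
    (h₁ : P.base.IsKernelOp (P.base.relKer coulKer) L₁) (h₂ : P.IsKernelOp (P.relKer P.denKer) L₂)
    {g : ℝ} (hg : 0 ≤ g) (ζ : L²(E)) :
    -(max 0 (1 - g) * symConst * ‖ζ‖ ^ 2) ≤ g * (inner ℂ ζ (L₁ ζ)).re - (inner ℂ ζ (L₂ ζ)).re := by
  have a := re_inner_sub_nonneg h₁ h₂ (s := 1) (by simp) ζ
  have b := re_inner_sub_nonneg h₁ h₂ (s := 0) (by simp) ζ
  have c := re_inner_denKer_le h₂ ζ
  rcases le_total g 1 with h | h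
  · rw [max_eq_right (by linarith)]
    nlinarith
  · rw [max_eq_left (by linarith)]
    nlinarith

end PairFrame

end

section

/-! ### The Fourier transform on `L²` -/

section FourierL2

variable {E : Type} [NormedAddCommGroup E] [InnerProductSpace ℝ E]
  [FiniteDimensional ℝ E] [MeasurableSpace E] [BorelSpace E]

theorem ae_eq_of_integral_schwartz {u v : E → ℂ} (hu : LocallyIntegrable u) (hv : LocallyIntegrable v)
    (h : ∀ φ : 𝓢(E, ℂ), HasCompactSupport φ → ∫ x, φ x * u x = ∫ x, φ x * v x) : u =ᵐ[volume] v := by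
  refine ae_eq_of_integral_contDiff_smul_eq hu hv fun g hg hgc => ?_
  have hg₁ : HasCompactSupport (Complex.ofRealCLM ∘ g) := hgc.comp_left rfl
  have hg₂ : ContDiff ℝ (⊤ : ℕ∞) (Complex.ofRealCLM ∘ g) := by
    have : ContDiff ℝ (⊤ : ℕ∞) g := hg
    fun_prop
  have := h (hg₁.toSchwartzMap hg₂) hg₁
  simpa using this

theorem locallyIntegrable_Lp (u : L²(E)) : LocallyIntegrable u :=
  (Lp.memLp u).locallyIntegrable (by norm_num)

theorem locallyIntegrable_mul_Lp {g : E → ℂ} (hg : Continuous g) (u : L²(E)) :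
    LocallyIntegrable fun x => g x * u x := by
  have := (locallyIntegrable_Lp u).locallyIntegrableOn univ
  have h := this.continuousOn_mul hg.continuousOn isClosed_univ.isLocallyClosed
  rwa [locallyIntegrableOn_univ] at h

theorem integral_schwartz_mul_fourier (u : L²(E)) (φ : 𝓢(E, ℂ)) :
    ∫ x, φ x * (𝓕 u : L²(E)) x = ∫ x, (𝓕 φ : 𝓢(E, ℂ)) x * u x := by
  have h := congrArg (fun T : 𝓢'(E, ℂ) => T φ) (Lp.fourier_toTemperedDistribution_eq u)
  simp only [TemperedDistribution.fourier_apply, Lp.toTemperedDistribution_apply, smul_eq_mul] at h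
  exact h.symm

theorem integral_fourierInv_mul_fourier (u : L²(E)) (φ : 𝓢(E, ℂ)) :
    ∫ x, (𝓕⁻ φ : 𝓢(E, ℂ)) x * (𝓕 u : L²(E)) x = ∫ x, φ x * u x := by
  rw [integral_schwartz_mul_fourier, FourierTransform.fourier_fourierInv_eq]

/-- Multiplication by a bounded function. -/
theorem exists_mulOp {m : E → ℂ} (hm : Measurable m) {C : ℝ} (hC : ∀ᵐ x, ‖m x‖ ≤ C) :
    ∃ M : L²(E) →L[ℂ] L²(E),
      (∀ f, ∀ᵐ x, M f x = m x * f x) ∧ ∀ f, ‖M f‖ ≤ max C 0 * ‖f‖ := by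
  have hC' : ∀ᵐ x, ‖m x‖ ≤ max C 0 := hC.mono fun x h => h.trans (le_max_left _ _)
  have hle : ∀ f : L²(E), ∀ᵐ x, ‖m x * f x‖ ≤ max C 0 * ‖f x‖ := by
    intro f
    filter_upwards [hC'] with x hx
    rw [norm_mul]; gcongr
  have hmem : ∀ f : L²(E), MemLp (fun x => m x * f x) 2 volume := fun f =>
    (Lp.memLp f).of_le_mul (hm.aestronglyMeasurable.mul (Lp.aestronglyMeasurable f)) (hle f)
  have hb : ∀ f : L²(E), ‖(hmem f).toLp _‖ ≤ max C 0 * ‖f‖ := by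
    intro f
    refine Lp.norm_le_mul_norm_of_ae_le_mul ?_
    filter_upwards [(hmem f).coeFn_toLp, hle f] with x h1 h2
    rwa [h1]
  let M₀ : L²(E) →ₗ[ℂ] L²(E) :=
    { toFun := fun f => (hmem f).toLp _
      map_add' := fun f g => by
        ext1
        filter_upwards [(hmem (f + g)).coeFn_toLp, Lp.coeFn_add ((hmem f).toLp _) ((hmem g).toLp _),
          (hmem f).coeFn_toLp, (hmem g).coeFn_toLp, Lp.coeFn_add f g] with x h1 h2 h3 h4 h5
        rw [h1, h2, Pi.add_apply, h3, h4, h5, Pi.add_apply, mul_add]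
      map_smul' := fun c f => by
        ext1
        filter_upwards [(hmem (c • f)).coeFn_toLp, Lp.coeFn_smul c ((hmem f).toLp _),
          (hmem f).coeFn_toLp, Lp.coeFn_smul c f] with x h1 h2 h3 h4
        rw [h1, RingHom.id_apply, h2, Pi.smul_apply, h3, h4, Pi.smul_apply, smul_eq_mul, smul_eq_mul]
        ring }
  exact ⟨M₀.mkContinuous _ hb, fun f => (hmem f).coeFn_toLp, hb⟩

/-- The Fourier transform turns modulations into translations. -/
theorem fourier_modulation (b : E) {u v : L²(E)}
    (h : ∀ᵐ x, v x = Complex.exp (2 * π * Complex.I * inner ℝ b x) * u x) :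
    ∀ᵐ x, (𝓕 v : L²(E)) x = (𝓕 u : L²(E)) (x - b) := by
  have hmp : MeasurePreserving (fun x : E => x - b) volume volume := measurePreserving_sub_right volume b
  have hmem := (Lp.memLp (𝓕 u : L²(E))).comp_measurePreserving hmp
  refine ae_eq_of_integral_schwartz (locallyIntegrable_Lp _) (hmem.locallyIntegrable (by norm_num))
    fun φ _ => ?_
  rw [integral_schwartz_mul_fourier]
  have e1 : ∫ x, φ x * (𝓕 u : L²(E)) (x - b) =
      ∫ x, (SchwartzMap.compSubConstCLM ℂ (-b) φ) x * (𝓕 u : L²(E)) x := by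
    rw [← integral_sub_right_eq_self (fun x => (SchwartzMap.compSubConstCLM ℂ (-b) φ) x * _) b]
    refine integral_congr_ae (Eventually.of_forall fun x => ?_)
    simp
  have e2 : ∀ x, (𝓕 (SchwartzMap.compSubConstCLM ℂ (-b) φ) : 𝓢(E, ℂ)) x =
      Complex.exp (2 * π * Complex.I * inner ℝ b x) * (𝓕 φ : 𝓢(E, ℂ)) x := by
    intro x
    rw [SchwartzMap.fourier_coe, SchwartzMap.fourier_coe, Real.fourier_eq', Real.fourier_eq']
    rw [← integral_sub_right_eq_self _ b, ← integral_const_mul]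
    refine integral_congr_ae (Eventually.of_forall fun y => ?_)
    simp only [SchwartzMap.compSubConstCLM_apply, sub_neg_eq_add, sub_add_cancel, smul_eq_mul]
    rw [← mul_assoc, ← Complex.exp_add]
    congr 2
    rw [inner_sub_left]
    push_cast
    ring
  change _ = ∫ x, φ x * (𝓕 u : L²(E)) (x - b)
  rw [e1, integral_schwartz_mul_fourier]
  refine integral_congr_ae ?_
  filter_upwards [h] with x hx
  rw [hx, e2]
  ring

/-- The Fourier transform commutes with linear isometries. -/
theorem fourier_comp_isometry (A : E ≃ₗᵢ[ℝ] E) {u v : L²(E)}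
    (h : ∀ᵐ x, v x = u (A x)) :
    ∀ᵐ x, (𝓕 v : L²(E)) x = (𝓕 u : L²(E)) (A x) := by
  have hA : MeasurePreserving A volume volume := A.measurePreserving
  have hAe : MeasurableEmbedding A := A.toHomeomorph.measurableEmbedding
  have hmem := (Lp.memLp (𝓕 u : L²(E))).comp_measurePreserving hA
  refine ae_eq_of_integral_schwartz (locallyIntegrable_Lp _) (hmem.locallyIntegrable (by norm_num))
    fun φ _ => ?_
  let ψ : 𝓢(E, ℂ) := SchwartzMap.compCLMOfContinuousLinearEquiv ℂ A.symm.toContinuousLinearEquiv φ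
  have hψ : ∀ x, ψ x = φ (A.symm x) := fun x => rfl
  have e1 : ∫ x, φ x * (𝓕 u : L²(E)) (A x) =
      ∫ x, ψ x * (𝓕 u : L²(E)) x := by
    rw [← hA.integral_comp hAe (fun x => ψ x * _)]
    refine integral_congr_ae (Eventually.of_forall fun x => ?_)
    simp [hψ]
  have e2 : ∀ x, (𝓕 ψ : 𝓢(E, ℂ)) (A x) = (𝓕 φ : 𝓢(E, ℂ)) x := by
    intro x
    rw [SchwartzMap.fourier_coe, SchwartzMap.fourier_coe, Real.fourier_eq', Real.fourier_eq']
    rw [← hA.integral_comp hAe]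
    refine integral_congr_ae (Eventually.of_forall fun y => ?_)
    simp [hψ, A.inner_map_map]
  change _ = ∫ x, φ x * (𝓕 u : L²(E)) (A x)
  rw [integral_schwartz_mul_fourier, e1, integral_schwartz_mul_fourier,
    ← hA.integral_comp hAe (fun x => (𝓕 ψ : 𝓢(E, ℂ)) x * _)]
  refine integral_congr_ae ?_
  filter_upwards [h] with x hx
  rw [hx, e2]

/-- The Sobolev space `H^s` in terms of the Fourier transform on `L²`. -/
theorem memSobolev_two_iff {s : ℝ} (u : L²(E)) :
    TemperedDistribution.MemSobolev s 2 (u : 𝓢'(E, ℂ)) ↔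
      ∃ h : L²(E), ∀ᵐ x, h x =
        ((1 + ‖x‖ ^ 2) ^ (s / 2) : ℝ) * (𝓕 u : L²(E)) x := by
  have hg : Function.HasTemperateGrowth fun x : E => (((1 + ‖x‖ ^ 2) ^ (s / 2) : ℝ) : ℂ) := by fun_prop
  have hgc : Continuous fun x : E => (((1 + ‖x‖ ^ 2) ^ (s / 2) : ℝ) : ℂ) := hg.1.continuous
  rw [TemperedDistribution.memSobolev_iff_exists_smulLeftCLM_fourier,
    Lp.fourier_toTemperedDistribution_eq]
  refine exists_congr fun h => ?_
  constructor
  · intro hh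
    refine ae_eq_of_integral_schwartz (locallyIntegrable_Lp _) (locallyIntegrable_mul_Lp hgc _)
      fun φ _ => ?_
    have := congrArg (fun T : 𝓢'(E, ℂ) => T φ) hh
    simp only [TemperedDistribution.smulLeftCLM_apply_apply, Lp.toTemperedDistribution_apply,
      SchwartzMap.smulLeftCLM_apply_apply hg, smul_eq_mul] at this
    rw [← this]
    refine integral_congr_ae (Eventually.of_forall fun x => ?_)
    simp only
    ring
  · intro hh
    ext φ
    simp only [TemperedDistribution.smulLeftCLM_apply_apply, Lp.toTemperedDistribution_apply,
      SchwartzMap.smulLeftCLM_apply_apply hg, smul_eq_mul]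
    refine integral_congr_ae ?_
    filter_upwards [hh] with x hx
    rw [hx]; ring

theorem integral_laplacian_fourierInv (u : L²(E)) (φ : 𝓢(E, ℂ)) :
    (Δ (u : 𝓢'(E, ℂ))) φ = ∫ x, (𝓕⁻ φ : 𝓢(E, ℂ)) x *
      (-(2 * π) ^ 2 * ‖x‖ ^ 2 * (𝓕 u : L²(E)) x) := by
  have hg : Function.HasTemperateGrowth fun x : E => ((‖x‖ ^ 2 : ℝ) : ℂ) := by fun_prop
  rw [TemperedDistribution.laplacian_eq_fourierMultiplierCLM,
    TemperedDistribution.fourierMultiplierCLM_apply, Lp.fourier_toTemperedDistribution_eq]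
  change (-(2 * π) ^ 2 : ℝ) • ((𝓕⁻ (TemperedDistribution.smulLeftCLM ℂ
    (fun x : E => ((‖x‖ ^ 2 : ℝ) : ℂ)) ((𝓕 u : L²(E)) : 𝓢'(E, ℂ)))) φ) = _
  rw [TemperedDistribution.fourierInv_apply, TemperedDistribution.smulLeftCLM_apply_apply,
    Lp.toTemperedDistribution_apply, ← integral_smul]
  refine integral_congr_ae (Eventually.of_forall fun x => ?_)
  simp only [SchwartzMap.smulLeftCLM_apply_apply hg, smul_eq_mul, Complex.real_smul]
  push_cast
  ring

/-- The distributional Laplacian in terms of the Fourier transform on `L²`. -/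
theorem eq_neg_laplacian_iff (u h : L²(E)) :
    (h : 𝓢'(E, ℂ)) = -Δ (u : 𝓢'(E, ℂ)) ↔
      ∀ᵐ x, (𝓕 h : L²(E)) x =
        (((2 * π) ^ 2 * ‖x‖ ^ 2 : ℝ) : ℂ) * (𝓕 u : L²(E)) x := by
  constructor
  · intro hh
    refine ae_eq_of_integral_schwartz (locallyIntegrable_Lp _)
      (locallyIntegrable_mul_Lp (by fun_prop) _) fun φ _ => ?_
    have := congrArg (fun T : 𝓢'(E, ℂ) => T (𝓕 φ)) hh
    simp only [Lp.toTemperedDistribution_apply, smul_eq_mul] at this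
    rw [integral_schwartz_mul_fourier, this]
    change -((Δ (u : 𝓢'(E, ℂ))) (𝓕 φ)) = _
    rw [integral_laplacian_fourierInv, FourierTransform.fourierInv_fourier_eq, ← integral_neg]
    refine integral_congr_ae (Eventually.of_forall fun x => ?_)
    push_cast
    ring
  · intro hh
    ext φ
    change _ = -((Δ (u : 𝓢'(E, ℂ))) φ)
    rw [integral_laplacian_fourierInv, Lp.toTemperedDistribution_apply, ← integral_neg]
    simp only [smul_eq_mul]
    rw [← integral_fourierInv_mul_fourier]
    refine integral_congr_ae ?_
    filter_upwards [hh] with x hx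
    rw [hx]
    push_cast
    ring

end FourierL2

end

section

/-! ### The Coulomb potential in momentum space -/

/-- The Gaussian kernel whose Fourier transform is `2 / √π * exp (-s² |x|²)`. -/
noncomputable def gaussKer (s : ℝ) (v : R3) : ℝ :=
  2 * π / s ^ 3 * Real.exp (-(π / s) ^ 2 * ‖v‖ ^ 2)

theorem fourier_gaussKer {s : ℝ} (hs : 0 < s) (x : R3) :
    ∫ v : R3, (gaussKer s v : ℂ) * Complex.exp (-(2 * π * Complex.I * inner ℝ v x)) =
      ((2 / √π * Real.exp (-s ^ 2 * ‖x‖ ^ 2) : ℝ) : ℂ) := by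
  have hpi := Real.pi_pos
  have hb : 0 < ((π / s) ^ 2 : ℝ) := by positivity
  have h := fourier_gaussian_innerProductSpace (b := (((π / s) ^ 2 : ℝ) : ℂ))
    (by rw [Complex.ofReal_re]; exact hb) x
  rw [Real.fourier_eq'] at h
  have e1 : ∫ v : R3, (gaussKer s v : ℂ) * Complex.exp (-(2 * π * Complex.I * inner ℝ v x)) =
      ((2 * π / s ^ 3 : ℝ) : ℂ) * ∫ v : R3, Complex.exp (((-2 * π * inner ℝ v x : ℝ) : ℂ) * Complex.I) •
        Complex.exp (-(((π / s) ^ 2 : ℝ) : ℂ) * (‖v‖ : ℂ) ^ 2) := by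
    rw [← integral_const_mul]
    refine integral_congr_ae (Eventually.of_forall fun v => ?_)
    simp only [gaussKer, smul_eq_mul]
    push_cast
    have : (-2 * (π : ℂ) * (inner ℝ v x : ℝ) * Complex.I) = -(2 * π * Complex.I * (inner ℝ v x : ℝ)) := by ring
    rw [this]
    ring
  rw [e1, h]
  have hfr : ((Module.finrank ℝ R3 : ℕ) : ℂ) / 2 = ((3 / 2 : ℝ) : ℂ) := by
    simp
  have e2 : ((π : ℂ) / (((π / s) ^ 2 : ℝ) : ℂ)) = ((s ^ 2 / π : ℝ) : ℂ) := by
    rw [← Complex.ofReal_div]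
    congr 1
    field_simp
  rw [hfr, e2, ← Complex.ofReal_cpow (by positivity)]
  have e3 : (s ^ 2 / π) ^ (3 / 2 : ℝ) = s ^ 3 / (π * √π) := by
    have h1 : (s ^ 2 / π) = (s / √π) ^ 2 := by
      rw [div_pow, Real.sq_sqrt hpi.le]
    have h0 : 0 ≤ s / √π := by positivity
    rw [h1, ← Real.rpow_natCast, ← Real.rpow_mul h0]
    norm_num
    rw [div_pow]
    congr 1
    calc √π ^ 3 = √π ^ 2 * √π := by ring
      _ = _ := by rw [Real.sq_sqrt hpi.le]
  rw [e3]
  have e4 : Complex.exp (-(π : ℂ) ^ 2 * (‖x‖ : ℂ) ^ 2 / (((π / s) ^ 2 : ℝ) : ℂ)) =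
      ((Real.exp (-s ^ 2 * ‖x‖ ^ 2) : ℝ) : ℂ) := by
    rw [Complex.ofReal_exp]
    congr 1
    push_cast
    have : (π : ℂ) ≠ 0 := by exact_mod_cast hpi.ne'
    have : (s : ℂ) ≠ 0 := by exact_mod_cast hs.ne'
    field_simp
  rw [e4, ← Complex.ofReal_mul, ← Complex.ofReal_mul]
  congr 1
  field_simp

/-- The truncated range of Gaussian scales. -/
def scales (n : ℕ) : Set ℝ := Ioc (1 / ((n : ℝ) + 1)) ((n : ℝ) + 1)

theorem scales_le (n : ℕ) : 1 / ((n : ℝ) + 1) ≤ (n : ℝ) + 1 := by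
  have : (1 : ℝ) ≤ n + 1 := by have := n.cast_nonneg (α := ℝ); linarith
  rw [div_le_iff₀ (by linarith)]; nlinarith

theorem pos_of_mem_scales {n : ℕ} {s : ℝ} (hs : s ∈ scales n) : 0 < s :=
  lt_trans (by positivity) hs.1

theorem scales_monotone : Monotone scales := by
  intro m n h
  have : (m : ℝ) ≤ n := by exact_mod_cast h
  exact Ioc_subset_Ioc (by gcongr) (by gcongr)

theorem iUnion_scales : ⋃ n, scales n = Ioi (0 : ℝ) := by
  ext s
  simp only [mem_iUnion, mem_Ioi]
  constructor
  · rintro ⟨n, hn⟩; exact pos_of_mem_scales hn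
  · intro hs
    obtain ⟨n, hn⟩ := exists_nat_gt (max s (1 / s))
    have h1 : s < n := (le_max_left _ _).trans_lt hn
    have h2 : 1 / s < n := (le_max_right _ _).trans_lt hn
    refine ⟨n, ?_, by linarith⟩
    rw [div_lt_iff₀ (by positivity)]
    rw [div_lt_iff₀ hs] at h2
    nlinarith

/-- The truncated Coulomb potential. -/
noncomputable def truncCoul (n : ℕ) (x : R3) : ℝ :=
  ∫ s in scales n, 2 / √π * Real.exp (-s ^ 2 * ‖x‖ ^ 2)

/-- The Fourier transform of the truncated Coulomb potential. -/
noncomputable def truncKer (n : ℕ) (v : R3) : ℝ := ∫ s in scales n, gaussKer s v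

theorem integrableOn_gaussian {r : ℝ} (hr : 0 < r) :
    IntegrableOn (fun s : ℝ => 2 / √π * Real.exp (-s ^ 2 * r ^ 2)) (Ioi 0) := by
  have : Integrable fun s : ℝ => Real.exp (-(r ^ 2) * s ^ 2) :=
    integrable_exp_neg_mul_sq (by positivity)
  refine ((this.const_mul (2 / √π)).integrableOn).congr_fun (fun s _ => ?_) measurableSet_Ioi
  simp only
  congr 2; ring

theorem truncCoul_nonneg (n : ℕ) (x : R3) : 0 ≤ truncCoul n x :=
  integral_nonneg fun s => by positivity

theorem integral_gaussian_scales {r : ℝ} (hr : 0 < r) :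
    ∫ s in Ioi (0 : ℝ), 2 / √π * Real.exp (-s ^ 2 * r ^ 2) = 1 / r := by
  have h := integral_gaussian_Ioi (r ^ 2)
  have e : ∀ s : ℝ, Real.exp (-s ^ 2 * r ^ 2) = Real.exp (-(r ^ 2) * s ^ 2) := fun s => by
    congr 1; ring
  simp only [e]
  rw [integral_const_mul, h, Real.sqrt_div Real.pi_pos.le, Real.sqrt_sq hr.le]
  have := Real.sqrt_pos.2 Real.pi_pos
  field_simp

theorem truncCoul_le (n : ℕ) {x : R3} (hx : x ≠ 0) : truncCoul n x ≤ 1 / ‖x‖ := by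
  have hr : 0 < ‖x‖ := norm_pos_iff.2 hx
  rw [← integral_gaussian_scales hr, truncCoul]
  refine setIntegral_mono_set (integrableOn_gaussian hr) (Eventually.of_forall fun s => by positivity)
    (LE.le.eventuallyLE (show scales n ≤ Ioi 0 from fun s hs => pos_of_mem_scales hs))

theorem tendsto_truncCoul {x : R3} (hx : x ≠ 0) :
    Tendsto (fun n => truncCoul n x) atTop (𝓝 (1 / ‖x‖)) := by
  have hr : 0 < ‖x‖ := norm_pos_iff.2 hx
  have := tendsto_setIntegral_of_monotone (s := scales) (fun n => measurableSet_Ioc) scales_monotone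
    (by rw [iUnion_scales]; exact integrableOn_gaussian hr)
  rwa [iUnion_scales, integral_gaussian_scales hr] at this

theorem truncKer_eq (n : ℕ) {v : R3} (hv : v ≠ 0) :
    truncKer n v = Real.exp (-(π / ((n : ℝ) + 1)) ^ 2 * ‖v‖ ^ 2) / (π * ‖v‖ ^ 2) -
      Real.exp (-(π * ((n : ℝ) + 1)) ^ 2 * ‖v‖ ^ 2) / (π * ‖v‖ ^ 2) := by
  have hr : 0 < ‖v‖ := norm_pos_iff.2 hv
  have hpi := Real.pi_pos
  have hn : (0 : ℝ) < 1 / ((n : ℝ) + 1) := by positivity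
  have hder : ∀ s ∈ uIcc (1 / ((n : ℝ) + 1)) ((n : ℝ) + 1), HasDerivAt
      (fun s => Real.exp (-(π / s) ^ 2 * ‖v‖ ^ 2) / (π * ‖v‖ ^ 2)) (gaussKer s v) s := by
    intro s hs
    rw [uIcc_of_le (scales_le n)] at hs
    have hs0 : 0 < s := hn.trans_le hs.1
    have h1 : HasDerivAt (fun s : ℝ => π / s) (-π / s ^ 2) s := by
      have := (hasDerivAt_inv hs0.ne').const_mul π
      refine this.congr_deriv ?_
      field_simp
    have h2 : HasDerivAt (fun s : ℝ => -(π / s) ^ 2 * ‖v‖ ^ 2) _ s :=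
      ((h1.pow 2).neg).mul_const (‖v‖ ^ 2)
    have h3 := h2.exp.div_const (π * ‖v‖ ^ 2)
    refine h3.congr_deriv ?_
    rw [gaussKer]
    have hv0 := hr.ne'
    field_simp
    norm_num
    field_simp
  have hc : ContinuousOn (fun s => gaussKer s v) (uIcc (1 / ((n : ℝ) + 1)) ((n : ℝ) + 1)) := by
    intro s hs
    rw [uIcc_of_le (scales_le n)] at hs
    have hs0 : s ≠ 0 := (hn.trans_le hs.1).ne'
    unfold gaussKer
    refine ContinuousAt.continuousWithinAt ?_
    have : ContinuousAt (fun s : ℝ => s ^ 3) s := by fun_prop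
    have h2 : ContinuousAt (fun s : ℝ => π / s) s := continuousAt_const.div continuousAt_id hs0
    exact (continuousAt_const.div this (pow_ne_zero 3 hs0)).mul
      (Real.continuous_exp.continuousAt.comp (((h2.pow 2).neg).mul continuousAt_const))
  have := intervalIntegral.integral_eq_sub_of_hasDerivAt hder hc.intervalIntegrable
  rw [intervalIntegral.integral_of_le (scales_le n)] at this
  rw [truncKer, scales, this]
  congr 4
  field_simp

theorem truncKer_nonneg (n : ℕ) (v : R3) : 0 ≤ truncKer n v := by
  refine setIntegral_nonneg measurableSet_Ioc fun s hs => ?_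
  have := pos_of_mem_scales hs
  unfold gaussKer; positivity

theorem truncKer_le (n : ℕ) {v : R3} (hv : v ≠ 0) : truncKer n v ≤ 1 / (π * ‖v‖ ^ 2) := by
  have hr : 0 < ‖v‖ := norm_pos_iff.2 hv
  rw [truncKer_eq n hv]
  have h1 : Real.exp (-(π / ((n : ℝ) + 1)) ^ 2 * ‖v‖ ^ 2) ≤ 1 :=
    Real.exp_le_one_iff.2 (by rw [neg_mul]; exact neg_nonpos.2 (by positivity))
  have h2 : 0 ≤ Real.exp (-(π * ((n : ℝ) + 1)) ^ 2 * ‖v‖ ^ 2) / (π * ‖v‖ ^ 2) := by positivity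
  have h3 : Real.exp (-(π / ((n : ℝ) + 1)) ^ 2 * ‖v‖ ^ 2) / (π * ‖v‖ ^ 2) ≤
      1 / (π * ‖v‖ ^ 2) := by gcongr
  linarith

theorem tendsto_truncKer {v : R3} (hv : v ≠ 0) :
    Tendsto (fun n => truncKer n v) atTop (𝓝 (1 / (π * ‖v‖ ^ 2))) := by
  have hr : 0 < ‖v‖ := norm_pos_iff.2 hv
  have hpi := Real.pi_pos
  simp only [truncKer_eq _ hv]
  have hN : Tendsto (fun n : ℕ => (n : ℝ) + 1) atTop atTop :=
    tendsto_atTop_add_const_right _ _ tendsto_natCast_atTop_atTop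
  have t1 : Tendsto (fun n : ℕ => Real.exp (-(π / ((n : ℝ) + 1)) ^ 2 * ‖v‖ ^ 2)) atTop (𝓝 1) := by
    have h0 : Tendsto (fun n : ℕ => π / ((n : ℝ) + 1)) atTop (𝓝 0) :=
      hN.const_div_atTop _
    have := ((h0.pow 2).neg).mul_const (‖v‖ ^ 2)
    have := (Real.continuous_exp.tendsto _).comp this
    simpa [Function.comp_def] using this
  have t2 : Tendsto (fun n : ℕ => Real.exp (-(π * ((n : ℝ) + 1)) ^ 2 * ‖v‖ ^ 2)) atTop (𝓝 0) := by
    refine Real.tendsto_exp_atBot.comp ?_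
    have h1 : Tendsto (fun n : ℕ => π * ((n : ℝ) + 1)) atTop atTop := hN.const_mul_atTop hpi
    have h2 := (tendsto_pow_atTop (two_ne_zero)).comp h1
    have h3 := (tendsto_neg_atTop_atBot.comp h2).atBot_mul_const (by positivity : 0 < ‖v‖ ^ 2)
    exact h3
  have := (t1.div_const (π * ‖v‖ ^ 2)).sub (t2.div_const (π * ‖v‖ ^ 2))
  simpa using this

theorem measurable_gaussKer : Measurable fun z : R3 × ℝ => gaussKer z.2 z.1 := by
  unfold gaussKer; fun_prop

theorem integrable_gaussKer_scales (n : ℕ) :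
    Integrable (fun z : R3 × ℝ => gaussKer z.2 z.1) (volume.prod (volume.restrict (scales n))) := by
  have hpi := Real.pi_pos
  have hb : (0 : ℝ) < (π / ((n : ℝ) + 1)) ^ 2 := by positivity
  have h1 : Integrable fun v : R3 => Real.exp (-(π / ((n : ℝ) + 1)) ^ 2 * ‖v‖ ^ 2) := by
    have := GaussianFourier.integrable_cexp_neg_mul_sq_norm_add (V := R3)
      (b := (((π / ((n : ℝ) + 1)) ^ 2 : ℝ) : ℂ)) (by rw [Complex.ofReal_re]; exact hb) 0 0
    refine this.re.congr (Eventually.of_forall fun v => ?_)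
    simp only [zero_mul, add_zero, RCLike.re_eq_complex_re]
    rw [← Complex.ofReal_pow, ← Complex.ofReal_neg, ← Complex.ofReal_mul, ← Complex.ofReal_exp,
      Complex.ofReal_re]
  have : IsFiniteMeasure (volume.restrict (scales n)) := ⟨by
    rw [Measure.restrict_apply_univ]; exact measure_Ioc_lt_top⟩
  have h2 : Integrable (fun z : R3 × ℝ => 2 * π * ((n : ℝ) + 1) ^ 3 *
      Real.exp (-(π / ((n : ℝ) + 1)) ^ 2 * ‖z.1‖ ^ 2)) (volume.prod (volume.restrict (scales n))) :=
    ((h1.comp_fst (volume.restrict (scales n)))).const_mul _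
  refine h2.mono' measurable_gaussKer.aestronglyMeasurable ?_
  have hs : ∀ᵐ z ∂((volume : Measure R3).prod (volume.restrict (scales n))), z.2 ∈ scales n :=
    Measure.quasiMeasurePreserving_snd.ae (ae_restrict_mem measurableSet_Ioc)
  filter_upwards [hs] with z hz
  have hz0 := pos_of_mem_scales hz
  have hz1 : 1 / z.2 ≤ (n : ℝ) + 1 := by
    have := hz.1
    rw [div_lt_iff₀ (by positivity)] at this
    rw [div_le_iff₀ hz0]; nlinarith
  rw [gaussKer, Real.norm_of_nonneg (by positivity)]
  have e1 : 2 * π / z.2 ^ 3 ≤ 2 * π * ((n : ℝ) + 1) ^ 3 := by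
    rw [div_eq_mul_one_div, ← one_div_pow]
    gcongr
  have e2 : Real.exp (-(π / z.2) ^ 2 * ‖z.1‖ ^ 2) ≤
      Real.exp (-(π / ((n : ℝ) + 1)) ^ 2 * ‖z.1‖ ^ 2) := by
    rw [Real.exp_le_exp, neg_mul, neg_mul, neg_le_neg_iff]
    have := hz.2
    gcongr
  gcongr

theorem integrable_truncKer (n : ℕ) : Integrable (truncKer n) :=
  (integrable_gaussKer_scales n).integral_prod_left

theorem fourier_truncKer (n : ℕ) (x : R3) :
    ∫ v : R3, (truncKer n v : ℂ) * Complex.exp (-(2 * π * Complex.I * inner ℝ v x)) =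
      truncCoul n x := by
  have hint : Integrable (Function.uncurry fun (v : R3) (s : ℝ) => (gaussKer s v : ℂ) *
      Complex.exp (-(2 * π * Complex.I * inner ℝ v x))) (volume.prod (volume.restrict (scales n))) := by
    refine (integrable_gaussKer_scales n).ofReal.mul_bdd (c := 1) ?_ ?_
    · exact Continuous.aestronglyMeasurable (by fun_prop)
    · refine Eventually.of_forall fun z => le_of_eq ?_
      rw [Complex.norm_exp]; simp
  have e : ∀ v : R3, (truncKer n v : ℂ) * Complex.exp (-(2 * π * Complex.I * inner ℝ v x)) =
      ∫ s in scales n, (gaussKer s v : ℂ) * Complex.exp (-(2 * π * Complex.I * inner ℝ v x)) := by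
    intro v
    rw [integral_mul_const, truncKer, integral_complex_ofReal]
  simp only [e]
  rw [integral_integral_swap hint, truncCoul, ← integral_complex_ofReal]
  refine setIntegral_congr_fun measurableSet_Ioc fun s hs => ?_
  exact fourier_gaussKer (pos_of_mem_scales hs) x

theorem abs_truncCoul_le (n : ℕ) : ∃ C, ∀ x, |truncCoul n x| ≤ C := by
  refine ⟨∫ v, truncKer n v, fun x => ?_⟩
  have h := fourier_truncKer n x
  rw [← Real.norm_eq_abs, ← Complex.norm_real, ← h]
  refine norm_integral_le_of_norm_le (integrable_truncKer n) (Eventually.of_forall fun v => le_of_eq ?_)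
  rw [norm_mul, Complex.norm_real, Real.norm_of_nonneg (truncKer_nonneg n v), Complex.norm_exp]
  simp

theorem measurable_truncCoul (n : ℕ) : Measurable (truncCoul n) := by
  have : StronglyMeasurable fun z : R3 × ℝ => 2 / √π * Real.exp (-z.2 ^ 2 * ‖z.1‖ ^ 2) :=
    Measurable.stronglyMeasurable (by fun_prop)
  exact (this.integral_prod_right' (ν := volume.restrict (scales n))).measurable

end

section

namespace PairFrame

variable {E : Type} [NormedAddCommGroup E] [InnerProductSpace ℝ E] {P : PairFrame E}
  [FiniteDimensional ℝ E] [MeasurableSpace E] [BorelSpace E]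

theorem integrable_conj_mul (g u : L²(E)) :
    Integrable fun x => starRingEnd ℂ (g x) * u x := by
  refine (L2.integrable_inner (𝕜 := ℂ) g u).congr (Eventually.of_forall fun x => ?_)
  simp [mul_comm]

theorem inner_Lp_eq (g u : L²(E)) :
    inner ℂ g u = ∫ x, starRingEnd ℂ (g x) * u x := by
  rw [L2.inner_def]
  refine integral_congr_ae (Eventually.of_forall fun x => ?_)
  simp [mul_comm]

/-- Multiplication by a function of the relative position is a convolution along the fibres in
momentum space. -/
theorem integral_truncCoul_mul {w : E →L[ℝ] R3} (hw : ∀ v X, inner ℝ (P.ι v) X = inner ℝ v (w X))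
    (g u : L²(E)) (n : ℕ) :
    ∫ X, starRingEnd ℂ (g X) * ((truncCoul n (w X) : ℂ) * u X) =
      ∫ v, (truncKer n v : ℂ) * ∫ x, starRingEnd ℂ ((𝓕 g : L²(E)) x) *
        (𝓕 u : L²(E)) (x + P.ι v) := by
  let m : R3 → E → ℂ := fun v X => Complex.exp (-(2 * π * Complex.I * inner ℝ v (w X)))
  have hm1 : ∀ v X, ‖m v X‖ = 1 := fun v X => by simp only [m]; rw [Complex.norm_exp]; simp
  have hmc : Continuous fun z : E × R3 => m z.2 z.1 := by simp only [m]; fun_prop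
  have hint : Integrable (Function.uncurry fun (X : E) (v : R3) =>
      (starRingEnd ℂ (g X) * u X) * (truncKer n v : ℂ) * m v X) ((volume : Measure E).prod volume) := by
    refine ((integrable_conj_mul g u).mul_prod (integrable_truncKer n).ofReal).mul_bdd (c := 1)
      hmc.aestronglyMeasurable (Eventually.of_forall fun z => (hm1 z.2 z.1).le)
  have e1 : ∀ X, starRingEnd ℂ (g X) * ((truncCoul n (w X) : ℂ) * u X) =
      ∫ v, (starRingEnd ℂ (g X) * u X) * (truncKer n v : ℂ) * m v X := by
    intro X
    simp only [mul_assoc]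
    rw [integral_const_mul, integral_const_mul, fourier_truncKer]
    ring
  simp only [e1]
  rw [integral_integral_swap hint]
  refine integral_congr_ae (Eventually.of_forall fun v => ?_)
  simp only
  have e2 : ∀ X, (starRingEnd ℂ (g X) * u X) * (truncKer n v : ℂ) * m v X =
      (truncKer n v : ℂ) * (starRingEnd ℂ (g X) * (m v X * u X)) := fun X => by ring
  simp only [e2]
  rw [integral_const_mul]
  congr 1
  obtain ⟨M, hM, -⟩ := exists_mulOp (E := E) (m := m v) (C := 1)
    (by simp only [m]; fun_prop) (Eventually.of_forall fun X => (hm1 v X).le)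
  have e3 : ∀ᵐ x, (𝓕 (M u) : L²(E)) x =
      (𝓕 u : L²(E)) (x + P.ι v) := by
    have := fourier_modulation (-P.ι v) (u := u) (v := M u) (by
      filter_upwards [hM u] with X hX
      rw [hX]
      simp only [m]
      congr 2
      rw [inner_neg_left, hw]
      push_cast; ring)
    simpa using this
  have e4 : inner ℂ g (M u) = ∫ X, starRingEnd ℂ (g X) * (m v X * u X) := by
    rw [inner_Lp_eq]
    refine integral_congr_ae ?_
    filter_upwards [hM u] with X hX
    rw [hX]
  rw [← e4, ← Lp.inner_fourier_eq, inner_Lp_eq]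
  refine integral_congr_ae ?_
  filter_upwards [e3] with x hx
  rw [hx]

/-- Multiplication by the Coulomb potential `1 / |w X|` of a function whose Fourier transform is
`ζ / sym`, in momentum space. This contains Hardy's inequality. -/
theorem exists_coulomb {w : E →L[ℝ] R3} (hw : ∀ v X, inner ℝ (P.ι v) X = inner ℝ v (w X))
    {L : L²(E) →L[ℂ] L²(E)}
    (hL : P.base.IsKernelOp (P.base.relKer coulKer) L) {u ζ : L²(E)}
    (hu : ∀ᵐ x, ζ x = P.sym x * (𝓕 u : L²(E)) x) :
    ∃ η : L²(E), (∀ᵐ X, η X = ((1 / ‖w X‖ : ℝ) : ℂ) * u X) ∧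
      (𝓕 η : L²(E)) = ((1 / π : ℝ) : ℂ) • L ζ := by
  have hpi := Real.pi_pos
  have hk := P.base.isPairKernel_coulKer
  set f : L²(E) := 𝓕 u with hf
  -- the integrand in momentum space, and its bound
  let Φ : L²(E) → E × R3 → ℂ := fun g z =>
    starRingEnd ℂ (g z.1) * ((P.base.relKer coulKer z.1 z.2 : ℂ) * ζ (P.base.mv z.1 z.2))
  have hΦ : ∀ g, Integrable (Φ g) ((volume : Measure E).prod volume) := fun g => hk.integrable g ζ
  have hΦf : ∀ g, ∀ᵐ z ∂((volume : Measure E).prod (volume : Measure R3)),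
      Φ g z = ((1 / ‖z.2‖ ^ 2 : ℝ) : ℂ) * (starRingEnd ℂ (g z.1) * f (z.1 + P.ι z.2)) := by
    intro g
    filter_upwards [P.base.ae_prod_mv hu] with z hz
    have h0 : (P.sym (P.base.mv z.1 z.2) : ℂ) ≠ 0 := by exact_mod_cast (P.sym_pos _).ne'
    simp only [Φ, relKer, coulKer]
    rw [hz.2, base_sym, base_mv]
    rw [base_mv] at h0
    push_cast
    field_simp
  let Φn : L²(E) → ℕ → E × R3 → ℂ := fun g n z =>
    (truncKer n z.2 : ℂ) * (starRingEnd ℂ (g z.1) * f (z.1 + P.ι z.2))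
  have hv : ∀ᵐ z ∂((volume : Measure E).prod (volume : Measure R3)), z.2 ≠ 0 :=
    Measure.quasiMeasurePreserving_snd.ae (Measure.ae_ne volume 0)
  have hΦnm : ∀ g n, AEStronglyMeasurable (Φn g n) ((volume : Measure E).prod volume) := by
    intro g n
    have h1 : AEStronglyMeasurable (fun z : E × R3 => (truncKer n z.2 : ℂ))
        ((volume : Measure E).prod volume) :=
      ((integrable_truncKer n).ofReal.aestronglyMeasurable).comp_snd
    have h2 : Measurable fun z : E × R3 => f (z.1 + P.ι z.2) :=
      (Lp.stronglyMeasurable f).measurable.comp P.base.measurable_mv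
    have h3 : Measurable fun z : E × R3 => starRingEnd ℂ (g z.1) :=
      (RCLike.continuous_conj (K := ℂ)).measurable.comp
        ((Lp.stronglyMeasurable g).measurable.comp measurable_fst)
    exact h1.mul (h3.mul h2).aestronglyMeasurable
  have hΦnle : ∀ g n, ∀ᵐ z ∂((volume : Measure E).prod (volume : Measure R3)),
      ‖Φn g n z‖ ≤ 1 / π * ‖Φ g z‖ := by
    intro g n
    filter_upwards [hΦf g, hv] with z hz hz2
    simp only [Φn]
    rw [hz, norm_mul (truncKer n z.2 : ℂ), norm_mul ((1 / ‖z.2‖ ^ 2 : ℝ) : ℂ), ← mul_assoc]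
    refine mul_le_mul_of_nonneg_right ?_ (norm_nonneg _)
    rw [Complex.norm_real, Complex.norm_real, Real.norm_of_nonneg (truncKer_nonneg _ _),
      Real.norm_of_nonneg (by positivity)]
    refine (truncKer_le n hz2).trans (le_of_eq ?_)
    have : 0 < ‖z.2‖ := norm_pos_iff.2 hz2
    field_simp
  have hΦni : ∀ g n, Integrable (Φn g n) ((volume : Measure E).prod volume) := fun g n =>
    Integrable.mono' ((hΦ g).norm.const_mul _) (hΦnm g n) (hΦnle g n)
  have hΦlim : ∀ g, Tendsto (fun n => ∫ z, Φn g n z ∂((volume : Measure E).prod volume)) atTop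
      (𝓝 (∫ z, ((1 / π : ℝ) : ℂ) * Φ g z ∂((volume : Measure E).prod volume))) := by
    intro g
    refine tendsto_integral_of_dominated_convergence _ (hΦnm g) ((hΦ g).norm.const_mul (1 / π))
      (hΦnle g) ?_
    filter_upwards [hΦf g, hv] with z hz hz2
    rw [hz, ← mul_assoc]
    refine Tendsto.mul_const _ ?_
    rw [← Complex.ofReal_mul]
    refine (Complex.continuous_ofReal.tendsto _).comp ?_
    have := tendsto_truncKer hz2
    convert this using 2
    have : 0 < ‖z.2‖ := norm_pos_iff.2 hz2
    field_simp
  -- the truncated potentials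
  have hMn : ∀ n, ∃ M : L²(E) →L[ℂ] L²(E),
      ∀ f, ∀ᵐ X, M f X = (truncCoul n (w X) : ℂ) * f X := by
    intro n
    obtain ⟨C, hC⟩ := abs_truncCoul_le n
    obtain ⟨M, hM, -⟩ := exists_mulOp (E := E) (m := fun X => (truncCoul n (w X) : ℂ)) (C := C)
      (Complex.measurable_ofReal.comp ((measurable_truncCoul n).comp w.measurable))
      (Eventually.of_forall fun X => by
        rw [Complex.norm_real]; exact hC _)
    exact ⟨M, hM⟩
  choose M hM using hMn
  have hkey : ∀ g n, inner ℂ g (M n u) =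
      ∫ z, Φn (𝓕 g : L²(E)) n z ∂((volume : Measure E).prod volume) := by
    intro g n
    rw [integral_prod_symm _ (hΦni _ n)]
    simp only [Φn, integral_const_mul]
    rw [← integral_truncCoul_mul hw g u n, inner_Lp_eq]
    refine integral_congr_ae ?_
    filter_upwards [hM n u] with X hX
    rw [hX]
  -- The truncated products converge weakly, so they are bounded. Hence their pointwise limit is in
  -- `L²`, by Fatou's lemma: this is the content of Hardy's inequality.
  obtain ⟨C, hbd⟩ : ∃ C, ∀ n, ‖innerSL ℂ (M n u)‖ ≤ C := by
    refine banach_steinhaus fun g => ?_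
    have hb : Bornology.IsBounded (Set.range fun n => inner ℂ g (M n u)) := by
      simp only [hkey]
      exact Metric.isBounded_range_of_tendsto _ (hΦlim _)
    obtain ⟨C, hC⟩ := hb.exists_norm_le
    refine ⟨C, fun n => ?_⟩
    rw [innerSL_apply_apply, norm_inner_symm]
    exact hC _ ⟨n, rfl⟩
  have hw0 : ∀ᵐ X : E, w X ≠ 0 := by
    have hker : LinearMap.ker (w : E →ₗ[ℝ] R3) ≠ ⊤ := by
      intro h
      obtain ⟨v, hv⟩ := exists_ne (0 : R3)
      have h1 : w (P.ι v) = 0 := by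
        have : P.ι v ∈ LinearMap.ker (w : E →ₗ[ℝ] R3) := h ▸ Submodule.mem_top
        simpa using this
      have h2 := hw v (P.ι v)
      rw [h1, inner_zero_right, inner_self_eq_zero] at h2
      have h3 := P.a_ι v
      rw [h2, map_zero] at h3
      exact hv h3.symm
    have := Measure.addHaar_submodule (volume : Measure E) _ hker
    rw [ae_iff]
    convert this using 2
    ext X; simp
  have hηm : MemLp (fun X => ((1 / ‖w X‖ : ℝ) : ℂ) * u X) 2 volume := by
    have hmeas : AEStronglyMeasurable (fun X => ((1 / ‖w X‖ : ℝ) : ℂ) * u X) volume := by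
      refine AEStronglyMeasurable.mul ?_ (Lp.aestronglyMeasurable u)
      exact (Complex.measurable_ofReal.comp (by fun_prop)).aestronglyMeasurable
    refine ⟨hmeas, ?_⟩
    have hlim : ∀ᵐ X, Tendsto (fun n => (M n u) X) atTop (𝓝 (((1 / ‖w X‖ : ℝ) : ℂ) * u X)) := by
      filter_upwards [ae_all_iff.2 fun n => hM n u, hw0] with X hX h0
      simp only [hX]
      exact ((Complex.continuous_ofReal.tendsto _).comp (tendsto_truncCoul h0)).mul_const _
    refine lt_of_le_of_lt (Lp.eLpNorm_lim_le_liminf_eLpNorm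
      (fun n => (Lp.aestronglyMeasurable (M n u))) _ hlim) ?_
    refine lt_of_le_of_lt (liminf_le_of_frequently_le' (x := ENNReal.ofReal C)
      (Frequently.of_forall fun n => ?_)) ENNReal.ofReal_lt_top
    rw [← ENNReal.ofReal_toReal (Lp.eLpNorm_ne_top (M n u)), ← Lp.norm_def]
    exact ENNReal.ofReal_le_ofReal (by simpa using hbd n)
  refine ⟨hηm.toLp _, hηm.coeFn_toLp, ?_⟩
  refine ext_inner_left ℂ fun G => ?_
  obtain ⟨g, rfl⟩ : ∃ g : L²(E), 𝓕 g = G :=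
    ⟨𝓕⁻ G, FourierTransform.fourier_fourierInv_eq G⟩
  rw [Lp.inner_fourier_eq, inner_smul_right, hL.inner_eq_of_isPairKernel hk, ← integral_const_mul]
  -- Both sides are limits of the same sequence of truncated forms.
  refine tendsto_nhds_unique ?_ (hΦlim _)
  simp only [← hkey, inner_Lp_eq]
  have hgη : Integrable fun X => starRingEnd ℂ (g X) * (((1 / ‖w X‖ : ℝ) : ℂ) * u X) := by
    refine (integrable_conj_mul g (hηm.toLp _)).congr ?_
    filter_upwards [hηm.coeFn_toLp] with X hX
    rw [hX]
  refine tendsto_integral_of_dominated_convergence _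
    (fun n => (integrable_conj_mul g (M n u)).aestronglyMeasurable) hgη.norm (fun n => ?_) ?_
  · filter_upwards [hM n u, hw0] with X hX h0
    rw [hX, norm_mul, norm_mul, norm_mul, norm_mul, Complex.norm_real, Complex.norm_real,
      Real.norm_of_nonneg (truncCoul_nonneg _ _), Real.norm_of_nonneg (by positivity)]
    gcongr
    exact truncCoul_le n h0
  · filter_upwards [ae_all_iff.2 fun n => hM n u, hw0, hηm.coeFn_toLp] with X hX h0 h1
    rw [h1]
    simp only [hX]
    exact (((Complex.continuous_ofReal.tendsto _).comp (tendsto_truncCoul h0)).mul_const _).const_mul _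

end PairFrame

end

section

/-! ### The pair frames of the charge space -/

/-- A linear map into configurations, given by its components. -/
noncomputable def configCLM {ι : Type} [Fintype ι] {F : Type*} [NormedAddCommGroup F] [NormedSpace ℝ F]
    (f : ι → F →L[ℝ] R3) : F →L[ℝ] Config ι :=
  ((PiLp.continuousLinearEquiv 2 ℝ (fun _ : ι => R3)).symm : (ι → R3) →L[ℝ] Config ι).comp
    (ContinuousLinearMap.pi f)

@[simp] theorem configCLM_apply {ι : Type} [Fintype ι] {F : Type*} [NormedAddCommGroup F]
    [NormedSpace ℝ F] (f : ι → F →L[ℝ] R3) (x : F) (m : ι) : configCLM f x m = f m x := rfl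

/-- The position of particle `m`. -/
noncomputable abbrev coord {ι : Type} [Fintype ι] (m : ι) : Config ι →L[ℝ] R3 :=
  PiLp.proj 2 (fun _ : ι => R3) m

/-- The relative position of the particles `m` and `m'`. -/
noncomputable abbrev relCoord {ι : Type} [Fintype ι] (m m' : ι) : Config ι →L[ℝ] R3 :=
  coord m - coord m'

theorem relCoord_apply {ι : Type} [Fintype ι] (m m' : ι) (X : Config ι) :
    relCoord m m' X = X m - X m' := rfl

theorem config_ext {ι : Type} [Fintype ι] {X Y : Config ι} (h : ∀ m, X m = Y m) : X = Y :=
  PiLp.ext h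

theorem norm_sq_config {ι : Type} [Fintype ι] (X : Config ι) : ‖X‖ ^ 2 = ∑ m, ‖X m‖ ^ 2 :=
  PiLp.norm_sq_eq_of_L2 _ X

theorem inner_config {ι : Type} [Fintype ι] (X Y : Config ι) :
    inner ℝ X Y = ∑ m, inner ℝ (X m) (Y m) := PiLp.inner_apply X Y

variable {n : ℕ}

/-- The kinetic energy of a charge. -/
noncomputable def chargeEnergy (t : ℝ) (X : Config (Option (Fin n))) : ℝ :=
  1 / 4 * ‖X none‖ ^ 2 + 1 / 2 * ∑ k, ‖X (some k)‖ ^ 2 + t / 2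

/-- Shift of the relative momentum of the pair `none` and particle `a`. -/
noncomputable def shiftA (a : Fin n) : R3 →L[ℝ] Config (Option (Fin n)) :=
  configCLM fun m => m.elim (-ContinuousLinearMap.id ℝ R3)
    fun b => if b = a then ContinuousLinearMap.id ℝ R3 else 0

@[simp] theorem shiftA_none (a : Fin n) (v : R3) : shiftA a v none = -v := rfl

@[simp] theorem shiftA_some (a b : Fin n) (v : R3) :
    shiftA a v (some b) = if b = a then v else 0 := by
  simp only [shiftA, configCLM_apply, Option.elim]
  split_ifs <;> rfl

/-- Shift of the relative momentum of the particles `a` and `b`. -/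
noncomputable def shiftB (a b : Fin n) : R3 →L[ℝ] Config (Option (Fin n)) :=
  configCLM fun m => m.elim 0
    fun d => if d = a then ContinuousLinearMap.id ℝ R3 else
      if d = b then -ContinuousLinearMap.id ℝ R3 else 0

@[simp] theorem shiftB_none (a b : Fin n) (v : R3) : shiftB a b v none = 0 := rfl

@[simp] theorem shiftB_some (a b d : Fin n) (v : R3) :
    shiftB a b v (some d) = if d = a then v else if d = b then -v else 0 := by
  simp only [shiftB, configCLM_apply, Option.elim]
  split_ifs <;> rfl

/-- Exchange of the pair `none` with the pair of the particles `a` and `b`; the relative momentum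
of `a` and `b` is kept. -/
noncomputable def exchangeB (a b : Fin n) : Config (Option (Fin n)) →L[ℝ] Config (Option (Fin n)) :=
  configCLM fun m => m.elim (coord (some a) + coord (some b))
    fun d => if d = a then (1 / 2 : ℝ) • (coord none + coord (some a) - coord (some b)) else
      if d = b then (1 / 2 : ℝ) • (coord none - coord (some a) + coord (some b)) else coord (some d)

@[simp] theorem exchangeB_none (a b : Fin n) (X : Config (Option (Fin n))) :
    exchangeB a b X none = X (some a) + X (some b) := rfl

@[simp] theorem exchangeB_some (a b d : Fin n) (X : Config (Option (Fin n))) :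
    exchangeB a b X (some d) = if d = a then (1 / 2 : ℝ) • (X none + X (some a) - X (some b)) else
      if d = b then (1 / 2 : ℝ) • (X none - X (some a) + X (some b)) else X (some d) := by
  simp only [exchangeB, configCLM_apply, Option.elim]
  split_ifs <;> rfl

/-- The frame for the pair that carries the charge, and one further particle. -/
noncomputable def frameA {t : ℝ} (ht : 0 < t) (a : Fin n) : PairFrame (Config (Option (Fin n))) where
  ι := shiftA a
  U := ContinuousLinearMap.id ℝ _
  a := (1 / 3 : ℝ) • ((2 : ℝ) • coord (some a) - coord none)
  m2 X := 2 / 9 * ‖X none + X (some a)‖ ^ 2 + 2 / 3 * ∑ b ∈ Finset.univ.erase a, ‖X (some b)‖ ^ 2 +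
    2 / 3 * t
  m0 := 2 / 3 * t
  c := -(1 / 2)
  U_U _ := rfl
  U_ι _ := rfl
  a_ι v := by
    simp only [_root_.smul_apply, _root_.sub_apply, PiLp.proj_apply,
      shiftA_none, shiftA_some, if_true]
    module
  a_U _ := rfl
  m2_add X v := by
    have : ∑ b ∈ Finset.univ.erase a, ‖(X + shiftA a v) (some b)‖ ^ 2 =
        ∑ b ∈ Finset.univ.erase a, ‖X (some b)‖ ^ 2 := by
      refine Finset.sum_congr rfl fun b hb => ?_
      simp [(Finset.mem_erase.1 hb).1]
    rw [this]
    simp [show X none + -v + (X (some a) + v) = X none + X (some a) by abel]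
  m2_U _ := rfl
  m2_cont := by fun_prop
  m0_pos := by positivity
  m0_le X := by
    have : 0 ≤ ∑ b ∈ Finset.univ.erase a, ‖X (some b)‖ ^ 2 := by positivity
    nlinarith [sq_nonneg ‖X none + X (some a)‖]
  abs_c_le := by norm_num [abs_of_pos]

/-- The frame for two particles that do not belong to the pair that carries the charge. -/
noncomputable def frameB {t : ℝ} (ht : 0 < t) {a b : Fin n} (hab : a ≠ b) :
    PairFrame (Config (Option (Fin n))) where
  ι := shiftB a b
  U := exchangeB a b
  a := (1 / 2 : ℝ) • (coord (some a) - coord (some b))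
  m2 X := 1 / 4 * ‖X none‖ ^ 2 + 1 / 4 * ‖X (some a) + X (some b)‖ ^ 2 +
    1 / 2 * ∑ d ∈ (Finset.univ.erase a).erase b, ‖X (some d)‖ ^ 2 + t / 2
  m0 := t / 2
  c := 0
  U_U X := by
    refine config_ext fun m => ?_
    rcases m with _ | d
    · simp only [exchangeB_none, exchangeB_some, if_true, if_neg hab.symm]
      module
    · simp only [exchangeB_none, exchangeB_some, if_true, if_neg hab.symm]
      split_ifs with h1 h2
      · subst h1; module
      · subst h2; module
      · rfl
  U_ι v := by
    refine config_ext fun m => ?_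
    rcases m with _ | d
    · simp [hab.symm]
    · simp only [exchangeB_some, shiftB_some, shiftB_none, if_true, if_neg hab.symm]
      split_ifs <;> module
  a_ι v := by
    simp only [_root_.smul_apply, _root_.sub_apply, PiLp.proj_apply,
      shiftB_some, if_true, if_neg hab.symm]
    module
  a_U X := by
    simp only [_root_.smul_apply, _root_.sub_apply, PiLp.proj_apply,
      exchangeB_some, if_true, if_neg hab.symm]
    module
  m2_add X v := by
    have : ∑ d ∈ (Finset.univ.erase a).erase b, ‖(X + shiftB a b v) (some d)‖ ^ 2 =
        ∑ d ∈ (Finset.univ.erase a).erase b, ‖X (some d)‖ ^ 2 := by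
      refine Finset.sum_congr rfl fun d hd => ?_
      simp only [Finset.mem_erase] at hd
      simp [hd.1, hd.2.1]
    rw [this]
    simp [hab.symm, show X (some a) + v + (X (some b) + -v) = X (some a) + X (some b) by abel]
  m2_U X := by
    have : ∑ d ∈ (Finset.univ.erase a).erase b, ‖(exchangeB a b X) (some d)‖ ^ 2 =
        ∑ d ∈ (Finset.univ.erase a).erase b, ‖X (some d)‖ ^ 2 := by
      refine Finset.sum_congr rfl fun d hd => ?_
      simp only [Finset.mem_erase] at hd
      simp [hd.1, hd.2.1]
    rw [this]
    simp only [exchangeB_some, exchangeB_none, if_true, if_neg hab.symm]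
    have : (1 / 2 : ℝ) • (X none + X (some a) - X (some b)) +
        (1 / 2 : ℝ) • (X none - X (some a) + X (some b)) = X none := by module
    rw [this]
    ring
  m2_cont := by fun_prop
  m0_pos := by positivity
  m0_le X := by
    have : 0 ≤ ∑ d ∈ (Finset.univ.erase a).erase b, ‖X (some d)‖ ^ 2 := by positivity
    nlinarith [sq_nonneg ‖X none‖, sq_nonneg ‖X (some a) + X (some b)‖]
  abs_c_le := by norm_num

variable {t : ℝ} (ht : 0 < t)

theorem chargeEnergy_pos (X : Config (Option (Fin n))) (ht : 0 < t) : 0 < chargeEnergy t X := by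
  unfold chargeEnergy; positivity

/-- The symbol of the frame is a multiple of the square root of the kinetic energy. -/
theorem sym_frameA (a : Fin n) (X : Config (Option (Fin n))) :
    (frameA ht a).sym X = 2 / √3 * √(chargeEnergy t X) := by
  have h3 : (2 / √3 : ℝ) = √(4 / 3) := by
    rw [Real.sqrt_div (by norm_num)]
    congr 1
    rw [show (4 : ℝ) = 2 ^ 2 by norm_num, Real.sqrt_sq (by norm_num)]
  rw [h3, ← Real.sqrt_mul (by norm_num), PairFrame.sym]
  congr 1
  have hs := Finset.add_sum_erase Finset.univ (fun b => ‖X (some b)‖ ^ 2) (Finset.mem_univ a)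
  simp only at hs
  simp only [frameA, chargeEnergy, _root_.smul_apply, _root_.sub_apply,
    PiLp.proj_apply]
  rw [← hs, norm_smul, mul_pow, norm_sub_sq_real, norm_add_sq_real, norm_smul, real_inner_smul_left,
    real_inner_comm]
  norm_num
  ring

/-- The symbol of the frame is the square root of the kinetic energy. -/
theorem sym_frameB {a b : Fin n} (hab : a ≠ b) (X : Config (Option (Fin n))) :
    (frameB ht hab).sym X = √(chargeEnergy t X) := by
  rw [PairFrame.sym]
  congr 1
  have hs := Finset.add_sum_erase Finset.univ (fun b => ‖X (some b)‖ ^ 2) (Finset.mem_univ a)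
  have hs2 := Finset.add_sum_erase (Finset.univ.erase a) (fun b => ‖X (some b)‖ ^ 2)
    (Finset.mem_erase.2 ⟨hab.symm, Finset.mem_univ b⟩)
  simp only at hs hs2
  simp only [frameB, chargeEnergy, _root_.smul_apply, _root_.sub_apply,
    PiLp.proj_apply]
  rw [← hs, ← hs2, norm_smul, mul_pow, norm_sub_sq_real, norm_add_sq_real]
  norm_num
  ring

theorem inner_shiftA (a : Fin n) (v : R3) (X : Config (Option (Fin n))) :
    inner ℝ (shiftA a v) X = inner ℝ v (relCoord (some a) none X) := by
  rw [inner_config, Fintype.sum_option, relCoord_apply]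
  have : ∀ d, inner ℝ (shiftA a v (some d)) (X (some d)) =
      if d = a then inner ℝ v (X (some d)) else 0 := by
    intro d
    rw [shiftA_some]
    split_ifs <;> simp
  simp only [this, shiftA_none, inner_neg_left, inner_sub_right]
  simp
  ring

theorem inner_shiftB {a b : Fin n} (hab : a ≠ b) (v : R3) (X : Config (Option (Fin n))) :
    inner ℝ (shiftB a b v) X = inner ℝ v (relCoord (some a) (some b) X) := by
  rw [inner_config, Fintype.sum_option, relCoord_apply]
  have : ∀ d, inner ℝ (shiftB a b v (some d)) (X (some d)) =
      (if d = a then inner ℝ v (X (some d)) else 0) - if d = b then inner ℝ v (X (some d)) else 0 := by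
    intro d
    rw [shiftB_some]
    split_ifs with h1 h2
    · exact absurd (h1.symm.trans h2) hab
    · simp
    · simp
    · simp
  simp only [this, Finset.sum_sub_distrib]
  simp [inner_sub_right]

end

section

/-! ### Coincidence hyperplanes in momentum space -/

variable {N : ℕ}

theorem others_strictMono (i j : Fin N) : StrictMono (others i j) := by
  intro a b hab
  have h : (a : ℕ) < b := hab
  change (others i j a : ℕ) < others i j b
  simp only [others]
  split_ifs <;> omega

theorem others_injective (i j : Fin N) : Function.Injective (others i j) :=
  (others_strictMono i j).injective

theorem others_ne_left {i j : Fin N} (hij : i ≠ j) (k : Fin (N - 2)) : others i j k ≠ i := by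
  have h : (i : ℕ) ≠ j := fun h => hij (Fin.ext h)
  intro he
  have := congrArg (fun x : Fin N => (x : ℕ)) he
  simp only [others] at this
  split_ifs at this <;> omega

theorem others_comm (i j : Fin N) : others i j = others j i := by
  funext k
  simp only [others, min_comm (i : ℕ) j, max_comm (i : ℕ) j]

theorem others_ne_right {i j : Fin N} (hij : i ≠ j) (k : Fin (N - 2)) : others i j k ≠ j := by
  rw [others_comm]; exact others_ne_left hij.symm k

theorem univ_eq_others {i j : Fin N} (hij : i ≠ j) :
    (Finset.univ : Finset (Fin N)) =
      insert i (insert j (Finset.univ.map ⟨others i j, others_injective i j⟩)) := by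
  symm
  rw [← Finset.card_eq_iff_eq_univ, Finset.card_insert_of_notMem, Finset.card_insert_of_notMem,
    Finset.card_map, Finset.card_univ, Fintype.card_fin, Fintype.card_fin]
  · have h1 := i.isLt
    have h2 := j.isLt
    have : (i : ℕ) ≠ j := fun h => hij (Fin.ext h)
    omega
  · simp only [Finset.mem_map, Finset.mem_univ, true_and, Function.Embedding.coeFn_mk, not_exists]
    exact others_ne_right hij
  · simp only [Finset.mem_insert, Finset.mem_map, Finset.mem_univ, true_and,
      Function.Embedding.coeFn_mk, not_or, not_exists]
    exact ⟨hij, others_ne_left hij⟩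

theorem sum_eq_others {M : Type*} [AddCommMonoid M] {i j : Fin N} (hij : i ≠ j) (g : Fin N → M) :
    ∑ m, g m = g i + (g j + ∑ k, g (others i j k)) := by
  rw [univ_eq_others hij, Finset.sum_insert, Finset.sum_insert, Finset.sum_map]
  · rfl
  · simp only [Finset.mem_map, Finset.mem_univ, true_and, Function.Embedding.coeFn_mk, not_exists]
    exact others_ne_right hij
  · simp only [Finset.mem_insert, Finset.mem_map, Finset.mem_univ, true_and,
      Function.Embedding.coeFn_mk, not_or, not_exists]
    exact ⟨hij, others_ne_left hij⟩

theorem eq_or_eq_others {i j : Fin N} (hij : i ≠ j) (m : Fin N) :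
    m = i ∨ m = j ∨ ∃ k, m = others i j k := by
  have := Finset.mem_univ m
  rw [univ_eq_others hij] at this
  simpa [eq_comm] using this

theorem merge_left (i j : Fin N) (a b : R3) (Y : Fin (N - 2) → R3) : merge i j a b Y i = a := by
  simp [merge]

theorem merge_right {i j : Fin N} (hij : i ≠ j) (a b : R3) (Y : Fin (N - 2) → R3) :
    merge i j a b Y j = b := by
  simp [merge, hij.symm]

theorem merge_others {i j : Fin N} (hij : i ≠ j) (a b : R3) (Y : Fin (N - 2) → R3)
    (k : Fin (N - 2)) : merge i j a b Y (others i j k) = Y k := by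
  simp [merge, others_ne_left hij, others_ne_right hij, (others_injective i j).eq_iff]

@[simp] theorem contract_none (i j : Fin N) (p : Config (Fin N)) : contract i j p none = p i + p j := rfl

@[simp] theorem contract_some (i j : Fin N) (p : Config (Fin N)) (k : Fin (N - 2)) :
    contract i j p (some k) = p (others i j k) := rfl

theorem contract_comm (i j : Fin N) (p : Config (Fin N)) : contract i j p = contract j i p := by
  refine config_ext fun m => ?_
  rcases m with _ | k
  · exact add_comm _ _
  · rw [contract_some, contract_some, others_comm]

theorem contract_split {i j : Fin N} (hij : i ≠ j) (κ : Config (ChargeIdx N)) (q : R3) :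
    contract i j (split i j κ q) = κ := by
  refine config_ext fun m => ?_
  rcases m with _ | k
  · rw [contract_none, split, merge_left, merge_right hij]; abel
  · rw [contract_some, split, merge_others hij]

theorem inner_onPlane {i j : Fin N} (hij : i ≠ j) (p : Config (Fin N)) (X : Config (ChargeIdx N)) :
    inner ℝ p (onPlane i j X) = inner ℝ (contract i j p) X := by
  rw [inner_config, inner_config, sum_eq_others hij, Fintype.sum_option]
  simp only [onPlane, merge_left, merge_right hij, merge_others hij, contract_none, contract_some,
    inner_add_left]
  ring

theorem norm_sq_split {i j : Fin N} (hij : i ≠ j) (κ : Config (ChargeIdx N)) (q : R3) :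
    ‖split i j κ q‖ ^ 2 = ‖q‖ ^ 2 + ‖κ none - q‖ ^ 2 + ∑ k, ‖κ (some k)‖ ^ 2 := by
  rw [norm_sq_config, sum_eq_others hij]
  simp only [split, merge_left, merge_right hij, merge_others hij]
  ring

/-- `contract` as a continuous linear map. -/
noncomputable def contractCLM (i j : Fin N) : Config (Fin N) →L[ℝ] Config (ChargeIdx N) :=
  configCLM fun m => m.elim (coord i + coord j) fun k => coord (others i j k)

theorem contractCLM_apply (i j : Fin N) (p : Config (Fin N)) : contractCLM i j p = contract i j p := by
  refine config_ext fun m => ?_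
  rcases m with _ | k <;> rfl

theorem continuous_contract (i j : Fin N) : Continuous (contract i j : Config (Fin N) → _) := by
  have : (contract i j : Config (Fin N) → _) = contractCLM i j :=
    funext fun p => (contractCLM_apply i j p).symm
  rw [this]; exact (contractCLM i j).continuous

/-- `onPlane` as a continuous linear map. -/
noncomputable def onPlaneCLM (i j : Fin N) : Config (ChargeIdx N) →L[ℝ] Config (Fin N) :=
  configCLM fun m => if m = i then coord none else if m = j then coord none else
    ∑ k, if others i j k = m then coord (some k) else 0

theorem onPlaneCLM_apply (i j : Fin N) (X : Config (ChargeIdx N)) :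
    onPlaneCLM i j X = onPlane i j X := by
  refine config_ext fun m => ?_
  simp only [onPlaneCLM, configCLM_apply, onPlane, merge]
  split_ifs
  · rfl
  · rfl
  · rw [_root_.sum_apply]
    refine Finset.sum_congr rfl fun k _ => ?_
    split_ifs <;> rfl

/-- The momenta `(p_i, p_j, P_{ij})` as orthogonal coordinates of `p`. -/
noncomputable def mergeIso {i j : Fin N} (hij : i ≠ j) :
    WithLp 2 (Config (ChargeIdx N) × R3) ≃ₗᵢ[ℝ] Config (Fin N) where
  toFun z := merge i j z.snd (z.fst none) fun k => z.fst (some k)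
  invFun p := WithLp.toLp 2 (WithLp.toLp 2 fun m => m.elim (p j) fun k => p (others i j k), p i)
  map_add' x y := by
    refine config_ext fun m => ?_
    rcases eq_or_eq_others hij m with rfl | rfl | ⟨k, rfl⟩ <;>
      simp [merge_left, merge_right hij, merge_others hij]
  map_smul' c x := by
    refine config_ext fun m => ?_
    rcases eq_or_eq_others hij m with rfl | rfl | ⟨k, rfl⟩ <;>
      simp [merge_left, merge_right hij, merge_others hij]
  left_inv z := by
    refine (WithLp.ofLp_injective 2) (Prod.ext ?_ ?_)
    · refine config_ext fun m => ?_
      rcases m with _ | k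
      · simp [merge_right hij]
      · simp [merge_others hij]
    · simp [merge_left]
  right_inv p := by
    refine config_ext fun m => ?_
    rcases eq_or_eq_others hij m with rfl | rfl | ⟨k, rfl⟩ <;>
      simp [merge_left, merge_right hij, merge_others hij]
  norm_map' z := by
    have h : ‖merge i j z.snd (z.fst none) fun k => z.fst (some k)‖ ^ 2 = ‖z‖ ^ 2 := by
      rw [norm_sq_config, sum_eq_others hij, WithLp.prod_norm_sq_eq_of_L2, norm_sq_config,
        Fintype.sum_option]
      simp only [merge_left, merge_right hij, merge_others hij]
      ring
    exact (sq_eq_sq₀ (norm_nonneg _) (norm_nonneg _)).1 h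

/-- Shift of the component `none`. -/
noncomputable def shiftNone : R3 →L[ℝ] Config (ChargeIdx N) :=
  configCLM fun m => m.elim (ContinuousLinearMap.id ℝ R3) fun _ => 0

theorem measurePreserving_split {i j : Fin N} (hij : i ≠ j) :
    MeasurePreserving (fun z : Config (ChargeIdx N) × R3 => split i j z.1 z.2)
      ((volume : Measure (Config (ChargeIdx N))).prod volume) volume := by
  have h1 : MeasurePreserving (fun z : R3 × Config (ChargeIdx N) => (z.1, z.2 - shiftNone z.1))
      ((volume : Measure R3).prod volume) (volume.prod volume) := by
    refine (MeasurePreserving.id volume).skew_product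
      (g := fun (q : R3) (κ : Config (ChargeIdx N)) => κ - shiftNone q)
      (by unfold Function.uncurry; fun_prop) (ae_of_all _ fun q => ?_)
    exact (measurePreserving_sub_right volume (shiftNone q)).map_eq
  have h2 : MeasurePreserving (WithLp.toLp 2 : Config (ChargeIdx N) × R3 → _)
      (volume.prod volume) volume := WithLp.volume_preserving_toLp _ _
  have h3 := (mergeIso hij).measurePreserving.comp (h2.comp
    (Measure.measurePreserving_swap.comp (h1.comp Measure.measurePreserving_swap)))
  have e : (fun z : Config (ChargeIdx N) × R3 => split i j z.1 z.2) =
      (mergeIso hij) ∘ WithLp.toLp 2 ∘ Prod.swap ∘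
        (fun z : R3 × Config (ChargeIdx N) => (z.1, z.2 - shiftNone z.1)) ∘ Prod.swap := by
    funext z
    refine config_ext fun m => ?_
    rcases eq_or_eq_others hij m with rfl | rfl | ⟨k, rfl⟩
    · simp [split, mergeIso, merge_left]
    · simp [split, mergeIso, merge_right hij, shiftNone]
    · simp [split, mergeIso, merge_others hij, shiftNone]
  rw [e]
  exact h3

end

section

/-! ### The interacting pairs of particles -/

/-- Relabelling of the particles as an isometry of the configurations. -/
noncomputable abbrev relabel {ι : Type} [Fintype ι] (e : Equiv.Perm ι) : Config ι ≃ₗᵢ[ℝ] Config ι :=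
  LinearIsometryEquiv.piLpCongrLeft 2 ℝ R3 e

theorem relabel_apply {ι : Type} [Fintype ι] (e : Equiv.Perm ι) (X : Config ι) (m : ι) :
    relabel e X m = X (e.symm m) := rfl

theorem permL2_ae {ι : Type} [Fintype ι] (e : Equiv.Perm ι) (u : L2 ι) :
    ∀ᵐ X, permL2 e u X = u (relabel e X) :=
  Lp.coeFn_compMeasurePreserving u (relabel e).measurePreserving

theorem fourier_permL2 {ι : Type} [Fintype ι] (e : Equiv.Perm ι) (u : L2 ι) :
    (𝓕 (permL2 e u) : L2 ι) = permL2 e (𝓕 u) := by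
  refine Lp.ext ?_
  filter_upwards [fourier_comp_isometry (relabel e) (permL2_ae e u), permL2_ae e (𝓕 u : L2 ι)]
    with x h1 h2
  rw [h1, h2]

theorem exists_perm_comp {n : ℕ} {α : Type*} {f g : Fin n → α} (hf : Function.Injective f)
    (h : ∀ b, ∃ a, g a = f b) : ∃ σ : Equiv.Perm (Fin n), ∀ b, f b = g (σ b) := by
  choose s hs using h
  have : Function.Injective s := fun a b hab => hf (by rw [← hs, ← hs, hab])
  exact ⟨Equiv.ofBijective s (Finite.injective_iff_bijective.1 this), fun b => (hs b).symm⟩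

/-- The permutations of the arguments `y_1, …, y_n` of a charge. -/
abbrev chargePerm {n : ℕ} (σ : Equiv.Perm (Fin n)) : Equiv.Perm (Option (Fin n)) :=
  Equiv.optionCongr σ

variable {n : ℕ}

@[simp] theorem relabel_chargePerm_none (σ : Equiv.Perm (Fin n)) (X : Config (Option (Fin n))) :
    relabel (chargePerm σ) X none = X none := rfl

@[simp] theorem relabel_chargePerm_some (σ : Equiv.Perm (Fin n)) (X : Config (Option (Fin n)))
    (k : Fin n) : relabel (chargePerm σ) X (some k) = X (some (σ.symm k)) := rfl

theorem chargeEnergy_relabel (t : ℝ) (σ : Equiv.Perm (Fin n)) (X : Config (Option (Fin n))) :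
    chargeEnergy t (relabel (chargePerm σ) X) = chargeEnergy t X := by
  simp only [chargeEnergy, relabel_chargePerm_none, relabel_chargePerm_some]
  rw [Equiv.sum_comp σ.symm (fun k => ‖X (some k)‖ ^ 2)]

/-- The pairs of particles that interact with a charge: the pair that carries the charge and
another particle, or an ordered pair of two others. -/
abbrev Link (n : ℕ) : Type := Fin n ⊕ {p : Fin n × Fin n // p.1 ≠ p.2}

/-- The pair frame of a link. -/
noncomputable def linkFrame {t : ℝ} (ht : 0 < t) : Link n → PairFrame (Config (Option (Fin n)))
  | .inl a => frameA ht a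
  | .inr p => frameB ht p.2

/-- The relative position of a link. -/
noncomputable def linkPos : Link n → Config (Option (Fin n)) →L[ℝ] R3
  | .inl a => relCoord (some a) none
  | .inr p => relCoord (some p.1.1) (some p.1.2)

/-- The ratio between the symbol of the frame and the square root of the kinetic energy. -/
noncomputable def linkScale : Link n → ℝ
  | .inl _ => 2 / √3
  | .inr _ => 1

/-- The strength of the interaction of a link. For the ordered pairs it is halved, since each
unordered pair occurs twice. -/
noncomputable def linkCoef : Link n → ℝ
  | .inl _ => 2 / √3 / π ^ 2
  | .inr _ => 1 / (4 * π ^ 2)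

/-- The action of the permutations on the links. -/
def linkPerm (σ : Equiv.Perm (Fin n)) : Equiv.Perm (Link n) :=
  Equiv.sumCongr σ ((σ.prodCongr σ).subtypeEquiv fun p => by simp)

theorem linkScale_pos (y : Link n) : 0 < linkScale y := by
  rcases y with a | p <;> simp only [linkScale] <;> positivity

theorem linkCoef_nonneg (y : Link n) : 0 ≤ linkCoef y := by
  rcases y with a | p <;> simp only [linkCoef] <;> positivity

theorem linkCoef_linkPerm (σ : Equiv.Perm (Fin n)) (y : Link n) :
    linkCoef (linkPerm σ y) = linkCoef y := by
  rcases y with a | p <;> rfl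

theorem sum_linkCoef : ∑ y : Link n, linkCoef y =
    1 / π ^ 2 * (2 / √3 * n + n * (n - 1) / 4) := by
  have hc : (Fintype.card {p : Fin n × Fin n // p.1 ≠ p.2} : ℝ) = n * (n - 1) := by
    have h1 : Fintype.card {p : Fin n × Fin n // p.1 ≠ p.2} = n * n - n := by
      rw [Fintype.card_subtype]
      have := Finset.offDiag_card (Finset.univ : Finset (Fin n))
      rw [Finset.card_univ, Fintype.card_fin] at this
      rw [← this]
      congr 1
      ext p; simp [Finset.mem_offDiag]
    rw [h1, Nat.cast_sub (Nat.le_mul_self n)]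
    push_cast; ring
  rw [Fintype.sum_sum_type]
  simp only [linkCoef, Finset.sum_const, Finset.card_univ, nsmul_eq_mul, Fintype.card_fin, hc]
  field_simp

theorem relCoord_relabel {ι : Type} [Fintype ι] (e : Equiv.Perm ι) (m m' : ι) (X : Config ι) :
    relCoord (e m) (e m') (relabel e X) = relCoord m m' X := by
  rw [relCoord_apply, relCoord_apply, relabel_apply, relabel_apply, Equiv.symm_apply_apply,
    Equiv.symm_apply_apply]

theorem inner_link_ι {t : ℝ} (ht : 0 < t) (y : Link n) (v : R3) (X : Config (Option (Fin n))) :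
    inner ℝ ((linkFrame ht y).ι v) X = inner ℝ v (linkPos y X) := by
  rcases y with a | p
  · exact inner_shiftA a v X
  · exact inner_shiftB p.2 v X

theorem sym_linkFrame {t : ℝ} (ht : 0 < t) (y : Link n) (X : Config (Option (Fin n))) :
    (linkFrame ht y).sym X = linkScale y * √(chargeEnergy t X) := by
  rcases y with a | p
  · exact sym_frameA ht a X
  · simp only [linkScale, one_mul]; exact sym_frameB ht p.2 X

theorem relabel_ι {t : ℝ} (ht : 0 < t) (σ : Equiv.Perm (Fin n)) (y : Link n) (v : R3) :
    relabel (chargePerm σ) ((linkFrame ht y).ι v) = (linkFrame ht (linkPerm σ y)).ι v := by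
  refine config_ext fun m => ?_
  rcases y with a | p
  · rcases m with _ | k
    · rfl
    · change shiftA a v (some (σ.symm k)) = shiftA (σ a) v (some k)
      simp only [shiftA_some, Equiv.symm_apply_eq]
  · rcases m with _ | k
    · rfl
    · change shiftB p.1.1 p.1.2 v (some (σ.symm k)) = shiftB (σ p.1.1) (σ p.1.2) v (some k)
      simp only [shiftB_some, Equiv.symm_apply_eq]

theorem relabel_U {t : ℝ} (ht : 0 < t) (σ : Equiv.Perm (Fin n)) (y : Link n)
    (X : Config (Option (Fin n))) :
    relabel (chargePerm σ) ((linkFrame ht y).U X) =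
      (linkFrame ht (linkPerm σ y)).U (relabel (chargePerm σ) X) := by
  rcases y with a | p
  · rfl
  · refine config_ext fun m => ?_
    rcases m with _ | k
    · change X _ + X _ = X (some (σ.symm (σ _))) + X (some (σ.symm (σ _)))
      simp
    · change exchangeB p.1.1 p.1.2 X (some (σ.symm k)) =
        exchangeB (σ p.1.1) (σ p.1.2) (relabel (chargePerm σ) X) (some k)
      simp only [exchangeB_some, Equiv.symm_apply_eq, relabel_chargePerm_none,
        relabel_chargePerm_some, Equiv.symm_apply_apply]

theorem relabel_mv {t : ℝ} (ht : 0 < t) (σ : Equiv.Perm (Fin n)) (y : Link n)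
    (X : Config (Option (Fin n))) (v : R3) :
    relabel (chargePerm σ) ((linkFrame ht y).mv X v) =
      (linkFrame ht (linkPerm σ y)).mv (relabel (chargePerm σ) X) v := by
  rw [PairFrame.mv, PairFrame.mv, map_add, relabel_ι, relabel_U]

theorem sum_erase_comp_perm {α : Type*} [Fintype α] [DecidableEq α] (σ : Equiv.Perm α) (a : α)
    (g : α → ℝ) : ∑ b ∈ Finset.univ.erase (σ a), g (σ.symm b) = ∑ b ∈ Finset.univ.erase a, g b := by
  have h1 := Finset.add_sum_erase Finset.univ (fun b => g (σ.symm b)) (Finset.mem_univ (σ a))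
  have h2 := Finset.add_sum_erase Finset.univ g (Finset.mem_univ a)
  rw [Equiv.sum_comp σ.symm g] at h1
  simp only [Equiv.symm_apply_apply] at h1
  linarith

theorem sum_erase_erase_comp_perm {α : Type*} [Fintype α] [DecidableEq α] (σ : Equiv.Perm α)
    {a b : α} (hab : a ≠ b) (g : α → ℝ) :
    ∑ d ∈ (Finset.univ.erase (σ a)).erase (σ b), g (σ.symm d) =
      ∑ d ∈ (Finset.univ.erase a).erase b, g d := by
  have h1 := Finset.add_sum_erase (Finset.univ.erase (σ a)) (fun b => g (σ.symm b))
    (Finset.mem_erase.2 ⟨fun h => hab (σ.injective h).symm, Finset.mem_univ (σ b)⟩)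
  have h2 := Finset.add_sum_erase (Finset.univ.erase a) g
    (Finset.mem_erase.2 ⟨hab.symm, Finset.mem_univ b⟩)
  rw [sum_erase_comp_perm] at h1
  simp only [Equiv.symm_apply_apply] at h1
  linarith

theorem den_relabel {t : ℝ} (ht : 0 < t) (σ : Equiv.Perm (Fin n)) (y : Link n)
    (X : Config (Option (Fin n))) (v : R3) :
    (linkFrame ht (linkPerm σ y)).den (relabel (chargePerm σ) X) v = (linkFrame ht y).den X v := by
  have ha : (linkFrame ht (linkPerm σ y)).a (relabel (chargePerm σ) X) = (linkFrame ht y).a X := by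
    rcases y with a | p
    · change (1 / 3 : ℝ) • ((2 : ℝ) • X (some (σ.symm (σ a))) - X none) = _
      rw [Equiv.symm_apply_apply]; rfl
    · change (1 / 2 : ℝ) • (X (some (σ.symm (σ _))) - X (some (σ.symm (σ _)))) = _
      rw [Equiv.symm_apply_apply, Equiv.symm_apply_apply]; rfl
  have hm : (linkFrame ht (linkPerm σ y)).m2 (relabel (chargePerm σ) X) = (linkFrame ht y).m2 X := by
    rcases y with a | p
    · change 2 / 9 * ‖X none + X (some (σ.symm (σ a)))‖ ^ 2 +
        2 / 3 * ∑ b ∈ Finset.univ.erase (σ a), ‖X (some (σ.symm b))‖ ^ 2 + 2 / 3 * t = _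
      rw [Equiv.symm_apply_apply, sum_erase_comp_perm σ a fun b => ‖X (some b)‖ ^ 2]; rfl
    · change 1 / 4 * ‖X none‖ ^ 2 +
        1 / 4 * ‖X (some (σ.symm (σ _))) + X (some (σ.symm (σ _)))‖ ^ 2 +
        1 / 2 * ∑ d ∈ (Finset.univ.erase (σ _)).erase (σ _), ‖X (some (σ.symm d))‖ ^ 2 + t / 2 = _
      rw [Equiv.symm_apply_apply, Equiv.symm_apply_apply,
        sum_erase_erase_comp_perm σ p.2 fun b => ‖X (some b)‖ ^ 2]; rfl
  have hc : (linkFrame ht (linkPerm σ y)).c = (linkFrame ht y).c := by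
    rcases y with a | p <;> rfl
  rw [PairFrame.den, PairFrame.den, ha, hm, hc]

end

section

variable {N : ℕ}

/-- The non-local term that couples the hyperplanes `π_{ij}` and `π_{lm}` is, up to a permutation
of the arguments of the charge and an affine isometry of the integration variable, the operator of
the link `y`. -/
def IsCoupling {t : ℝ} (ht : 0 < t) (i j l m : Fin N) (y : Link (N - 2)) : Prop :=
  ∃ (σ : Equiv.Perm (Fin (N - 2))) (ε : ℝ) (c : Config (ChargeIdx N) → R3), (ε = 1 ∨ ε = -1) ∧
    ∀ κ v, contract l m (split i j κ (c κ + ε • v)) =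
        relabel (chargePerm σ) ((linkFrame ht y).mv κ v) ∧
      ‖split i j κ (c κ + ε • v)‖ ^ 2 + t = 2 * (linkFrame ht y).den κ v

variable {t : ℝ} (ht : 0 < t)

/-- On the fibre, the energy denominator of `Γ` is that of the frame, for a suitable parametrization
of the fibre. -/
theorem norm_sq_split_left {i j : Fin N} (hij : i ≠ j) (a : Fin (N - 2)) (κ : Config (ChargeIdx N))
    (q : R3) : ‖split i j κ q‖ ^ 2 + t =
      2 * (frameA ht a).den κ (κ none - q - κ (some a)) := by
  have hs := Finset.add_sum_erase Finset.univ (fun b => ‖κ (some b)‖ ^ 2) (Finset.mem_univ a)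
  simp only at hs
  rw [norm_sq_split hij, ← hs]
  simp only [PairFrame.den, frameA, _root_.smul_apply, _root_.sub_apply, PiLp.proj_apply]
  simp only [norm_sub_sq_real, norm_add_sq_real, norm_smul, mul_pow, inner_add_right,
    inner_sub_left, inner_sub_right, real_inner_smul_left, real_inner_smul_right,
    real_inner_self_eq_norm_sq, real_inner_comm q, real_inner_comm (κ none) (κ (some a))]
  norm_num
  ring

theorem norm_sq_split_others {i j : Fin N} (hij : i ≠ j) {a b : Fin (N - 2)} (hab : a ≠ b)
    (κ : Config (ChargeIdx N)) (v : R3) :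
    ‖split i j κ ((1 / 2 : ℝ) • (κ none + κ (some a) - κ (some b)) + v)‖ ^ 2 + t =
      2 * (frameB ht hab).den κ v := by
  have hs := Finset.add_sum_erase Finset.univ (fun b => ‖κ (some b)‖ ^ 2) (Finset.mem_univ a)
  have hs2 := Finset.add_sum_erase (Finset.univ.erase a) (fun b => ‖κ (some b)‖ ^ 2)
    (Finset.mem_erase.2 ⟨hab.symm, Finset.mem_univ b⟩)
  simp only at hs hs2
  rw [norm_sq_split hij, ← hs, ← hs2]
  simp only [PairFrame.den, frameB, _root_.smul_apply, _root_.sub_apply, PiLp.proj_apply]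
  simp only [norm_sub_sq_real, norm_add_sq_real, norm_smul, mul_pow, inner_add_left, inner_add_right,
    inner_sub_right, real_inner_smul_right,
    real_inner_self_eq_norm_sq, real_inner_comm v, real_inner_comm (κ (some a)) (κ none),
    real_inner_comm (κ (some b)) (κ none), real_inner_comm (κ (some b)) (κ (some a))]
  norm_num
  ring

theorem isCoupling_left {i j : Fin N} (hij : i ≠ j) (a : Fin (N - 2)) :
    IsCoupling ht i j i (others i j a) (.inl a) := by
  have hil : i ≠ others i j a := (others_ne_left hij a).symm
  obtain ⟨σ, hσ⟩ := exists_perm_comp (f := others i (others i j a))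
    (g := fun b => if b = a then j else others i j b) (others_injective _ _) (by
      intro b
      rcases eq_or_eq_others hij (others i (others i j a) b) with h | h | ⟨d, h⟩
      · exact absurd h (others_ne_left hil b)
      · exact ⟨a, by simp [h]⟩
      · refine ⟨d, ?_⟩
        have : d ≠ a := by
          rintro rfl
          exact others_ne_right hil b h
        simp [h, this])
  refine ⟨σ.symm, -1, fun κ => κ none - κ (some a), Or.inr rfl, fun κ v => ⟨?_, ?_⟩⟩
  · refine config_ext fun m => ?_
    rcases m with _ | b
    · simp only [contract_none, split, merge_left, merge_others hij, relabel_chargePerm_none,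
        PairFrame.mv]
      change _ = κ none + -v
      module
    · simp only [contract_some, relabel_chargePerm_some, Equiv.symm_symm, hσ]
      change _ = κ (some (σ b)) + shiftA a v (some (σ b))
      rw [shiftA_some]
      split_ifs with h
      · rw [split, merge_right hij, h]; module
      · rw [split, merge_others hij, add_zero]
  · rw [norm_sq_split_left ht hij a]
    change 2 * (frameA ht a).den κ _ = 2 * (frameA ht a).den κ _
    congr 2
    module

theorem isCoupling_right {i j : Fin N} (hij : i ≠ j) (a : Fin (N - 2)) :
    IsCoupling ht i j j (others i j a) (.inl a) := by
  have hjl : j ≠ others i j a := (others_ne_right hij a).symm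
  obtain ⟨σ, hσ⟩ := exists_perm_comp (f := others j (others i j a))
    (g := fun b => if b = a then i else others i j b) (others_injective _ _) (by
      intro b
      rcases eq_or_eq_others hij (others j (others i j a) b) with h | h | ⟨d, h⟩
      · exact ⟨a, by simp [h]⟩
      · exact absurd h (others_ne_left hjl b)
      · refine ⟨d, ?_⟩
        have : d ≠ a := by
          rintro rfl
          exact others_ne_right hjl b h
        simp [h, this])
  refine ⟨σ.symm, 1, fun κ => κ (some a), Or.inl rfl, fun κ v => ⟨?_, ?_⟩⟩
  · refine config_ext fun m => ?_
    rcases m with _ | b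
    · simp only [contract_none, split, merge_right hij, merge_others hij, relabel_chargePerm_none,
        PairFrame.mv]
      change _ = κ none + -v
      module
    · simp only [contract_some, relabel_chargePerm_some, Equiv.symm_symm, hσ]
      change _ = κ (some (σ b)) + shiftA a v (some (σ b))
      rw [shiftA_some]
      split_ifs with h
      · rw [split, merge_left, h]; module
      · rw [split, merge_others hij, add_zero]
  · -- the energy is symmetric under the exchange of `q` and `k - q`
    have h : ‖split i j κ (κ (some a) + (1 : ℝ) • v)‖ ^ 2 =
        ‖split i j κ (κ none - (κ (some a) + v))‖ ^ 2 := by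
      rw [norm_sq_split hij, norm_sq_split hij]
      simp only [one_smul, sub_sub_cancel]
      ring
    rw [h, norm_sq_split_left ht hij a]
    change 2 * (frameA ht a).den κ _ = 2 * (frameA ht a).den κ _
    congr 2
    module

theorem isCoupling_others {i j : Fin N} (hij : i ≠ j) {a b : Fin (N - 2)} (hab : a ≠ b) :
    IsCoupling ht i j (others i j a) (others i j b) (.inr ⟨(a, b), hab⟩) := by
  have hlm : others i j a ≠ others i j b := fun h => hab (others_injective i j h)
  obtain ⟨σ, hσ⟩ := exists_perm_comp (f := others (others i j a) (others i j b))
    (g := fun d => if d = a then i else if d = b then j else others i j d) (others_injective _ _) (by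
      intro d
      rcases eq_or_eq_others hij (others (others i j a) (others i j b) d) with h | h | ⟨d', h⟩
      · exact ⟨a, by simp [h]⟩
      · exact ⟨b, by simp [h, hab.symm]⟩
      · refine ⟨d', ?_⟩
        have h1 : d' ≠ a := by
          rintro rfl
          exact others_ne_left hlm d h
        have h2 : d' ≠ b := by
          rintro rfl
          exact others_ne_right hlm d h
        simp [h, h1, h2])
  refine ⟨σ.symm, 1, fun κ => (1 / 2 : ℝ) • (κ none + κ (some a) - κ (some b)), Or.inl rfl,
    fun κ v => ⟨?_, ?_⟩⟩
  · refine config_ext fun m => ?_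
    rcases m with _ | d
    · simp only [contract_none, split, merge_others hij, relabel_chargePerm_none, PairFrame.mv]
      change _ = κ (some a) + κ (some b) + 0
      rw [add_zero]
    · simp only [contract_some, relabel_chargePerm_some, Equiv.symm_symm, hσ]
      change _ = exchangeB a b κ (some (σ d)) + shiftB a b v (some (σ d))
      rw [shiftB_some, exchangeB_some]
      split_ifs with h1 h2
      · rw [split, merge_left, one_smul]
      · rw [split, merge_right hij]; module
      · rw [split, merge_others hij, add_zero]
  · rw [one_smul]
    exact norm_sq_split_others ht hij hab κ v

theorem IsCoupling.symm {i j l m : Fin N} {y : Link (N - 2)} (h : IsCoupling ht i j l m y) :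
    IsCoupling ht i j m l y := by
  obtain ⟨σ, ε, c, hε, h⟩ := h
  exact ⟨σ, ε, c, hε, fun κ v => by rw [contract_comm]; exact h κ v⟩

/-- Every two different hyperplanes are coupled by some link. -/
theorem exists_isCoupling {i j l m : Fin N} (hij : i ≠ j) (hlm : l ≠ m)
    (h : ({l, m} : Finset (Fin N)) ≠ {i, j}) : ∃ y, IsCoupling ht i j l m y := by
  rcases eq_or_eq_others hij l with rfl | rfl | ⟨a, rfl⟩
  · rcases eq_or_eq_others hij m with rfl | rfl | ⟨b, rfl⟩
    · exact absurd rfl hlm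
    · exact absurd rfl h
    · exact ⟨_, isCoupling_left ht hij b⟩
  · rcases eq_or_eq_others hij m with rfl | rfl | ⟨b, rfl⟩
    · exact absurd (Finset.pair_comm _ _) h
    · exact absurd rfl hlm
    · exact ⟨_, isCoupling_right ht hij b⟩
  · rcases eq_or_eq_others hij m with rfl | rfl | ⟨b, rfl⟩
    · exact ⟨_, (isCoupling_left ht hij a).symm⟩
    · exact ⟨_, (isCoupling_right ht hij a).symm⟩
    · exact ⟨_, isCoupling_others ht hij fun hab => hlm (congrArg _ hab)⟩

end

section

/-! ### The local part of the modified boundary condition -/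

/-- Null sets of radii are negligible in `ℝ³`. -/
theorem ae_norm_of_ae_Ioi {p : ℝ → Prop} (hp : ∀ᵐ r ∂(volume.restrict (Ioi (0 : ℝ))), p r) :
    ∀ᵐ x : R3, p ‖x‖ := by
  let Z := toMeasurable (volume.restrict (Ioi (0 : ℝ))) {r | ¬ p r}
  have hZ : MeasurableSet Z := measurableSet_toMeasurable _ _
  have hZ0 : ∀ᵐ r ∂(volume.restrict (Ioi (0 : ℝ))), r ∉ Z := by
    rw [ae_iff]
    simp only [not_not]
    change (volume.restrict (Ioi (0 : ℝ))) Z = 0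
    rw [measure_toMeasurable]; exact hp
  have h0 : (fun r : ℝ => r ^ (Module.finrank ℝ R3 - 1) • Z.indicator (1 : ℝ → ℝ) r)
      =ᵐ[volume.restrict (Ioi 0)] fun _ => 0 := by
    filter_upwards [hZ0] with r hr
    simp [hr]
  have hi : Integrable fun x : R3 => Z.indicator (1 : ℝ → ℝ) ‖x‖ := by
    rw [integrable_fun_norm_addHaar]
    exact (integrable_zero _ _ _).congr h0.symm
  have h : ∫ x : R3, Z.indicator (1 : ℝ → ℝ) ‖x‖ = 0 := by
    rw [integral_fun_norm_addHaar, integral_congr_ae h0]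
    simp
  have h := (integral_eq_zero_iff_of_nonneg
    (fun x : R3 => indicator_nonneg (fun _ _ => zero_le_one) ‖x‖) hi).1 h
  filter_upwards [h] with x hx
  by_contra hpx
  have : ‖x‖ ∈ Z := subset_toMeasurable _ _ hpx
  simp [this] at hx

theorem ae_comp_of_surjective {F G : Type*} [NormedAddCommGroup F] [InnerProductSpace ℝ F]
    [FiniteDimensional ℝ F] [MeasurableSpace F] [BorelSpace F] [NormedAddCommGroup G]
    [InnerProductSpace ℝ G] [FiniteDimensional ℝ G] [MeasurableSpace G] [BorelSpace G]
    (w : F →L[ℝ] G) (hw : Function.Surjective w) {p : G → Prop} (hp : ∀ᵐ x, p x) :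
    ∀ᵐ X, p (w X) := by
  let Z := toMeasurable (volume : Measure G) {x | ¬ p x}
  have hZ : MeasurableSet Z := measurableSet_toMeasurable _ _
  have hZ0 : ∀ᵐ x : G, x ∈ Zᶜ := by
    rw [ae_iff]
    simp only [mem_compl_iff, not_not]
    change volume Z = 0
    rw [measure_toMeasurable]; exact hp
  have := (ae_comp_linearMap_mem_iff (w : F →ₗ[ℝ] G) (volume : Measure F) (volume : Measure G) hw
    hZ.compl).2 hZ0
  filter_upwards [this] with X hX
  by_contra hpX
  exact hX (subset_toMeasurable _ _ hpX)

/-- Up to a bounded function, `θ(r)/r` is the Coulomb potential. -/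
theorem exists_bounded_part {θ : ℝ → ℝ} (hθ : AEStronglyMeasurable θ (volume.restrict (Ioi (0 : ℝ))))
    {b : ℝ} (hb : 0 < b)
    (hθb : ∀ᵐ r ∂(volume.restrict (Ioi (0 : ℝ))), 1 - r / b ≤ θ r ∧ θ r ≤ 1 + r / b) :
    ∃ β : ℝ → ℝ, Measurable β ∧ (∀ r, |β r| ≤ 1 / b) ∧
      ∀ᵐ x : R3, θ ‖x‖ / ‖x‖ = 1 / ‖x‖ + β ‖x‖ := by
  obtain ⟨g, hg, hgθ⟩ := hθ
  let S : Set ℝ := {r | |(g r - 1) / r| ≤ 1 / b}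
  have hm : Measurable fun r => (g r - 1) / r := by
    have := hg.measurable; fun_prop
  have hS : MeasurableSet S := measurableSet_le (by fun_prop) measurable_const
  refine ⟨S.indicator fun r => (g r - 1) / r, hm.indicator hS, fun r => ?_, ?_⟩
  · by_cases h : r ∈ S
    · rw [indicator_of_mem h]; exact h
    · rw [indicator_of_notMem h, abs_zero]; positivity
  · refine ae_norm_of_ae_Ioi (p := fun r => θ r / r = 1 / r + S.indicator (fun r => (g r - 1) / r) r) ?_
    filter_upwards [hθb, hgθ, ae_restrict_mem measurableSet_Ioi] with r h1 h2 h3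
    have hr : 0 < r := h3
    have hmem : r ∈ S := by
      change |(g r - 1) / r| ≤ 1 / b
      rw [← h2, abs_div, abs_of_pos hr, div_le_iff₀ hr, abs_le]
      have : 1 / b * r = r / b := by ring
      rw [this]
      constructor <;> linarith [h1.1, h1.2]
    rw [indicator_of_mem hmem, ← h2]
    field_simp
    ring

/-- Twice a sum over unordered pairs is a sum over ordered pairs. -/
theorem sum_ordered_pairs {n : ℕ} {M : Type*} [AddCommMonoid M] (G : Fin n → Fin n → M)
    (hG : ∀ k l, G k l = G l k) :
    ∑ p : {p : Fin n × Fin n // p.1 ≠ p.2}, G p.1.1 p.1.2 =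
      (∑ k, ∑ l, if k < l then G k l else 0) + ∑ k, ∑ l, if k < l then G k l else 0 := by
  have h1 : ∑ p : {p : Fin n × Fin n // p.1 ≠ p.2}, G p.1.1 p.1.2 =
      ∑ k, ∑ l, if k ≠ l then G k l else 0 := by
    rw [← Fintype.sum_prod_type' (f := fun k l => if k ≠ l then G k l else 0), ← Finset.sum_filter]
    exact (Finset.sum_subtype (Finset.univ.filter fun p : Fin n × Fin n => p.1 ≠ p.2)
      (fun p => by simp) (fun p => G p.1 p.2)).symm
  have h2 : (∑ k, ∑ l, if k < l then G k l else 0) = ∑ k, ∑ l, if l < k then G k l else 0 := by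
    rw [Finset.sum_comm]
    simp only [hG]
  rw [h1]
  nth_rw 2 [h2]
  rw [← Finset.sum_add_distrib]
  refine Finset.sum_congr rfl fun k _ => ?_
  rw [← Finset.sum_add_distrib]
  refine Finset.sum_congr rfl fun l _ => ?_
  rcases lt_trichotomy k l with h | h | h
  · simp [h, h.ne, h.not_gt]
  · simp [h]
  · simp [h, h.ne', h.not_gt]

/-- The strength of the local interaction of a link, as a multiple of `γ`. -/
noncomputable def linkWeight {n : ℕ} : Link n → ℝ
  | .inl _ => 1
  | .inr _ => 1 / 4

theorem linkWeight_eq {n : ℕ} (y : Link n) :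
    2 * π * (linkCoef y * (1 / 2)) = linkWeight y * (1 / π * linkScale y) := by
  rcases y with a | p <;> simp only [linkCoef, linkWeight, linkScale] <;> field_simp

theorem coefA_eq {N : ℕ} (α γ : ℝ) (θ : ℝ → ℝ) (X : Config (ChargeIdx N)) :
    coefA α γ θ X = α + γ * ∑ y : Link (N - 2), linkWeight y * (θ ‖linkPos y X‖ / ‖linkPos y X‖) := by
  have h := sum_ordered_pairs
    (fun k l : Fin (N - 2) => 1 / 4 * (θ ‖X (some k) - X (some l)‖ / ‖X (some k) - X (some l)‖))
    (fun k l => by rw [norm_sub_rev])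
  rw [Fintype.sum_sum_type]
  simp only [linkWeight, linkPos, relCoord_apply]
  rw [h, coefA]
  have : ∀ k l : Fin (N - 2), (if k < l then
      1 / 4 * (θ ‖X (some k) - X (some l)‖ / ‖X (some k) - X (some l)‖) else 0) = 1 / 4 *
      if k < l then θ ‖X (some k) - X (some l)‖ / ‖X (some k) - X (some l)‖ else 0 := fun k l => by
    split_ifs <;> simp
  simp only [this, ← Finset.mul_sum]
  ring

theorem linkPos_surjective {n : ℕ} (y : Link n) : Function.Surjective (linkPos y) := by
  intro v
  rcases y with a | p
  · refine ⟨WithLp.toLp 2 fun m => m.elim 0 fun _ => v, ?_⟩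
    simp [linkPos]
  · refine ⟨WithLp.toLp 2 fun m => if m = some p.1.1 then v else 0, ?_⟩
    simp [linkPos, p.2.symm]

/-- The bounded part of the function `A`. -/
theorem exists_coefA_eq {N : ℕ} (α γ : ℝ) {θ : ℝ → ℝ}
    (hθ : AEStronglyMeasurable θ (volume.restrict (Ioi (0 : ℝ)))) {b : ℝ} (hb : 0 < b)
    (hθb : ∀ᵐ r ∂(volume.restrict (Ioi (0 : ℝ))), 1 - r / b ≤ θ r ∧ θ r ≤ 1 + r / b) :
    ∃ (B : Config (ChargeIdx N) → ℝ) (C : ℝ), Measurable B ∧ (∀ X, |B X| ≤ C) ∧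
      (∀ σ X, B (relabel (chargePerm σ) X) = B X) ∧
      ∀ᵐ X, coefA α γ θ X = B X + γ * ∑ y : Link (N - 2), linkWeight y * (1 / ‖linkPos y X‖) := by
  obtain ⟨β, hβ, hβb, hβθ⟩ := exists_bounded_part hθ hb hθb
  refine ⟨fun X => α + γ * ∑ y : Link (N - 2), linkWeight y * β ‖linkPos y X‖,
    |α| + |γ| * ∑ y : Link (N - 2), |linkWeight y| * (1 / b), by fun_prop, fun X => ?_, fun σ X => ?_, ?_⟩
  · refine (abs_add_le _ _).trans ?_
    rw [abs_mul]
    gcongr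
    refine (Finset.abs_sum_le_sum_abs _ _).trans (Finset.sum_le_sum fun y _ => ?_)
    rw [abs_mul]
    gcongr
    exact hβb _
  · simp only
    congr 2
    rw [← Equiv.sum_comp (linkPerm σ)]
    refine Finset.sum_congr rfl fun y _ => ?_
    rcases y with a | p
    · change linkWeight (.inl a) * β ‖relCoord (chargePerm σ (some a)) (chargePerm σ none)
        (relabel (chargePerm σ) X)‖ = _
      rw [relCoord_relabel]; rfl
    · change linkWeight (.inr p) * β ‖relCoord (chargePerm σ (some p.1.1)) (chargePerm σ (some p.1.2))
        (relabel (chargePerm σ) X)‖ = _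
      rw [relCoord_relabel]; rfl
  · have : ∀ y : Link (N - 2), ∀ᵐ X : Config (ChargeIdx N),
        θ ‖linkPos y X‖ / ‖linkPos y X‖ = 1 / ‖linkPos y X‖ + β ‖linkPos y X‖ := fun y =>
      ae_comp_of_surjective (linkPos y) (linkPos_surjective y) hβθ
    filter_upwards [ae_all_iff.2 this] with X hX
    rw [coefA_eq]
    simp only [hX, mul_add, Finset.sum_add_distrib]
    ring

end

section

/-! ### The operators of the charge space -/

/-- Covariance of the integral operators under an isometry that maps one pair frame to another. -/
theorem PairFrame.IsKernelOp.comp_relabel {ι : Type} [Fintype ι] {P P' : PairFrame (Config ι)}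
    {k k' : Config ι → R3 → ℝ} {L L' : L2 ι →L[ℂ] L2 ι} (hL : P.IsKernelOp k L)
    (hL' : P'.IsKernelOp k' L') (e : Equiv.Perm ι)
    (hmv : ∀ x v, relabel e (P.mv x v) = P'.mv (relabel e x) v)
    (hk : ∀ x v, k x v = k' (relabel e x) v) (ζ : L2 ι) :
    L (permL2 e ζ) = permL2 e (L' ζ) := by
  refine Lp.ext ?_
  filter_upwards [hL (permL2 e ζ), P.ae_ae_mv (permL2_ae e ζ), permL2_ae e (L' ζ),
    (relabel e).measurePreserving.quasiMeasurePreserving.ae (hL' ζ)] with x h1 h2 h3 h4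
  rw [h1.2, h3, h4.2]
  refine integral_congr_ae ?_
  filter_upwards [h2] with v hv
  rw [hv, hmv, hk]

variable {n : ℕ} {t : ℝ}

theorem exists_linkOps (ht : 0 < t) : ∃ V K : Link n → L2 (Option (Fin n)) →L[ℂ] L2 (Option (Fin n)),
    (∀ y, (linkFrame ht y).base.IsKernelOp ((linkFrame ht y).base.relKer PairFrame.coulKer) (V y)) ∧
    ∀ y, (linkFrame ht y).IsKernelOp ((linkFrame ht y).relKer (linkFrame ht y).denKer) (K y) := by
  choose V hV using fun y : Link n => ((linkFrame ht y).base.isPairKernel_coulKer).exists_op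
  choose K hK using fun y : Link n => ((linkFrame ht y).isPairKernel_denKer).exists_op
  exact ⟨V, K, hV, hK⟩

theorem linkScale_linkPerm (σ : Equiv.Perm (Fin n)) (y : Link n) :
    linkScale (linkPerm σ y) = linkScale y := by
  rcases y with a | p <;> rfl

theorem sym_linkFrame_relabel (ht : 0 < t) (σ : Equiv.Perm (Fin n)) (y : Link n)
    (X : Config (Option (Fin n))) :
    (linkFrame ht (linkPerm σ y)).sym (relabel (chargePerm σ) X) = (linkFrame ht y).sym X := by
  rw [sym_linkFrame, sym_linkFrame, chargeEnergy_relabel, linkScale_linkPerm]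

theorem linkOp_comp_perm (ht : 0 < t) {K : Link n → L2 (Option (Fin n)) →L[ℂ] L2 (Option (Fin n))}
    (hK : ∀ y, (linkFrame ht y).IsKernelOp ((linkFrame ht y).relKer (linkFrame ht y).denKer) (K y))
    (σ : Equiv.Perm (Fin n)) (y : Link n) (ζ : L2 (Option (Fin n))) :
    K y (permL2 (chargePerm σ) ζ) = permL2 (chargePerm σ) (K (linkPerm σ y) ζ) := by
  refine (hK y).comp_relabel (hK _) _ (relabel_mv ht σ y) (fun x v => ?_) ζ
  rw [PairFrame.relKer, PairFrame.relKer, PairFrame.denKer, PairFrame.denKer, den_relabel,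
    ← relabel_mv, sym_linkFrame_relabel]

theorem linkOp_base_comp_perm (ht : 0 < t)
    {V : Link n → L2 (Option (Fin n)) →L[ℂ] L2 (Option (Fin n))}
    (hV : ∀ y, (linkFrame ht y).base.IsKernelOp
      ((linkFrame ht y).base.relKer PairFrame.coulKer) (V y))
    (σ : Equiv.Perm (Fin n)) (y : Link n) (ζ : L2 (Option (Fin n))) :
    V y (permL2 (chargePerm σ) ζ) = permL2 (chargePerm σ) (V (linkPerm σ y) ζ) := by
  have hmv : ∀ (x : Config (Option (Fin n))) v, relabel (chargePerm σ) ((linkFrame ht y).base.mv x v) =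
      (linkFrame ht (linkPerm σ y)).base.mv (relabel (chargePerm σ) x) v := fun x v => by
    rw [PairFrame.base_mv, PairFrame.base_mv, map_add, relabel_ι]
  refine (hV y).comp_relabel (hV _) _ hmv (fun x v => ?_) ζ
  rw [PairFrame.relKer, PairFrame.relKer, ← hmv, PairFrame.base_sym, PairFrame.base_sym,
    sym_linkFrame_relabel]
  rfl

theorem linkSum_comp_perm {M : Link n → L2 (Option (Fin n)) →L[ℂ] L2 (Option (Fin n))}
    {σ : Equiv.Perm (Fin n)}
    (hM : ∀ y ζ, M y (permL2 (chargePerm σ) ζ) = permL2 (chargePerm σ) (M (linkPerm σ y) ζ))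
    (ζ : L2 (Option (Fin n))) :
    (∑ y, (linkCoef y : ℂ) • M y) (permL2 (chargePerm σ) ζ) =
      permL2 (chargePerm σ) ((∑ y, (linkCoef y : ℂ) • M y) ζ) := by
  simp only [_root_.sum_apply, _root_.smul_apply, hM, map_sum, map_smul]
  rw [← Equiv.sum_comp (linkPerm σ) (fun y => (linkCoef y : ℂ) • permL2 (chargePerm σ) (M y ζ))]
  simp only [linkCoef_linkPerm]

theorem chargeEnergy_ge (X : Config (Option (Fin n))) : t / 2 ≤ chargeEnergy t X := by
  unfold chargeEnergy
  have : 0 ≤ 1 / 4 * ‖X none‖ ^ 2 + 1 / 2 * ∑ k, ‖X (some k)‖ ^ 2 := by positivity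
  linarith

theorem continuous_chargeEnergy : Continuous (chargeEnergy t : Config (Option (Fin n)) → ℝ) := by
  unfold chargeEnergy; fun_prop

/-- The inverse of the square root of the kinetic energy, in momentum space. -/
theorem exists_invSqrtEnergy (ht : 0 < t) :
    ∃ J : L2 (Option (Fin n)) →L[ℂ] L2 (Option (Fin n)),
      (∀ f, ∀ᵐ x, J f x = ((1 / √(chargeEnergy t x) : ℝ) : ℂ) * f x) ∧
      (∀ f g, inner ℂ (J f) g = inner ℂ f (J g)) ∧
      (∀ f, 0 ≤ (inner ℂ f (J f)).re) ∧
      (∀ f, ‖J f‖ ^ 2 ≤ 1 / √(t / 2) * (inner ℂ f (J f)).re) ∧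
      (∀ f, ‖J f‖ ≤ 1 / √(t / 2) * ‖f‖) ∧ (∀ f, J f = 0 → f = 0) ∧
      ∀ σ f, J (permL2 (chargePerm σ) f) = permL2 (chargePerm σ) (J f) := by
  have hle : ∀ x : Config (Option (Fin n)), 1 / √(chargeEnergy t x) ≤ 1 / √(t / 2) := fun x =>
    one_div_le_one_div_of_le (Real.sqrt_pos.2 (by positivity)) (Real.sqrt_le_sqrt (chargeEnergy_ge x))
  have hpos : ∀ x : Config (Option (Fin n)), 0 < 1 / √(chargeEnergy t x) := fun x =>
    one_div_pos.2 (Real.sqrt_pos.2 (chargeEnergy_pos x ht))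
  obtain ⟨J, hJ, hJb⟩ := exists_mulOp (E := Config (Option (Fin n)))
    (m := fun x => ((1 / √(chargeEnergy t x) : ℝ) : ℂ)) (C := 1 / √(t / 2))
    (Complex.measurable_ofReal.comp (by
      have := (continuous_chargeEnergy (n := n) (t := t)).measurable
      fun_prop))
    (Eventually.of_forall fun x => by
      rw [Complex.norm_real, Real.norm_of_nonneg (hpos x).le]; exact hle x)
  have hre : ∀ f g : L2 (Option (Fin n)), (inner ℂ f (J g)) =
      ∫ x, ((1 / √(chargeEnergy t x) : ℝ) : ℂ) * (starRingEnd ℂ (f x) * g x) := by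
    intro f g
    rw [PairFrame.inner_Lp_eq]
    refine integral_congr_ae ?_
    filter_upwards [hJ g] with x hx
    rw [hx]; ring
  have hreal : ∀ f : L2 (Option (Fin n)), (inner ℂ f (J f)).re =
      ∫ x, 1 / √(chargeEnergy t x) * ‖f x‖ ^ 2 := by
    intro f
    rw [hre]
    have : ∀ x, ((1 / √(chargeEnergy t x) : ℝ) : ℂ) * (starRingEnd ℂ (f x) * f x) =
        ((1 / √(chargeEnergy t x) * ‖f x‖ ^ 2 : ℝ) : ℂ) := fun x => by
      rw [RCLike.conj_mul]; push_cast; rfl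
    simp only [this, integral_complex_ofReal, Complex.ofReal_re]
  have hnorm : ∀ f : L2 (Option (Fin n)), ‖f‖ ^ 2 = ∫ x, ‖f x‖ ^ 2 := by
    intro f
    rw [← inner_self_eq_norm_sq (𝕜 := ℂ), PairFrame.inner_Lp_eq]
    have : ∀ x, (starRingEnd ℂ (f x) * f x) = ((‖f x‖ ^ 2 : ℝ) : ℂ) := fun x => by
      rw [RCLike.conj_mul]; push_cast; rfl
    simp only [this, integral_complex_ofReal]
    exact Complex.ofReal_re _
  have hint : ∀ f : L2 (Option (Fin n)), Integrable fun x => ‖f x‖ ^ 2 := fun f => by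
    refine (PairFrame.integrable_conj_mul f f).norm.congr (Eventually.of_forall fun x => ?_)
    simp [sq]
  have hint2 : ∀ f : L2 (Option (Fin n)), Integrable fun x => 1 / √(chargeEnergy t x) * ‖f x‖ ^ 2 :=
    fun f => (hint f).bdd_mul (c := 1 / √(t / 2))
      (Measurable.aestronglyMeasurable (by
        have := (continuous_chargeEnergy (n := n) (t := t)).measurable
        fun_prop))
      (Eventually.of_forall fun x => by rw [Real.norm_of_nonneg (hpos x).le]; exact hle x)
  refine ⟨J, hJ, fun f g => ?_, fun f => ?_, fun f => ?_, fun f => ?_, fun f hf => ?_, fun σ f => ?_⟩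
  · rw [hre, ← inner_conj_symm, hre, ← integral_conj]
    refine integral_congr_ae (Eventually.of_forall fun x => ?_)
    simp only [map_mul, Complex.conj_conj, Complex.conj_ofReal]
    ring
  · rw [hreal]
    exact integral_nonneg fun x => mul_nonneg (hpos x).le (sq_nonneg _)
  · rw [hreal, hnorm, ← integral_const_mul]
    refine integral_mono_ae (hint _) ((hint2 f).const_mul _) ?_
    filter_upwards [hJ f] with x hx
    rw [hx, norm_mul, Complex.norm_real, Real.norm_of_nonneg (hpos x).le, mul_pow, sq, ← mul_assoc]
    have := hle x
    have := (hpos x).le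
    gcongr
  · refine (hJb f).trans (le_of_eq ?_)
    rw [max_eq_left (by positivity)]
  · refine (Lp.eq_zero_iff_ae_eq_zero).2 ?_
    have h0 := Lp.eq_zero_iff_ae_eq_zero.1 hf
    filter_upwards [hJ f, h0] with x h1 h2
    rw [h2] at h1
    have h3 : ((1 / √(chargeEnergy t x) : ℝ) : ℂ) ≠ 0 := by exact_mod_cast (hpos x).ne'
    exact (mul_eq_zero.1 h1.symm).resolve_left h3
  · refine Lp.ext ?_
    filter_upwards [hJ (permL2 (chargePerm σ) f), permL2_ae (chargePerm σ) f,
      permL2_ae (chargePerm σ) (J f),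
      (relabel (chargePerm σ)).measurePreserving.quasiMeasurePreserving.ae (hJ f)] with x h1 h2 h3 h4
    rw [h1, h2, h3, h4, chargeEnergy_relabel]

end

section

theorem Lp_coeFn_sum {α ι : Type*} [MeasurableSpace α] {μ : Measure α} (s : Finset ι)
    (f : ι → Lp ℂ 2 μ) : ∀ᵐ x ∂μ, (∑ i ∈ s, f i : Lp ℂ 2 μ) x = ∑ i ∈ s, f i x := by
  classical
  induction s using Finset.induction_on with
  | empty =>
    simp only [Finset.sum_empty]
    exact Lp.coeFn_zero ℂ 2 μ
  | insert i s hi ih =>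
    rw [Finset.sum_insert hi]
    filter_upwards [ih, Lp.coeFn_add (f i) (∑ i ∈ s, f i)] with x h1 h2
    rw [h2, Finset.sum_insert hi, Pi.add_apply, h1]

/-- The constant in the lower bound of the form of the boundary operator. -/
noncomputable def gap (n : ℕ) (γ : ℝ) : ℝ :=
  1 - max 0 (1 - γ / 2) * symConst * ∑ y : Link n, linkCoef y

/-- This is where `γ > γ_c` enters: with `π³` in place of `symConst < π³`, the inequality `0 < gap`
would be equivalent to it. -/
theorem gap_pos {N : ℕ} (hN : 3 ≤ N) {γ : ℝ} (hγ : gammaCrit N < γ) : 0 < gap (N - 2) γ := by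
  have hpi := Real.pi_pos
  have hs3 : 0 < √3 := by positivity
  have h33 : √3 * √3 = 3 := Real.mul_self_sqrt (by norm_num)
  have hn : ((N - 2 : ℕ) : ℝ) = N - 2 := by rw [Nat.cast_sub (by omega)]; norm_num
  have hN' : (3 : ℝ) ≤ N := by exact_mod_cast hN
  have hsc := symConst_lt
  have hsc0 : 0 ≤ symConst := by unfold symConst; positivity
  rw [gap, sum_linkCoef, hn]
  set m : ℝ := N - 2 with hm
  have hm1 : 1 ≤ m := by rw [hm]; linarith
  have hm3 : (N : ℝ) - 3 = m - 1 := by rw [hm]; ring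
  have hS : 2 / √3 * m + m * (m - 1) / 4 = m * (8 + √3 * (m - 1)) / (4 * √3) := by
    field_simp
    ring
  have hden : 0 < m * (8 + √3 * (m - 1)) := by
    have : 0 ≤ √3 * (m - 1) := mul_nonneg hs3.le (by linarith)
    positivity
  rcases le_total (1 - γ / 2) 0 with h | h
  · rw [max_eq_left h]; norm_num
  rw [max_eq_right h, hS]
  have hcrit : 1 - γ / 2 < 4 * √3 / (π * (m * (8 + √3 * (m - 1)))) := by
    rw [gammaCrit, hm3] at hγ
    have e : 8 * √3 / (π * m * (8 + √3 * (m - 1))) =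
        2 * (4 * √3 / (π * (m * (8 + √3 * (m - 1))))) := by
      field_simp; ring
    rw [e] at hγ
    linarith
  have h1 : (1 - γ / 2) * symConst * (1 / π ^ 2 * (m * (8 + √3 * (m - 1)) / (4 * √3))) <
      4 * √3 / (π * (m * (8 + √3 * (m - 1)))) * π ^ 3 *
        (1 / π ^ 2 * (m * (8 + √3 * (m - 1)) / (4 * √3))) := by
    refine mul_lt_mul_of_pos_right ?_ (by positivity)
    exact mul_lt_mul'' hcrit hsc h hsc0
  have h2 : 4 * √3 / (π * (m * (8 + √3 * (m - 1)))) * π ^ 3 *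
        (1 / π ^ 2 * (m * (8 + √3 * (m - 1)) / (4 * √3))) = 1 := by
    have hq : 8 + √3 * (m - 1) ≠ 0 := by
      have : 0 ≤ √3 * (m - 1) := mul_nonneg hs3.le (by linarith)
      positivity
    field_simp
  linarith

theorem gammaCrit_nonneg {N : ℕ} (hN : 3 ≤ N) : 0 ≤ gammaCrit N := by
  have hpi := Real.pi_gt_three
  have hs3 : √3 ≤ 2 := by rw [Real.sqrt_le_left (by norm_num)]; norm_num
  have hs30 : 0 < √3 := by positivity
  have hN' : (3 : ℝ) ≤ N := by exact_mod_cast hN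
  have h1 : 8 ≤ 8 + √3 * ((N : ℝ) - 3) := by
    have := mul_nonneg hs30.le (sub_nonneg.2 hN')
    linarith
  have h2 : 24 ≤ π * ((N : ℝ) - 2) * (8 + √3 * ((N : ℝ) - 3)) := by
    have : 3 ≤ π * ((N : ℝ) - 2) := by nlinarith
    nlinarith
  rw [gammaCrit, sub_nonneg, div_le_iff₀ (by linarith)]
  linarith

section

variable {N : ℕ} {t : ℝ}

/-- The Fourier transform of the charges, as a unitary map. -/
noncomputable abbrev chargeFourier (N : ℕ) : L2 (ChargeIdx N) ≃ₗᵢ[ℂ] L2 (ChargeIdx N) :=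
  Lp.fourierTransformₗᵢ (Config (ChargeIdx N)) ℂ

/-- `L` is the operator in position space that acts as `M` in momentum space. -/
def IsFourierConj (L M : L2 (ChargeIdx N) →L[ℂ] L2 (ChargeIdx N)) : Prop :=
  ∀ ζ, (𝓕 (L ζ) : L2 (ChargeIdx N)) = M (𝓕 ζ)

theorem exists_isFourierConj (M : L2 (ChargeIdx N) →L[ℂ] L2 (ChargeIdx N)) :
    ∃ L, IsFourierConj L M :=
  ⟨((chargeFourier N).symm.toContinuousLinearEquiv : L2 (ChargeIdx N) →L[ℂ] L2 (ChargeIdx N)) ∘L M ∘L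
    ((chargeFourier N).toContinuousLinearEquiv : L2 (ChargeIdx N) →L[ℂ] L2 (ChargeIdx N)),
    fun _ => (chargeFourier N).apply_symm_apply _⟩

theorem fourier_injective {u v : L2 (ChargeIdx N)} (h : (𝓕 u : L2 (ChargeIdx N)) = 𝓕 v) : u = v :=
  (chargeFourier N).injective h

namespace IsFourierConj

variable {L M L' M' : L2 (ChargeIdx N) →L[ℂ] L2 (ChargeIdx N)}

theorem inner_right (h : IsFourierConj L M) (x ζ : L2 (ChargeIdx N)) :
    inner ℂ x (L ζ) = inner ℂ (𝓕 x : L2 (ChargeIdx N)) (M (𝓕 ζ)) := by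
  rw [← Lp.inner_fourier_eq, h]

theorem comp_perm (h : IsFourierConj L M) {e : Equiv.Perm (ChargeIdx N)}
    (hM : ∀ ζ, M (permL2 e ζ) = permL2 e (M ζ)) (ζ : L2 (ChargeIdx N)) :
    L (permL2 e ζ) = permL2 e (L ζ) := by
  refine fourier_injective ?_
  rw [h, fourier_permL2, hM, fourier_permL2, h]

theorem norm_eq (h : IsFourierConj L M) (ζ : L2 (ChargeIdx N)) : ‖L ζ‖ = ‖M (𝓕 ζ)‖ := by
  rw [← Lp.norm_fourier_eq, h]

theorem symm (h : IsFourierConj L M) (h' : IsFourierConj L' M')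
    (hM : ∀ f g, inner ℂ (M f) (M' g) = inner ℂ (M' f) (M g)) (f g : L2 (ChargeIdx N)) :
    inner ℂ (L f) (L' g) = inner ℂ (L' f) (L g) := by
  rw [← Lp.inner_fourier_eq, h, h', hM, ← Lp.inner_fourier_eq (L' f), h, h']

end IsFourierConj

theorem re_inner_sum_smul {n : ℕ} (c : Link n → ℝ)
    (W : Link n → L2 (Option (Fin n)) →L[ℂ] L2 (Option (Fin n))) (ζ : L2 (Option (Fin n))) :
    (inner ℂ ζ ((∑ y, (c y : ℂ) • W y) ζ)).re = ∑ y, c y * (inner ℂ ζ (W y ζ)).re := by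
  simp only [_root_.sum_apply, _root_.smul_apply, inner_sum, inner_smul_right, Complex.re_sum,
    Complex.re_ofReal_mul]

/-- The bounds for the pairs, summed over the links. -/
theorem re_inner_linkSum_ge {n : ℕ} (ht : 0 < t)
    {V K : Link n → L2 (Option (Fin n)) →L[ℂ] L2 (Option (Fin n))}
    (hV : ∀ y, (linkFrame ht y).base.IsKernelOp
      ((linkFrame ht y).base.relKer PairFrame.coulKer) (V y))
    (hK : ∀ y, (linkFrame ht y).IsKernelOp ((linkFrame ht y).relKer (linkFrame ht y).denKer) (K y))
    {γ : ℝ} (hγ : 0 ≤ γ) (ζ : L2 (Option (Fin n))) :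
    gap n γ * ‖ζ‖ ^ 2 ≤ γ / 2 * (inner ℂ ζ ((∑ y, (linkCoef y : ℂ) • V y) ζ)).re +
      (‖ζ‖ ^ 2 - (inner ℂ ζ ((∑ y, (linkCoef y : ℂ) • K y) ζ)).re) := by
  have h2 : ∀ y : Link n, linkCoef y * (-(max 0 (1 - γ / 2) * symConst * ‖ζ‖ ^ 2)) ≤
      linkCoef y * (γ / 2 * (inner ℂ ζ (V y ζ)).re - (inner ℂ ζ (K y ζ)).re) := fun y =>
    mul_le_mul_of_nonneg_left
      (PairFrame.re_inner_pair_ge (hV y) (hK y) (by positivity) ζ) (linkCoef_nonneg y)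
  have h3 := Finset.sum_le_sum fun y (_ : y ∈ Finset.univ) => h2 y
  have e3 : ∑ y, linkCoef y * (γ / 2 * (inner ℂ ζ (V y ζ)).re - (inner ℂ ζ (K y ζ)).re) =
      γ / 2 * ∑ y, linkCoef y * (inner ℂ ζ (V y ζ)).re -
        ∑ y, linkCoef y * (inner ℂ ζ (K y ζ)).re := by
    rw [Finset.mul_sum, ← Finset.sum_sub_distrib]
    exact Finset.sum_congr rfl fun y _ => by ring
  rw [← Finset.sum_mul, e3] at h3
  rw [re_inner_sum_smul, re_inner_sum_smul, gap]
  linarith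

set_option maxHeartbeats 1000000 in
/-- The operator `A + Γ`, factored through the inverse square root `J` of the kinetic energy:
`Lₐ = A J` and `L_g = Γ J` are bounded. -/
theorem exists_boundary_ops (α γ : ℝ) (hγ : 0 ≤ γ) (θ : ℝ → ℝ) {B : Config (ChargeIdx N) → ℝ} {C : ℝ}
    (hBm : Measurable B) (hC : 0 ≤ C) (hBC : ∀ X, |B X| ≤ C)
    (hBσ : ∀ σ X, B (relabel (chargePerm σ) X) = B X)
    (hB : ∀ᵐ X, coefA α γ θ X =
      B X + γ * ∑ y : Link (N - 2), linkWeight y * (1 / ‖linkPos y X‖)) (ht : 0 < t) :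
    ∃ (J Lₐ L_g : L2 (ChargeIdx N) →L[ℂ] L2 (ChargeIdx N))
      (K : Link (N - 2) → L2 (ChargeIdx N) →L[ℂ] L2 (ChargeIdx N)),
      (∀ y, (linkFrame ht y).IsKernelOp ((linkFrame ht y).relKer (linkFrame ht y).denKer) (K y)) ∧
      (∀ ζ, ∀ᵐ x, (𝓕 (J ζ) : L2 (ChargeIdx N)) x =
        ((1 / √(chargeEnergy t x) : ℝ) : ℂ) * (𝓕 ζ : L2 (ChargeIdx N)) x) ∧
      (∀ ζ, ∀ᵐ X, Lₐ ζ X = (coefA α γ θ X : ℂ) * J ζ X) ∧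
      (∀ ζ, (𝓕 (L_g ζ) : L2 (ChargeIdx N)) = ((2 * π : ℝ) : ℂ) •
        (𝓕 ζ - ∑ y, (linkCoef y : ℂ) • K y (𝓕 ζ))) ∧
      (∀ ζ, J ζ = 0 → ζ = 0) ∧
      (∀ x y, inner ℂ (Lₐ x + L_g x) (J y) = inner ℂ (J x) (Lₐ y + L_g y)) ∧
      (∀ f, 0 ≤ (inner ℂ f (J f)).re) ∧
      (∀ f, ‖J f‖ ^ 2 ≤ 1 / √(t / 2) * (inner ℂ f (J f)).re) ∧
      (∀ f, ‖J f‖ ≤ 1 / √(t / 2) * ‖f‖) ∧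
      (∀ f, 2 * π * gap (N - 2) γ * ‖f‖ ^ 2 - C * ‖f‖ * ‖J f‖ ≤ (inner ℂ f (Lₐ f + L_g f)).re) ∧
      (∀ σ f, J (permL2 (chargePerm σ) f) = permL2 (chargePerm σ) (J f)) ∧
      (∀ σ f, Lₐ (permL2 (chargePerm σ) f) = permL2 (chargePerm σ) (Lₐ f)) ∧
      ∀ σ f, L_g (permL2 (chargePerm σ) f) = permL2 (chargePerm σ) (L_g f) := by
  -- In momentum space: `V` are the local and `K` the non-local terms of the links. In position space:
  -- `M` is the regular part of `A`.
  obtain ⟨V, K, hV, hK⟩ := exists_linkOps (n := N - 2) ht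
  obtain ⟨J, hJ, hJsa, hJpos, hJsq, hJb, hJ0, hJσ⟩ := exists_invSqrtEnergy (n := N - 2) ht
  obtain ⟨M, hM, hMb⟩ := exists_mulOp (E := Config (ChargeIdx N)) (m := fun X => (B X : ℂ)) (C := C)
    (Complex.measurable_ofReal.comp hBm)
    (Eventually.of_forall fun X => by rw [Complex.norm_real]; exact hBC X)
  have hMσ : ∀ σ f, M (permL2 (chargePerm σ) f) = permL2 (chargePerm σ) (M f) := fun σ f => by
    refine Lp.ext ?_
    filter_upwards [hM (permL2 (chargePerm σ) f), permL2_ae (chargePerm σ) f,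
      permL2_ae (chargePerm σ) (M f),
      (relabel (chargePerm σ)).measurePreserving.quasiMeasurePreserving.ae (hM f)] with x h1 h2 h3 h4
    rw [h1, h2, h3, h4, hBσ]
  have hMsa : ∀ f g, inner ℂ (M f) g = inner ℂ f (M g) := fun f g => by
    rw [PairFrame.inner_Lp_eq, PairFrame.inner_Lp_eq]
    refine integral_congr_ae ?_
    filter_upwards [hM f, hM g] with x h1 h2
    rw [h1, h2, map_mul, Complex.conj_ofReal]; ring
  obtain ⟨SV, hSV⟩ : ∃ S : L2 (ChargeIdx N) →L[ℂ] L2 (ChargeIdx N),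
    S = ∑ y, (linkCoef y : ℂ) • V y := ⟨_, rfl⟩
  obtain ⟨SK, hSK⟩ : ∃ S : L2 (ChargeIdx N) →L[ℂ] L2 (ChargeIdx N),
    S = ∑ y, (linkCoef y : ℂ) • K y := ⟨_, rfl⟩
  obtain ⟨JJ, hJJ⟩ := exists_isFourierConj J
  obtain ⟨LV, hLV⟩ := exists_isFourierConj (((2 * π * (γ / 2) : ℝ) : ℂ) • SV)
  obtain ⟨LG, hLG⟩ := exists_isFourierConj
    (((2 * π : ℝ) : ℂ) • (ContinuousLinearMap.id ℂ _ - SK))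
  obtain ⟨LA, hLA⟩ : ∃ S : L2 (ChargeIdx N) →L[ℂ] L2 (ChargeIdx N), ∀ ζ, S ζ = M (JJ ζ) + LV ζ :=
    ⟨M ∘L JJ + LV, fun ζ => rfl⟩
  have hJF : ∀ ζ, ∀ᵐ x, (𝓕 (JJ ζ) : L2 (ChargeIdx N)) x =
        ((1 / √(chargeEnergy t x) : ℝ) : ℂ) * (𝓕 ζ : L2 (ChargeIdx N)) x := fun ζ => by
    rw [hJJ]; exact hJ _
  have hscale : ∀ (y : Link (N - 2)) (f : L2 (ChargeIdx N)), ∀ᵐ x, J f x =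
      ((linkScale y / (linkFrame ht y).sym x : ℝ) : ℂ) * f x := fun y f => by
    filter_upwards [hJ f] with x hx
    rw [hx, sym_linkFrame]
    have := linkScale_pos y
    congr 2
    field_simp
  have hscale' : ∀ (y : Link (N - 2)) (f : L2 (ChargeIdx N)), ∀ᵐ x, J f x =
      ((linkScale y / (linkFrame ht y).base.sym x : ℝ) : ℂ) * f x := hscale
  have hVsym : ∀ f g, inner ℂ (SV f) (J g) = inner ℂ (J f) (SV g) := fun f g => by
    simp only [hSV, _root_.sum_apply, _root_.smul_apply, sum_inner, inner_sum, inner_smul_left,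
      inner_smul_right, Complex.conj_ofReal]
    refine Finset.sum_congr rfl fun y _ => ?_
    rw [(hV y).inner_symm ((linkFrame ht y).base.isPairKernel_coulKer) (hscale' y f) (hscale' y g)]
  have hKsym : ∀ f g, inner ℂ (SK f) (J g) = inner ℂ (J f) (SK g) := fun f g => by
    simp only [hSK, _root_.sum_apply, _root_.smul_apply, sum_inner, inner_sum, inner_smul_left,
      inner_smul_right, Complex.conj_ofReal]
    refine Finset.sum_congr rfl fun y _ => ?_
    rw [(hK y).inner_symm ((linkFrame ht y).isPairKernel_denKer) (hscale y f) (hscale y g)]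
  refine ⟨JJ, LA, LG, K, hK, hJF, fun ζ => ?_, fun ζ => ?_, fun ζ h => ?_, fun x y => ?_, fun f => ?_,
    fun f => ?_, fun f => ?_, fun f => ?_, fun σ f => ?_, fun σ f => ?_, fun σ f => ?_⟩
  · -- `Lₐ = A J`: the local terms act as multiplication by the Coulomb potentials.
    have hco : ∀ y : Link (N - 2), ∃ η : L2 (ChargeIdx N),
        (∀ᵐ X, η X = ((1 / ‖linkPos y X‖ : ℝ) : ℂ) * JJ ζ X) ∧
        (𝓕 η : L2 (ChargeIdx N)) =
          ((1 / π : ℝ) : ℂ) • V y ((linkScale y : ℂ) • (𝓕 ζ : L2 (ChargeIdx N))) := fun y => by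
      refine PairFrame.exists_coulomb (inner_link_ι ht y) (hV y) ?_
      filter_upwards [hJF ζ, Lp.coeFn_smul (linkScale y : ℂ) (𝓕 ζ : L2 (ChargeIdx N))] with x h1 h2
      have := Real.sqrt_pos.2 (chargeEnergy_pos x ht)
      have h3 : ((√(chargeEnergy t x) : ℝ) : ℂ) ≠ 0 := by exact_mod_cast this.ne'
      rw [h2, h1, sym_linkFrame, Pi.smul_apply, smul_eq_mul]
      push_cast
      field_simp
    choose η hη1 hη2 using hco
    have hsum : LV ζ = ∑ y, ((γ * linkWeight y : ℝ) : ℂ) • η y := by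
      refine fourier_injective ?_
      have hF : (𝓕 (∑ y, ((γ * linkWeight y : ℝ) : ℂ) • η y) : L2 (ChargeIdx N)) =
          ∑ y, ((γ * linkWeight y : ℝ) : ℂ) • (𝓕 (η y) : L2 (ChargeIdx N)) := by
        change chargeFourier N _ = ∑ y, _ • chargeFourier N (η y)
        rw [map_sum]; simp only [map_smul]
      rw [hF]
      rw [hLV, _root_.smul_apply]
      simp only [hSV, _root_.sum_apply, _root_.smul_apply, Finset.smul_sum]
      refine Finset.sum_congr rfl fun y _ => ?_
      rw [hη2, map_smul, smul_smul, smul_smul, smul_smul]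
      congr 1
      have := linkWeight_eq y
      norm_cast
      linear_combination γ * this
    have hη : ∀ᵐ X, (∑ y, ((γ * linkWeight y : ℝ) : ℂ) • η y : L2 (ChargeIdx N)) X =
        ∑ y, ((γ * linkWeight y : ℝ) : ℂ) * η y X := by
      filter_upwards [Lp_coeFn_sum Finset.univ fun y => ((γ * linkWeight y : ℝ) : ℂ) • η y,
        ae_all_iff.2 fun y => Lp.coeFn_smul ((γ * linkWeight y : ℝ) : ℂ) (η y)] with X h1 h2
      rw [h1]
      refine Finset.sum_congr rfl fun y _ => ?_
      rw [h2]; rfl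
    have hadd : LA ζ = M (JJ ζ) + ∑ y, ((γ * linkWeight y : ℝ) : ℂ) • η y := by
      rw [← hsum, hLA]
    rw [hadd]
    filter_upwards [hB, hM (JJ ζ), hη, ae_all_iff.2 hη1,
      Lp.coeFn_add (M (JJ ζ)) (∑ y, ((γ * linkWeight y : ℝ) : ℂ) • η y)] with X h1 h2 h3 h4 h5
    rw [h5, Pi.add_apply, h2, h3, h1]
    simp only [h4]
    push_cast
    rw [Finset.mul_sum, add_mul, Finset.sum_mul]
    congr 1
    refine Finset.sum_congr rfl fun y _ => ?_
    ring
  · rw [hLG, _root_.smul_apply, _root_.sub_apply, ContinuousLinearMap.id_apply, hSK]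
    simp only [_root_.sum_apply, _root_.smul_apply]
  · refine fourier_injective ?_
    have h1 : J (𝓕 ζ) = 0 := by
      rw [← hJJ]
      change chargeFourier N (JJ ζ) = 0
      rw [h, map_zero]
    have h2 : (𝓕 (0 : L2 (ChargeIdx N)) : L2 (ChargeIdx N)) = 0 := (chargeFourier N).map_zero
    rw [hJ0 _ h1, h2]
  · -- symmetry of `A + Γ`
    have h1 : inner ℂ (M (JJ x)) (JJ y) = inner ℂ (JJ x) (M (JJ y)) := hMsa _ _
    have h2 : inner ℂ (LV x) (JJ y) = inner ℂ (JJ x) (LV y) := hLV.symm hJJ (fun f g => by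
      rw [_root_.smul_apply, _root_.smul_apply, inner_smul_left, inner_smul_right,
        Complex.conj_ofReal, hVsym]) x y
    have h3 : inner ℂ (LG x) (JJ y) = inner ℂ (JJ x) (LG y) := hLG.symm hJJ (fun f g => by
      rw [_root_.smul_apply, _root_.smul_apply, inner_smul_left, inner_smul_right,
        Complex.conj_ofReal, _root_.sub_apply, _root_.sub_apply, inner_sub_left, inner_sub_right,
        hKsym, ContinuousLinearMap.id_apply, ContinuousLinearMap.id_apply, hJsa f g]) x y
    rw [hLA, hLA, inner_add_left, inner_add_left, inner_add_right, inner_add_right, h1, h2, h3]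
  · rw [hJJ.inner_right]; exact hJpos _
  · rw [hJJ.inner_right, hJJ.norm_eq]; exact hJsq _
  · rw [hJJ.norm_eq, ← Lp.norm_fourier_eq f]; exact hJb _
  · -- the lower bound, by `re_inner_linkSum_ge` and the bound of `M`
    obtain ⟨ζ, hζ⟩ : ∃ ζ : L2 (ChargeIdx N), ζ = 𝓕 f := ⟨_, rfl⟩
    have hnorm : ‖f‖ = ‖ζ‖ := by rw [hζ, Lp.norm_fourier_eq]
    have e1 : (inner ℂ f (LV f)).re = 2 * π * (γ / 2) * (inner ℂ ζ (SV ζ)).re := by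
      rw [hLV.inner_right, ← hζ, _root_.smul_apply, inner_smul_right, Complex.re_ofReal_mul]
    have e2 : (inner ℂ f (LG f)).re = 2 * π * (‖ζ‖ ^ 2 - (inner ℂ ζ (SK ζ)).re) := by
      rw [hLG.inner_right, ← hζ, _root_.smul_apply, inner_smul_right, Complex.re_ofReal_mul,
        _root_.sub_apply, ContinuousLinearMap.id_apply, inner_sub_right, Complex.sub_re]
      congr 2
      exact inner_self_eq_norm_sq (𝕜 := ℂ) ζ
    have h3 := re_inner_linkSum_ge ht hV hK hγ ζ
    rw [← hSV, ← hSK] at h3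
    have h4 : -(C * ‖f‖ * ‖JJ f‖) ≤ (inner ℂ f (M (JJ f))).re := by
      have a1 := Complex.abs_re_le_norm (inner ℂ f (M (JJ f)))
      have a2 := norm_inner_le_norm (𝕜 := ℂ) f (M (JJ f))
      have a3 := hMb (JJ f)
      rw [max_eq_left hC] at a3
      have a4 : ‖f‖ * ‖M (JJ f)‖ ≤ ‖f‖ * (C * ‖JJ f‖) := by gcongr
      have a5 := (abs_le.1 (a1.trans (a2.trans a4))).1
      linarith
    have h5 := mul_le_mul_of_nonneg_left h3 (by positivity : (0 : ℝ) ≤ 2 * π)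
    rw [inner_add_right, hLA, inner_add_right, Complex.add_re, Complex.add_re, e1, e2]
    rw [← hnorm] at h5 ⊢
    linarith
  · exact hJJ.comp_perm (hJσ σ) f
  · -- covariance under the permutations, which permute the links
    have e1 : LV (permL2 (chargePerm σ) f) = permL2 (chargePerm σ) (LV f) := by
      refine hLV.comp_perm (fun ζ => ?_) f
      rw [_root_.smul_apply, _root_.smul_apply, map_smul, hSV]
      congr 1
      exact linkSum_comp_perm (linkOp_base_comp_perm ht hV σ) ζ
    rw [hLA, hLA, e1, map_add, ← hMσ, hJJ.comp_perm (hJσ σ)]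
  · refine hLG.comp_perm (fun ζ => ?_) f
    rw [_root_.smul_apply, _root_.smul_apply, map_smul, _root_.sub_apply, _root_.sub_apply, map_sub,
      hSK]
    congr 2
    exact linkSum_comp_perm (linkOp_comp_perm ht hK σ) ζ

end

end

section

/-! ### The operators `Γ` -/

section

variable {N : ℕ} {t : ℝ}

theorem integrable_comp_affine (g : R3 → ℂ) (c : R3) {ε : ℝ} (hε : ε = 1 ∨ ε = -1) :
    Integrable (fun v => g (c + ε • v)) ↔ Integrable g := by
  rcases hε with rfl | rfl
  · simp only [one_smul]
    exact (measurePreserving_add_left (volume : Measure R3) c).integrable_comp_emb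
      (measurableEmbedding_addLeft c) (g := g)
  · simp only [neg_smul, one_smul, ← sub_eq_add_neg]
    exact integrable_comp_sub_left g c

theorem integral_comp_affine (g : R3 → ℂ) (c : R3) {ε : ℝ} (hε : ε = 1 ∨ ε = -1) :
    ∫ v, g (c + ε • v) = ∫ v, g v := by
  rcases hε with rfl | rfl
  · simp only [one_smul]
    exact integral_add_left_eq_self g c
  · simp only [neg_smul, one_smul, ← sub_eq_add_neg]
    exact integral_sub_left_eq_self g volume c

theorem IsCoupling.integral_eq {ht : 0 < t} {i j l m : Fin N} {y : Link (N - 2)}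
    (h : IsCoupling ht i j l m y) {K : L2 (ChargeIdx N) →L[ℂ] L2 (ChargeIdx N)}
    (hK : (linkFrame ht y).IsKernelOp ((linkFrame ht y).relKer (linkFrame ht y).denKer) K)
    {f ζ : L2 (ChargeIdx N)} (hf : ∀ᵐ x, f x = ((1 / √(chargeEnergy t x) : ℝ) : ℂ) * ζ x)
    (hfσ : ∀ σ : Equiv.Perm (Fin (N - 2)), ∀ᵐ x, f (relabel (chargePerm σ) x) = f x) :
    ∀ᵐ κ, Integrable (fun q => f (contract l m (split i j κ q)) / ((‖split i j κ q‖ ^ 2 + t : ℝ) : ℂ)) ∧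
      ∫ q, f (contract l m (split i j κ q)) / ((‖split i j κ q‖ ^ 2 + t : ℝ) : ℂ) =
        (linkScale y / 2 : ℝ) * K ζ κ := by
  obtain ⟨σ, ε, c, hε, h⟩ := h
  filter_upwards [hK ζ, (linkFrame ht y).ae_ae_mv hf, (linkFrame ht y).ae_ae_mv (hfσ σ)]
    with κ h1 h2 h3
  set g : R3 → ℂ := fun q =>
    f (contract l m (split i j κ q)) / ((‖split i j κ q‖ ^ 2 + t : ℝ) : ℂ) with hg
  have e : (fun v => g (c κ + ε • v)) =ᵐ[volume] fun v => ((linkScale y / 2 : ℝ) : ℂ) *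
      (((linkFrame ht y).relKer (linkFrame ht y).denKer κ v : ℂ) * ζ ((linkFrame ht y).mv κ v)) := by
    filter_upwards [h2, h3] with v hv1 hv2
    simp only [hg]
    rw [(h κ v).1, (h κ v).2, hv2, hv1, PairFrame.relKer, PairFrame.denKer, sym_linkFrame]
    have a1 : (linkScale y : ℂ) ≠ 0 := by exact_mod_cast (linkScale_pos y).ne'
    have a2 : ((√(chargeEnergy t ((linkFrame ht y).mv κ v)) : ℝ) : ℂ) ≠ 0 := by
      exact_mod_cast (Real.sqrt_pos.2 (chargeEnergy_pos _ ht)).ne'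
    have a3 : ((linkFrame ht y).den κ v : ℂ) ≠ 0 := by
      exact_mod_cast ((linkFrame ht y).den_pos κ v).ne'
    push_cast
    field_simp
  refine ⟨(integrable_comp_affine g (c κ) hε).1 ((h1.1.const_mul _).congr e.symm), ?_⟩
  rw [← integral_comp_affine g (c κ) hε, integral_congr_ae e, integral_const_mul, h1.2]

/-- The factor in `f̂(p) = c (𝓕 f)(p / 2π)`. -/
noncomputable def hatConst (ι : Type) [Fintype ι] : ℂ :=
  (((2 * π) ^ (-(3 * (Fintype.card ι : ℝ)) / 2) : ℝ) : ℂ)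

theorem hat_eq {ι : Type} [Fintype ι] (f : L2 ι) (p : Config ι) :
    hat f p = hatConst ι * (𝓕 f : L2 ι) ((2 * π)⁻¹ • p) := rfl

theorem hatConst_ne_zero (ι : Type) [Fintype ι] : hatConst ι ≠ 0 := by
  unfold hatConst
  have : 0 < (2 * π) ^ (-(3 * (Fintype.card ι : ℝ)) / 2) := by positivity
  exact_mod_cast this.ne'

theorem split_smul {i j : Fin N} (hij : i ≠ j) (s : ℝ) (κ : Config (ChargeIdx N)) (q : R3) :
    split i j (s • κ) (s • q) = s • split i j κ q := by
  refine config_ext fun m => ?_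
  rcases eq_or_eq_others hij m with rfl | rfl | ⟨k, rfl⟩ <;>
    simp [split, merge_left, merge_right hij, merge_others hij, smul_sub]

theorem contract_smul (i j : Fin N) (s : ℝ) (p : Config (Fin N)) :
    contract i j (s • p) = s • contract i j p := by
  rw [← contractCLM_apply, ← contractCLM_apply, map_smul]

/-- The squared mass that corresponds to `lam` for the Fourier transform `𝓕`. -/
noncomputable def massOf (lam : ℝ) : ℝ := lam / (2 * π) ^ 2

theorem massOf_pos {lam : ℝ} (h : 0 < lam) : 0 < massOf lam := by
  unfold massOf; positivity

theorem gammaIntegrand_eq {lam : ℝ} {i j : Fin N} (hij : i ≠ j) (l m : Fin N) (ξ : ChargeSpace N)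
    (κ : Config (ChargeIdx N)) (q : R3) :
    gammaIntegrand lam i j l m ξ κ q = hatConst (ChargeIdx N) / ((2 * π : ℝ) : ℂ) ^ 2 *
      ((𝓕 (ξ : L2 (ChargeIdx N)) : L2 (ChargeIdx N))
          (contract l m (split i j ((2 * π)⁻¹ • κ) ((2 * π)⁻¹ • q))) /
        ((‖split i j ((2 * π)⁻¹ • κ) ((2 * π)⁻¹ • q)‖ ^ 2 + massOf lam : ℝ) : ℂ)) := by
  rw [gammaIntegrand, hat_eq, split_smul hij, contract_smul, norm_smul, mul_pow, massOf]
  have h2 : (0 : ℝ) < 2 * π := by positivity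
  rw [Real.norm_of_nonneg (by positivity)]
  have : ((2 * π)⁻¹ ^ 2 * ‖split i j κ q‖ ^ 2 + lam / (2 * π) ^ 2 : ℝ) =
      (‖split i j κ q‖ ^ 2 + lam) / (2 * π) ^ 2 := by
    field_simp
  rw [this]
  have h3 : ((2 * π : ℝ) : ℂ) ≠ 0 := by exact_mod_cast h2.ne'
  rw [Complex.ofReal_div, Complex.ofReal_pow]
  field_simp

theorem integrable_gammaIntegrand_iff {lam : ℝ} {i j : Fin N} (hij : i ≠ j) (l m : Fin N)
    (ξ : ChargeSpace N) (κ : Config (ChargeIdx N))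
    (h : Integrable fun q => (𝓕 (ξ : L2 (ChargeIdx N)) : L2 (ChargeIdx N))
          (contract l m (split i j ((2 * π)⁻¹ • κ) q)) /
        ((‖split i j ((2 * π)⁻¹ • κ) q‖ ^ 2 + massOf lam : ℝ) : ℂ)) :
    Integrable (gammaIntegrand lam i j l m ξ κ) := by
  have h2 : (2 * π)⁻¹ ≠ 0 := by positivity
  have := (integrable_comp_smul_iff volume _ h2).2 h
  refine (this.const_mul (hatConst (ChargeIdx N) / ((2 * π : ℝ) : ℂ) ^ 2)).congr
    (Eventually.of_forall fun q => ?_)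
  exact (gammaIntegrand_eq hij l m ξ κ q).symm

theorem integral_gammaIntegrand {lam : ℝ} {i j : Fin N} (hij : i ≠ j) (l m : Fin N)
    (ξ : ChargeSpace N) (κ : Config (ChargeIdx N)) :
    ∫ q, gammaIntegrand lam i j l m ξ κ q = hatConst (ChargeIdx N) * ((2 * π : ℝ) : ℂ) *
      ∫ q, (𝓕 (ξ : L2 (ChargeIdx N)) : L2 (ChargeIdx N))
          (contract l m (split i j ((2 * π)⁻¹ • κ) q)) /
        ((‖split i j ((2 * π)⁻¹ • κ) q‖ ^ 2 + massOf lam : ℝ) : ℂ) := by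
  have h2 : (0 : ℝ) < 2 * π := by positivity
  have h3 : ((2 * π : ℝ) : ℂ) ≠ 0 := by exact_mod_cast h2.ne'
  simp only [gammaIntegrand_eq hij]
  rw [integral_const_mul, Measure.integral_comp_inv_smul volume (fun q =>
    (𝓕 (ξ : L2 (ChargeIdx N)) : L2 (ChargeIdx N))
          (contract l m (split i j ((2 * π)⁻¹ • κ) q)) /
        ((‖split i j ((2 * π)⁻¹ • κ) q‖ ^ 2 + massOf lam : ℝ) : ℂ)) (2 * π)]
  have hd : Module.finrank ℝ R3 = 3 := by simp
  rw [hd, abs_of_pos (by positivity), Complex.real_smul, ← mul_assoc]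
  congr 1
  rw [Complex.ofReal_pow]
  field_simp

theorem sum_pairs_left {i j : Fin N} (hij : i ≠ j) (G : Fin N → ℂ) :
    (∑ l : Fin N, if l ≠ i ∧ l ≠ j then G l else 0) = ∑ a, G (others i j a) := by
  rw [sum_eq_others hij]
  simp [others_ne_left hij, others_ne_right hij]

theorem sum_pairs_others {i j : Fin N} (hij : i ≠ j) (G : Fin N → Fin N → ℂ) :
    (∑ l : Fin N, ∑ m : Fin N, if l < m ∧ l ≠ i ∧ l ≠ j ∧ m ≠ i ∧ m ≠ j then G l m else 0) =
      ∑ a, ∑ b, if a < b then G (others i j a) (others i j b) else 0 := by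
  rw [sum_eq_others hij]
  simp only [ne_eq, not_true_eq_false, false_and, and_false, if_false, Finset.sum_const_zero, zero_add]
  refine Finset.sum_congr rfl fun a _ => ?_
  rw [sum_eq_others hij]
  simp [others_ne_left hij, others_ne_right hij, (others_strictMono i j).lt_iff_lt]

theorem mem_chargeSpace_iff (u : L2 (ChargeIdx N)) :
    u ∈ invariantL2 (fun σ : Equiv.Perm (Fin (N - 2)) =>
      (Equiv.optionCongr σ : Equiv.Perm (ChargeIdx N))) ↔ ∀ σ : Equiv.Perm (Fin (N - 2)), permL2 (chargePerm σ) u = u := by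
  simp only [invariantL2, Submodule.mem_iInf]
  rfl

theorem mem_bosonSpace_iff (u : L2 (Fin N)) :
    u ∈ invariantL2 (fun σ : Equiv.Perm (Fin N) => σ) ↔ ∀ σ : Equiv.Perm (Fin N), permL2 σ u = u := by
  simp only [invariantL2, Submodule.mem_iInf]
  rfl

theorem fourier_charge_relabel (ξ : ChargeSpace N) (σ : Equiv.Perm (Fin (N - 2))) :
    ∀ᵐ x, (𝓕 (ξ : L2 (ChargeIdx N)) : L2 (ChargeIdx N)) (relabel (chargePerm σ) x) =
      (𝓕 (ξ : L2 (ChargeIdx N)) : L2 (ChargeIdx N)) x := by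
  have h := permL2_ae (chargePerm σ) (𝓕 (ξ : L2 (ChargeIdx N)) : L2 (ChargeIdx N))
  rw [← fourier_permL2, (mem_chargeSpace_iff _).1 ξ.2 σ] at h
  filter_upwards [h] with x hx
  exact hx.symm

/-- `Γ` in terms of the operators of the links. -/
theorem isGamma_of_fourier {lam : ℝ} (hlam : 0 < lam) {i j : Fin N} (hij : i ≠ j)
    {K : Link (N - 2) → L2 (ChargeIdx N) →L[ℂ] L2 (ChargeIdx N)}
    (hK : ∀ y, (linkFrame (massOf_pos hlam) y).IsKernelOp
      ((linkFrame (massOf_pos hlam) y).relKer (linkFrame (massOf_pos hlam) y).denKer) (K y))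
    (ξ η : ChargeSpace N) (ζ : L2 (ChargeIdx N))
    (hξ : ∀ᵐ x, (𝓕 (ξ : L2 (ChargeIdx N)) : L2 (ChargeIdx N)) x =
      ((1 / √(chargeEnergy (massOf lam) x) : ℝ) : ℂ) * ζ x)
    (hη : (𝓕 (η : L2 (ChargeIdx N)) : L2 (ChargeIdx N)) = ((2 * π : ℝ) : ℂ) •
        (ζ - ∑ y, (linkCoef y : ℂ) • K y ζ)) :
    IsGamma lam i j ξ η := by
  have ht := massOf_pos hlam
  have h2 : (0 : ℝ) < 2 * π := by positivity
  have hq : Measure.QuasiMeasurePreserving (fun κ : Config (ChargeIdx N) => (2 * π)⁻¹ • κ)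
      volume volume := Measure.quasiMeasurePreserving_smul volume (inv_ne_zero h2.ne')
  have hint : ∀ l m y, IsCoupling ht i j l m y → _ := fun l m y h =>
    hq.ae (h.integral_eq (hK y) hξ (fourier_charge_relabel ξ))
  have hI : ∀ᵐ κ : Config (ChargeIdx N), ∀ l m : Fin N, l ≠ m → ({l, m} : Finset (Fin N)) ≠ {i, j} →
      Integrable (gammaIntegrand lam i j l m ξ κ) := by
    refine ae_all_iff.2 fun l => ae_all_iff.2 fun m => ?_
    by_cases hlm : l ≠ m
    · by_cases h : ({l, m} : Finset (Fin N)) ≠ {i, j}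
      · obtain ⟨y, hy⟩ := exists_isCoupling ht hij hlm h
        filter_upwards [hint l m y hy] with κ hκ _ _
        exact integrable_gammaIntegrand_iff hij l m ξ κ hκ.1
      · exact Eventually.of_forall fun κ _ h' => absurd h' h
    · exact Eventually.of_forall fun κ h' => absurd h' hlm
  have hA : ∀ᵐ κ : Config (ChargeIdx N), ∀ a : Fin (N - 2),
      ∫ q, gammaIntegrand lam i j i (others i j a) ξ κ q =
        hatConst (ChargeIdx N) * ((2 * π : ℝ) : ℂ) *
          ((linkScale (.inl a : Link (N - 2)) / 2 : ℝ) * K (.inl a) ζ ((2 * π)⁻¹ • κ)) := by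
    refine ae_all_iff.2 fun a => ?_
    filter_upwards [hint i _ _ (isCoupling_left ht hij a)] with κ hκ
    rw [integral_gammaIntegrand hij, hκ.2]
  have hB : ∀ᵐ κ : Config (ChargeIdx N), ∀ p : {p : Fin (N - 2) × Fin (N - 2) // p.1 ≠ p.2},
      ∫ q, gammaIntegrand lam i j (others i j p.1.2) (others i j p.1.1) ξ κ q =
        hatConst (ChargeIdx N) * ((2 * π : ℝ) : ℂ) *
          ((1 / 2 : ℝ) * K (.inr p) ζ ((2 * π)⁻¹ • κ)) := by
    refine ae_all_iff.2 fun p => ?_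
    filter_upwards [hint _ _ _ (isCoupling_others ht hij p.2).symm] with κ hκ
    rw [integral_gammaIntegrand hij, hκ.2]
    rfl
  have hηx : ∀ᵐ x, (𝓕 (η : L2 (ChargeIdx N)) : L2 (ChargeIdx N)) x = ((2 * π : ℝ) : ℂ) *
      (ζ x - ∑ y, (linkCoef y : ℂ) * K y ζ x) := by
    rw [hη]
    filter_upwards [Lp.coeFn_smul ((2 * π : ℝ) : ℂ) (ζ - ∑ y, (linkCoef y : ℂ) • K y ζ),
      Lp.coeFn_sub ζ (∑ y, (linkCoef y : ℂ) • K y ζ),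
      Lp_coeFn_sum Finset.univ fun y => (linkCoef y : ℂ) • K y ζ,
      ae_all_iff.2 fun y => Lp.coeFn_smul (linkCoef y : ℂ) (K y ζ)] with x h1 h2 h3 h4
    rw [h1, Pi.smul_apply, h2, Pi.sub_apply, h3, smul_eq_mul]
    simp only [h4, Pi.smul_apply, smul_eq_mul]
  filter_upwards [hI, hA, hB, hq.ae hξ, hq.ae hηx] with κ k1 k2 k3 k4 k5
  refine ⟨k1, ?_⟩
  have hC := sum_ordered_pairs
    (fun a b => ∫ q, gammaIntegrand lam i j (others i j b) (others i j a) ξ κ q) (fun a b => by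
      refine integral_congr_ae (Eventually.of_forall fun q => ?_)
      simp only [gammaIntegrand, contract_comm (others i j b)])
  simp only [k3] at hC
  rw [← Finset.mul_sum, ← Finset.mul_sum, ← two_mul] at hC
  rw [sum_pairs_left hij (fun l => ∫ q, gammaIntegrand lam i j i l ξ κ q),
    sum_pairs_others hij (fun l m => ∫ q, gammaIntegrand lam i j m l ξ κ q)]
  simp only [k2]
  have hC' : (∑ a, ∑ b, if a < b then
      ∫ q, gammaIntegrand lam i j (others i j b) (others i j a) ξ κ q else 0) =
      1 / 4 * (hatConst (ChargeIdx N) * ((2 * π : ℝ) : ℂ) *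
        ∑ p : {p : Fin (N - 2) × Fin (N - 2) // p.1 ≠ p.2}, K (.inr p) ζ ((2 * π)⁻¹ • κ)) := by
    have : ((1 / 2 : ℝ) : ℂ) = 1 / 2 := by norm_num
    rw [this] at hC
    linear_combination -(1 / 2) * hC
  rw [hC', hat_eq, hat_eq, k4, k5, Fintype.sum_sum_type]
  have hE : 1 / √2 * √(1 / 2 * ‖κ none‖ ^ 2 + ∑ k, ‖κ (some k)‖ ^ 2 + lam) =
      2 * π * √(chargeEnergy (massOf lam) ((2 * π)⁻¹ • κ)) := by
    have e1 : chargeEnergy (massOf lam) ((2 * π)⁻¹ • κ) =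
        (1 / 2 * ‖κ none‖ ^ 2 + ∑ k, ‖κ (some k)‖ ^ 2 + lam) / (2 * (2 * π) ^ 2) := by
      simp only [chargeEnergy, massOf, PiLp.smul_apply, norm_smul, mul_pow, ← Finset.mul_sum,
        Real.norm_of_nonneg (inv_nonneg.2 h2.le)]
      field_simp
      ring
    rw [e1, Real.sqrt_div' _ (by positivity), Real.sqrt_mul (by norm_num), Real.sqrt_sq h2.le]
    field_simp
  rw [hE]
  have hE0 : ((√(chargeEnergy (massOf lam) ((2 * π)⁻¹ • κ)) : ℝ) : ℂ) ≠ 0 := by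
    exact_mod_cast (Real.sqrt_pos.2 (chargeEnergy_pos _ ht)).ne'
  simp only [linkCoef, linkScale, ← Finset.mul_sum]
  have hpi : (π : ℂ) ≠ 0 := by exact_mod_cast Real.pi_pos.ne'
  have hs3 : ((√3 : ℝ) : ℂ) ≠ 0 := by
    have : (0 : ℝ) < √3 := by positivity
    exact_mod_cast this.ne'
  generalize (2 * π)⁻¹ • κ = κ' at hE0 ⊢
  push_cast
  generalize ((√(chargeEnergy (massOf lam) κ') : ℝ) : ℂ) = e at hE0 ⊢
  field_simp
  ring

end

end

section

section

variable {N : ℕ}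

theorem norm_sq_charge (X : Config (ChargeIdx N)) :
    ‖X‖ ^ 2 = ‖X none‖ ^ 2 + ∑ k, ‖X (some k)‖ ^ 2 := by
  rw [norm_sq_config, Fintype.sum_option]

/-- `H¹` in terms of the kinetic energy. -/
theorem memSobolev_one_iff {t : ℝ} (ht : 0 < t) (u : L2 (ChargeIdx N)) :
    TemperedDistribution.MemSobolev 1 2 (u : 𝓢'(Config (ChargeIdx N), ℂ)) ↔
      ∃ ζ : L2 (ChargeIdx N), ∀ᵐ x, (𝓕 u : L2 (ChargeIdx N)) x =
        ((1 / √(chargeEnergy t x) : ℝ) : ℂ) * ζ x := by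
  have hw : ∀ x : Config (ChargeIdx N), (1 + ‖x‖ ^ 2) ^ ((1 : ℝ) / 2) = √(1 + ‖x‖ ^ 2) := fun x => by
    rw [Real.sqrt_eq_rpow]
  have hE : ∀ x : Config (ChargeIdx N), 0 < √(chargeEnergy t x) := fun x =>
    Real.sqrt_pos.2 (chargeEnergy_pos x ht)
  have hW : ∀ x : Config (ChargeIdx N), 0 < √(1 + ‖x‖ ^ 2) := fun x => Real.sqrt_pos.2 (by positivity)
  have hEm := (continuous_chargeEnergy (n := N - 2) (t := t)).measurable
  have hsum : ∀ X : Config (ChargeIdx N), 0 ≤ ∑ k, ‖X (some k)‖ ^ 2 := fun X => by positivity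
  rw [memSobolev_two_iff]
  simp only [hw]
  -- The quotients of the weights `√E` and `√(1 + |x|²)` are bounded by `√(1 + t)` and `√(4 + 2 / t)`.
  constructor
  · rintro ⟨h, hh⟩
    obtain ⟨M, hM, -⟩ := exists_mulOp (E := Config (ChargeIdx N))
      (m := fun x => ((√(chargeEnergy t x) / √(1 + ‖x‖ ^ 2) : ℝ) : ℂ)) (C := √(1 + t))
      (Complex.measurable_ofReal.comp (by fun_prop))
      (Eventually.of_forall fun x => by
        rw [Complex.norm_real, Real.norm_of_nonneg (div_nonneg (hE x).le (hW x).le),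
          div_le_iff₀ (hW x), ← Real.sqrt_mul (by positivity)]
        refine Real.sqrt_le_sqrt ?_
        rw [norm_sq_charge, chargeEnergy]
        nlinarith [hsum x, sq_nonneg ‖x none‖, mul_nonneg ht.le (hsum x),
          mul_nonneg ht.le (sq_nonneg ‖x none‖)])
    refine ⟨M h, ?_⟩
    filter_upwards [hM h, hh] with x h1 h2
    rw [h1, h2]
    have e1 : ((√(chargeEnergy t x) : ℝ) : ℂ) ≠ 0 := by exact_mod_cast (hE x).ne'
    have e2 : ((√(1 + ‖x‖ ^ 2) : ℝ) : ℂ) ≠ 0 := by exact_mod_cast (hW x).ne'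
    rw [Complex.ofReal_div, Complex.ofReal_div, Complex.ofReal_one]
    field_simp
  · rintro ⟨ζ, hζ⟩
    obtain ⟨M, hM, -⟩ := exists_mulOp (E := Config (ChargeIdx N))
      (m := fun x => ((√(1 + ‖x‖ ^ 2) / √(chargeEnergy t x) : ℝ) : ℂ)) (C := √(4 + 2 / t))
      (Complex.measurable_ofReal.comp (by fun_prop))
      (Eventually.of_forall fun x => by
        rw [Complex.norm_real, Real.norm_of_nonneg (div_nonneg (hW x).le (hE x).le),
          div_le_iff₀ (hE x), ← Real.sqrt_mul (by positivity)]
        refine Real.sqrt_le_sqrt ?_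
        rw [norm_sq_charge, chargeEnergy]
        have h1 : 2 / t * (t / 2) = 1 := by field_simp
        have h2 : 0 ≤ 2 / t := by positivity
        nlinarith [hsum x, sq_nonneg ‖x none‖, mul_nonneg h2 (hsum x),
          mul_nonneg h2 (sq_nonneg ‖x none‖)])
    refine ⟨M ζ, ?_⟩
    filter_upwards [hM ζ, hζ] with x h1 h2
    rw [h1, h2]
    have e1 : ((√(chargeEnergy t x) : ℝ) : ℂ) ≠ 0 := by exact_mod_cast (hE x).ne'
    rw [Complex.ofReal_div, Complex.ofReal_div, Complex.ofReal_one]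
    field_simp

theorem hat_injective {ι : Type} [Fintype ι] {u v : L2 ι} (h : ∀ᵐ p, hat u p = hat v p) : u = v := by
  have h2 : (0 : ℝ) < 2 * π := by positivity
  have hq : Measure.QuasiMeasurePreserving (fun κ : Config ι => (2 * π) • κ)
      volume volume := Measure.quasiMeasurePreserving_smul volume h2.ne'
  have e : (𝓕 u : L2 ι) = 𝓕 v := by
    refine Lp.ext ?_
    filter_upwards [hq.ae h] with x hx
    rw [hat_eq, hat_eq, smul_smul, inv_mul_cancel₀ h2.ne', one_smul] at hx
    exact mul_left_cancel₀ (hatConst_ne_zero ι) hx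
  exact (Lp.fourierTransformₗᵢ (Config ι) ℂ).injective e

theorem IsAddGamma.unique {α γ : ℝ} {θ : ℝ → ℝ} {lam : ℝ} {i j : Fin N} {ξ η η' : ChargeSpace N}
    (h : IsAddGamma α γ θ lam i j ξ η) (h' : IsAddGamma α γ θ lam i j ξ η') : η = η' := by
  obtain ⟨a, b, ha, hb, rfl⟩ := h
  obtain ⟨a', b', ha', hb', rfl⟩ := h'
  have h1 : a = a' := by
    refine Subtype.ext (Lp.ext ?_)
    filter_upwards [ha, ha'] with x h1 h2
    rw [h1, h2]
  have h2 : b = b' := by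
    refine Subtype.ext (hat_injective ?_)
    filter_upwards [hb, hb'] with x h1 h2
    rw [h1.2, h2.2]
  rw [h1, h2]

/-- The bounded operators `J = (kinetic energy)^{-1/2}` and `L = (A + Γ) J` on the charge space,
with the estimates that control the operator `A + Γ`. -/
structure IsBoundaryPair (α γ : ℝ) (θ : ℝ → ℝ) (C lam : ℝ) (J L : ChargeSpace N →L[ℂ] ChargeSpace N) :
    Prop where
  memH1_iff : ∀ ξ : ChargeSpace N, MemH1 ξ ↔ ∃ ζ, ξ = J ζ
  isAddGamma : ∀ i j : Fin N, i ≠ j → ∀ ζ, IsAddGamma α γ θ lam i j (J ζ) (L ζ)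
  injective : ∀ ζ, J ζ = 0 → ζ = 0
  symm : ∀ x y, inner ℂ (L x) (J y) = inner ℂ (J x) (L y)
  nonneg : ∀ ζ, 0 ≤ (inner ℂ ζ (J ζ)).re
  norm_sq_le : ∀ ζ, ‖J ζ‖ ^ 2 ≤ 1 / √(massOf lam / 2) * (inner ℂ ζ (J ζ)).re
  norm_le : ∀ ζ, ‖J ζ‖ ≤ 1 / √(massOf lam / 2) * ‖ζ‖
  form_ge : ∀ ζ, 2 * π * gap (N - 2) γ * ‖ζ‖ ^ 2 - C * ‖ζ‖ * ‖J ζ‖ ≤ (inner ℂ ζ (L ζ)).re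

/-- An operator that commutes with the permutations acts on the charge space. -/
theorem exists_restrict {L : L2 (ChargeIdx N) →L[ℂ] L2 (ChargeIdx N)}
    (hL : ∀ (σ : Equiv.Perm (Fin (N - 2))) f, L (permL2 (chargePerm σ) f) = permL2 (chargePerm σ) (L f)) :
    ∃ L' : ChargeSpace N →L[ℂ] ChargeSpace N, ∀ ζ : ChargeSpace N,
      (L' ζ : L2 (ChargeIdx N)) = L (ζ : L2 (ChargeIdx N)) := by
  refine ⟨(L ∘L (Submodule.subtypeL _)).codRestrict _ fun ζ => ?_, fun ζ => rfl⟩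
  rw [mem_chargeSpace_iff]
  intro σ
  change permL2 (chargePerm σ) (L ζ) = L ζ
  rw [← hL, (mem_chargeSpace_iff _).1 ζ.2 σ]

/-- The operators of `exists_boundary_ops` commute with the permutations, so they act on the charge
space. The constant `C`, a bound of the regular part of `A`, does not depend on `lam`. -/
theorem exists_isBoundaryPair (α : ℝ) {γ : ℝ} (hγ : 0 ≤ γ) {θ : ℝ → ℝ}
    (hθ : AEStronglyMeasurable θ (volume.restrict (Ioi (0 : ℝ)))) {b : ℝ} (hb : 0 < b)
    (hθb : ∀ᵐ r ∂(volume.restrict (Ioi (0 : ℝ))), 1 - r / b ≤ θ r ∧ θ r ≤ 1 + r / b) :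
    ∃ C : ℝ, 0 ≤ C ∧ ∀ lam : ℝ, 0 < lam →
      ∃ J L : ChargeSpace N →L[ℂ] ChargeSpace N, IsBoundaryPair α γ θ C lam J L := by
  obtain ⟨B, C, hBm, hBC, hBσ, hB⟩ := exists_coefA_eq (N := N) α γ hθ hb hθb
  have hC : 0 ≤ C := (abs_nonneg _).trans (hBC 0)
  refine ⟨C, hC, fun lam hlam => ?_⟩
  have ht := massOf_pos hlam
  obtain ⟨J, LA, LG, K, hK, hJF, hLA, hLG, hJ0, hsym, hpos, hsq, hle, hge, hJσ, hLAσ, hLGσ⟩ :=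
    exists_boundary_ops α γ hγ θ hBm hC hBC hBσ hB ht
  obtain ⟨J', hJ'⟩ := exists_restrict hJσ
  obtain ⟨LA', hLA'⟩ := exists_restrict hLAσ
  obtain ⟨LG', hLG'⟩ := exists_restrict hLGσ
  refine ⟨J', LA' + LG', ?_, ?_, ?_, ?_, ?_, ?_, ?_, ?_⟩
  · intro ξ
    rw [MemH1, memSobolev_one_iff ht]
    constructor
    · rintro ⟨z, hz⟩
      obtain ⟨ζ, rfl⟩ : ∃ ζ : L2 (ChargeIdx N), 𝓕 ζ = z :=
        ⟨𝓕⁻ z, FourierTransform.fourier_fourierInv_eq z⟩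
      have e : J ζ = ξ := by
        refine fourier_injective (Lp.ext ?_)
        filter_upwards [hz, hJF ζ] with x h1 h2
        rw [h1, h2]
      have hmem : ∀ σ : Equiv.Perm (Fin (N - 2)), permL2 (chargePerm σ) ζ = ζ := by
        intro σ
        refine sub_eq_zero.1 (hJ0 _ ?_)
        rw [map_sub, hJσ, e, (mem_chargeSpace_iff _).1 ξ.2 σ, sub_self]
      exact ⟨⟨ζ, (mem_chargeSpace_iff _).2 hmem⟩, Subtype.ext (by rw [hJ', e])⟩
    · rintro ⟨ζ, rfl⟩
      refine ⟨𝓕 (ζ : L2 (ChargeIdx N)), ?_⟩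
      rw [hJ']; exact hJF _
  · intro i j hij ζ
    refine ⟨LA' ζ, LG' ζ, ?_, ?_, rfl⟩
    · rw [IsMulA, hLA', hJ']; exact hLA _
    · refine isGamma_of_fourier hlam hij hK _ _ (𝓕 (ζ : L2 (ChargeIdx N))) ?_ ?_
      · rw [hJ']; exact hJF _
      · rw [hLG']; exact hLG _
  · intro ζ h
    refine Subtype.ext (hJ0 _ ?_)
    rw [← hJ', h]; rfl
  · intro x y
    have := hsym x y
    rw [← hLA', ← hLG', ← hJ', ← hLA', ← hLG', ← hJ'] at this
    exact this
  · intro ζ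
    have := hpos ζ
    rw [← hJ'] at this
    exact this
  · intro ζ
    have := hsq ζ
    rw [← hJ'] at this
    exact this
  · intro ζ
    have := hle ζ
    rw [← hJ'] at this
    exact this
  · intro ζ
    have := hge ζ
    rw [← hJ', ← hLA', ← hLG'] at this
    exact this

theorem re_inner_add_smul {H : Type*} [NormedAddCommGroup H] [InnerProductSpace ℂ H] (x y z : H)
    (s : ℝ) : (inner ℂ x (y + (s : ℂ) • z)).re = (inner ℂ x y).re + s * (inner ℂ x z).re := by
  rw [inner_add_right, inner_smul_right, Complex.add_re, Complex.re_ofReal_mul]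

namespace IsBoundaryPair

variable {α γ : ℝ} {θ : ℝ → ℝ} {C lam : ℝ} {J L : ChargeSpace N →L[ℂ] ChargeSpace N}

/-- `L + s J` is coercive for some shift `s`. -/
theorem exists_coercive (h : IsBoundaryPair α γ θ C lam J L)
    (hgap : 0 < gap (N - 2) γ) :
    ∃ c s : ℝ, 0 < c ∧ ∀ x, c * ‖x‖ ^ 2 ≤ (inner ℂ x (L x + (s : ℂ) • J x)).re := by
  set δ := π * gap (N - 2) γ with hδ
  have hδ0 : 0 < δ := mul_pos Real.pi_pos hgap
  -- The shift absorbs the bounded part: by Young's inequality, half of the lower bound `2 δ ‖x‖²` and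
  -- a multiple of `‖J x‖²` control `C ‖x‖ ‖J x‖`.
  refine ⟨δ, C ^ 2 / (4 * δ) * (1 / √(massOf lam / 2)), hδ0, fun x => ?_⟩
  have h1 := h.form_ge x
  have h2 := mul_le_mul_of_nonneg_left (h.norm_sq_le x) (by positivity : 0 ≤ C ^ 2 / (4 * δ))
  refine le_of_le_of_eq ?_ (re_inner_add_smul x (L x) (J x) _).symm
  have h3 : C * ‖x‖ * ‖J x‖ ≤ δ * ‖x‖ ^ 2 + C ^ 2 / (4 * δ) * ‖J x‖ ^ 2 := by
    have e : δ * ‖x‖ ^ 2 + C ^ 2 / (4 * δ) * ‖J x‖ ^ 2 - C * ‖x‖ * ‖J x‖ =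
        δ * (‖x‖ - C / (2 * δ) * ‖J x‖) ^ 2 := by
      field_simp; ring
    have : 0 ≤ δ * (‖x‖ - C / (2 * δ) * ‖J x‖) ^ 2 := by positivity
    linarith
  have e2 : 2 * π * gap (N - 2) γ = 2 * δ := by rw [hδ]; ring
  rw [e2] at h1
  rw [mul_assoc]
  linarith

/-- For large `lam`, `L + s J` is coercive for all `s ≥ -1`. -/
theorem coercive_of_large (h : IsBoundaryPair α γ θ C lam J L) (hC : 0 ≤ C)
    (hlarge : (C + 1) * (1 / √(massOf lam / 2)) ≤ π * gap (N - 2) γ) {s : ℝ} (hs : -1 ≤ s)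
    (x : ChargeSpace N) :
    π * gap (N - 2) γ * ‖x‖ ^ 2 ≤ (inner ℂ x (L x + (s : ℂ) • J x)).re := by
  have h1 := h.form_ge x
  have h2 := h.norm_le x
  have h3 := h.nonneg x
  have h4 : (inner ℂ x (J x)).re ≤ ‖x‖ * ‖J x‖ :=
    (Complex.re_le_norm _).trans (norm_inner_le_norm x (J x))
  refine le_of_le_of_eq ?_ (re_inner_add_smul x (L x) (J x) _).symm
  have h5 : C * ‖x‖ * ‖J x‖ + ‖x‖ * ‖J x‖ ≤ π * gap (N - 2) γ * ‖x‖ ^ 2 := by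
    calc C * ‖x‖ * ‖J x‖ + ‖x‖ * ‖J x‖ = (C + 1) * ‖x‖ * ‖J x‖ := by ring
      _ ≤ (C + 1) * ‖x‖ * (1 / √(massOf lam / 2) * ‖x‖) := by gcongr
      _ = (C + 1) * (1 / √(massOf lam / 2)) * ‖x‖ ^ 2 := by ring
      _ ≤ _ := by gcongr
  have h6 : -(inner ℂ x (J x)).re ≤ s * (inner ℂ x (J x)).re := by nlinarith
  linarith

theorem isChargeOperator (h : IsBoundaryPair α γ θ C lam J L) {i j : Fin N} (hij : i ≠ j) :
    IsChargeOperator α γ θ lam i j (pmapOfFactor J L) where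
  mem_domain_iff ξ := by
    rw [h.memH1_iff, LinearPMap.mem_domain_iff]
    simp only [mem_graph_pmapOfFactor h.injective]
    exact ⟨fun ⟨y, z, hz, _⟩ => ⟨z, hz⟩, fun ⟨z, hz⟩ => ⟨_, z, hz, rfl⟩⟩
  apply ξ := by
    obtain ⟨z, hz1, hz2⟩ := (mem_graph_pmapOfFactor h.injective _ _).1 ((pmapOfFactor J L).mem_graph ξ)
    rw [hz1, hz2]
    exact h.isAddGamma i j hij z

/-- The lower bound `1` for the operator `A + Γ`. -/
theorem norm_sq_le_form (h : IsBoundaryPair α γ θ C lam J L) (hC : 0 ≤ C)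
    (hgap : 0 < gap (N - 2) γ)
    (hlarge : (C + 1) * (1 / √(massOf lam / 2)) ≤ π * gap (N - 2) γ) (ζ : ChargeSpace N) :
    ‖J ζ‖ ^ 2 ≤ (inner ℂ (J ζ) (L ζ)).re := by
  have hJsa : ∀ x y, inner ℂ (L x - J x) (J y) = inner ℂ (J x) (L y - J y) := fun x y => by
    rw [inner_sub_left, inner_sub_right, h.symm]
  -- The operator `(L - J) J⁻¹ = A + Γ - 1` is nonnegative.
  have := re_inner_nonneg_of_coercive (J := J) (L := L - J) h.injective (fun x y => hJsa x y)
    (mul_pos Real.pi_pos hgap) (fun s hs x => by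
      have := h.coercive_of_large hC hlarge (s := s - 1) (by linarith) x
      refine this.trans (le_of_eq ?_)
      rw [_root_.sub_apply]
      congr 2
      push_cast
      rw [sub_smul, one_smul]
      abel) ζ
  rw [_root_.sub_apply, inner_sub_right, Complex.sub_re] at this
  have e : (inner ℂ (J ζ) (J ζ)).re = ‖J ζ‖ ^ 2 := inner_self_eq_norm_sq (𝕜 := ℂ) (J ζ)
  linarith

theorem re_inner_pmap (h : IsBoundaryPair α γ θ C lam J L) (hC : 0 ≤ C)
    (hgap : 0 < gap (N - 2) γ)
    (hlarge : (C + 1) * (1 / √(massOf lam / 2)) ≤ π * gap (N - 2) γ)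
    (ξ : (pmapOfFactor J L).domain) :
    1 * ‖(ξ : ChargeSpace N)‖ ^ 2 ≤ (inner ℂ (ξ : ChargeSpace N) (pmapOfFactor J L ξ)).re := by
  obtain ⟨z, hz1, hz2⟩ := (mem_graph_pmapOfFactor h.injective _ _).1 ((pmapOfFactor J L).mem_graph ξ)
  rw [hz1, hz2, one_mul]
  exact h.norm_sq_le_form hC hgap hlarge z

end IsBoundaryPair

end

end

section

/-! ### Potentials of charges -/

/-- The difference of two resolvent kernels is integrable over `ℝ³`, although neither of them is. -/
theorem lintegral_resolvent_sub {a b : ℝ} (ha : 0 < a) (hab : a ≤ b) :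
    ∫⁻ q : R3, ENNReal.ofReal (1 / (‖q‖ ^ 2 + a ^ 2) - 1 / (‖q‖ ^ 2 + b ^ 2)) =
      ENNReal.ofReal (2 * π ^ 2 * (b - a)) := by
  have hb : 0 < b := ha.trans_le hab
  have h := lintegral_radial_eq (G := fun r => b * Real.arctan (r / b) - a * Real.arctan (r / a))
    (g := fun r => 1 / (r ^ 2 + a ^ 2) - 1 / (r ^ 2 + b ^ 2)) (l := b * (π / 2) - a * (π / 2))
    (by fun_prop) (fun r hr => ?_) (fun r hr => ?_) ?_
  · rw [h]
    congr 1
    simp only [zero_div, Real.arctan_zero]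
    ring
  · have h1 : ∀ c : ℝ, 0 < c → HasDerivAt (fun r : ℝ => c * Real.arctan (r / c)) (c ^ 2 / (r ^ 2 + c ^ 2)) r := by
      intro c hc
      have := (((hasDerivAt_id r).div_const c).arctan).const_mul c
      have e : c ^ 2 / (r ^ 2 + c ^ 2) = c * (1 / (1 + (r / c) ^ 2) * (1 / c)) := by
        field_simp
        ring
      rw [e]; exact this
    have e : r ^ 2 * (1 / (r ^ 2 + a ^ 2) - 1 / (r ^ 2 + b ^ 2)) =
        b ^ 2 / (r ^ 2 + b ^ 2) - a ^ 2 / (r ^ 2 + a ^ 2) := by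
      field_simp
      ring
    rw [e]
    exact (h1 b hb).sub (h1 a ha)
  · rw [sub_nonneg]
    apply one_div_le_one_div_of_le
    · positivity
    · gcongr
  · have h1 : ∀ c : ℝ, 0 < c → Tendsto (fun r : ℝ => c * Real.arctan (r / c)) atTop (𝓝 (c * (π / 2))) := by
      intro c hc
      have := (Real.tendsto_arctan_atTop.mono_right nhdsWithin_le_nhds).comp
        (tendsto_id.atTop_div_const hc)
      exact this.const_mul c
    exact (h1 b hb).sub (h1 a ha)

theorem integral_resolvent_sub_of_le {a b : ℝ} (ha : 0 < a) (hab : a ≤ b) :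
    Integrable (fun q : R3 => 1 / (‖q‖ ^ 2 + a ^ 2) - 1 / (‖q‖ ^ 2 + b ^ 2)) ∧
    ∫ q : R3, (1 / (‖q‖ ^ 2 + a ^ 2) - 1 / (‖q‖ ^ 2 + b ^ 2)) = 2 * π ^ 2 * (b - a) := by
  have hb : 0 < b := ha.trans_le hab
  have h := lintegral_resolvent_sub ha hab
  have hc : ∀ c : ℝ, 0 < c → Continuous fun q : R3 => 1 / (‖q‖ ^ 2 + c ^ 2) := fun c hc =>
    continuous_const.div (by fun_prop) fun q => by positivity
  have hm : AEStronglyMeasurable (fun q : R3 => 1 / (‖q‖ ^ 2 + a ^ 2) - 1 / (‖q‖ ^ 2 + b ^ 2)) :=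
    ((hc a ha).sub (hc b hb)).aestronglyMeasurable
  have h0 : ∀ q : R3, 0 ≤ 1 / (‖q‖ ^ 2 + a ^ 2) - 1 / (‖q‖ ^ 2 + b ^ 2) := by
    intro q
    rw [sub_nonneg]
    apply one_div_le_one_div_of_le
    · positivity
    · gcongr
  constructor
  · refine (lintegral_ofReal_ne_top_iff_integrable hm (ae_of_all _ h0)).1 ?_
    rw [h]; exact ENNReal.ofReal_ne_top
  · rw [integral_eq_lintegral_of_nonneg_ae (ae_of_all _ h0) hm, h, ENNReal.toReal_ofReal]
    have := sub_nonneg.2 hab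
    positivity

theorem integral_resolvent_sub {a b : ℝ} (ha : 0 < a) (hb : 0 < b) :
    Integrable (fun q : R3 => 1 / (‖q‖ ^ 2 + a ^ 2) - 1 / (‖q‖ ^ 2 + b ^ 2)) ∧
    ∫ q : R3, (1 / (‖q‖ ^ 2 + a ^ 2) - 1 / (‖q‖ ^ 2 + b ^ 2)) = 2 * π ^ 2 * (b - a) := by
  rcases le_total a b with h | h
  · exact integral_resolvent_sub_of_le ha h
  · obtain ⟨h1, h2⟩ := integral_resolvent_sub_of_le hb h
    have e : (fun q : R3 => 1 / (‖q‖ ^ 2 + a ^ 2) - 1 / (‖q‖ ^ 2 + b ^ 2)) =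
        fun q => -(1 / (‖q‖ ^ 2 + b ^ 2) - 1 / (‖q‖ ^ 2 + a ^ 2)) := by
      funext q; ring
    rw [e]
    refine ⟨h1.neg, ?_⟩
    rw [integral_neg, h2]; ring

theorem lintegral_resolvent_sq_lt_top {t : ℝ} (ht : 0 < t) :
    ∫⁻ q : R3, ENNReal.ofReal ((1 / (‖q‖ ^ 2 + t)) ^ 2) < ∞ := by
  have hs : √t ^ 2 = t := Real.sq_sqrt ht.le
  have h := lintegral_resolvent_sub (Real.sqrt_pos.2 ht) (b := 2 * √t) (by linarith [Real.sqrt_nonneg t])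
  refine lt_of_le_of_lt (b := ∫⁻ q : R3, ENNReal.ofReal (4 / (3 * t)) * ENNReal.ofReal
    (1 / (‖q‖ ^ 2 + √t ^ 2) - 1 / (‖q‖ ^ 2 + (2 * √t) ^ 2))) (lintegral_mono fun q => ?_) ?_
  · rw [← ENNReal.ofReal_mul (by positivity)]
    apply ENNReal.ofReal_le_ofReal
    rw [mul_pow, hs]
    have e : 4 / (3 * t) * (1 / (‖q‖ ^ 2 + t) - 1 / (‖q‖ ^ 2 + 2 ^ 2 * t)) =
        1 / ((‖q‖ ^ 2 + t) * ((‖q‖ ^ 2 + 4 * t) / 4)) := by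
      field_simp
      ring
    rw [e, div_pow, one_pow, sq (‖q‖ ^ 2 + t)]
    apply one_div_le_one_div_of_le
    · positivity
    · gcongr
      nlinarith [sq_nonneg ‖q‖]
  · rw [lintegral_const_mul' _ _ ENNReal.ofReal_ne_top, h]
    exact ENNReal.mul_lt_top ENNReal.ofReal_lt_top ENNReal.ofReal_lt_top

/-- The symbol of `-Δ + lam` for the Fourier transform `𝓕`. -/
noncomputable def freeSymbol {E : Type*} [NormedAddCommGroup E] (lam : ℝ) (p : E) : ℝ :=
  (2 * π) ^ 2 * ‖p‖ ^ 2 + lam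

theorem freeSymbol_pos {E : Type*} [NormedAddCommGroup E] {lam : ℝ} (h : 0 < lam) (p : E) :
    0 < freeSymbol lam p := by
  unfold freeSymbol; positivity

theorem freeSymbol_eq {E : Type*} [NormedAddCommGroup E] (lam : ℝ) (p : E) :
    freeSymbol lam p = (2 * π) ^ 2 * (‖p‖ ^ 2 + massOf lam) := by
  unfold freeSymbol massOf; field_simp

theorem continuous_freeSymbol {E : Type*} [NormedAddCommGroup E] (lam : ℝ) :
    Continuous (freeSymbol lam : E → ℝ) := by
  unfold freeSymbol; fun_prop

variable {N : ℕ}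

theorem exists_lintegral_contract_le {lam : ℝ} (hlam : 0 < lam) {i j : Fin N} (hij : i ≠ j) :
    ∃ C : ℝ, 0 ≤ C ∧ ∀ v : L2 (ChargeIdx N), ∫⁻ p, ‖((1 / freeSymbol lam p : ℝ) : ℂ) * v (contract i j p)‖ₑ ^ 2 ≤
      ENNReal.ofReal (C * ‖v‖ ^ 2) := by
  have hfin := lintegral_resolvent_sq_lt_top (massOf_pos hlam)
  set I := ∫⁻ q : R3, ENNReal.ofReal ((1 / (‖q‖ ^ 2 + massOf lam)) ^ 2) with hI
  have h2 : (0 : ℝ) < 2 * π := by positivity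
  set c : ℝ := 1 / ((2 * π) ^ 2) ^ 2
  refine ⟨c * I.toReal, by positivity, fun v => ?_⟩
  have hv : Measurable v := (Lp.stronglyMeasurable v).measurable
  have hfs := (continuous_freeSymbol lam (E := Config (Fin N))).measurable
  have hc := (continuous_contract i j).measurable
  have hm : Measurable fun p : Config (Fin N) =>
      ‖((1 / freeSymbol lam p : ℝ) : ℂ) * v (contract i j p)‖ₑ ^ 2 :=
    (((by fun_prop : Measurable fun p : Config (Fin N) => ((1 / freeSymbol lam p : ℝ) : ℂ)).mul
      (hv.comp hc)).enorm.pow_const 2)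
  rw [← (measurePreserving_split hij).lintegral_comp hm,
    lintegral_prod (fun z : Config (ChargeIdx N) × R3 => ‖((1 / freeSymbol lam (split i j z.1 z.2) : ℝ) : ℂ) *
      v (contract i j (split i j z.1 z.2))‖ₑ ^ 2)
      (hm.comp (measurePreserving_split hij).measurable).aemeasurable]
  calc _ ≤ ∫⁻ κ : Config (ChargeIdx N), ∫⁻ q : R3, (ENNReal.ofReal c * ‖v κ‖ₑ ^ 2) *
        ENNReal.ofReal ((1 / (‖q‖ ^ 2 + massOf lam)) ^ 2) := by
        refine lintegral_mono fun κ => lintegral_mono fun q => ?_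
        simp only
        rw [contract_split hij, enorm_mul, mul_pow, mul_right_comm]
        gcongr
        rw [← ofReal_norm, Complex.norm_real, Real.norm_of_nonneg
          (one_div_nonneg.2 (freeSymbol_pos hlam _).le), ← ENNReal.ofReal_pow
          (one_div_nonneg.2 (freeSymbol_pos hlam _).le), ← ENNReal.ofReal_mul (by positivity)]
        apply ENNReal.ofReal_le_ofReal
        have e : c * (1 / (‖q‖ ^ 2 + massOf lam)) ^ 2 =
            (1 / ((2 * π) ^ 2 * (‖q‖ ^ 2 + massOf lam))) ^ 2 := by
          have := massOf_pos hlam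
          simp only [c]; field_simp
        rw [e]
        have hs : ‖q‖ ^ 2 ≤ ‖split i j κ q‖ ^ 2 := by
          rw [norm_sq_split hij]
          have : 0 ≤ ∑ k, ‖κ (some k)‖ ^ 2 := Finset.sum_nonneg fun _ _ => by positivity
          nlinarith [sq_nonneg ‖κ none - q‖]
        have := massOf_pos hlam
        rw [freeSymbol_eq]
        gcongr
    _ = ENNReal.ofReal (c * I.toReal * ‖v‖ ^ 2) := by
        have h1 : ∀ κ : Config (ChargeIdx N), ∫⁻ q : R3, (ENNReal.ofReal c * ‖v κ‖ₑ ^ 2) *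
            ENNReal.ofReal ((1 / (‖q‖ ^ 2 + massOf lam)) ^ 2) = (ENNReal.ofReal c * I) * ‖v κ‖ₑ ^ 2 := by
          intro κ
          rw [lintegral_const_mul _ (by fun_prop), ← hI]; ring
        simp only [h1]
        rw [lintegral_const_mul _ (hv.enorm.pow_const 2), lintegral_enorm_sq_Lp,
          ENNReal.ofReal_mul (by positivity), ENNReal.ofReal_mul (by positivity),
          ENNReal.ofReal_toReal hfin.ne]

theorem contract_surjective {i j : Fin N} (hij : i ≠ j) : Function.Surjective (contractCLM i j) :=
  fun κ => ⟨split i j κ 0, by rw [contractCLM_apply, contract_split hij]⟩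

theorem ae_contract {i j : Fin N} (hij : i ≠ j) {p : Config (ChargeIdx N) → Prop} (hp : ∀ᵐ x, p x) :
    ∀ᵐ X : Config (Fin N), p (contract i j X) := by
  filter_upwards [ae_comp_of_surjective (contractCLM i j) (contract_surjective hij) hp] with X hX
  rwa [contractCLM_apply] at hX

/-- The bounded operator `v ↦ v(p_i + p_j, P_{ij}) / ((2π)² p² + lam)`. -/
theorem exists_contractOp {lam : ℝ} (hlam : 0 < lam) {i j : Fin N} (hij : i ≠ j) :
    ∃ M : L2 (ChargeIdx N) →L[ℂ] L2 (Fin N),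
      ∀ v, ∀ᵐ p, M v p = ((1 / freeSymbol lam p : ℝ) : ℂ) * v (contract i j p) := by
  obtain ⟨C, hC, h⟩ := exists_lintegral_contract_le hlam hij
  have hmeas : ∀ v : L2 (ChargeIdx N), AEStronglyMeasurable
      (fun p : Config (Fin N) => ((1 / freeSymbol lam p : ℝ) : ℂ) * v (contract i j p)) := fun v => by
    have hv : Measurable v := (Lp.stronglyMeasurable v).measurable
    have hfs := (continuous_freeSymbol lam (E := Config (Fin N))).measurable
    have hc := (continuous_contract i j).measurable
    exact (((by fun_prop : Measurable fun p : Config (Fin N) => ((1 / freeSymbol lam p : ℝ) : ℂ)).mul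
      (hv.comp hc)).aestronglyMeasurable)
  have hmem : ∀ v : L2 (ChargeIdx N), MemLp
      (fun p : Config (Fin N) => ((1 / freeSymbol lam p : ℝ) : ℂ) * v (contract i j p)) 2 volume := fun v => by
    refine ⟨hmeas v, ?_⟩
    rw [eLpNorm_lt_top_iff_lintegral_rpow_enorm_lt_top (by norm_num) (by norm_num)]
    simp only [ENNReal.toReal_ofNat, ENNReal.rpow_ofNat]
    exact (h v).trans_lt ENNReal.ofReal_lt_top
  have hb : ∀ v : L2 (ChargeIdx N), ‖(hmem v).toLp _‖ ≤ √C * ‖v‖ := fun v => by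
    have e := lintegral_enorm_sq_Lp ((hmem v).toLp _)
    have e2 : ∫⁻ x, ‖(hmem v).toLp _ x‖ₑ ^ 2 =
        ∫⁻ p, ‖((1 / freeSymbol lam p : ℝ) : ℂ) * v (contract i j p)‖ₑ ^ 2 :=
      lintegral_congr_ae ((hmem v).coeFn_toLp.mono fun x hx => by simp only [hx])
    have h3 := h v
    rw [← e2, e, ENNReal.ofReal_le_ofReal_iff (by positivity)] at h3
    refine le_of_sq_le_sq ?_ (by positivity)
    rw [mul_pow, Real.sq_sqrt hC]
    exact h3
  refine ⟨LinearMap.mkContinuous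
    { toFun := fun v => (hmem v).toLp _
      map_add' := fun u v => ?_
      map_smul' := fun c v => ?_ } (√C) hb, fun v => (hmem v).coeFn_toLp⟩
  · refine Lp.ext ?_
    filter_upwards [(hmem (u + v)).coeFn_toLp, Lp.coeFn_add ((hmem u).toLp _) ((hmem v).toLp _),
      (hmem u).coeFn_toLp, (hmem v).coeFn_toLp, ae_contract hij (Lp.coeFn_add u v)] with p h1 h2 h3 h4 h5
    rw [h1, h2, Pi.add_apply, h3, h4, h5, Pi.add_apply, mul_add]
  · refine Lp.ext ?_
    filter_upwards [(hmem (c • v)).coeFn_toLp, Lp.coeFn_smul c ((hmem v).toLp _),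
      (hmem v).coeFn_toLp, ae_contract hij (Lp.coeFn_smul c v)] with p h1 h2 h3 h5
    simp only [RingHom.id_apply]
    rw [h1, h2, Pi.smul_apply, h3, h5, Pi.smul_apply, smul_eq_mul, smul_eq_mul]
    ring

end

section

section

variable {E : Type} [NormedAddCommGroup E] [InnerProductSpace ℝ E] [FiniteDimensional ℝ E]
  [MeasurableSpace E] [BorelSpace E]

/-- `(-Δ + lam) φ` for a Schwartz function `φ`. -/
noncomputable def freeSchwartz (lam : ℝ) (φ : 𝓢(E, ℂ)) : 𝓢(E, ℂ) := (lam : ℂ) • φ - Δ φ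

theorem integrable_schwartz_mul_Lp (φ : 𝓢(E, ℂ)) (u : L²(E)) :
    Integrable fun x => φ x * u x :=
  (φ.memLp 2 volume).integrable_mul (Lp.memLp u)

theorem integral_freeSchwartz_mul (lam : ℝ) (φ : 𝓢(E, ℂ)) (u : L²(E)) :
    ∫ x, freeSchwartz lam φ x * u x =
      (-Δ (u : 𝓢'(E, ℂ)) + (lam : ℂ) • (u : 𝓢'(E, ℂ))) φ := by
  change _ = -((Δ (u : 𝓢'(E, ℂ))) φ) + (lam : ℂ) • ((u : 𝓢'(E, ℂ)) φ)
  rw [TemperedDistribution.laplacian_apply_apply, Lp.toTemperedDistribution_apply,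
    Lp.toTemperedDistribution_apply]
  simp only [smul_eq_mul]
  have : (fun x => freeSchwartz lam φ x * u x) = fun x => (lam : ℂ) * (φ x * u x) - (Δ φ) x * u x := by
    funext x
    simp only [freeSchwartz, _root_.sub_apply, _root_.smul_apply, smul_eq_mul]
    ring
  rw [this, integral_sub ((integrable_schwartz_mul_Lp φ u).const_mul _) (integrable_schwartz_mul_Lp _ u),
    integral_const_mul]
  ring

theorem integral_freeSchwartz_mul_eq (lam : ℝ) (φ : 𝓢(E, ℂ)) (u : L²(E)) :
    ∫ x, freeSchwartz lam φ x * u x = ∫ x, (𝓕⁻ φ : 𝓢(E, ℂ)) x *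
      ((freeSymbol lam x : ℂ) * (𝓕 u : L²(E)) x) := by
  rw [integral_freeSchwartz_mul]
  change -((Δ (u : 𝓢'(E, ℂ))) φ) + (lam : ℂ) • ((u : 𝓢'(E, ℂ)) φ) = _
  rw [integral_laplacian_fourierInv, Lp.toTemperedDistribution_apply]
  simp only [smul_eq_mul]
  rw [← integral_fourierInv_mul_fourier, ← integral_neg, ← integral_const_mul, ← integral_add]
  · refine integral_congr_ae (Eventually.of_forall fun x => ?_)
    simp only [freeSymbol]; push_cast; ring
  · have hg : Function.HasTemperateGrowth fun x : E => ((‖x‖ ^ 2 : ℝ) : ℂ) := by fun_prop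
    have := ((integrable_schwartz_mul_Lp (SchwartzMap.smulLeftCLM ℂ
      (fun x : E => ((‖x‖ ^ 2 : ℝ) : ℂ)) (𝓕⁻ φ : 𝓢(E, ℂ))) (𝓕 u : L²(E))).const_mul
      ((2 * π : ℂ) ^ 2))
    refine this.congr (Eventually.of_forall fun x => ?_)
    simp only [SchwartzMap.smulLeftCLM_apply_apply hg, smul_eq_mul]
    push_cast; ring
  · exact (integrable_schwartz_mul_Lp _ _).const_mul _

theorem eq_zero_of_integral_freeSchwartz {lam : ℝ} (hlam : 0 < lam) {u : L²(E)}
    (h : ∀ φ : 𝓢(E, ℂ), ∫ x, freeSchwartz lam φ x * u x = 0) : u = 0 := by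
  have hc : Continuous fun x : E => (freeSymbol lam x : ℂ) :=
    Complex.continuous_ofReal.comp (continuous_freeSymbol lam)
  have h1 : (fun x : E => (freeSymbol lam x : ℂ) * (𝓕 u : L²(E)) x) =ᵐ[volume]
      fun _ => 0 := by
    refine ae_eq_of_integral_schwartz (locallyIntegrable_mul_Lp hc _) (locallyIntegrable_const _)
      fun φ _ => ?_
    have := h (𝓕 φ)
    rw [integral_freeSchwartz_mul_eq, FourierTransform.fourierInv_fourier_eq] at this
    rw [this]; simp
  apply (Lp.fourierTransformₗᵢ E ℂ).injective
  change (𝓕 u : L²(E)) = 𝓕 (0 : L²(E))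
  refine Lp.ext ?_
  have h0 : (𝓕 (0 : L²(E)) : L²(E)) = 0 :=
    map_zero (Lp.fourierTransformₗᵢ E ℂ)
  rw [h0]
  filter_upwards [h1, Lp.coeFn_zero ℂ 2 (volume : Measure E)] with x hx hx0
  rw [hx0, Pi.zero_apply]
  have : (freeSymbol lam x : ℂ) ≠ 0 := by exact_mod_cast (freeSymbol_pos hlam x).ne'
  exact (mul_eq_zero.1 hx).resolve_left this

/-- The complex conjugate of a Schwartz function. -/
noncomputable def conjSchwartz (φ : 𝓢(E, ℂ)) : 𝓢(E, ℂ) :=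
  φ.postcompCLM (𝕜 := ℝ) (Complex.conjCLE : ℂ →L[ℝ] ℂ)

theorem conjSchwartz_apply (φ : 𝓢(E, ℂ)) (x : E) : conjSchwartz φ x = starRingEnd ℂ (φ x) := rfl

theorem freeSchwartz_conjSchwartz (lam : ℝ) (φ : 𝓢(E, ℂ)) (x : E) :
    freeSchwartz lam (conjSchwartz φ) x = starRingEnd ℂ (freeSchwartz lam φ x) := by
  simp only [freeSchwartz, _root_.sub_apply, _root_.smul_apply, smul_eq_mul, map_sub, map_mul,
    Complex.conj_ofReal, conjSchwartz_apply]
  congr 1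
  rw [SchwartzMap.laplacian_apply, SchwartzMap.laplacian_apply]
  have := (φ.contDiffAt 2 (x := x)).laplacian_CLM_comp_left (l := (Complex.conjCLE : ℂ →L[ℝ] ℂ))
  exact this

theorem continuous_integral_schwartz_mul (φ : 𝓢(E, ℂ)) :
    Continuous fun u : L²(E) => ∫ x, φ x * u x := by
  have : (fun u : L²(E) => ∫ x, φ x * u x) =
      fun u => inner ℂ ((conjSchwartz φ).toLp 2) u := by
    funext u
    rw [PairFrame.inner_Lp_eq]
    refine integral_congr_ae ?_
    filter_upwards [(conjSchwartz φ).coeFn_toLp 2] with x hx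
    rw [hx, conjSchwartz_apply, Complex.conj_conj]
  rw [this]
  exact continuous_const.inner continuous_id

theorem inner_toLp_right (φ : 𝓢(E, ℂ)) (u : L²(E)) :
    inner ℂ u (φ.toLp 2) = starRingEnd ℂ (∫ x, conjSchwartz φ x * u x) := by
  rw [PairFrame.inner_Lp_eq, ← integral_conj]
  refine integral_congr_ae ?_
  filter_upwards [φ.coeFn_toLp 2] with x hx
  rw [hx, map_mul, conjSchwartz_apply, Complex.conj_conj, mul_comm]

end

section

variable {N : ℕ}

theorem onPlane_antilipschitz {i j : Fin N} (hij : i ≠ j) :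
    AntilipschitzWith 1 (onPlaneCLM i j) := by
  refine ContinuousLinearMap.antilipschitz_of_bound _ fun X => ?_
  rw [NNReal.coe_one, one_mul, onPlaneCLM_apply]
  refine le_of_sq_le_sq ?_ (norm_nonneg _)
  rw [norm_sq_config, norm_sq_config, sum_eq_others hij, Fintype.sum_option]
  simp only [onPlane, merge_left, merge_right hij, merge_others hij]
  nlinarith [sq_nonneg ‖X none‖]

/-- The restriction of a Schwartz function to a coincidence hyperplane. -/
noncomputable def planeSchwartz {i j : Fin N} (hij : i ≠ j) (φ : 𝓢(Config (Fin N), ℂ)) :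
    𝓢(Config (ChargeIdx N), ℂ) :=
  SchwartzMap.compCLMOfAntilipschitz ℂ (onPlaneCLM i j).hasTemperateGrowth (onPlane_antilipschitz hij) φ

theorem planeSchwartz_apply {i j : Fin N} (hij : i ≠ j) (φ : 𝓢(Config (Fin N), ℂ))
    (X : Config (ChargeIdx N)) : planeSchwartz hij φ X = φ (onPlane i j X) := by
  rw [← onPlaneCLM_apply]; rfl

/-- The restriction to a hyperplane in momentum space. -/
theorem integral_fourier_contract_mul {i j : Fin N} (hij : i ≠ j) (u : 𝓢(Config (ChargeIdx N), ℂ))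
    (ψ : 𝓢(Config (Fin N), ℂ)) :
    ∫ p, (𝓕 u : 𝓢(Config (ChargeIdx N), ℂ)) (contract i j p) * ψ p =
      ∫ X, u X * (𝓕 ψ : 𝓢(Config (Fin N), ℂ)) (onPlane i j X) := by
  let B : Config (ChargeIdx N) →ₗ[ℝ] Config (Fin N) →ₗ[ℝ] ℝ :=
    (innerₗ (Config (ChargeIdx N))).compl₂ (contractCLM i j : Config (Fin N) →ₗ[ℝ] Config (ChargeIdx N))
  have hB : ∀ X p, B X p = inner ℝ X (contract i j p) := fun X p => by
    rw [← contractCLM_apply]; rfl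
  have h := VectorFourier.integral_bilin_fourierIntegral_eq_flip (e := Real.fourierChar)
    (μ := volume) (ν := volume) (L := B) (f := u) (g := ψ)
    (ContinuousLinearMap.mul ℂ ℂ) Real.continuous_fourierChar
    (by
      have hc := continuous_contract i j
      simp only [hB]; fun_prop) u.integrable ψ.integrable
  simp only [ContinuousLinearMap.mul_apply'] at h
  have e1 : ∀ p, VectorFourier.fourierIntegral Real.fourierChar volume B u p =
      (𝓕 u : 𝓢(Config (ChargeIdx N), ℂ)) (contract i j p) := fun p => by
    rw [SchwartzMap.fourier_coe, Real.fourier_eq, VectorFourier.fourierIntegral]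
    simp only [hB]
  have e2 : ∀ X, VectorFourier.fourierIntegral Real.fourierChar volume B.flip ψ X =
      (𝓕 ψ : 𝓢(Config (Fin N), ℂ)) (onPlane i j X) := fun X => by
    rw [SchwartzMap.fourier_coe, Real.fourier_eq, VectorFourier.fourierIntegral]
    refine integral_congr_ae (Eventually.of_forall fun p => ?_)
    simp only [LinearMap.flip_apply]
    rw [hB, inner_onPlane hij, real_inner_comm]
  simp only [e1, e2] at h
  exact h

/-- `G` is the operator `ξ ↦ (-Δ + lam)⁻¹ δ_{π_{ij}} ξ` in momentum space. -/
def IsPlanePotential (lam : ℝ) (i j : Fin N) (G : L2 (ChargeIdx N) →L[ℂ] L2 (Fin N)) : Prop :=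
  ∀ u, ∀ᵐ p, (𝓕 (G u) : L2 (Fin N)) p =
    ((1 / freeSymbol lam p : ℝ) : ℂ) * (𝓕 u : L2 (ChargeIdx N)) (contract i j p)

theorem exists_isPlanePotential {lam : ℝ} (hlam : 0 < lam) {i j : Fin N} (hij : i ≠ j) :
    ∃ G : L2 (ChargeIdx N) →L[ℂ] L2 (Fin N), IsPlanePotential lam i j G := by
  obtain ⟨M, hM⟩ := exists_contractOp hlam hij
  refine ⟨((Lp.fourierTransformₗᵢ (Config (Fin N)) ℂ).symm.toContinuousLinearEquiv :
    L2 (Fin N) →L[ℂ] L2 (Fin N)).comp (M.comp ((Lp.fourierTransformₗᵢ (Config (ChargeIdx N)) ℂ).toContinuousLinearEquiv :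
    L2 (ChargeIdx N) →L[ℂ] L2 (ChargeIdx N))), fun u => ?_⟩
  have : (𝓕 ((Lp.fourierTransformₗᵢ (Config (Fin N)) ℂ).symm
      (M (𝓕 u : L2 (ChargeIdx N)))) : L2 (Fin N)) = M (𝓕 u : L2 (ChargeIdx N)) :=
    (Lp.fourierTransformₗᵢ (Config (Fin N)) ℂ).apply_symm_apply _
  have h2 := hM (𝓕 u : L2 (ChargeIdx N))
  rw [← this] at h2
  exact h2

theorem IsPlanePotential.fourier_toLp {lam : ℝ} {i j : Fin N} (hij : i ≠ j)
    {G : L2 (ChargeIdx N) →L[ℂ] L2 (Fin N)} (hG : IsPlanePotential lam i j G)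
    (f : 𝓢(Config (ChargeIdx N), ℂ)) :
    ∀ᵐ p, (𝓕 (G (f.toLp 2)) : L2 (Fin N)) p = ((1 / freeSymbol lam p : ℝ) : ℂ) *
      (𝓕 f : 𝓢(Config (ChargeIdx N), ℂ)) (contract i j p) := by
  have h3 : ∀ᵐ p, (𝓕 (f.toLp 2 : L2 (ChargeIdx N)) : L2 (ChargeIdx N)) p =
      (𝓕 f : 𝓢(Config (ChargeIdx N), ℂ)) p := by
    rw [SchwartzMap.toLp_fourier_eq]
    exact SchwartzMap.coeFn_toLp (𝓕 f : 𝓢(Config (ChargeIdx N), ℂ)) 2 volume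
  filter_upwards [hG (f.toLp 2), ae_contract hij h3] with p h4 h5
  rw [h4, h5]

theorem IsPlanePotential.integral_freeSchwartz_mul_toLp {lam : ℝ} (hlam : 0 < lam) {i j : Fin N}
    (hij : i ≠ j) {G : L2 (ChargeIdx N) →L[ℂ] L2 (Fin N)} (hG : IsPlanePotential lam i j G)
    (f : 𝓢(Config (ChargeIdx N), ℂ)) (φ : 𝓢(Config (Fin N), ℂ)) :
    ∫ x, freeSchwartz lam φ x * G (f.toLp 2) x = ∫ X, f X * φ (onPlane i j X) := by
  rw [integral_freeSchwartz_mul_eq]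
  have h1 := integral_fourier_contract_mul hij f (𝓕⁻ φ)
  rw [FourierTransform.fourier_fourierInv_eq] at h1
  rw [← h1]
  refine integral_congr_ae ?_
  filter_upwards [hG.fourier_toLp hij f] with p h4
  rw [h4]
  have : (freeSymbol lam p : ℂ) ≠ 0 := by exact_mod_cast (freeSymbol_pos hlam p).ne'
  rw [← mul_assoc (freeSymbol lam p : ℂ), Complex.ofReal_div, Complex.ofReal_one, mul_one_div_cancel this,
    one_mul, mul_comm]

/-- `G u` solves `(-Δ + lam) (G u) = δ_{π_{ij}} u` in the sense of distributions. -/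
theorem IsPlanePotential.integral_freeSchwartz_mul {lam : ℝ} (hlam : 0 < lam) {i j : Fin N} (hij : i ≠ j)
    {G : L2 (ChargeIdx N) →L[ℂ] L2 (Fin N)} (hG : IsPlanePotential lam i j G)
    (u : L2 (ChargeIdx N)) (φ : 𝓢(Config (Fin N), ℂ)) :
    ∫ x, freeSchwartz lam φ x * G u x = ∫ X, planeSchwartz hij φ X * u X := by
  have hc1 : Continuous fun u : L2 (ChargeIdx N) => ∫ x, freeSchwartz lam φ x * G u x :=
    (continuous_integral_schwartz_mul _).comp G.continuous
  have hd := SchwartzMap.denseRange_toLpCLM (E := Config (ChargeIdx N)) (F := ℂ) (p := 2) (by norm_num)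
    (μ := volume)
  refine congrFun (hd.equalizer hc1 (continuous_integral_schwartz_mul (planeSchwartz hij φ)) ?_) u
  funext f
  refine (hG.integral_freeSchwartz_mul_toLp hlam hij f φ).trans (integral_congr_ae ?_)
  filter_upwards [f.coeFn_toLp 2] with x hx
  rw [planeSchwartz_apply, SchwartzMap.toLpCLM_apply, hx, mul_comm]

/-- The adjoint of `G` maps `(-Δ + lam) φ` to the restriction of `φ` to the hyperplane. -/
theorem IsPlanePotential.adjoint_freeSchwartz {lam : ℝ} (hlam : 0 < lam) {i j : Fin N} (hij : i ≠ j)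
    {G : L2 (ChargeIdx N) →L[ℂ] L2 (Fin N)} (hG : IsPlanePotential lam i j G)
    (φ : 𝓢(Config (Fin N), ℂ)) :
    ContinuousLinearMap.adjoint G ((freeSchwartz lam φ).toLp 2) = (planeSchwartz hij φ).toLp 2 := by
  refine ext_inner_left ℂ fun u => ?_
  rw [ContinuousLinearMap.adjoint_inner_right, inner_toLp_right, inner_toLp_right]
  congr 1
  have := hG.integral_freeSchwartz_mul hlam hij u (conjSchwartz φ)
  simp only [freeSchwartz_conjSchwartz] at this
  simp only [conjSchwartz_apply]
  exact this

end

end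

section

/-! ### The free resolvent and traces -/

section

variable {E : Type} [NormedAddCommGroup E] [InnerProductSpace ℝ E] [FiniteDimensional ℝ E]
  [MeasurableSpace E] [BorelSpace E]

/-- `R = (-Δ + lam)⁻¹`, in momentum space. -/
def IsFreeResolvent (lam : ℝ) (R : L²(E) →L[ℂ] L²(E)) : Prop :=
  ∀ f, ∀ᵐ p, (𝓕 (R f) : L²(E)) p =
    ((1 / freeSymbol lam p : ℝ) : ℂ) * (𝓕 f : L²(E)) p

theorem fourier_Lp_injective {u v : L²(E)}
    (h : ∀ᵐ p, (𝓕 u : L²(E)) p = (𝓕 v : L²(E)) p) : u = v := by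
  apply (Lp.fourierTransformₗᵢ E ℂ).injective
  exact Lp.ext h

theorem exists_fourier_eq (v : L²(E)) :
    ∃ u : L²(E), (𝓕 u : L²(E)) = v :=
  ⟨(Lp.fourierTransformₗᵢ E ℂ).symm v, (Lp.fourierTransformₗᵢ E ℂ).apply_symm_apply v⟩

theorem fourier_add_smul_ae (u v : L²(E)) (c : ℂ) :
    ∀ᵐ p, (𝓕 (u + c • v) : L²(E)) p =
      (𝓕 u : L²(E)) p + c * (𝓕 v : L²(E)) p := by
  have e : (𝓕 (u + c • v) : L²(E)) = 𝓕 u + c • (𝓕 v : L²(E)) :=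
    ((Lp.fourierTransformₗᵢ E ℂ).map_add u (c • v)).trans
      (congrArg _ ((Lp.fourierTransformₗᵢ E ℂ).map_smul c v))
  rw [e]
  filter_upwards [Lp.coeFn_add (𝓕 u : L²(E)) (c • (𝓕 v : L²(E))),
    Lp.coeFn_smul c (𝓕 v : L²(E))] with p h1 h2
  rw [h1, Pi.add_apply, h2, Pi.smul_apply, smul_eq_mul]

theorem exists_isFreeResolvent {lam : ℝ} (hlam : 0 < lam) :
    ∃ R : L²(E) →L[ℂ] L²(E), IsFreeResolvent lam R := by
  have hfs := (continuous_freeSymbol lam (E := E)).measurable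
  obtain ⟨M, hM, -⟩ := exists_mulOp (E := E) (m := fun p => ((1 / freeSymbol lam p : ℝ) : ℂ)) (by fun_prop)
    (C := 1 / lam) (ae_of_all _ fun p => by
      rw [Complex.norm_real, Real.norm_of_nonneg (one_div_nonneg.2 (freeSymbol_pos hlam p).le)]
      apply one_div_le_one_div_of_le hlam
      unfold freeSymbol
      have : 0 ≤ (2 * π) ^ 2 * ‖p‖ ^ 2 := by positivity
      linarith)
  refine ⟨((Lp.fourierTransformₗᵢ E ℂ).symm.toContinuousLinearEquiv :
    L²(E) →L[ℂ] L²(E)).comp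
      (M.comp ((Lp.fourierTransformₗᵢ E ℂ).toContinuousLinearEquiv :
        L²(E) →L[ℂ] L²(E))), fun u => ?_⟩
  have : (𝓕 ((Lp.fourierTransformₗᵢ E ℂ).symm
      (M (𝓕 u : L²(E)))) : L²(E)) =
      M (𝓕 u : L²(E)) :=
    (Lp.fourierTransformₗᵢ E ℂ).apply_symm_apply _
  have h2 := hM (𝓕 u : L²(E))
  rw [← this] at h2
  exact h2

namespace IsFreeResolvent

variable {lam : ℝ} {R : L²(E) →L[ℂ] L²(E)}

/-- `h = -Δ w` means that `w` is the resolvent of `h + lam w`. -/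
theorem isFree_iff (hR : IsFreeResolvent lam R) (hlam : 0 < lam) (w h : L²(E)) :
    (h : 𝓢'(E, ℂ)) = -Δ (w : 𝓢'(E, ℂ)) ↔ w = R (h + (lam : ℂ) • w) := by
  rw [eq_neg_laplacian_iff]
  have h1 := fourier_add_smul_ae h w (lam : ℂ)
  have hne : ∀ p : E, (freeSymbol lam p : ℂ) ≠ 0 := fun p => by
    exact_mod_cast (freeSymbol_pos hlam p).ne'
  constructor
  · intro hh
    refine fourier_Lp_injective ?_
    filter_upwards [hh, h1, hR (h + (lam : ℂ) • w)] with p k1 k2 k3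
    rw [k3, k2, k1, ← add_mul, ← Complex.ofReal_add, ← mul_assoc, ← Complex.ofReal_mul]
    change _ = ((1 / freeSymbol lam p * freeSymbol lam p : ℝ) : ℂ) * _
    rw [one_div_mul_cancel (freeSymbol_pos hlam p).ne', Complex.ofReal_one, one_mul]
  · intro hw
    have h3 := hR (h + (lam : ℂ) • w)
    rw [← hw] at h3
    filter_upwards [h1, h3] with p k2 k3
    rw [k2] at k3
    have := hne p
    have e : (freeSymbol lam p : ℂ) = (((2 * π) ^ 2 * ‖p‖ ^ 2 : ℝ) : ℂ) + (lam : ℂ) := by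
      rw [← Complex.ofReal_add]; rfl
    have k4 : (freeSymbol lam p : ℂ) * (𝓕 w : L²(E)) p =
        (𝓕 h : L²(E)) p + (lam : ℂ) * (𝓕 w : L²(E)) p := by
      conv_lhs => rw [k3]
      rw [← mul_assoc, Complex.ofReal_div, Complex.ofReal_one, mul_one_div_cancel this, one_mul]
    rw [e] at k4
    linear_combination -k4

/-- The range of the resolvent is `H²`. -/
theorem memSobolev_iff (hR : IsFreeResolvent lam R) (hlam : 0 < lam) (w : L²(E)) :
    TemperedDistribution.MemSobolev 2 2 (w : 𝓢'(E, ℂ)) ↔ ∃ f, w = R f := by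
  rw [memSobolev_two_iff]
  have e2 : ∀ p : E, (1 + ‖p‖ ^ 2) ^ ((2 : ℝ) / 2) = 1 + ‖p‖ ^ 2 := fun p => by norm_num
  simp only [e2]
  have hfs := (continuous_freeSymbol lam (E := E)).measurable
  have hpi : 1 ≤ (2 * π) ^ 2 := by
    have := Real.pi_gt_three
    nlinarith
  constructor
  · rintro ⟨h, hh⟩
    obtain ⟨M, hM, -⟩ := exists_mulOp (E := E) (m := fun p => ((freeSymbol lam p / (1 + ‖p‖ ^ 2) : ℝ) : ℂ))
      (by fun_prop) (C := (2 * π) ^ 2 + lam) (ae_of_all _ fun p => by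
        have h0 : 0 < 1 + ‖p‖ ^ 2 := by positivity
        rw [Complex.norm_real, Real.norm_of_nonneg (div_nonneg (freeSymbol_pos hlam p).le h0.le),
          div_le_iff₀ h0]
        unfold freeSymbol
        nlinarith [sq_nonneg ‖p‖])
    obtain ⟨f, hf⟩ := exists_fourier_eq (M h)
    refine ⟨f, fourier_Lp_injective ?_⟩
    have h1 := hM h
    rw [← hf] at h1
    filter_upwards [hh, h1, hR f] with p k1 k2 k3
    rw [k3, k2, k1, ← mul_assoc, ← mul_assoc, ← Complex.ofReal_mul, ← Complex.ofReal_mul]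
    have : 1 / freeSymbol lam p * (freeSymbol lam p / (1 + ‖p‖ ^ 2)) * (1 + ‖p‖ ^ 2) = 1 := by
      have := freeSymbol_pos hlam p
      field_simp
    rw [this, Complex.ofReal_one, one_mul]
  · rintro ⟨f, rfl⟩
    obtain ⟨M, hM, -⟩ := exists_mulOp (E := E) (m := fun p => (((1 + ‖p‖ ^ 2) / freeSymbol lam p : ℝ) : ℂ))
      (by fun_prop) (C := 1 + 1 / lam) (ae_of_all _ fun p => by
        have h0 : 0 < 1 + ‖p‖ ^ 2 := by positivity
        have h1 := freeSymbol_pos hlam p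
        rw [Complex.norm_real, Real.norm_of_nonneg (div_nonneg h0.le h1.le), div_le_iff₀ h1]
        have h2 : lam ≤ freeSymbol lam p := by
          unfold freeSymbol
          have : 0 ≤ (2 * π) ^ 2 * ‖p‖ ^ 2 := by positivity
          linarith
        have h3 : ‖p‖ ^ 2 ≤ freeSymbol lam p := by
          unfold freeSymbol
          nlinarith [sq_nonneg ‖p‖]
        have h4 : 1 ≤ 1 / lam * freeSymbol lam p := by
          rw [one_div_mul_eq_div, one_le_div hlam]; exact h2
        linarith)
    refine ⟨M (𝓕 f : L²(E)), ?_⟩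
    filter_upwards [hM (𝓕 f : L²(E)), hR f] with p k1 k2
    rw [k1, k2, ← mul_assoc, ← Complex.ofReal_mul, mul_one_div]

theorem symm (hR : IsFreeResolvent lam R) (f g : L²(E)) :
    inner ℂ (R f) g = inner ℂ f (R g) := by
  rw [← Lp.inner_fourier_eq, ← Lp.inner_fourier_eq f, PairFrame.inner_Lp_eq, PairFrame.inner_Lp_eq]
  refine integral_congr_ae ?_
  filter_upwards [hR f, hR g] with p h1 h2
  rw [h1, h2, map_mul, Complex.conj_ofReal]
  ring

theorem re_inner_eq (hR : IsFreeResolvent lam R) (f : L²(E)) :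
    (inner ℂ f (R f)).re = ∫ p, 1 / freeSymbol lam p * ‖(𝓕 f : L²(E)) p‖ ^ 2 := by
  rw [← Lp.inner_fourier_eq, PairFrame.inner_Lp_eq, ← RCLike.re_to_complex, ← integral_re (PairFrame.integrable_conj_mul _ _)]
  refine integral_congr_ae ?_
  filter_upwards [hR f] with p h1
  rw [h1, mul_left_comm, mul_comm (starRingEnd ℂ _), Complex.mul_conj, RCLike.re_to_complex,
    ← Complex.ofReal_mul, Complex.ofReal_re, Complex.normSq_eq_norm_sq]

theorem re_inner_nonneg (hR : IsFreeResolvent lam R) (hlam : 0 < lam) (f : L²(E)) :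
    0 ≤ (inner ℂ f (R f)).re := by
  rw [hR.re_inner_eq]
  exact integral_nonneg fun p => mul_nonneg (one_div_nonneg.2 (freeSymbol_pos hlam p).le) (sq_nonneg _)

theorem injective (hR : IsFreeResolvent lam R) (hlam : 0 < lam) {f : L²(E)}
    (h : R f = 0) : f = 0 := by
  have h0 : (𝓕 (0 : L²(E)) : L²(E)) = 0 :=
    map_zero (Lp.fourierTransformₗᵢ E ℂ)
  refine fourier_Lp_injective ?_
  have h1 := hR f
  rw [h] at h1
  rw [h0] at h1 ⊢
  filter_upwards [h1, Lp.coeFn_zero ℂ 2 (volume : Measure E)] with p k1 k2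
  rw [k2, Pi.zero_apply] at k1 ⊢
  have : ((1 / freeSymbol lam p : ℝ) : ℂ) ≠ 0 := by
    exact_mod_cast (one_div_pos.2 (freeSymbol_pos hlam p)).ne'
  exact (mul_eq_zero.1 k1.symm).resolve_left this

theorem eq_zero_of_re_inner (hR : IsFreeResolvent lam R) (hlam : 0 < lam) {f : L²(E)}
    (h : (inner ℂ f (R f)).re = 0) : f = 0 := by
  have hint : Integrable fun p => 1 / freeSymbol lam p * ‖(𝓕 f : L²(E)) p‖ ^ 2 := by
    refine (PairFrame.integrable_conj_mul (𝓕 f : L²(E)) (𝓕 (R f))).re.congr ?_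
    filter_upwards [hR f] with p h1
    rw [h1, mul_left_comm, mul_comm (starRingEnd ℂ _), Complex.mul_conj, RCLike.re_to_complex,
      ← Complex.ofReal_mul, Complex.ofReal_re, Complex.normSq_eq_norm_sq]
  rw [hR.re_inner_eq, integral_eq_zero_iff_of_nonneg (fun p => mul_nonneg
    (one_div_nonneg.2 (freeSymbol_pos hlam p).le) (sq_nonneg _)) hint] at h
  have h0 : (𝓕 (0 : L²(E)) : L²(E)) = 0 :=
    map_zero (Lp.fourierTransformₗᵢ E ℂ)
  refine fourier_Lp_injective ?_
  rw [h0]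
  filter_upwards [h, Lp.coeFn_zero ℂ 2 (volume : Measure E)] with p k1 k2
  rw [k2]
  have := (mul_eq_zero.1 k1).resolve_left (one_div_pos.2 (freeSymbol_pos hlam p)).ne'
  simpa using this

theorem apply_freeSchwartz (hR : IsFreeResolvent lam R) (hlam : 0 < lam) (φ : 𝓢(E, ℂ)) :
    R ((freeSchwartz lam φ).toLp 2) = φ.toLp 2 := by
  have h := (hR.isFree_iff hlam (φ.toLp 2) ((-Δ φ).toLp 2)).1 (by
    rw [Lp.toTemperedDistribution_toLp_eq,
      Lp.toTemperedDistribution_toLp_eq,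
      TemperedDistribution.laplacian_toTemperedDistributionCLM_eq, map_neg])
  rw [h]
  congr 1
  have e : freeSchwartz lam φ = -Δ φ + (lam : ℂ) • φ := by
    rw [freeSchwartz, sub_eq_neg_add]
  rw [e]
  have := (SchwartzMap.toLpCLM ℂ (E := E) ℂ 2 volume).map_add (-Δ φ) ((lam : ℂ) • φ)
  rw [map_smul] at this
  exact this

end IsFreeResolvent

theorem toLp_freeSchwartz (lam : ℝ) (φ : 𝓢(E, ℂ)) :
    (freeSchwartz lam φ).toLp 2 volume = (lam : ℂ) • (φ.toLp 2 volume : L²(E)) - (Δ φ : 𝓢(E, ℂ)).toLp 2 volume := by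
  have := (SchwartzMap.toLpCLM ℂ (E := E) ℂ 2 volume).map_sub ((lam : ℂ) • φ) (Δ φ)
  rw [map_smul] at this
  exact this

/-- The functions `(-Δ + lam) φ` are dense in `L²`, since the homogeneous equation has no solution. -/
theorem exists_tendsto_freeSchwartz {lam : ℝ} (hlam : 0 < lam) (f : L²(E)) :
    ∃ φ : ℕ → 𝓢(E, ℂ), Tendsto (fun n => (freeSchwartz lam (φ n)).toLp 2) atTop (𝓝 f) := by
  let T : 𝓢(E, ℂ) →ₗ[ℂ] L²(E) :=
    { toFun := fun φ => (freeSchwartz lam φ).toLp 2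
      map_add' := fun φ ψ => by
        have e : freeSchwartz lam (φ + ψ) = freeSchwartz lam φ + freeSchwartz lam ψ := by
          have : Δ (φ + ψ) = Δ φ + Δ ψ := by
            simp only [SchwartzMap.laplacian_eq_sum (stdOrthonormalBasis ℝ E), LineDeriv.lineDerivOp_add,
              Finset.sum_add_distrib]
          rw [freeSchwartz, freeSchwartz, freeSchwartz, this, smul_add]; abel
        rw [e]
        exact (SchwartzMap.toLpCLM ℂ (E := E) ℂ 2 volume).map_add _ _
      map_smul' := fun c φ => by
        have e : freeSchwartz lam (c • φ) = c • freeSchwartz lam φ := by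
          have : Δ (c • φ) = c • Δ φ := by
            simp only [SchwartzMap.laplacian_eq_sum (stdOrthonormalBasis ℝ E), LineDeriv.lineDerivOp_smul,
              Finset.smul_sum]
          rw [freeSchwartz, freeSchwartz, this, smul_sub, smul_comm]
        rw [e]
        exact (SchwartzMap.toLpCLM ℂ (E := E) ℂ 2 volume).map_smul c _ }
  have hT : (LinearMap.range T).topologicalClosure = ⊤ := by
    rw [Submodule.topologicalClosure_eq_top_iff, Submodule.eq_bot_iff]
    intro g hg
    have h2 : star g = 0 := by
      refine eq_zero_of_integral_freeSchwartz hlam fun φ => ?_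
      have := Submodule.inner_left_of_mem_orthogonal (LinearMap.mem_range_self T φ) hg
      rw [PairFrame.inner_Lp_eq] at this
      rw [← this]
      refine integral_congr_ae ?_
      filter_upwards [(freeSchwartz lam φ).coeFn_toLp 2, Lp.coeFn_star g] with x h1 h2
      change _ = _ * ((freeSchwartz lam φ).toLp 2 volume) x
      rw [h1, h2, mul_comm]; rfl
    refine Lp.ext ?_
    have h3 := Lp.coeFn_star g
    rw [h2] at h3
    filter_upwards [h3, Lp.coeFn_zero ℂ 2 (volume : Measure E)] with x k1 k2
    rw [k2, Pi.zero_apply] at k1 ⊢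
    exact star_eq_zero.1 k1.symm
  have hf : f ∈ closure (LinearMap.range T : Set (L²(E))) := by
    have : f ∈ (LinearMap.range T).topologicalClosure := by rw [hT]; trivial
    exact this
  obtain ⟨x, hx, hxf⟩ := mem_closure_iff_seq_limit.1 hf
  choose φ hφ using hx
  refine ⟨φ, ?_⟩
  have : (fun n => (freeSchwartz lam (φ n)).toLp 2 volume) = x := funext hφ
  rw [this]; exact hxf

end

end

section

section

variable {N : ℕ} {lam : ℝ}

theorem tendsto_toLp_iff {E : Type} [NormedAddCommGroup E] [InnerProductSpace ℝ E] [FiniteDimensional ℝ E]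
    [MeasurableSpace E] [BorelSpace E] (φ : ℕ → 𝓢(E, ℂ)) (u : L²(E)) :
    Tendsto (fun n => eLpNorm (fun x => φ n x - u x) 2 volume) atTop (𝓝 0) ↔
      Tendsto (fun n => (φ n).toLp 2) atTop (𝓝 u) := by
  rw [Lp.tendsto_Lp_iff_tendsto_eLpNorm']
  have : ∀ n, eLpNorm (fun x => φ n x - u x) 2 volume =
      eLpNorm (⇑((φ n).toLp 2 volume) - ⇑u) 2 volume := fun n => by
    refine eLpNorm_congr_ae ?_
    filter_upwards [(φ n).coeFn_toLp 2] with x hx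
    rw [Pi.sub_apply, hx]
  simp only [this]

/-- The trace of `w = (-Δ + lam)⁻¹ f` is `G* f`, where `G` is the potential operator of the
hyperplane: this holds for Schwartz functions, and both sides are continuous in `f`. -/
theorem isTrace_iff_adjoint (hlam : 0 < lam) {i j : Fin N} (hij : i ≠ j)
    {R : L2 (Fin N) →L[ℂ] L2 (Fin N)} (hR : IsFreeResolvent lam R)
    {G : L2 (ChargeIdx N) →L[ℂ] L2 (Fin N)} (hG : IsPlanePotential lam i j G)
    {w h : BosonSpace N} (hwh : IsFree w h) (η : ChargeSpace N) :
    IsTrace i j w η ↔ (η : L2 (ChargeIdx N)) =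
      ContinuousLinearMap.adjoint G ((h : L2 (Fin N)) + (lam : ℂ) • (w : L2 (Fin N))) := by
  have hw := (hR.isFree_iff hlam (w : L2 (Fin N)) (h : L2 (Fin N))).1 hwh
  set f : L2 (Fin N) := (h : L2 (Fin N)) + (lam : ℂ) • (w : L2 (Fin N)) with hf
  have hpl : ∀ φ : ℕ → 𝓢(Config (Fin N), ℂ),
      Tendsto (fun n => eLpNorm (fun X => φ n (onPlane i j X) - (η : L2 (ChargeIdx N)) X) 2 volume)
        atTop (𝓝 0) ↔ Tendsto (fun n => (planeSchwartz hij (φ n)).toLp 2) atTop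
          (𝓝 (η : L2 (ChargeIdx N))) := fun φ => by
    rw [← tendsto_toLp_iff]
    simp only [planeSchwartz_apply]
  constructor
  · rintro ⟨φ, g, h1, h2, h3⟩
    rw [hpl] at h3
    have h4 : Tendsto (fun n => (freeSchwartz lam (φ n)).toLp 2) atTop
        (𝓝 ((lam : ℂ) • (w : L2 (Fin N)) - g)) := by
      simp only [toLp_freeSchwartz]
      exact (h1.const_smul _).sub h2
    have h5 := (R.continuous.tendsto _).comp h4
    have h6 : R ((lam : ℂ) • (w : L2 (Fin N)) - g) = R f := by
      rw [← hw]
      refine tendsto_nhds_unique h5 (h1.congr fun n => ?_)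
      exact (hR.apply_freeSchwartz hlam (φ n)).symm
    have h7 : (lam : ℂ) • (w : L2 (Fin N)) - g = f := by
      rw [← sub_eq_zero, ← map_sub] at h6
      exact sub_eq_zero.1 (hR.injective hlam h6)
    rw [h7] at h4
    refine tendsto_nhds_unique h3 (Tendsto.congr (fun n => ?_)
      (((ContinuousLinearMap.adjoint G).continuous.tendsto f).comp h4))
    exact hG.adjoint_freeSchwartz hlam hij (φ n)
  · intro hη
    obtain ⟨φ, hφ⟩ := exists_tendsto_freeSchwartz hlam f
    have h1 : Tendsto (fun n => (φ n).toLp 2) atTop (𝓝 (w : L2 (Fin N))) := by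
      rw [hw]
      refine Tendsto.congr (fun n => ?_) ((R.continuous.tendsto f).comp hφ)
      exact hR.apply_freeSchwartz hlam (φ n)
    refine ⟨φ, (lam : ℂ) • (w : L2 (Fin N)) - f, h1, ?_, ?_⟩
    · refine Tendsto.congr (fun n => ?_) ((h1.const_smul (lam : ℂ)).sub hφ)
      rw [toLp_freeSchwartz]; abel
    · rw [hpl, hη]
      refine Tendsto.congr (fun n => ?_)
        (((ContinuousLinearMap.adjoint G).continuous.tendsto f).comp hφ)
      exact hG.adjoint_freeSchwartz hlam hij (φ n)

/-- The labels, with `i` and `j` in front. -/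
noncomputable def labelEquiv {i j : Fin N} (hij : i ≠ j) : Option (Option (Fin (N - 2))) ≃ Fin N :=
  Equiv.ofBijective (fun m => m.elim i fun m => m.elim j (others i j)) <| by
    constructor
    · rintro (_ | _ | a) (_ | _ | b) h
      · rfl
      · exact absurd h hij
      · exact absurd h.symm (others_ne_left hij b)
      · exact absurd h.symm hij
      · rfl
      · exact absurd h.symm (others_ne_right hij b)
      · exact absurd h (others_ne_left hij a)
      · exact absurd h (others_ne_right hij a)
      · rw [others_injective i j h]
    · intro m
      rcases eq_or_eq_others hij m with rfl | rfl | ⟨k, rfl⟩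
      · exact ⟨none, rfl⟩
      · exact ⟨some none, rfl⟩
      · exact ⟨some (some k), rfl⟩

theorem exists_contract_relabel_of_charge {i j i' j' : Fin N} (hij : i ≠ j) (hij' : i' ≠ j')
    (τ : Equiv.Perm (Fin (N - 2))) : ∃ σ : Equiv.Perm (Fin N), ∀ p : Config (Fin N),
      contract i j (relabel σ p) = relabel (chargePerm τ) (contract i' j' p) := by
  refine ⟨((labelEquiv hij).symm.trans ((chargePerm τ.symm).optionCongr.trans (labelEquiv hij'))).symm,
    fun p => config_ext fun m => ?_⟩
  have h0 : (labelEquiv hij).symm i = none := (labelEquiv hij).symm_apply_eq.2 rfl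
  have h1 : (labelEquiv hij).symm j = some none := (labelEquiv hij).symm_apply_eq.2 rfl
  have h2 : ∀ k, (labelEquiv hij).symm (others i j k) = some (some k) := fun k =>
    (labelEquiv hij).symm_apply_eq.2 rfl
  rcases m with _ | k
  · rw [contract_none, relabel_chargePerm_none, contract_none, relabel_apply, relabel_apply]
    simp only [Equiv.symm_symm, Equiv.trans_apply, h0, h1]
    rfl
  · rw [contract_some, relabel_chargePerm_some, contract_some, relabel_apply]
    simp only [Equiv.symm_symm, Equiv.trans_apply, h2]
    rfl

theorem exists_contract_relabel_of_perm {i j : Fin N} (hij : i ≠ j) (σ : Equiv.Perm (Fin N)) :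
    ∃ τ : Equiv.Perm (Fin (N - 2)), ∀ p : Config (Fin N),
      contract i j (relabel σ p) = relabel (chargePerm τ) (contract (σ.symm i) (σ.symm j) p) := by
  have hij' : σ.symm i ≠ σ.symm j := σ.symm.injective.ne hij
  obtain ⟨τ, hτ⟩ := exists_perm_comp (f := fun k => σ.symm (others i j k))
    (g := others (σ.symm i) (σ.symm j)) (σ.symm.injective.comp (others_injective i j)) fun k => by
      rcases eq_or_eq_others hij' (σ.symm (others i j k)) with h | h | ⟨k', h⟩
      · exact absurd (σ.symm.injective h) (others_ne_left hij k)
      · exact absurd (σ.symm.injective h) (others_ne_right hij k)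
      · exact ⟨k', h.symm⟩
  refine ⟨τ.symm, fun p => config_ext fun m => ?_⟩
  rcases m with _ | k
  · rw [contract_none, relabel_chargePerm_none, contract_none, relabel_apply, relabel_apply]
  · rw [contract_some, relabel_chargePerm_some, contract_some, relabel_apply, Equiv.symm_symm, hτ]

/-- The potentials of the hyperplanes are carried into each other by the permutations. -/
theorem IsPlanePotential.permL2_comm {i j i' j' : Fin N} (hij' : i' ≠ j')
    {G G' : L2 (ChargeIdx N) →L[ℂ] L2 (Fin N)} (hG : IsPlanePotential lam i j G)
    (hG' : IsPlanePotential lam i' j' G') {σ : Equiv.Perm (Fin N)} {τ : Equiv.Perm (Fin (N - 2))}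
    (h : ∀ p : Config (Fin N), contract i j (relabel σ p) = relabel (chargePerm τ) (contract i' j' p))
    (u : L2 (ChargeIdx N)) : permL2 σ (G u) = G' (permL2 (chargePerm τ) u) := by
  refine fourier_Lp_injective ?_
  have h1 := (relabel σ).measurePreserving.quasiMeasurePreserving.ae (hG u)
  have h2 := hG' (permL2 (chargePerm τ) u)
  rw [fourier_permL2] at h2 ⊢
  have h3 := ae_contract hij' (permL2_ae (chargePerm τ) (𝓕 u : L2 (ChargeIdx N)))
  filter_upwards [h1, h2, h3, permL2_ae σ (𝓕 (G u) : L2 (Fin N))] with p k1 k2 k3 k4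
  rw [k4, k1, k2, k3, h, freeSymbol, freeSymbol, LinearIsometryEquiv.norm_map]

theorem IsPlanePotential.unique {i j : Fin N} {G G' : L2 (ChargeIdx N) →L[ℂ] L2 (Fin N)}
    (hG : IsPlanePotential lam i j G) (hG' : IsPlanePotential lam i j G') : G = G' := by
  ext1 u
  refine fourier_Lp_injective ?_
  filter_upwards [hG u, hG' u] with p h1 h2
  rw [h1, h2]

theorem IsPlanePotential.comm {i j : Fin N} {G : L2 (ChargeIdx N) →L[ℂ] L2 (Fin N)}
    (hG : IsPlanePotential lam i j G) : IsPlanePotential lam j i G := fun u => by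
  filter_upwards [hG u] with p h
  rw [h, contract_comm]

theorem IsFreeResolvent.permL2_comm {R : L2 (Fin N) →L[ℂ] L2 (Fin N)} (hR : IsFreeResolvent lam R)
    (σ : Equiv.Perm (Fin N)) (f : L2 (Fin N)) : permL2 σ (R f) = R (permL2 σ f) := by
  refine fourier_Lp_injective ?_
  have h1 := (relabel σ).measurePreserving.quasiMeasurePreserving.ae (hR f)
  have h2 := hR (permL2 σ f)
  rw [fourier_permL2] at h2 ⊢
  filter_upwards [h1, h2, permL2_ae σ (𝓕 (R f) : L2 (Fin N)), permL2_ae σ (𝓕 f : L2 (Fin N))]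
    with p k1 k2 k3 k4
  rw [k3, k1, k2, k4, freeSymbol, freeSymbol, LinearIsometryEquiv.norm_map]

/-- For symmetric `f`, the function `G* f` is symmetric and does not depend on the hyperplane. -/
theorem inner_permL2_adjoint {i j i' j' : Fin N} (hij : i ≠ j) (hij' : i' ≠ j')
    {G G' : L2 (ChargeIdx N) →L[ℂ] L2 (Fin N)} (hG : IsPlanePotential lam i j G)
    (hG' : IsPlanePotential lam i' j' G') (f : BosonSpace N) (τ : Equiv.Perm (Fin (N - 2)))
    (u : L2 (ChargeIdx N)) :
    inner ℂ (permL2 (chargePerm τ) u) (ContinuousLinearMap.adjoint G' (f : L2 (Fin N))) =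
      inner ℂ u (ContinuousLinearMap.adjoint G (f : L2 (Fin N))) := by
  obtain ⟨σ, hσ⟩ := exists_contract_relabel_of_charge hij hij' τ
  rw [ContinuousLinearMap.adjoint_inner_right, ContinuousLinearMap.adjoint_inner_right,
    ← hG.permL2_comm hij' hG' hσ]
  have hf := (mem_bosonSpace_iff _).1 f.2 σ
  calc inner ℂ (permL2 σ (G u)) (f : L2 (Fin N)) = inner ℂ (permL2 σ (G u)) (permL2 σ (f : L2 (Fin N))) := by
        rw [hf]
    _ = _ := LinearIsometry.inner_map_map _ _ _

/-- On symmetric functions all the hyperplanes have the same trace. -/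
theorem adjoint_eq_adjoint {i j i' j' : Fin N} (hij : i ≠ j) (hij' : i' ≠ j')
    {G G' : L2 (ChargeIdx N) →L[ℂ] L2 (Fin N)} (hG : IsPlanePotential lam i j G)
    (hG' : IsPlanePotential lam i' j' G') (f : BosonSpace N) :
    ContinuousLinearMap.adjoint G' (f : L2 (Fin N)) = ContinuousLinearMap.adjoint G (f : L2 (Fin N)) := by
  refine ext_inner_left ℂ fun u => ?_
  have h1 : ∀ p : Config (ChargeIdx N), relabel (chargePerm (1 : Equiv.Perm (Fin (N - 2)))) p = p := fun p =>
    config_ext fun m => by rcases m with _ | k <;> rfl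
  have h : permL2 (chargePerm 1) u = u := by
    refine Lp.ext ?_
    filter_upwards [permL2_ae (chargePerm 1) u] with x hx
    rw [hx, h1]
  have := inner_permL2_adjoint hij hij' hG hG' f 1 u
  rwa [h] at this

/-- The trace of a symmetric function is symmetric in the remaining particles. -/
theorem adjoint_mem_chargeSpace {i j : Fin N} (hij : i ≠ j) {G : L2 (ChargeIdx N) →L[ℂ] L2 (Fin N)}
    (hG : IsPlanePotential lam i j G) (f : BosonSpace N) :
    ContinuousLinearMap.adjoint G (f : L2 (Fin N)) ∈ invariantL2 (fun σ : Equiv.Perm (Fin (N - 2)) =>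
      (Equiv.optionCongr σ : Equiv.Perm (ChargeIdx N))) := by
  rw [mem_chargeSpace_iff]
  intro τ
  have h := inner_permL2_adjoint hij hij hG hG f τ
  set y := ContinuousLinearMap.adjoint G (f : L2 (Fin N))
  have h2 : inner ℂ y (permL2 (chargePerm τ) y) = inner ℂ y y := by
    rw [← inner_conj_symm, h, inner_conj_symm]
  rw [← sub_eq_zero, ← inner_self_eq_zero (𝕜 := ℂ), inner_sub_left, inner_sub_right, inner_sub_right,
    LinearIsometry.inner_map_map, h, h2]
  ring

end

end

section

section

variable {N : ℕ} {lam : ℝ}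

/-- The trace in momentum space: an integral over the fibre `p_i + p_j = k`. -/
theorem IsPlanePotential.fourier_adjoint {i j : Fin N} (hij : i ≠ j)
    {G : L2 (ChargeIdx N) →L[ℂ] L2 (Fin N)} (hG : IsPlanePotential lam i j G) (f : L2 (Fin N)) :
    ∀ᵐ κ, (𝓕 (ContinuousLinearMap.adjoint G f) : L2 (ChargeIdx N)) κ =
      ∫ q, ((1 / freeSymbol lam (split i j κ q) : ℝ) : ℂ) * (𝓕 f : L2 (Fin N)) (split i j κ q) := by
  have hmp := measurePreserving_split hij
  have key : ∀ s : Set (Config (ChargeIdx N)), MeasurableSet s → volume s < ∞ →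
      IntegrableOn (fun κ => ∫ q, ((1 / freeSymbol lam (split i j κ q) : ℝ) : ℂ) *
        (𝓕 f : L2 (Fin N)) (split i j κ q)) s ∧
      ∫ κ in s, (𝓕 (ContinuousLinearMap.adjoint G f) : L2 (ChargeIdx N)) κ = ∫ κ in s, ∫ q,
        ((1 / freeSymbol lam (split i j κ q) : ℝ) : ℂ) * (𝓕 f : L2 (Fin N)) (split i j κ q) := by
    intro s hs hμs
    -- Test against the function whose Fourier transform is the indicator of `s`.
    obtain ⟨u, hu⟩ := exists_fourier_eq (indicatorConstLp 2 hs hμs.ne (1 : ℂ))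
    have hv : ∀ᵐ κ, (𝓕 u : L2 (ChargeIdx N)) κ = s.indicator (fun _ => (1 : ℂ)) κ := by
      rw [hu]; exact indicatorConstLp_coeFn
    have e0 : (fun p => starRingEnd ℂ ((𝓕 (G u) : L2 (Fin N)) p) * (𝓕 f : L2 (Fin N)) p) =ᵐ[volume]
        fun p => s.indicator (fun _ => (1 : ℂ)) (contract i j p) *
          (((1 / freeSymbol lam p : ℝ) : ℂ) * (𝓕 f : L2 (Fin N)) p) := by
      filter_upwards [hG u, ae_contract hij hv] with p h1 h2
      rw [h1, h2, map_mul, Complex.conj_ofReal]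
      by_cases hp : contract i j p ∈ s
      · simp [Set.indicator_of_mem hp]
      · simp [Set.indicator_of_notMem hp]
    have hint := (PairFrame.integrable_conj_mul (𝓕 (G u) : L2 (Fin N)) (𝓕 f : L2 (Fin N))).congr e0
    have hint2 := hmp.integrable_comp_of_integrable hint
    have e1 : (fun p => s.indicator (fun _ => (1 : ℂ)) (contract i j p) *
          (((1 / freeSymbol lam p : ℝ) : ℂ) * (𝓕 f : L2 (Fin N)) p)) ∘
        (fun z : Config (ChargeIdx N) × R3 => split i j z.1 z.2) =
        fun z => s.indicator (fun _ => (1 : ℂ)) z.1 *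
          (((1 / freeSymbol lam (split i j z.1 z.2) : ℝ) : ℂ) * (𝓕 f : L2 (Fin N)) (split i j z.1 z.2)) := by
      funext z
      simp only [Function.comp_apply, contract_split hij]
    rw [e1] at hint2
    have e2 : (fun κ : Config (ChargeIdx N) => ∫ q, s.indicator (fun _ => (1 : ℂ)) κ *
          (((1 / freeSymbol lam (split i j κ q) : ℝ) : ℂ) * (𝓕 f : L2 (Fin N)) (split i j κ q))) =
        s.indicator fun κ => ∫ q, ((1 / freeSymbol lam (split i j κ q) : ℝ) : ℂ) *
          (𝓕 f : L2 (Fin N)) (split i j κ q) := by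
      funext κ
      rw [integral_const_mul]
      by_cases hp : κ ∈ s
      · simp [Set.indicator_of_mem hp]
      · simp [Set.indicator_of_notMem hp]
    have hint3 := hint2.integral_prod_left
    simp only at hint3
    rw [e2] at hint3
    refine ⟨(integrable_indicator_iff hs).1 hint3, ?_⟩
    rw [← integral_indicator hs (f := fun κ => ∫ q, ((1 / freeSymbol lam (split i j κ q) : ℝ) : ℂ) *
      (𝓕 f : L2 (Fin N)) (split i j κ q)), ← e2, ← integral_prod _ hint2, ← e1,
      ← L2.inner_indicatorConstLp_one hs hμs.ne, ← hu, Lp.inner_fourier_eq,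
      ContinuousLinearMap.adjoint_inner_right, ← Lp.inner_fourier_eq, PairFrame.inner_Lp_eq,
      integral_congr_ae e0]
    have := integral_map (μ := (volume : Measure (Config (ChargeIdx N))).prod (volume : Measure R3))
      hmp.measurable.aemeasurable (f := fun p => s.indicator (fun _ => (1 : ℂ)) (contract i j p) *
          (((1 / freeSymbol lam p : ℝ) : ℂ) * (𝓕 f : L2 (Fin N)) p))
      (by rw [hmp.map_eq]; exact hint.aestronglyMeasurable)
    rw [hmp.map_eq] at this
    exact this
  refine ae_eq_of_forall_setIntegral_eq_of_sigmaFinite (fun s hs hμs => ?_) (fun s hs hμs => (key s hs hμs).1)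
    fun s hs hμs => (key s hs hμs).2
  exact integrableOn_Lp_of_measure_ne_top _ (by norm_num) hμs.ne

theorem integral_schwartz_mul_eq_inner {E : Type} [NormedAddCommGroup E] [InnerProductSpace ℝ E]
    [FiniteDimensional ℝ E] [MeasurableSpace E] [BorelSpace E] (φ : 𝓢(E, ℂ))
    (u : L²(E)) :
    ∫ x, φ x * u x = inner ℂ ((conjSchwartz φ).toLp 2) u := by
  rw [PairFrame.inner_Lp_eq]
  refine integral_congr_ae ?_
  filter_upwards [(conjSchwartz φ).coeFn_toLp 2] with x hx
  rw [hx, conjSchwartz_apply, Complex.conj_conj]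

/-- The number of pairs of particles. -/
noncomputable def pairCount (N : ℕ) : ℝ := ∑ i : Fin N, ∑ j : Fin N, if i < j then 1 else 0

theorem pairCount_pos (hN : 2 ≤ N) : 0 < pairCount N := by
  have h : ∀ i j : Fin N, (0 : ℝ) ≤ if i < j then 1 else 0 := fun i j => by split_ifs <;> norm_num
  have h1 := Finset.single_le_sum (f := fun j : Fin N => (if (⟨0, by omega⟩ : Fin N) < j then (1 : ℝ) else 0))
    (fun j _ => h _ j) (Finset.mem_univ ⟨1, by omega⟩)
  have h2 := Finset.single_le_sum (f := fun i : Fin N => ∑ j : Fin N, (if i < j then (1 : ℝ) else 0))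
    (fun i _ => Finset.sum_nonneg fun j _ => h i j) (Finset.mem_univ ⟨0, by omega⟩)
  have h3 : (1 : ℝ) ≤ if (⟨0, by omega⟩ : Fin N) < ⟨1, by omega⟩ then (1 : ℝ) else 0 := by
    rw [if_pos (by simp [Fin.lt_def])]
  unfold pairCount
  linarith

/-- The factor between the trace of `(-Δ + lam)⁻¹ f` and `𝒢* f`. -/
noncomputable def traceConst (N : ℕ) : ℝ := 1 / (8 * π * pairCount N)

theorem traceConst_pos (hN : 2 ≤ N) : 0 < traceConst N := by
  have := pairCount_pos hN
  unfold traceConst; positivity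

/-- The bounded operators `R = (-Δ + lam)⁻¹` on the boson space and `G = 𝒢^lam` from the charge space
to the boson space, with their relations to potentials and traces. -/
structure IsPotentialPair (lam : ℝ) (R : BosonSpace N →L[ℂ] BosonSpace N)
    (G : ChargeSpace N →L[ℂ] BosonSpace N) : Prop where
  fourier_resolvent : ∀ f : BosonSpace N, ∀ᵐ p, (𝓕 (R f : L2 (Fin N)) : L2 (Fin N)) p =
    ((1 / freeSymbol lam p : ℝ) : ℂ) * (𝓕 (f : L2 (Fin N)) : L2 (Fin N)) p
  fourier_potential : ∀ ξ : ChargeSpace N, ∀ᵐ p, (𝓕 (G ξ : L2 (Fin N)) : L2 (Fin N)) p =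
    8 * (π : ℂ) * ((1 / freeSymbol lam p : ℝ) : ℂ) * ∑ i : Fin N, ∑ j : Fin N,
      if i < j then (𝓕 (ξ : L2 (ChargeIdx N)) : L2 (ChargeIdx N)) (contract i j p) else 0
  fourier_trace : ∀ i j : Fin N, i ≠ j → ∀ f : BosonSpace N, ∀ᵐ κ,
    (𝓕 (((traceConst N : ℂ) • ContinuousLinearMap.adjoint G f : ChargeSpace N) : L2 (ChargeIdx N)) :
      L2 (ChargeIdx N)) κ =
      ∫ q, ((1 / freeSymbol lam (split i j κ q) : ℝ) : ℂ) *
        (𝓕 (f : L2 (Fin N)) : L2 (Fin N)) (split i j κ q)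
  isPotential_iff : ∀ (ξ : ChargeSpace N) (u : BosonSpace N), IsPotential lam ξ u ↔ u = G ξ
  isFree_iff : ∀ w h : BosonSpace N, IsFree w h ↔ w = R (h + (lam : ℂ) • w)
  memH2_iff : ∀ w : BosonSpace N, MemH2 w ↔ ∃ f, w = R f
  isTrace_iff : ∀ i j : Fin N, i ≠ j → ∀ (w h : BosonSpace N) (η : ChargeSpace N), IsFree w h →
    (IsTrace i j w η ↔ η = (traceConst N : ℂ) • ContinuousLinearMap.adjoint G (h + (lam : ℂ) • w))
  symm : ∀ f g : BosonSpace N, inner ℂ (R f) g = inner ℂ f (R g)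
  nonneg : ∀ f : BosonSpace N, 0 ≤ (inner ℂ f (R f)).re
  eq_zero : ∀ f : BosonSpace N, (inner ℂ f (R f)).re = 0 → f = 0

theorem sum_pairs_perm {M : Type*} [AddCommGroup M] [Module ℝ M] (F : Fin N → Fin N → M)
    (hF : ∀ i j, F i j = F j i) (σ : Equiv.Perm (Fin N)) :
    (∑ i, ∑ j, if i < j then F (σ i) (σ j) else 0) = ∑ i, ∑ j, if i < j then F i j else 0 := by
  have h1 := sum_ordered_pairs F hF
  have h2 := sum_ordered_pairs (fun i j => F (σ i) (σ j)) fun i j => hF _ _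
  have h3 : ∑ p : {p : Fin N × Fin N // p.1 ≠ p.2}, F (σ p.1.1) (σ p.1.2) =
      ∑ p : {p : Fin N × Fin N // p.1 ≠ p.2}, F p.1.1 p.1.2 :=
    Equiv.sum_comp ((σ.prodCongr σ).subtypeEquiv fun p => by simp :
      {p : Fin N × Fin N // p.1 ≠ p.2} ≃ {p : Fin N × Fin N // p.1 ≠ p.2}) fun p => F p.1.1 p.1.2
  rw [h1, h2, ← two_smul ℝ, ← two_smul ℝ] at h3
  exact smul_right_injective M (two_ne_zero' ℝ) h3

theorem exists_planePotentials (hlam : 0 < lam) :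
    ∃ G : Fin N → Fin N → (L2 (ChargeIdx N) →L[ℂ] L2 (Fin N)),
      ∀ i j, i ≠ j → IsPlanePotential lam i j (G i j) := by
  have : ∀ i j : Fin N, ∃ G : L2 (ChargeIdx N) →L[ℂ] L2 (Fin N), i ≠ j → IsPlanePotential lam i j G := by
    intro i j
    by_cases hij : i = j
    · exact ⟨0, fun h => absurd hij h⟩
    · obtain ⟨G, hG⟩ := exists_isPlanePotential hlam hij
      exact ⟨G, fun _ => hG⟩
  choose G hG using this
  exact ⟨G, hG⟩

end

end

section

section

variable {N : ℕ} {lam : ℝ}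

theorem planePotential_comm {G : Fin N → Fin N → (L2 (ChargeIdx N) →L[ℂ] L2 (Fin N))}
    (hG : ∀ i j, i ≠ j → IsPlanePotential lam i j (G i j)) (i j : Fin N) : G i j = G j i := by
  by_cases hij : i = j
  · rw [hij]
  · exact (hG i j hij).unique (hG j i (Ne.symm hij)).comm

theorem sum_planePotential_mem {G : Fin N → Fin N → (L2 (ChargeIdx N) →L[ℂ] L2 (Fin N))}
    (hG : ∀ i j, i ≠ j → IsPlanePotential lam i j (G i j)) (ξ : ChargeSpace N) :
    (∑ i, ∑ j, if i < j then G i j (ξ : L2 (ChargeIdx N)) else 0) ∈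
      invariantL2 (fun σ : Equiv.Perm (Fin N) => σ) := by
  rw [mem_bosonSpace_iff]
  intro σ
  have h1 : ∀ i j : Fin N, permL2 σ (if i < j then G i j (ξ : L2 (ChargeIdx N)) else 0) =
      if i < j then G (σ.symm i) (σ.symm j) (ξ : L2 (ChargeIdx N)) else 0 := by
    intro i j
    split_ifs with hij
    · obtain ⟨τ, hτ⟩ := exists_contract_relabel_of_perm hij.ne σ
      have hij' : σ.symm i ≠ σ.symm j := σ.symm.injective.ne hij.ne
      rw [(hG i j hij.ne).permL2_comm hij' (hG _ _ hij') hτ, (mem_chargeSpace_iff _).1 ξ.2 τ]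
    · exact map_zero _
  have h2 : ∀ i : Fin N, permL2 σ (∑ j, if i < j then G i j (ξ : L2 (ChargeIdx N)) else 0) =
      ∑ j, if i < j then G (σ.symm i) (σ.symm j) (ξ : L2 (ChargeIdx N)) else 0 := fun i => by
    rw [map_sum]; exact Finset.sum_congr rfl fun j _ => h1 i j
  rw [map_sum]
  simp only [h2]
  exact sum_pairs_perm (fun i j => G i j (ξ : L2 (ChargeIdx N)))
    (fun i j => by rw [planePotential_comm hG]) σ.symm

theorem sum_planePotential_ae {G : Fin N → Fin N → (L2 (ChargeIdx N) →L[ℂ] L2 (Fin N))}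
    (hG : ∀ i j, i ≠ j → IsPlanePotential lam i j (G i j)) (ξ : L2 (ChargeIdx N)) :
    ∀ᵐ p, (𝓕 ((8 * (π : ℂ)) • ∑ i, ∑ j, if i < j then G i j ξ else 0) : L2 (Fin N)) p =
      8 * (π : ℂ) * ((1 / freeSymbol lam p : ℝ) : ℂ) * ∑ i : Fin N, ∑ j : Fin N,
        if i < j then (𝓕 ξ : L2 (ChargeIdx N)) (contract i j p) else 0 := by
  have e : (𝓕 ((8 * (π : ℂ)) • ∑ i, ∑ j, if i < j then G i j ξ else 0) : L2 (Fin N)) =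
      (8 * (π : ℂ)) • ∑ i, ∑ j, if i < j then (𝓕 (G i j ξ) : L2 (Fin N)) else 0 := by
    change Lp.fourierTransformₗᵢ (Config (Fin N)) ℂ _ = _
    rw [map_smul, map_sum]
    congr 1
    refine Finset.sum_congr rfl fun i _ => ?_
    rw [map_sum]
    refine Finset.sum_congr rfl fun j _ => ?_
    split_ifs
    · rfl
    · exact map_zero _
  rw [e]
  have h1 : ∀ᵐ p, ∀ i j : Fin N, (if i < j then (𝓕 (G i j ξ) : L2 (Fin N)) else 0) p =
      ((1 / freeSymbol lam p : ℝ) : ℂ) *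
        if i < j then (𝓕 ξ : L2 (ChargeIdx N)) (contract i j p) else 0 := by
    refine ae_all_iff.2 fun i => ae_all_iff.2 fun j => ?_
    split_ifs with hij
    · exact hG i j hij.ne ξ
    · filter_upwards [Lp.coeFn_zero ℂ 2 (volume : Measure (Config (Fin N)))] with p hp
      rw [hp, Pi.zero_apply, mul_zero]
  filter_upwards [Lp.coeFn_smul (8 * (π : ℂ)) (∑ i, ∑ j, if i < j then (𝓕 (G i j ξ) : L2 (Fin N)) else 0),
    Lp_coeFn_sum Finset.univ fun i => ∑ j, if i < j then (𝓕 (G i j ξ) : L2 (Fin N)) else 0,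
    ae_all_iff.2 fun i => Lp_coeFn_sum Finset.univ fun j => if i < j then (𝓕 (G i j ξ) : L2 (Fin N)) else 0,
    h1] with p k1 k2 k3 k4
  rw [k1, Pi.smul_apply, k2, smul_eq_mul, mul_assoc (8 * (π : ℂ))]
  congr 1
  simp only [k3, k4, Finset.mul_sum]

theorem isPotential_of_eq (hlam : 0 < lam) {G : Fin N → Fin N → (L2 (ChargeIdx N) →L[ℂ] L2 (Fin N))}
    (hG : ∀ i j, i ≠ j → IsPlanePotential lam i j (G i j)) (ξ : ChargeSpace N) (u : BosonSpace N)
    (hu : (u : L2 (Fin N)) = (8 * (π : ℂ)) • ∑ i, ∑ j, if i < j then G i j (ξ : L2 (ChargeIdx N)) else 0) :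
    IsPotential lam ξ u := by
  intro φ
  rw [← integral_freeSchwartz_mul, integral_schwartz_mul_eq_inner, hu, inner_smul_right, inner_sum]
  congr 1
  refine Finset.sum_congr rfl fun i _ => ?_
  rw [inner_sum]
  refine Finset.sum_congr rfl fun j _ => ?_
  split_ifs with hij
  · rw [← integral_schwartz_mul_eq_inner, (hG i j hij.ne).integral_freeSchwartz_mul hlam hij.ne]
    simp only [planeSchwartz_apply, mul_comm]
  · exact inner_zero_right _

/-- Since `(-Δ + lam) φ` ranges over a dense set, the distributional solution is unique in `L²`. -/
theorem IsPotential.unique (hlam : 0 < lam) {ξ : ChargeSpace N} {u v : BosonSpace N}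
    (hu : IsPotential lam ξ u) (hv : IsPotential lam ξ v) : u = v := by
  have h : (u : L2 (Fin N)) - (v : L2 (Fin N)) = 0 := by
    refine eq_zero_of_integral_freeSchwartz hlam fun φ => ?_
    rw [integral_schwartz_mul_eq_inner, inner_sub_right, ← integral_schwartz_mul_eq_inner,
      ← integral_schwartz_mul_eq_inner, integral_freeSchwartz_mul, integral_freeSchwartz_mul, hu φ, hv φ, sub_self]
  exact Subtype.ext (sub_eq_zero.1 h)

/-- The sum of the potentials of the hyperplanes, on symmetric charges, has all the properties of
`IsPotentialPair`. -/
theorem exists_isPotentialPair (hN : 2 ≤ N) (hlam : 0 < lam) :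
    ∃ (R : BosonSpace N →L[ℂ] BosonSpace N) (G : ChargeSpace N →L[ℂ] BosonSpace N),
      IsPotentialPair lam R G := by
  obtain ⟨R, hR⟩ := exists_isFreeResolvent (E := Config (Fin N)) hlam
  obtain ⟨G, hG⟩ := exists_planePotentials (N := N) hlam
  obtain ⟨R', hR'⟩ : ∃ R' : BosonSpace N →L[ℂ] BosonSpace N, ∀ f : BosonSpace N,
      (R' f : L2 (Fin N)) = R (f : L2 (Fin N)) := by
    refine ⟨(R ∘L (Submodule.subtypeL _)).codRestrict _ fun f => ?_, fun f => rfl⟩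
    rw [mem_bosonSpace_iff]
    intro σ
    change permL2 σ (R f) = R f
    rw [hR.permL2_comm, (mem_bosonSpace_iff _).1 f.2 σ]
  obtain ⟨G', hG'⟩ : ∃ G' : ChargeSpace N →L[ℂ] BosonSpace N, ∀ ξ : ChargeSpace N,
      (G' ξ : L2 (Fin N)) = (8 * (π : ℂ)) •
        ∑ i, ∑ j, if i < j then G i j (ξ : L2 (ChargeIdx N)) else 0 := by
    obtain ⟨S, hS⟩ : ∃ S : L2 (ChargeIdx N) →L[ℂ] L2 (Fin N), ∀ ξ, S ξ = (8 * (π : ℂ)) •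
        ∑ i, ∑ j, if i < j then G i j ξ else 0 := by
      refine ⟨(8 * (π : ℂ)) • ∑ i, ∑ j, if i < j then G i j else 0, fun ξ => ?_⟩
      simp only [_root_.smul_apply, _root_.sum_apply]
      congr 1
      refine Finset.sum_congr rfl fun i _ => Finset.sum_congr rfl fun j _ => ?_
      split_ifs <;> rfl
    refine ⟨(S ∘L (Submodule.subtypeL _)).codRestrict _ fun ξ => ?_, fun ξ => hS _⟩
    change S (ξ : L2 (ChargeIdx N)) ∈ _
    rw [hS]
    exact Submodule.smul_mem _ _ (sum_planePotential_mem hG ξ)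
  have hadj : ∀ i j : Fin N, i ≠ j → ∀ f : BosonSpace N,
      (((traceConst N : ℂ) • ContinuousLinearMap.adjoint G' f : ChargeSpace N) : L2 (ChargeIdx N)) =
        ContinuousLinearMap.adjoint (G i j) (f : L2 (Fin N)) := by
    intro i j hij f
    set y : ChargeSpace N := ⟨_, adjoint_mem_chargeSpace hij (hG i j hij) f⟩ with hy
    have h8 : (8 * (π : ℂ)) ≠ 0 := by
      have := Real.pi_pos.ne'
      simp [this]
    have hp : (pairCount N : ℂ) ≠ 0 := by exact_mod_cast (pairCount_pos hN).ne'
    -- Each of the `pairCount N` hyperplanes contributes the same adjoint.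
    have h1 : ContinuousLinearMap.adjoint G' f = (8 * (π : ℂ) * (pairCount N : ℂ)) • y := by
      refine ext_inner_left ℂ fun ξ => ?_
      rw [ContinuousLinearMap.adjoint_inner_right, Submodule.coe_inner, Submodule.coe_inner, hG',
        Submodule.coe_smul, inner_smul_right, inner_smul_left, sum_inner]
      have h2 : ∀ k l : Fin N, inner ℂ (if k < l then G k l (ξ : L2 (ChargeIdx N)) else 0) (f : L2 (Fin N)) =
          (if k < l then (1 : ℂ) else 0) * inner ℂ (ξ : L2 (ChargeIdx N)) (y : L2 (ChargeIdx N)) := by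
        intro k l
        split_ifs with hkl
        · rw [← ContinuousLinearMap.adjoint_inner_right, one_mul, hy,
            adjoint_eq_adjoint hij hkl.ne (hG i j hij) (hG k l hkl.ne) f]
        · rw [inner_zero_left, zero_mul]
      simp only [sum_inner, h2, ← Finset.sum_mul]
      rw [← mul_assoc]
      congr 1
      have h9 : starRingEnd ℂ (8 * (π : ℂ)) = 8 * (π : ℂ) := by
        have : (8 * (π : ℂ)) = ((8 * π : ℝ) : ℂ) := by push_cast; ring
        rw [this, Complex.conj_ofReal]
      rw [h9, pairCount, Complex.ofReal_sum]
      congr 1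
      refine Finset.sum_congr rfl fun k _ => ?_
      rw [Complex.ofReal_sum]
      refine Finset.sum_congr rfl fun l _ => ?_
      split_ifs <;> simp
    rw [h1, smul_smul, traceConst]
    have : ((1 / (8 * π * pairCount N) : ℝ) : ℂ) * (8 * (π : ℂ) * (pairCount N : ℂ)) = 1 := by
      push_cast
      field_simp
    rw [this, one_smul]
  have hpot : ∀ ξ : ChargeSpace N, IsPotential lam ξ (G' ξ) := fun ξ => isPotential_of_eq hlam hG ξ _ (hG' ξ)
  have hfree : ∀ w h : BosonSpace N, IsFree w h ↔ w = R' (h + (lam : ℂ) • w) := fun w h => by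
    rw [IsFree, hR.isFree_iff hlam, Subtype.ext_iff (a1 := w), hR']
    rfl
  refine ⟨R', G', ?_, ?_, ?_, ?_, hfree, ?_, ?_, ?_, ?_, ?_⟩
  · intro f
    rw [hR']; exact hR f
  · intro ξ
    rw [hG']; exact sum_planePotential_ae hG ξ
  · intro i j hij f
    rw [hadj i j hij]
    exact (hG i j hij).fourier_adjoint hij f
  · exact fun ξ u => ⟨fun h => h.unique hlam (hpot ξ), fun h => h ▸ hpot ξ⟩
  · intro w
    rw [MemH2, hR.memSobolev_iff hlam]
    constructor
    · rintro ⟨f, hf⟩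
      have hfm : f ∈ invariantL2 (fun σ : Equiv.Perm (Fin N) => σ) := by
        rw [mem_bosonSpace_iff]
        intro σ
        rw [← sub_eq_zero]
        refine hR.injective hlam ?_
        rw [map_sub, ← hR.permL2_comm, ← hf, (mem_bosonSpace_iff _).1 w.2 σ, sub_self]
      exact ⟨⟨f, hfm⟩, Subtype.ext (by rw [hR', hf])⟩
    · rintro ⟨f, rfl⟩
      exact ⟨f, hR' f⟩
  · intro i j hij w h η hwh
    rw [isTrace_iff_adjoint hlam hij hR (hG i j hij) hwh, Subtype.ext_iff (a1 := η), hadj i j hij]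
    rfl
  · intro f g
    rw [Submodule.coe_inner, Submodule.coe_inner, hR', hR']
    exact hR.symm _ _
  · intro f
    rw [Submodule.coe_inner, hR']
    exact hR.re_inner_nonneg hlam _
  · intro f hf
    rw [Submodule.coe_inner, hR'] at hf
    exact Subtype.ext (hR.eq_zero_of_re_inner hlam hf)

end

end

section

/-! ### Dependence on `lam` -/

section

variable {N : ℕ}

theorem sum_pairs_eq {i j : Fin N} (hij : i ≠ j) (T : Fin N → Fin N → ℂ) (hT : ∀ l m, T l m = T m l) :
    (∑ l, ∑ m, if l < m then T l m else 0) = T i j + ∑ a, (T i (others i j a) + T j (others i j a)) +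
      ∑ a, ∑ b, if a < b then T (others i j b) (others i j a) else 0 := by
  have h : ∀ (n : ℕ) (F : Fin n → Fin n → ℂ), (∀ k l, F k l = F l k) →
      ∑ k, ∑ l, F k l = 2 * (∑ k, ∑ l, if k < l then F k l else 0) + ∑ k, F k k := by
    intro n F hF
    have e : (∑ k, ∑ l, if k < l then F k l else 0) = ∑ k, ∑ l, if l < k then F k l else 0 := by
      rw [Finset.sum_comm]
      exact Finset.sum_congr rfl fun k _ => Finset.sum_congr rfl fun l _ => by rw [hF]
    rw [two_mul]
    nth_rw 2 [e]
    rw [← Finset.sum_add_distrib, ← Finset.sum_add_distrib]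
    refine Finset.sum_congr rfl fun k _ => ?_
    rw [← Finset.sum_add_distrib, ← Finset.sum_erase_add _ _ (Finset.mem_univ k),
      ← Finset.sum_erase_add (a := k) Finset.univ (fun l => (if k < l then F k l else 0) +
        if l < k then F k l else 0) (Finset.mem_univ k)]
    simp only [lt_self_iff_false, if_false, add_zero]
    congr 1
    refine Finset.sum_congr rfl fun l hl => ?_
    rcases lt_or_gt_of_ne (Finset.ne_of_mem_erase hl) with h | h
    · simp [h, h.not_gt]
    · simp [h, h.not_gt]
  have h1 := h N T hT
  have h2 := h (N - 2) (fun a b => T (others i j b) (others i j a)) fun _ _ => hT _ _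
  have h3 : ∑ a, ∑ b, T (others i j b) (others i j a) = ∑ a, ∑ b, T (others i j a) (others i j b) :=
    Finset.sum_congr rfl fun a _ => Finset.sum_congr rfl fun b _ => hT _ _
  obtain ⟨S, hS⟩ : ∃ S, S = ∑ l, ∑ m, if l < m then T l m else 0 := ⟨_, rfl⟩
  rw [← hS] at h1 ⊢
  simp only [sum_eq_others hij] at h1
  rw [h3] at h2
  simp only [Finset.sum_add_distrib] at h1 ⊢
  have h4 : ∀ l, ∑ a, T (others i j a) l = ∑ a, T l (others i j a) := fun l =>
    Finset.sum_congr rfl fun a _ => hT _ _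
  rw [h4, h4, hT j i] at h1
  linear_combination (-1 / 2) * h1 + (1 / 2) * h2

/-- `∫ ξ̂(p_l + p_m, P_{lm}) w(p)` over the fibre `p_i + p_j = k`. -/
noncomputable def fibreIntegrand (w : Config (Fin N) → ℝ) (i j : Fin N) (ξ : L2 (ChargeIdx N)) (l m : Fin N)
    (κ : Config (ChargeIdx N)) (q : R3) : ℂ :=
  (w (split i j κ q) : ℂ) * (𝓕 ξ : L2 (ChargeIdx N)) (contract l m (split i j κ q))

theorem fibreIntegrand_comm (w : Config (Fin N) → ℝ) (i j : Fin N) (ξ : L2 (ChargeIdx N)) (l m : Fin N)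
    (κ : Config (ChargeIdx N)) : fibreIntegrand w i j ξ l m κ = fibreIntegrand w i j ξ m l κ := by
  funext q
  rw [fibreIntegrand, fibreIntegrand, contract_comm]

theorem gammaIntegrand_smul {lam : ℝ} {i j : Fin N} (hij : i ≠ j) (l m : Fin N)
    (ξ : ChargeSpace N) (κ : Config (ChargeIdx N)) (q : R3) :
    gammaIntegrand lam i j l m ξ ((2 * π) • κ) q = hatConst (ChargeIdx N) *
      fibreIntegrand (fun p => 1 / freeSymbol lam p) i j (ξ : L2 (ChargeIdx N)) l m κ ((2 * π)⁻¹ • q) := by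
  have h2 : (2 * π : ℝ) ≠ 0 := by positivity
  rw [gammaIntegrand_eq hij, inv_smul_smul₀ h2, fibreIntegrand, freeSymbol_eq]
  have h3 : ((2 * π : ℝ) : ℂ) ≠ 0 := by exact_mod_cast h2
  generalize (2 * π)⁻¹ • q = q'
  generalize ‖split i j κ q'‖ ^ 2 + massOf lam = z
  push_cast
  ring

theorem integrable_fibreIntegrand_of_gamma {lam : ℝ} {i j : Fin N} (hij : i ≠ j) (l m : Fin N)
    (ξ : ChargeSpace N) (κ : Config (ChargeIdx N))
    (h : Integrable (gammaIntegrand lam i j l m ξ ((2 * π) • κ))) :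
    Integrable (fibreIntegrand (fun p => 1 / freeSymbol lam p) i j (ξ : L2 (ChargeIdx N)) l m κ) := by
  have h2 : (2 * π)⁻¹ ≠ 0 := by positivity
  refine (integrable_comp_smul_iff volume _ h2).1 ?_
  have e : gammaIntegrand lam i j l m ξ ((2 * π) • κ) = fun q => hatConst (ChargeIdx N) *
      fibreIntegrand (fun p => 1 / freeSymbol lam p) i j (ξ : L2 (ChargeIdx N)) l m κ ((2 * π)⁻¹ • q) :=
    funext fun q => gammaIntegrand_smul hij l m ξ κ q
  rw [e] at h
  exact (integrable_const_mul_iff (hatConst_ne_zero _).isUnit _).1 h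

theorem integral_gammaIntegrand_smul {lam : ℝ} {i j : Fin N} (hij : i ≠ j) (l m : Fin N)
    (ξ : ChargeSpace N) (κ : Config (ChargeIdx N)) :
    ∫ q, gammaIntegrand lam i j l m ξ ((2 * π) • κ) q = hatConst (ChargeIdx N) *
      ((2 * π : ℝ) : ℂ) ^ 3 *
      ∫ q, fibreIntegrand (fun p => 1 / freeSymbol lam p) i j (ξ : L2 (ChargeIdx N)) l m κ q := by
  simp only [gammaIntegrand_smul hij]
  rw [integral_const_mul, Measure.integral_comp_inv_smul volume
    (fibreIntegrand (fun p => 1 / freeSymbol lam p) i j (ξ : L2 (ChargeIdx N)) l m κ) (2 * π)]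
  have hd : Module.finrank ℝ R3 = 3 := by simp
  rw [hd, abs_of_pos (by positivity), Complex.real_smul, ← mul_assoc, Complex.ofReal_pow]

/-- `Γ` for the Fourier transform `𝓕`. -/
theorem IsGamma.fourier {lam : ℝ} {i j : Fin N} (hij : i ≠ j) {ξ η : ChargeSpace N}
    (h : IsGamma lam i j ξ η) : ∀ᵐ κ : Config (ChargeIdx N),
    (∀ l m : Fin N, l ≠ m → ({l, m} : Finset (Fin N)) ≠ {i, j} →
      Integrable (fibreIntegrand (fun p => 1 / freeSymbol lam p) i j (ξ : L2 (ChargeIdx N)) l m κ)) ∧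
    (𝓕 (η : L2 (ChargeIdx N)) : L2 (ChargeIdx N)) κ =
      2 * (π : ℂ) * ((√(chargeEnergy (massOf lam) κ) : ℝ) : ℂ) *
          (𝓕 (ξ : L2 (ChargeIdx N)) : L2 (ChargeIdx N)) κ
        - 8 * (π : ℂ) * ((∑ a, 2 * ∫ q, fibreIntegrand (fun p => 1 / freeSymbol lam p) i j
            (ξ : L2 (ChargeIdx N)) i (others i j a) κ q) +
          ∑ a, ∑ b, if a < b then ∫ q, fibreIntegrand (fun p => 1 / freeSymbol lam p) i j
            (ξ : L2 (ChargeIdx N)) (others i j b) (others i j a) κ q else 0) := by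
  have h2 : (0 : ℝ) < 2 * π := by positivity
  have hq : Measure.QuasiMeasurePreserving (fun κ : Config (ChargeIdx N) => (2 * π) • κ)
      volume volume := Measure.quasiMeasurePreserving_smul volume h2.ne'
  filter_upwards [hq.ae h] with κ hκ
  refine ⟨fun l m hlm hne => integrable_fibreIntegrand_of_gamma hij l m ξ κ (hκ.1 l m hlm hne), ?_⟩
  have h3 := hκ.2
  rw [sum_pairs_left hij (fun l => ∫ q, gammaIntegrand lam i j i l ξ ((2 * π) • κ) q),
    sum_pairs_others hij (fun l m => ∫ q, gammaIntegrand lam i j m l ξ ((2 * π) • κ) q),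
    hat_eq, hat_eq, inv_smul_smul₀ h2.ne'] at h3
  simp only [integral_gammaIntegrand_smul hij] at h3
  have hE : 1 / √2 * √(1 / 2 * ‖((2 * π) • κ) none‖ ^ 2 + ∑ k, ‖((2 * π) • κ) (some k)‖ ^ 2 + lam) =
      2 * π * √(chargeEnergy (massOf lam) κ) := by
    have e1 : 1 / 2 * ‖((2 * π) • κ) none‖ ^ 2 + ∑ k, ‖((2 * π) • κ) (some k)‖ ^ 2 + lam =
        2 * ((2 * π) ^ 2 * chargeEnergy (massOf lam) κ) := by
      simp only [chargeEnergy, massOf, PiLp.smul_apply, norm_smul, mul_pow, ← Finset.mul_sum,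
        Real.norm_of_nonneg h2.le]
      field_simp
      ring
    rw [e1, Real.sqrt_mul (by norm_num), Real.sqrt_mul (by positivity), Real.sqrt_sq h2.le]
    field_simp
  rw [hE] at h3
  refine mul_left_cancel₀ (hatConst_ne_zero (ChargeIdx N)) (h3.trans ?_)
  have h4 : ∀ F : Fin (N - 2) → Fin (N - 2) → ℂ, (∑ a, ∑ b, if a < b then
      hatConst (ChargeIdx N) * ((2 * π : ℝ) : ℂ) ^ 3 * F a b else 0) =
      hatConst (ChargeIdx N) * ((2 * π : ℝ) : ℂ) ^ 3 * ∑ a, ∑ b, if a < b then F a b else 0 := fun F => by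
    simp only [Finset.mul_sum, mul_ite, mul_zero]
  rw [h4, ← Finset.mul_sum, ← Finset.mul_sum]
  have hpi : (π : ℂ) ≠ 0 := by exact_mod_cast Real.pi_pos.ne'
  push_cast
  field_simp
  ring

end

end

section

section

variable {N : ℕ}

theorem ae_split {i j : Fin N} (hij : i ≠ j) {P : Config (Fin N) → Prop} (hP : ∀ᵐ p, P p) :
    ∀ᵐ κ : Config (ChargeIdx N), ∀ᵐ q : R3, P (split i j κ q) :=
  Measure.ae_ae_of_ae_prod ((measurePreserving_split hij).quasiMeasurePreserving.ae hP)

theorem split_swap {i j : Fin N} (hij : i ≠ j) (κ : Config (ChargeIdx N)) (q : R3) :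
    relabel (Equiv.swap i j) (split i j κ (κ none - q)) = split i j κ q := by
  refine config_ext fun m => ?_
  rw [relabel_apply, Equiv.symm_swap]
  rcases eq_or_eq_others hij m with rfl | rfl | ⟨k, rfl⟩
  · rw [Equiv.swap_apply_left, split, split, merge_right hij, merge_left]; abel
  · rw [Equiv.swap_apply_right, split, split, merge_right hij, merge_left]
  · rw [Equiv.swap_apply_of_ne_of_ne (others_ne_left hij k) (others_ne_right hij k), split, split,
      merge_others hij, merge_others hij]

/-- The two particles of the pair are interchangeable. -/
theorem fibreIntegrand_swap {i j : Fin N} (hij : i ≠ j) {w : Config (Fin N) → ℝ}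
    (hw : ∀ (σ : Equiv.Perm (Fin N)) p, w (relabel σ p) = w p) (ξ : ChargeSpace N) (a : Fin (N - 2)) :
    ∀ᵐ κ : Config (ChargeIdx N), fibreIntegrand w i j (ξ : L2 (ChargeIdx N)) j (others i j a) κ =ᵐ[volume]
      fun q => fibreIntegrand w i j (ξ : L2 (ChargeIdx N)) i (others i j a) κ (κ none - q) := by
  have hja : j ≠ others i j a := (others_ne_right hij a).symm
  have hia : i ≠ others i j a := (others_ne_left hij a).symm
  obtain ⟨τ, hτ⟩ := exists_contract_relabel_of_perm hja (Equiv.swap i j)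
  simp only [Equiv.symm_swap, Equiv.swap_apply_right,
    Equiv.swap_apply_of_ne_of_ne (others_ne_left hij a) (others_ne_right hij a)] at hτ
  filter_upwards [ae_split hij (ae_contract hia (fourier_charge_relabel ξ τ))] with κ hκ
  have hq := (Measure.measurePreserving_sub_left volume (κ none)).quasiMeasurePreserving.ae hκ
  filter_upwards [hq] with q h
  rw [fibreIntegrand, fibreIntegrand, ← split_swap hij κ q, hτ, hw, h]

theorem integral_fibreIntegrand_swap {i j : Fin N} (hij : i ≠ j) {w : Config (Fin N) → ℝ}
    (hw : ∀ (σ : Equiv.Perm (Fin N)) p, w (relabel σ p) = w p) (ξ : ChargeSpace N) :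
    ∀ᵐ κ : Config (ChargeIdx N), ∀ a : Fin (N - 2),
      ∫ q, fibreIntegrand w i j (ξ : L2 (ChargeIdx N)) j (others i j a) κ q =
        ∫ q, fibreIntegrand w i j (ξ : L2 (ChargeIdx N)) i (others i j a) κ q := by
  refine ae_all_iff.2 fun a => ?_
  filter_upwards [fibreIntegrand_swap hij hw ξ a] with κ hκ
  rw [integral_congr_ae hκ]
  exact integral_sub_left_eq_self (fibreIntegrand w i j (ξ : L2 (ChargeIdx N)) i (others i j a) κ) volume (κ none)

theorem freeSymbol_split {lam : ℝ} {i j : Fin N} (hij : i ≠ j) (κ : Config (ChargeIdx N)) (q : R3) :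
    freeSymbol lam (split i j κ q) =
      8 * π ^ 2 * (‖q - (1 / 2 : ℝ) • κ none‖ ^ 2 + chargeEnergy (massOf lam) κ) := by
  rw [freeSymbol_eq, norm_sq_split hij, norm_sub_sq_real, norm_sub_sq_real, inner_smul_right, norm_smul,
    real_inner_comm (κ none) q, chargeEnergy]
  norm_num
  ring

/-- The diagonal contribution: the pair `{i, j}` itself yields the difference of the values of `√E`,
which is the difference of the multiplication operators in `Γ`. -/
theorem integral_resolvent_sub_split {lam μ : ℝ} (hlam : 0 < lam) (hμ : 0 < μ) {i j : Fin N} (hij : i ≠ j)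
    (κ : Config (ChargeIdx N)) :
    Integrable (fun q => 1 / freeSymbol lam (split i j κ q) - 1 / freeSymbol μ (split i j κ q)) ∧
    ∫ q, (1 / freeSymbol lam (split i j κ q) - 1 / freeSymbol μ (split i j κ q)) =
      (√(chargeEnergy (massOf μ) κ) - √(chargeEnergy (massOf lam) κ)) / 4 := by
  have h1 := chargeEnergy_pos κ (massOf_pos hlam)
  have h2 := chargeEnergy_pos κ (massOf_pos hμ)
  obtain ⟨h3, h4⟩ := integral_resolvent_sub (Real.sqrt_pos.2 h1) (Real.sqrt_pos.2 h2)
  have e : (fun q => 1 / freeSymbol lam (split i j κ q) - 1 / freeSymbol μ (split i j κ q)) =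
      fun q => 1 / (8 * π ^ 2) *
        (1 / (‖q - (1 / 2 : ℝ) • κ none‖ ^ 2 + √(chargeEnergy (massOf lam) κ) ^ 2) -
          1 / (‖q - (1 / 2 : ℝ) • κ none‖ ^ 2 + √(chargeEnergy (massOf μ) κ) ^ 2)) := by
    funext q
    rw [freeSymbol_split hij, freeSymbol_split hij, Real.sq_sqrt h1.le, Real.sq_sqrt h2.le]
    field_simp
  rw [e]
  constructor
  · exact (h3.comp_sub_right ((1 / 2 : ℝ) • κ none)).const_mul _
  · rw [integral_const_mul, integral_sub_right_eq_self (fun q : R3 =>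
      (1 / (‖q‖ ^ 2 + √(chargeEnergy (massOf lam) κ) ^ 2) -
          1 / (‖q‖ ^ 2 + √(chargeEnergy (massOf μ) κ) ^ 2))) ((1 / 2 : ℝ) • κ none), h4]
    field_simp
    ring

/-- The difference of the inverse symbols. -/
noncomputable def symbolDiff (lam μ : ℝ) (p : Config (Fin N)) : ℝ := 1 / freeSymbol lam p - 1 / freeSymbol μ p

theorem fibreIntegrand_symbolDiff (lam μ : ℝ) (i j : Fin N) (ξ : L2 (ChargeIdx N)) (l m : Fin N)
    (κ : Config (ChargeIdx N)) : fibreIntegrand (symbolDiff lam μ) i j ξ l m κ =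
      fun q => fibreIntegrand (fun p => 1 / freeSymbol lam p) i j ξ l m κ q -
        fibreIntegrand (fun p => 1 / freeSymbol μ p) i j ξ l m κ q := by
  funext q
  simp only [fibreIntegrand, symbolDiff]
  push_cast; ring

/-- The difference of the operators `Γ` is the sum of the integrals of the differences of the
resolvents over all pairs. -/
theorem IsGamma.fourier_sub {lam μ : ℝ} (hlam : 0 < lam) (hμ : 0 < μ) {i j : Fin N} (hij : i ≠ j)
    {ξ η η' : ChargeSpace N} (h : IsGamma lam i j ξ η) (h' : IsGamma μ i j ξ η') :
    ∀ᵐ κ : Config (ChargeIdx N),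
      (∀ l m : Fin N, l ≠ m → Integrable (fibreIntegrand (symbolDiff lam μ) i j (ξ : L2 (ChargeIdx N)) l m κ)) ∧
      (𝓕 (η' : L2 (ChargeIdx N)) : L2 (ChargeIdx N)) κ - (𝓕 (η : L2 (ChargeIdx N)) : L2 (ChargeIdx N)) κ =
        8 * (π : ℂ) * ∑ l : Fin N, ∑ m : Fin N, if l < m then
          ∫ q, fibreIntegrand (symbolDiff lam μ) i j (ξ : L2 (ChargeIdx N)) l m κ q else 0 := by
  have hw : ∀ (σ : Equiv.Perm (Fin N)) p, symbolDiff lam μ (relabel σ p) = symbolDiff lam μ p := fun σ p => by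
    simp only [symbolDiff, freeSymbol, LinearIsometryEquiv.norm_map]
  filter_upwards [h.fourier hij, h'.fourier hij, integral_fibreIntegrand_swap hij hw ξ] with κ k1 k2 k3
  -- On the fibre `p_i + p_j = k`, the term of the pair `{i, j}` contains `ξ̂` as a constant factor.
  obtain ⟨d1, d2⟩ := integral_resolvent_sub_split hlam hμ hij κ
  have eij : fibreIntegrand (symbolDiff lam μ) i j (ξ : L2 (ChargeIdx N)) i j κ = fun q =>
      ((1 / freeSymbol lam (split i j κ q) - 1 / freeSymbol μ (split i j κ q) : ℝ) : ℂ) *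
        (𝓕 (ξ : L2 (ChargeIdx N)) : L2 (ChargeIdx N)) κ := by
    funext q
    rw [fibreIntegrand, contract_split hij, symbolDiff]
  have hd : ∀ l m : Fin N, l ≠ m → ({l, m} : Finset (Fin N)) ≠ {i, j} →
      Integrable (fibreIntegrand (symbolDiff lam μ) i j (ξ : L2 (ChargeIdx N)) l m κ) ∧
      ∫ q, fibreIntegrand (symbolDiff lam μ) i j (ξ : L2 (ChargeIdx N)) l m κ q =
        (∫ q, fibreIntegrand (fun p => 1 / freeSymbol lam p) i j (ξ : L2 (ChargeIdx N)) l m κ q) -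
        ∫ q, fibreIntegrand (fun p => 1 / freeSymbol μ p) i j (ξ : L2 (ChargeIdx N)) l m κ q := by
    intro l m hlm hne
    rw [fibreIntegrand_symbolDiff]
    exact ⟨(k1.1 l m hlm hne).sub (k2.1 l m hlm hne), integral_sub (k1.1 l m hlm hne) (k2.1 l m hlm hne)⟩
  have hpair : ∀ {l m l' m' : Fin N}, l ≠ l' → l ≠ m' → ({l, m} : Finset (Fin N)) ≠ {l', m'} := by
    intro l m l' m' h1 h2 he
    have : l ∈ ({l', m'} : Finset (Fin N)) := he ▸ Finset.mem_insert_self _ _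
    simp only [Finset.mem_insert, Finset.mem_singleton] at this
    exact this.elim h1 h2
  constructor
  · intro l m hlm
    by_cases he : ({l, m} : Finset (Fin N)) = {i, j}
    · have hiij : Integrable (fibreIntegrand (symbolDiff lam μ) i j (ξ : L2 (ChargeIdx N)) i j κ) := by
        rw [eij]; exact d1.ofReal.mul_const _
      have hl : l = i ∨ l = j := by
        have : l ∈ ({i, j} : Finset (Fin N)) := he ▸ Finset.mem_insert_self _ _
        simpa using this
      have hm : m = i ∨ m = j := by
        have : m ∈ ({i, j} : Finset (Fin N)) := he ▸ Finset.mem_insert_of_mem (Finset.mem_singleton_self _)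
        simpa using this
      rcases hl with rfl | rfl <;> rcases hm with rfl | rfl
      · exact absurd rfl hlm
      · exact hiij
      · rw [fibreIntegrand_comm]; exact hiij
      · exact absurd rfl hlm
    · exact (hd l m hlm he).1
  · have hia : ∀ a, ({i, others i j a} : Finset (Fin N)) ≠ {i, j} := fun a => by
      rw [Finset.pair_comm]; exact hpair (others_ne_left hij a) (others_ne_right hij a)
    have hab : ∀ a b, ({others i j b, others i j a} : Finset (Fin N)) ≠ {i, j} := fun a b =>
      hpair (others_ne_left hij b) (others_ne_right hij b)
    rw [sum_pairs_eq hij (fun l m => ∫ q, fibreIntegrand (symbolDiff lam μ) i j (ξ : L2 (ChargeIdx N)) l m κ q)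
      fun l m => by rw [fibreIntegrand_comm]]
    have e1 : ∀ a, ∫ q, fibreIntegrand (symbolDiff lam μ) i j (ξ : L2 (ChargeIdx N)) i (others i j a) κ q = _ :=
      fun a => (hd i (others i j a) (others_ne_left hij a).symm (hia a)).2
    have e2 : ∀ a b, (if a < b then ∫ q, fibreIntegrand (symbolDiff lam μ) i j (ξ : L2 (ChargeIdx N))
        (others i j b) (others i j a) κ q else 0) =
        (if a < b then ∫ q, fibreIntegrand (fun p => 1 / freeSymbol lam p) i j
            (ξ : L2 (ChargeIdx N)) (others i j b) (others i j a) κ q else 0) -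
        (if a < b then ∫ q, fibreIntegrand (fun p => 1 / freeSymbol μ p) i j
            (ξ : L2 (ChargeIdx N)) (others i j b) (others i j a) κ q else 0) := fun a b => by
      split_ifs with hlt
      · exact (hd _ _ ((others_injective i j).ne hlt.ne') (hab a b)).2
      · rw [sub_zero]
    have e3 : ∫ q, fibreIntegrand (symbolDiff lam μ) i j (ξ : L2 (ChargeIdx N)) i j κ q =
        (((√(chargeEnergy (massOf μ) κ) - √(chargeEnergy (massOf lam) κ)) / 4 : ℝ) : ℂ) *
          (𝓕 (ξ : L2 (ChargeIdx N)) : L2 (ChargeIdx N)) κ := by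
      rw [eij, integral_mul_const, integral_complex_ofReal, d2]
    rw [e3]
    simp only [k3, e1, e2, ← two_mul, mul_sub, Finset.sum_sub_distrib]
    rw [k1.2, k2.2]
    push_cast
    ring

end

end

section

section

variable {N : ℕ}

theorem symbolDiff_eq {lam μ : ℝ} (hlam : 0 < lam) (hμ : 0 < μ) (p : Config (Fin N)) :
    symbolDiff lam μ p = (μ - lam) * (1 / freeSymbol μ p) * (1 / freeSymbol lam p) := by
  have h1 := freeSymbol_pos hlam p
  have h2 := freeSymbol_pos hμ p
  have h3 : μ - lam = freeSymbol μ p - freeSymbol lam p := by unfold freeSymbol; ring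
  rw [symbolDiff, h3]
  field_simp

theorem fourier_smul_ae {E : Type} [NormedAddCommGroup E] [InnerProductSpace ℝ E] [FiniteDimensional ℝ E]
    [MeasurableSpace E] [BorelSpace E] (c : ℂ) (v : L²(E)) :
    ∀ᵐ p, (𝓕 (c • v) : L²(E)) p = c * (𝓕 v : L²(E)) p := by
  have e : (𝓕 (c • v) : L²(E)) = c • (𝓕 v : L²(E)) :=
    (Lp.fourierTransformₗᵢ E ℂ).map_smul c v
  rw [e]
  exact Lp.coeFn_smul c _

variable {lam μ : ℝ} {R R' : BosonSpace N →L[ℂ] BosonSpace N} {G G' : ChargeSpace N →L[ℂ] BosonSpace N}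

/-- The first resolvent identity for potentials. -/
theorem IsPotentialPair.sub_eq (hlam : 0 < lam) (hμ : 0 < μ) (h : IsPotentialPair lam R G)
    (h' : IsPotentialPair μ R' G') (ξ : ChargeSpace N) :
    G ξ = G' ξ + R' (((μ - lam : ℝ) : ℂ) • G ξ) := by
  refine Subtype.ext (fourier_Lp_injective ?_)
  have k := fourier_add_smul_ae (G' ξ : L2 (Fin N)) (R' (((μ - lam : ℝ) : ℂ) • G ξ) : L2 (Fin N)) 1
  rw [one_smul] at k
  filter_upwards [k, h.fourier_potential ξ, h'.fourier_potential ξ,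
    h'.fourier_resolvent (((μ - lam : ℝ) : ℂ) • G ξ), fourier_smul_ae ((μ - lam : ℝ) : ℂ) (G ξ : L2 (Fin N))]
    with p k1 k2 k3 k4 k5
  change _ = (𝓕 ((G' ξ : L2 (Fin N)) + (R' (((μ - lam : ℝ) : ℂ) • G ξ) : L2 (Fin N))) : L2 (Fin N)) p
  rw [k1, one_mul, k4]
  change _ = _ + _ * (𝓕 (((μ - lam : ℝ) : ℂ) • (G ξ : L2 (Fin N))) : L2 (Fin N)) p
  rw [k5, k3, k2]
  have e := congrArg (fun x : ℝ => (x : ℂ)) (symbolDiff_eq hlam hμ p)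
  rw [symbolDiff] at e
  push_cast at e ⊢
  generalize (∑ i : Fin N, ∑ j : Fin N, if i < j then
    (𝓕 (ξ : L2 (ChargeIdx N)) : L2 (ChargeIdx N)) (contract i j p) else 0) = S
  linear_combination (8 * (π : ℂ) * S) * e

/-- The operators `Γ` for two values of `lam` differ by the trace of the difference of the potentials. -/
theorem IsGamma.sub_eq (hlam : 0 < lam) (hμ : 0 < μ) (h : IsPotentialPair lam R G)
    (h' : IsPotentialPair μ R' G') {i j : Fin N} (hij : i ≠ j) {ξ η η' : ChargeSpace N}
    (hη : IsGamma lam i j ξ η) (hη' : IsGamma μ i j ξ η') :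
    η' = η + (traceConst N : ℂ) • ContinuousLinearMap.adjoint G' (((μ - lam : ℝ) : ℂ) • G ξ) := by
  refine Subtype.ext (fourier_Lp_injective ?_)
  have k := fourier_add_smul_ae (η : L2 (ChargeIdx N))
    (((traceConst N : ℂ) • ContinuousLinearMap.adjoint G' (((μ - lam : ℝ) : ℂ) • G ξ) : ChargeSpace N) :
      L2 (ChargeIdx N)) 1
  rw [one_smul] at k
  have hp : ∀ᵐ p, (𝓕 ((((μ - lam : ℝ) : ℂ) • G ξ : BosonSpace N) : L2 (Fin N)) : L2 (Fin N)) p =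
      ((μ - lam : ℝ) : ℂ) * (8 * (π : ℂ) * ((1 / freeSymbol lam p : ℝ) : ℂ) * ∑ i : Fin N, ∑ j : Fin N,
      if i < j then (𝓕 (ξ : L2 (ChargeIdx N)) : L2 (ChargeIdx N)) (contract i j p) else 0) := by
    filter_upwards [h.fourier_potential ξ, fourier_smul_ae ((μ - lam : ℝ) : ℂ) (G ξ : L2 (Fin N))]
      with p k2 k5
    rw [← k2, ← k5]; rfl
  filter_upwards [k, hη.fourier_sub hlam hμ hij hη', h'.fourier_trace i j hij (((μ - lam : ℝ) : ℂ) • G ξ),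
    ae_split hij hp] with κ k1 k2 k3 k4
  refine Eq.trans ?_ k1.symm
  rw [one_mul, k3, ← sub_eq_iff_eq_add', k2.2]
  have e : (fun q => ((1 / freeSymbol μ (split i j κ q) : ℝ) : ℂ) *
      (𝓕 ((((μ - lam : ℝ) : ℂ) • G ξ : BosonSpace N) : L2 (Fin N)) : L2 (Fin N)) (split i j κ q)) =ᵐ[volume]
      fun q => 8 * (π : ℂ) * ∑ l : Fin N, ∑ m : Fin N, if l < m then
        fibreIntegrand (symbolDiff lam μ) i j (ξ : L2 (ChargeIdx N)) l m κ q else 0 := by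
    filter_upwards [k4] with q hq
    rw [hq]
    have e := congrArg (fun x : ℝ => (x : ℂ)) (symbolDiff_eq hlam hμ (split i j κ q))
    have e2 : (∑ l : Fin N, ∑ m : Fin N, if l < m then
        fibreIntegrand (symbolDiff lam μ) i j (ξ : L2 (ChargeIdx N)) l m κ q else 0) =
        (symbolDiff lam μ (split i j κ q) : ℂ) * ∑ l : Fin N, ∑ m : Fin N, if l < m then
          (𝓕 (ξ : L2 (ChargeIdx N)) : L2 (ChargeIdx N)) (contract l m (split i j κ q)) else 0 := by
      simp only [Finset.mul_sum, mul_ite, mul_zero]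
      rfl
    rw [e2, e]
    push_cast
    ring
  rw [integral_congr_ae e, integral_const_mul]
  congr 1
  have hint : ∀ l m : Fin N, Integrable fun q => if l < m then
      fibreIntegrand (symbolDiff lam μ) i j (ξ : L2 (ChargeIdx N)) l m κ q else 0 := by
    intro l m
    split_ifs with hlm
    · exact k2.1 l m hlm.ne
    · exact integrable_zero _ _ _
  rw [integral_finsetSum _ fun l _ => integrable_finsetSum _ fun m _ => hint l m]
  refine Finset.sum_congr rfl fun l _ => ?_
  rw [integral_finsetSum _ fun m _ => hint l m]
  refine Finset.sum_congr rfl fun m _ => ?_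
  split_ifs
  · rfl
  · simp

/-- The operators `A + Γ` differ like the operators `Γ`, since `A` does not depend on `lam`. -/
theorem IsAddGamma.sub_eq {α γ : ℝ} {θ : ℝ → ℝ} (hlam : 0 < lam) (hμ : 0 < μ) (h : IsPotentialPair lam R G)
    (h' : IsPotentialPair μ R' G') {i j : Fin N} (hij : i ≠ j) {ξ η η' : ChargeSpace N}
    (hη : IsAddGamma α γ θ lam i j ξ η) (hη' : IsAddGamma α γ θ μ i j ξ η') :
    η' = η + (traceConst N : ℂ) • ContinuousLinearMap.adjoint G' (((μ - lam : ℝ) : ℂ) • G ξ) := by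
  obtain ⟨a, b, ha, hb, rfl⟩ := hη
  obtain ⟨a', b', ha', hb', rfl⟩ := hη'
  have : a' = a := by
    refine Subtype.ext (Lp.ext ?_)
    filter_upwards [ha, ha'] with X h1 h2
    rw [h1, h2]
  rw [this, hb.sub_eq hlam hμ h h' hij hb', add_assoc]

end

end

section

/-! ### The Hamiltonian -/

section

variable {H K : Type*} [NormedAddCommGroup H] [InnerProductSpace ℂ H] [CompleteSpace H]
  [NormedAddCommGroup K] [InnerProductSpace ℂ K] [CompleteSpace K]

/-- Krein's formula: if `L` is invertible, the functions `R f + G J ζ` with `L ζ = c G* f` are those of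
the form `(R + c G J L⁻¹ G*) f`, where `J L⁻¹` is self-adjoint and nonnegative. -/
theorem exists_krein_resolvent {R : H →L[ℂ] H} (hR : ∀ f g, inner ℂ (R f) g = inner ℂ f (R g))
    (hR0 : ∀ f, 0 ≤ (inner ℂ f (R f)).re) (hRinj : ∀ f, (inner ℂ f (R f)).re = 0 → f = 0)
    (G : K →L[ℂ] H) {J L : K →L[ℂ] K} (hsym : ∀ x y, inner ℂ (L x) (J y) = inner ℂ (J x) (L y))
    (hform : ∀ x, 0 ≤ (inner ℂ (J x) (L x)).re)
    {c₀ : ℝ} (hc₀ : 0 < c₀) (hL : ∀ x, c₀ * ‖x‖ ^ 2 ≤ (inner ℂ x (L x)).re) {c : ℝ} (hc : 0 < c) :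
    ∃ W : H →L[ℂ] H, IsSelfAdjoint W ∧ (∀ f, W f = 0 → f = 0) ∧ (∀ f, 0 ≤ (inner ℂ f (W f)).re) ∧
      ∀ f x, x = W f ↔ ∃ ζ, L ζ = (c : ℂ) • ContinuousLinearMap.adjoint G f ∧ x = R f + G (J ζ) := by
  obtain ⟨e, he⟩ := exists_inverse_of_coercive L hc₀ hL
  have he' : ∀ z, e z = L z := fun z => congrArg (fun M : K →L[ℂ] K => M z) he
  have hLe : ∀ x, L (e.symm x) = x := fun x => by rw [← he', ContinuousLinearEquiv.apply_symm_apply]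
  obtain ⟨W, hW⟩ : ∃ W : H →L[ℂ] H, ∀ f, W f = R f +
      (c : ℂ) • G (J (e.symm (ContinuousLinearMap.adjoint G f))) :=
    ⟨R + (c : ℂ) • (G ∘L J ∘L (e.symm : K →L[ℂ] K) ∘L ContinuousLinearMap.adjoint G), fun f => rfl⟩
  have hQ : ∀ f g, inner ℂ (G (J (e.symm (ContinuousLinearMap.adjoint G f)))) g =
      inner ℂ f (G (J (e.symm (ContinuousLinearMap.adjoint G g)))) := by
    intro f g
    rw [← ContinuousLinearMap.adjoint_inner_right G (J _) g,
      ← ContinuousLinearMap.adjoint_inner_left G (J _) f]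
    have := hsym (e.symm (ContinuousLinearMap.adjoint G f)) (e.symm (ContinuousLinearMap.adjoint G g))
    rw [hLe, hLe] at this
    exact this.symm
  -- The form of `W` is the sum of the forms of `R` and of `c J L⁻¹`, at `G* f`.
  have hre : ∀ f, (inner ℂ f (W f)).re = (inner ℂ f (R f)).re +
      c * (inner ℂ (J (e.symm (ContinuousLinearMap.adjoint G f)))
        (L (e.symm (ContinuousLinearMap.adjoint G f)))).re := by
    intro f
    rw [hW, inner_add_right, inner_smul_right, Complex.add_re, Complex.re_ofReal_mul, ← hQ,
      ← ContinuousLinearMap.adjoint_inner_right, hLe]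
  have hnn : ∀ f, 0 ≤ (inner ℂ f (W f)).re := fun f => by
    rw [hre]
    exact add_nonneg (hR0 f) (mul_nonneg hc.le (hform _))
  refine ⟨W, ?_, ?_, hnn, ?_⟩
  · refine ContinuousLinearMap.isSelfAdjoint_iff_isSymmetric.2 fun f g => ?_
    change inner ℂ (W f) g = inner ℂ f (W g)
    rw [hW, hW, inner_add_left, inner_add_right, inner_smul_left, inner_smul_right, hR, hQ,
      Complex.conj_ofReal]
  · intro f hf
    have h := hre f
    rw [hf, inner_zero_right, Complex.zero_re] at h
    have h1 := hR0 f
    have h2 := mul_nonneg hc.le (hform (e.symm (ContinuousLinearMap.adjoint G f)))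
    exact hRinj f (by linarith)
  · intro f x
    constructor
    · rintro rfl
      refine ⟨(c : ℂ) • e.symm (ContinuousLinearMap.adjoint G f), ?_, ?_⟩
      · rw [map_smul, hLe]
      · rw [hW, map_smul, map_smul]
    · rintro ⟨ζ, hζ, rfl⟩
      have : ζ = (c : ℂ) • e.symm (ContinuousLinearMap.adjoint G f) := by
        rw [← map_smul, ← hζ, ← he', ContinuousLinearEquiv.symm_apply_apply]
      rw [this, hW, map_smul, map_smul]

/-- A bounded self-adjoint injective operator `W` is the resolvent at `-s` of a self-adjoint operator. -/
theorem exists_operator_of_resolvent {W : H →L[ℂ] H} (hW : IsSelfAdjoint W) (hinj : ∀ f, W f = 0 → f = 0)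
    (s : ℝ) : ∃ T : H →ₗ.[ℂ] H, IsSelfAdjoint T ∧
      ∀ x y, (x, y) ∈ T.graph ↔ ∃ f, x = W f ∧ y = f - (s : ℂ) • W f := by
  have h : ∀ x y, (x, y) ∈ (pmapOfFactor W (ContinuousLinearMap.id ℂ H - (s : ℂ) • W)).graph ↔
      ∃ f, x = W f ∧ y = f - (s : ℂ) • W f := fun x y => mem_graph_pmapOfFactor hinj x y
  exact ⟨_, isSelfAdjoint_of_graph_resolvent W hW hinj s _ h, h⟩

/-- An operator with a nonnegative resolvent at `-s` is bounded below by `-s`. -/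
theorem re_inner_ge_of_graph {W : H →L[ℂ] H} (hnn : ∀ f, 0 ≤ (inner ℂ f (W f)).re) (s : ℝ)
    {x y f : H} (hx : x = W f) (hy : y = f - (s : ℂ) • W f) :
    -s * ‖x‖ ^ 2 ≤ (inner ℂ x y).re := by
  have h1 := hnn f
  rw [← hx] at h1 hy
  have h2 : (inner ℂ x f).re = (inner ℂ f x).re := by
    rw [← inner_conj_symm, Complex.conj_re]
  rw [hy, inner_sub_right, inner_smul_right, inner_self_eq_norm_sq_to_K, Complex.sub_re,
    Complex.re_ofReal_mul, h2]
  have h3 : (((‖x‖ : ℝ) : ℂ) ^ 2).re = ‖x‖ ^ 2 := by rw [← Complex.ofReal_pow, Complex.ofReal_re]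
  simp only [Complex.coe_algebraMap] at *
  rw [h3]
  linarith

end

section

variable {M : Type*} [AddCommGroup M] [Module ℂ M]

theorem shift_energy {h u y r w : M} (a b : ℂ) (hu : u = y + r) :
    h - a • u + b • y + b • (w + r) = h + b • w + (b - a) • u := by
  rw [hu]; module

theorem sub_smul_add (h w u : M) (a : ℂ) : h - a • u = h + a • w - a • (w + u) := by
  module

end

section

variable {N : ℕ} {α γ C lam μ : ℝ} {θ : ℝ → ℝ} {J L J' L' : ChargeSpace N →L[ℂ] ChargeSpace N}
  {R R' : BosonSpace N →L[ℂ] BosonSpace N} {G G' : ChargeSpace N →L[ℂ] BosonSpace N}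

/-- `(ψ, φ)` is in the graph of the Hamiltonian, written with the parameter `lam`. -/
def InHamiltonianGraph (α γ : ℝ) (θ : ℝ → ℝ) (lam : ℝ) (ψ φ : BosonSpace N) : Prop :=
  ∃ (ξ : ChargeSpace N) (w h u : BosonSpace N),
    MemH1 ξ ∧ MemH2 w ∧ IsFree w h ∧ IsPotential lam ξ u ∧
    (∀ i j : Fin N, i < j → ∃ η, IsAddGamma α γ θ lam i j ξ η ∧ IsTrace i j w η) ∧
    ψ = w + u ∧ φ = h - (lam : ℂ) • u

/-- The graph for `lam` is contained in the graph for `μ`: the function `𝒢^lam ξ - 𝒢^μ ξ` is in `H²`,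
and the operators `Γ` differ by its trace. -/
theorem InHamiltonianGraph.change (hlam : 0 < lam) (hμ : 0 < μ) (hp : IsPotentialPair lam R G)
    (hp' : IsPotentialPair μ R' G') (hb' : IsBoundaryPair α γ θ C μ J' L') {ψ φ : BosonSpace N}
    (h : InHamiltonianGraph α γ θ lam ψ φ) : InHamiltonianGraph α γ θ μ ψ φ := by
  obtain ⟨ξ, w, h, u, hξ, hw, hf, hu, htr, rfl, rfl⟩ := h
  have hu1 := (hp.isPotential_iff ξ u).1 hu
  have hsub := hp.sub_eq hlam hμ hp' ξ
  rw [← hu1] at hsub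
  have hw1 := (hp'.isFree_iff w h).1 hf
  have hfree : h - (lam : ℂ) • u + (μ : ℂ) • G' ξ + (μ : ℂ) • (w + R' (((μ - lam : ℝ) : ℂ) • u)) =
      h + (μ : ℂ) • w + ((μ - lam : ℝ) : ℂ) • u := by
    rw [Complex.ofReal_sub] at hsub ⊢
    exact shift_energy _ _ hsub
  have hwR : w + R' (((μ - lam : ℝ) : ℂ) • u) = R' (h + (μ : ℂ) • w + ((μ - lam : ℝ) : ℂ) • u) := by
    rw [map_add, ← hw1]
  have hfree' : IsFree (w + R' (((μ - lam : ℝ) : ℂ) • u)) (h - (lam : ℂ) • u + (μ : ℂ) • G' ξ) := by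
    rw [hp'.isFree_iff, hfree, ← hwR]
  refine ⟨ξ, w + R' (((μ - lam : ℝ) : ℂ) • u), h - (lam : ℂ) • u + (μ : ℂ) • G' ξ, G' ξ, hξ,
    (hp'.memH2_iff _).2 ⟨_, hwR⟩, hfree', (hp'.isPotential_iff _ _).2 rfl, fun i j hij => ?_, ?_, ?_⟩
  · obtain ⟨η, hη, hη2⟩ := htr i j hij
    obtain ⟨ζ, rfl⟩ := (hb'.memH1_iff ξ).1 hξ
    have h1 := hb'.isAddGamma i j hij.ne ζ
    refine ⟨L' ζ, h1, ?_⟩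
    rw [hp'.isTrace_iff i j hij.ne _ _ _ hfree', hfree, hη.sub_eq hlam hμ hp hp' hij.ne h1,
      (hp'.isTrace_iff i j hij.ne _ _ _ hf).1 hη2, map_add _ (h + (μ : ℂ) • w), smul_add, ← hu1]
  · nth_rw 1 [hsub]; abel
  · abel

/-- The graph of the Hamiltonian in terms of `f = (H + lam) ψ`: the boundary condition becomes an
equation for `ζ = J⁻¹ ξ`, the same for all the hyperplanes. -/
theorem inHamiltonianGraph_iff (hN : 2 ≤ N) (hp : IsPotentialPair lam R G) (hb : IsBoundaryPair α γ θ C lam J L)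
    (ψ φ : BosonSpace N) : InHamiltonianGraph α γ θ lam ψ φ ↔
      ∃ f, (∃ ζ, L ζ = (traceConst N : ℂ) • ContinuousLinearMap.adjoint G f ∧ ψ = R f + G (J ζ)) ∧
        φ = f - (lam : ℂ) • ψ := by
  constructor
  · rintro ⟨ξ, w, h, u, hξ, hw, hf, hu, htr, rfl, rfl⟩
    obtain ⟨ζ, rfl⟩ := (hb.memH1_iff ξ).1 hξ
    have hw1 := (hp.isFree_iff w h).1 hf
    obtain ⟨η, hη, hη2⟩ := htr ⟨0, by omega⟩ ⟨1, by omega⟩ (by simp [Fin.lt_def])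
    refine ⟨h + (lam : ℂ) • w, ⟨ζ, ?_, ?_⟩, ?_⟩
    · rw [(hb.isAddGamma _ _ (by simp [Fin.ext_iff]) ζ).unique hη]
      exact (hp.isTrace_iff _ _ (by simp [Fin.ext_iff]) _ _ _ hf).1 hη2
    · rw [← hw1, (hp.isPotential_iff _ _).1 hu]
    · exact sub_smul_add _ _ _ _
  · rintro ⟨f, ⟨ζ, hζ, rfl⟩, rfl⟩
    have e : f - (lam : ℂ) • R f + (lam : ℂ) • R f = f := sub_add_cancel _ _
    have hf : IsFree (R f) (f - (lam : ℂ) • R f) := by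
      rw [hp.isFree_iff, e]
    refine ⟨J ζ, R f, f - (lam : ℂ) • R f, G (J ζ), (hb.memH1_iff _).2 ⟨ζ, rfl⟩, (hp.memH2_iff _).2 ⟨f, rfl⟩,
      hf, (hp.isPotential_iff _ _).2 rfl, fun i j hij => ⟨L ζ, hb.isAddGamma i j hij.ne ζ, ?_⟩, rfl, ?_⟩
    · rw [hp.isTrace_iff i j hij.ne _ _ _ hf, e, hζ]
    · rw [smul_add, sub_add_eq_sub_sub]

end

end

theorem mainTheorem1 (N : ℕ) (hN : 3 ≤ N) (α γ : ℝ) (hγ : gammaCrit N < γ)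
    (θ : ℝ → ℝ) (hθ : MemLp θ ∞ (volume.restrict (Ioi (0 : ℝ))))
    (b : ℝ) (hb : 0 < b)
    (hθb : ∀ᵐ r ∂(volume.restrict (Ioi (0 : ℝ))), 1 - r / b ≤ θ r ∧ θ r ≤ 1 + r / b) :
    ∃ (T : ℝ → Fin N → Fin N → (ChargeSpace N →ₗ.[ℂ] ChargeSpace N))
      (H : BosonSpace N →ₗ.[ℂ] BosonSpace N) (lam₀ : ℝ), 0 < lam₀ ∧
      (∀ lam : ℝ, 0 < lam → ∀ i j : Fin N, i < j →
        IsChargeOperator α γ θ lam i j (T lam i j) ∧ IsSelfAdjoint (T lam i j)) ∧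
      (∀ lam : ℝ, lam₀ < lam → ∀ i j : Fin N, i < j →
        ∃ c : ℝ, 0 < c ∧ ∀ ξ : (T lam i j).domain,
          c * ‖(ξ : ChargeSpace N)‖ ^ 2 ≤ (inner ℂ (ξ : ChargeSpace N) (T lam i j ξ)).re) ∧
      (∀ lam : ℝ, 0 < lam → IsHamiltonian α γ θ lam H) ∧
      IsSelfAdjoint H ∧
      ∀ ψ : H.domain,
        -lam₀ * ‖(ψ : BosonSpace N)‖ ^ 2 ≤ (inner ℂ (ψ : BosonSpace N) (H ψ)).re := by
  have hN2 : 2 ≤ N := by omega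
  have hgap : 0 < gap (N - 2) γ := gap_pos hN hγ
  obtain ⟨C, hC, hpair⟩ := exists_isBoundaryPair (N := N) α ((gammaCrit_nonneg hN).trans hγ.le) hθ.1 hb hθb
  have hpair' : ∀ lam : ℝ, ∃ J L : ChargeSpace N →L[ℂ] ChargeSpace N,
      0 < lam → IsBoundaryPair α γ θ C lam J L := fun lam => by
    by_cases h : 0 < lam
    · obtain ⟨J, L, hJL⟩ := hpair lam h
      exact ⟨J, L, fun _ => hJL⟩
    · exact ⟨0, 0, fun h' => absurd h' h⟩
  choose J L hJL using hpair'
  set g := π * gap (N - 2) γ with hg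
  have hg0 : 0 < g := mul_pos Real.pi_pos hgap
  -- For `lam > lam₀` the bound `1 / √(massOf lam / 2)` of `‖J‖` is at most `g / (C + 1)`.
  set lam₀ : ℝ := 2 * (2 * π) ^ 2 * ((C + 1) / g) ^ 2 with hlam₀
  have hlam₀' : 0 < lam₀ := by positivity
  have hlarge : ∀ lam : ℝ, lam₀ < lam → (C + 1) * (1 / √(massOf lam / 2)) ≤ g := by
    intro lam h
    have h1 : (C + 1) / g ≤ √(massOf lam / 2) := by
      refine Real.le_sqrt_of_sq_le ?_
      rw [massOf, div_div, le_div_iff₀ (by positivity)]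
      linarith
    have h2 : 0 < √(massOf lam / 2) := lt_of_lt_of_le (by positivity) h1
    rw [mul_one_div, div_le_iff₀ h2]
    rw [div_le_iff₀ hg0] at h1
    linarith
  have hgraph : ∀ lam μ : ℝ, 0 < lam → 0 < μ → ∀ ψ φ : BosonSpace N,
      InHamiltonianGraph α γ θ lam ψ φ → InHamiltonianGraph α γ θ μ ψ φ := by
    intro lam μ hlam hμ ψ φ h
    obtain ⟨R, G, hp⟩ := exists_isPotentialPair hN2 hlam
    obtain ⟨R', G', hp'⟩ := exists_isPotentialPair hN2 hμ
    exact h.change hlam hμ hp hp' (hJL μ hμ)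
  have hres : ∀ lam : ℝ, lam₀ < lam → ∃ W : BosonSpace N →L[ℂ] BosonSpace N, IsSelfAdjoint W ∧
      (∀ f, W f = 0 → f = 0) ∧ (∀ f, 0 ≤ (inner ℂ f (W f)).re) ∧
      ∀ ψ φ, InHamiltonianGraph α γ θ lam ψ φ ↔ ∃ f, ψ = W f ∧ φ = f - (lam : ℂ) • W f := by
    intro lam h
    have hlam := hlam₀'.trans h
    have hB := hJL lam hlam
    obtain ⟨R, G, hp⟩ := exists_isPotentialPair hN2 hlam
    obtain ⟨W, h1, h2, h3, h4⟩ := exists_krein_resolvent hp.symm hp.nonneg hp.eq_zero G hB.symm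
      (fun ζ => (sq_nonneg _).trans (hB.norm_sq_le_form hC hgap (hlarge lam h) ζ)) hg0
      (fun x => by
        have := hB.coercive_of_large hC (hlarge lam h) (s := 0) (by norm_num) x
        rwa [Complex.ofReal_zero, zero_smul, add_zero] at this) (traceConst_pos hN2)
    refine ⟨W, h1, h2, h3, fun ψ φ => ?_⟩
    rw [inHamiltonianGraph_iff hN2 hp hB]
    refine exists_congr fun f => ?_
    rw [← h4 f ψ]
    exact and_congr_right fun h => by rw [h]
  have hlam₁ : lam₀ < lam₀ + 1 := lt_add_one _
  -- The Hamiltonian, defined by its resolvent at one point.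
  obtain ⟨W, hW, hWinj, -, hWg⟩ := hres (lam₀ + 1) hlam₁
  obtain ⟨H, hH, hHg⟩ := exists_operator_of_resolvent hW hWinj (lam₀ + 1)
  have hHam : ∀ lam : ℝ, 0 < lam → IsHamiltonian α γ θ lam H := by
    intro lam hlam ψ φ
    rw [hHg, ← hWg]
    exact ⟨hgraph _ _ (hlam₀'.trans hlam₁) hlam ψ φ, hgraph _ _ hlam (hlam₀'.trans hlam₁) ψ φ⟩
  refine ⟨fun lam _ _ => pmapOfFactor (J lam) (L lam), H, lam₀, hlam₀', ?_, ?_, hHam, hH, ?_⟩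
  · intro lam hlam i j hij
    obtain ⟨c, s, hc, hco⟩ := (hJL lam hlam).exists_coercive hgap
    exact ⟨(hJL lam hlam).isChargeOperator hij.ne,
      isSelfAdjoint_pmapOfFactor (hJL lam hlam).injective (hJL lam hlam).symm hc hco⟩
  · intro lam hlam i j _
    refine ⟨1, one_pos, fun ξ => ?_⟩
    exact (hJL lam (hlam₀'.trans hlam)).re_inner_pmap hC hgap (hlarge lam hlam) ξ
  · intro ψ
    have hlim : ∀ lam : ℝ, lam₀ < lam →
        -lam * ‖(ψ : BosonSpace N)‖ ^ 2 ≤ (inner ℂ (ψ : BosonSpace N) (H ψ)).re := by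
      intro lam hlam
      obtain ⟨W', -, -, hnn, hg'⟩ := hres lam hlam
      obtain ⟨f, hf1, hf2⟩ := (hg' _ _).1 ((hHam lam (hlam₀'.trans hlam) _ _).1 (H.mem_graph ψ))
      exact re_inner_ge_of_graph hnn lam hf1 hf2
    -- The bound holds for every `lam > lam₀`, hence in the limit.
    have h1 : Tendsto (fun lam : ℝ => -lam * ‖(ψ : BosonSpace N)‖ ^ 2) (𝓝[>] lam₀)
        (𝓝 (-lam₀ * ‖(ψ : BosonSpace N)‖ ^ 2)) :=
      ((continuous_neg.mul continuous_const).tendsto lam₀).mono_left nhdsWithin_le_nhds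
    exact le_of_tendsto h1 (eventually_mem_nhdsWithin.mono hlim)
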